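/- **Setting.** Matrices have entries in $\mathbb Z\cup\{\infty\}$, where the finite entries have $\mathrm{polylog}(n)$ bits, and dimensions $n^\alpha$ are rounded down. The min-plus product of $A$ and $B$ is $(A\star B)_{i,j}=\min_k (A_{i,k}+B_{k,j})$. Algorithms are deterministic programs for a word RAM with $O(\log n)$-bit words, and $\tilde O(\cdot)$ hides subpolynomial factors: a problem can be solved in $\tilde O(n^{\tau})$ time if for every $\varepsilon>0$ there is an algorithm for it that runs in $O(n^{\tau+\varepsilon})$ time. For non-negative reals $\alpha,\beta,\gamma,\theta$ let $g(\alpha,\beta,\gamma,\theta)$ be the smallest number such that the min-plus product of an $n^\alpha\times n^\beta$ matrix with entries in $\{-n^\theta,\dots,n^\theta\}\cup\{\infty\}$ by an arbitrary $n^\beta\times n^\gamma$ matrix can be computed in $\tilde O(n^{g(\alpha,\beta,\gamma,\theta)})$ time. An $n^\beta\times n^\gamma$ matrix $B$ is monotone if $B_{k,j}$ is non-decreasing in $j$ for every $k$; its total range is $\sum_{k}\bigl(\max_{j:\,B_{k,j}\neq\infty}B_{k,j}-B_{k,1}+1\bigr)$, where rows without a finite entry contribute $0$. Let $m(\alpha,\beta,\gamma,\eta)$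 be the smallest number such that the min-plus product of an arbitrary $n^\alpha\times n^\beta$ matrix $A$ by a monotone $n^\beta\times n^\gamma$ matrix $B$ of total range $O(n^{\beta+\eta})$ can be computed in $\tilde O(n^{m(\alpha,\beta,\gamma,\eta)})$ time. **Theorem.** Let $\beta,\eta\ge 0$ be real numbers. For every $\theta\in[0,\eta]$, the min-plus product of an $n\times n^\beta$ matrix $A$ and a monotone $n^\beta\times n$ matrix $B$ of total range $O(n^{\beta+\eta})$ can be computed deterministically in time $$\tilde O\Bigl(n^{\max\{1+\beta+\eta-\theta,\ \frac12(2+\beta+g(1,\beta,1,\theta))\}}\Bigr).$$ In other words, $$m(1,\beta,1,\eta)\ \le\ \min_{0\le\theta\le\eta}\ \max\Bigl\{1+\beta+\eta-\theta,\ \tfrac12\bigl(2+\beta+g(1,\beta,1,\theta)\bigr)\Bigr\}.$$ -/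

import Mathlib

/-! # Word RAM programs and the exponents of min-plus products -/

namespace MinPlus

/-! ## The machine model: a deterministic word RAM -/

/-- The binary word operations of the machine. -/
inductive Op
  | add | sub | mul | div | mod | and | or | xor | shl | shr

/-- The value of an operation. Subtraction is truncated at `0`; a result that does not fit into
a word is rejected by the execution relation `Exec` below. -/
def Op.eval : Op → ℕ → ℕ → ℕ
  | .add, x, y => x + y
  | .sub, x, y => x - y
  | .mul, x, y => x * y
  | .div, x, y => x / y
  | .mod, x, y => x % y
  | .and, x, y => x &&& y
  | .or, x, y => x ||| y
  | .xor, x, y => x ^^^ y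
  | .shl, x, y => x <<< y
  | .shr, x, y => x >>> y

/-- Programs. A program mentions finitely many registers (numbered by `ℕ`) and has access to a
random access memory whose cells are numbered by `ℕ`. -/
inductive Program
  /-- do nothing -/
  | nop
  /-- `reg r := v` -/
  | const (r v : ℕ)
  /-- `reg r := o (reg x) (reg y)` -/
  | op (o : Op) (r x y : ℕ)
  /-- `reg r := mem (reg x)` -/
  | load (r x : ℕ)
  /-- `mem (reg x) := reg y` -/
  | store (x y : ℕ)
  /-- run `p`, then `q` -/
  | seq (p q : Program)
  /-- if `reg x ≠ 0` run `p`, otherwise run `q` -/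
  | cond (x : ℕ) (p q : Program)
  /-- while `reg x ≠ 0` run `p` -/
  | loop (x : ℕ) (p : Program)

/-- Contents of the registers and of the memory. -/
structure State where
  reg : ℕ → ℕ
  mem : ℕ → ℕ

/-- Overwrite a register. -/
def State.setReg (s : State) (r v : ℕ) : State :=
  { s with reg := Function.update s.reg r v }

/-- Overwrite a memory cell. -/
def State.setMem (s : State) (a v : ℕ) : State :=
  { s with mem := Function.update s.mem a v }

/-- All registers and all memory cells contain `w`-bit words. -/
def State.Fits (w : ℕ) (s : State) : Prop :=
  (∀ r, s.reg r < 2 ^ w) ∧ ∀ a, s.mem a < 2 ^ w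

/-- `Exec w P s t s'`: on the machine with `w`-bit words, the program `P` started in the state `s`
halts after exactly `t` steps in the state `s'`. Every elementary instruction and every test of a
condition is one step. Each computed value has to fit into a word: a program that
computes a value which does not has no execution. -/
inductive Exec (w : ℕ) : Program → State → ℕ → State → Prop
  | nop (s : State) : Exec w .nop s 1 s
  | const (s : State) (r v : ℕ) (h : v < 2 ^ w) : Exec w (.const r v) s 1 (s.setReg r v)
  | op (s : State) (o : Op) (r x y : ℕ) (h : o.eval (s.reg x) (s.reg y) < 2 ^ w) :
      Exec w (.op o r x y) s 1 (s.setReg r (o.eval (s.reg x) (s.reg y)))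
  | load (s : State) (r x : ℕ) : Exec w (.load r x) s 1 (s.setReg r (s.mem (s.reg x)))
  | store (s : State) (x y : ℕ) : Exec w (.store x y) s 1 (s.setMem (s.reg x) (s.reg y))
  | seq {p q : Program} {s s₁ s₂ : State} {t₁ t₂ : ℕ}
      (h₁ : Exec w p s t₁ s₁) (h₂ : Exec w q s₁ t₂ s₂) : Exec w (.seq p q) s (t₁ + t₂) s₂
  | condTrue {x : ℕ} {p q : Program} {s s₁ : State} {t : ℕ}
      (hx : s.reg x ≠ 0) (h : Exec w p s t s₁) : Exec w (.cond x p q) s (t + 1) s₁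
  | condFalse {x : ℕ} {p q : Program} {s s₁ : State} {t : ℕ}
      (hx : s.reg x = 0) (h : Exec w q s t s₁) : Exec w (.cond x p q) s (t + 1) s₁
  | loopDone {x : ℕ} {p : Program} {s : State} (hx : s.reg x = 0) : Exec w (.loop x p) s 1 s
  | loopStep {x : ℕ} {p : Program} {s s₁ s₂ : State} {t₁ t₂ : ℕ}
      (hx : s.reg x ≠ 0) (h₁ : Exec w p s t₁ s₁) (h₂ : Exec w (.loop x p) s₁ t₂ s₂) :
      Exec w (.loop x p) s (t₁ + t₂ + 1) s₂

/-! ## Matrices over `ℤ ∪ {∞}` and their encoding in memory -/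

/-- The min-plus product `(A ⋆ B) i j = min_k (A i k + B k j)`. -/
def minPlus {a b c : ℕ} (A : Matrix (Fin a) (Fin b) (WithTop ℤ))
    (B : Matrix (Fin b) (Fin c) (WithTop ℤ)) : Matrix (Fin a) (Fin c) (WithTop ℤ) :=
  fun i j => Finset.univ.inf fun k => A i k + B k j

/-- All finite entries are integers of at most `l` bits, that is, of absolute value `< 2 ^ l`. -/
def HasBits {a b : ℕ} (l : ℕ) (A : Matrix (Fin a) (Fin b) (WithTop ℤ)) : Prop :=
  ∀ i j, ∀ x : ℤ, A i j = (x : WithTop ℤ) → |x| < 2 ^ l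

/-- An entry is written as a flag (`1` for `∞`, `0` for an integer) that is followed by `b` bits
in two's complement, least significant bit first, one bit per word (all `0` for `∞`). -/
def encodeEntry (b : ℕ) : WithTop ℤ → List ℕ
  | none => 1 :: List.replicate b 0
  | some x => 0 :: (List.range b).map fun i => (x / 2 ^ i % 2).toNat

/-- A matrix is written entry by entry, row after row. -/
def encodeMatrix {r c : ℕ} (b : ℕ) (X : Matrix (Fin r) (Fin c) (WithTop ℤ)) : List ℕ :=
  (List.ofFn fun i => (List.ofFn fun j => encodeEntry b (X i j)).flatten).flatten

/-- The input `(A, B)`: first `A`, then `B`. Entries of at most `l` bits and a sign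
take `l + 1` bits in two's complement. -/
def inputWords {a b c : ℕ} (l : ℕ) (A : Matrix (Fin a) (Fin b) (WithTop ℤ))
    (B : Matrix (Fin b) (Fin c) (WithTop ℤ)) : List ℕ :=
  encodeMatrix (l + 1) A ++ encodeMatrix (l + 1) B

/-- The initial state: the registers `0, 1, 2, 3` hold the three dimensions and the bit length of
the entries, the memory holds the two matrices from cell `0` on; everything else is `0`. -/
def inputState {a b c : ℕ} (l : ℕ) (A : Matrix (Fin a) (Fin b) (WithTop ℤ))
    (B : Matrix (Fin b) (Fin c) (WithTop ℤ)) : State where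
  reg r := [a, b, c, l].getD r 0
  mem x := (inputWords l A B).getD x 0

/-- The list `ws` stands in memory from cell `p` on. -/
def State.Holds (s : State) (p : ℕ) (ws : List ℕ) : Prop :=
  ∀ i, ∀ h : i < ws.length, s.mem (p + i) = ws[i]

/-- On the machine with `w`-bit words, the program `P` computes `A ⋆ B` in exactly `t` steps.
The result is written behind the input; its entries take `l + 2` bits in two's complement. -/
def ComputesIn {a b c : ℕ} (w : ℕ) (P : Program) (l : ℕ)
    (A : Matrix (Fin a) (Fin b) (WithTop ℤ)) (B : Matrix (Fin b) (Fin c) (WithTop ℤ))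
    (t : ℕ) : Prop :=
  (inputState l A B).Fits w ∧
    ∃ s : State, Exec w P (inputState l A B) t s ∧
      s.Holds (inputWords l A B).length (encodeMatrix (l + 2) (minPlus A B))

/-! ## Classes of instances and exponents -/

/-- The dimension `n ^ α`, rounded down. -/
noncomputable def dim (n : ℕ) (α : ℝ) : ℕ := ⌊(n : ℝ) ^ α⌋₊

/-- `Solvable α β γ Inst τ`: the min-plus products `A ⋆ B` of `n ^ α × n ^ β` matrices `A` and
`n ^ β × n ^ γ` matrices `B` in the class `Inst`, with entries that are `polylog n`-bit integers or
`∞`, can be computed in `Õ(n ^ τ)` time. Here `Õ` hides subpolynomial factors: for every `ε > 0`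
there is a program that runs in `O(n ^ (τ + ε))` time. `Inst C n A B` says that `(A, B)` belongs to
the class for the parameter `n` and for the hidden constant `C`.
The word length is `O(log (n + l))`, which is `O(log n)` as the bit length `l` is `polylog n`.
Neither the program nor the factor `κ` in the word length depends on the hidden constant `C`. -/
def Solvable (α β γ : ℝ)
    (Inst : ℕ → ∀ n : ℕ, Matrix (Fin (dim n α)) (Fin (dim n β)) (WithTop ℤ) →
      Matrix (Fin (dim n β)) (Fin (dim n γ)) (WithTop ℤ) → Prop) (τ : ℝ) : Prop :=
  ∀ ε : ℝ, 0 < ε → ∃ (P : Program) (κ : ℕ), ∀ C : ℕ, ∃ D : ℝ,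
    ∀ n : ℕ, 1 ≤ n → ∀ l : ℕ, l ≤ C * (Nat.log 2 n + 1) ^ C →
      ∀ (A : Matrix (Fin (dim n α)) (Fin (dim n β)) (WithTop ℤ))
        (B : Matrix (Fin (dim n β)) (Fin (dim n γ)) (WithTop ℤ)),
        HasBits l A → HasBits l B → Inst C n A B →
          ∃ t : ℕ, ComputesIn (κ * (Nat.log 2 (n + l) + 1)) P l A B t ∧
            (t : ℝ) ≤ D * (n : ℝ) ^ (τ + ε)

/-- The finite entries of `A` lie in `{-n ^ θ, …, n ^ θ}`. -/
def BoundedEntries {a b : ℕ} (n : ℕ) (θ : ℝ) (A : Matrix (Fin a) (Fin b) (WithTop ℤ)) : Prop :=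
  ∀ i j, ∀ x : ℤ, A i j = (x : WithTop ℤ) → |(x : ℝ)| ≤ (n : ℝ) ^ θ

/-- Min-plus products of an `n ^ α × n ^ β` matrix with entries in `{-n ^ θ, …, n ^ θ} ∪ {∞}` by an
arbitrary `n ^ β × n ^ γ` matrix can be computed in `Õ(n ^ τ)` time. -/
def BoundedSolvable (α β γ θ τ : ℝ) : Prop :=
  Solvable α β γ (fun _ n A _ => BoundedEntries n θ A) τ

/-- The exponent `g(α, β, γ, θ)`: the smallest `τ` such that bounded-entry min-plus products can be
computed in `Õ(n ^ τ)` time. -/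
noncomputable def g (α β γ θ : ℝ) : ℝ := sInf {τ : ℝ | BoundedSolvable α β γ θ τ}

/-- Every row of `B` is non-decreasing. -/
def IsMonotone {b c : ℕ} (B : Matrix (Fin b) (Fin c) (WithTop ℤ)) : Prop :=
  ∀ k, Monotone (B k)

/-- The total range `∑_k (max_{j, B k j ≠ ∞} B k j - B k 1 + 1)` of a monotone matrix; rows without
a finite entry contribute `0`. (In a monotone row with a finite entry, the first
entry is finite and the differences are non-negative.) -/
noncomputable def totalRange {b c : ℕ} (B : Matrix (Fin b) (Fin c) (WithTop ℤ)) : ℕ :=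
  ∑ k, (Finset.univ.filter fun j => B k j ≠ ⊤).sup fun j =>
    ((B k j).untopD 0 - (B k ⟨0, j.pos⟩).untopD 0 + 1).toNat

/-- Min-plus products of an `n ^ α × n ^ β` matrix by a monotone `n ^ β × n ^ γ` matrix of total
range `O(n ^ (β + η))` can be computed in `Õ(n ^ τ)` time. -/
def MonotoneSolvable (α β γ η τ : ℝ) : Prop :=
  Solvable α β γ
    (fun C n _ B => IsMonotone B ∧ (totalRange B : ℝ) ≤ C * (n : ℝ) ^ (β + η)) τ

/-- The exponent `m(α, β, γ, η)`: the smallest `τ` such that monotone min-plus products can be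
computed in `Õ(n ^ τ)` time. -/
noncomputable def m (α β γ η : ℝ) : ℝ := sInf {τ : ℝ | MonotoneSolvable α β γ η τ}

end MinPlus

/-!
# Monotone min-plus products by means of products with bounded entries

*The algorithm.* Let `A` be an `n × b` matrix and `B` a monotone `b × n` matrix of total range
`O(n ^ (β + η))`, where `b ≈ n ^ β`. Each row of `B` is cut greedily into segments on which it
varies by at most `d ≈ n ^ θ`; this gives `O(n ^ (β + η - θ))` segments in all (`nst_mul_le_range`,
`nseg_mul_le`). With `B` rounded down to the first entries of its segments, time proportional to
`n` times the number of segments suffices for an approximate product with error `d`, and for the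
positions of the *relevant* triples `(i, k, j)`, those for which `A i k + B k j` may be the
minimum: for a pair `(i, k)`, each segment of the row `k` contains at most one interval of them
(`Data.Rel`). Minimizing indices are relevant (`Data.Good.rel_of_min`), and the sum of a relevant
triple differs from the approximate product by `O(d)` (`Data.Good.abs_of_rel`).

The columns are swept from left to right. Whenever more than `T` of the pairs `(i, k)` that are not
yet covered are relevant for the current column `j`, one min-plus product is computed with the
bounded-entry algorithm: its factors are the difference of `A i k + B k j` and the approximate
product, which is replaced by `∞` where it exceeds `n ^ θ`, and the matrix `B k y - B k j`. The
sums in this product are the true sums, up to a shift, for *all* columns `y`. Hence the pairs with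
a finite entry, among which are all that are relevant for `j`, are covered once and for all. Each
such round covers more than `T` pairs, so there are at most `n b / T` rounds (`Tri.sweep`). In the
end, at most `T` uncovered pairs are relevant for each column, and the `n T` remaining triples are
enumerated one by one. The total time is

  `n ^ (1 + β + η - θ) + n ^ (1 + β) / T * n ^ g + n * T`,

and `T ≈ n ^ ((β + g) / 2)` gives the exponent of the theorem (`time_le`, `monotoneSolvable`).
Preparing and evaluating a round takes time `n ^ (1 + β) + n ^ 2`. This is no more than `n ^ g`,
because the bounded-entry algorithm has to write its output and to read the flags of its first
factor (`sq_le_steps`, `mul_le_steps`).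

*The implementation.* Programs are not written for the word RAM directly, but for an abstract
machine (`H`) with two-dimensional arrays of words and of integers, in which addition and
subtraction of integers are single instructions. Its states are represented in the memory of the
word RAM (`Rep`), and `Tri` is the corresponding notion of a Hoare triple with time bounds. A
program for the bounded-entry problem is simulated with its registers shifted and its memory in one
row of an array (`oracleOK_sim`). The word RAM finds the parameters of the memory layout by itself
(`setup_runs`). The result is `exists_monotone_program`.
-/

namespace MinPlus

/-! ### Running programs with postconditions -/

/-- `Runs w P s Q`: the program `P`, started in `s`, halts in a state `s'` after `t` steps such
that `Q s' t`. -/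
def Runs (w : ℕ) (P : Program) (s : State) (Q : State → ℕ → Prop) : Prop :=
  ∃ t s', Exec w P s t s' ∧ Q s' t

infixr:60 " ;; " => Program.seq

namespace Runs

variable {w : ℕ} {s : State} {Q : State → ℕ → Prop}

theorem mono {P : Program} {Q' : State → ℕ → Prop} (h : Runs w P s Q)
    (hQ : ∀ s' t, Q s' t → Q' s' t) : Runs w P s Q' := by
  obtain ⟨t, s', h1, h2⟩ := h
  exact ⟨t, s', h1, hQ _ _ h2⟩

theorem seq {p q : Program} (h : Runs w p s fun s₁ t₁ => Runs w q s₁ fun s₂ t₂ => Q s₂ (t₁ + t₂)) :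
    Runs w (p ;; q) s Q := by
  obtain ⟨t, s', h1, t', s'', h2, h3⟩ := h
  exact ⟨_, _, .seq h1 h2, h3⟩

theorem nop (h : Q s 1) : Runs w .nop s Q := ⟨_, _, .nop s, h⟩

theorem const {r v : ℕ} (hv : v < 2 ^ w) (h : Q (s.setReg r v) 1) : Runs w (.const r v) s Q :=
  ⟨_, _, .const s r v hv, h⟩

theorem op {o : Op} {r x y : ℕ} (hv : o.eval (s.reg x) (s.reg y) < 2 ^ w)
    (h : Q (s.setReg r (o.eval (s.reg x) (s.reg y))) 1) : Runs w (.op o r x y) s Q :=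
  ⟨_, _, .op s o r x y hv, h⟩

theorem load {r x : ℕ} (h : Q (s.setReg r (s.mem (s.reg x))) 1) : Runs w (.load r x) s Q :=
  ⟨_, _, .load s r x, h⟩

theorem store {x y : ℕ} (h : Q (s.setMem (s.reg x) (s.reg y)) 1) : Runs w (.store x y) s Q :=
  ⟨_, _, .store s x y, h⟩

/-- A loop that runs its body exactly `m` times, each time in at most `c` steps. -/
theorem loop_count {x : ℕ} {p : Program} (I : ℕ → State → Prop) (m c : ℕ) (h0 : I 0 s)
    (hstep : ∀ i < m, ∀ s, I i s → s.reg x ≠ 0 ∧ Runs w p s fun s' t => I (i + 1) s' ∧ t ≤ c)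
    (hend : ∀ s, I m s → s.reg x = 0) :
    Runs w (.loop x p) s fun s' t => I m s' ∧ t ≤ m * (c + 1) + 1 := by
  suffices H : ∀ j i s, i + j = m → I i s →
      Runs w (.loop x p) s fun s' t => I m s' ∧ t ≤ j * (c + 1) + 1 from H m 0 s (by simp) h0
  intro j
  induction j with
  | zero =>
    intro i s hi hI
    obtain rfl : i = m := by omega
    exact ⟨1, s, .loopDone (hend s hI), hI, by simp⟩
  | succ j ih =>
    intro i s hi hI
    obtain ⟨hx, t₁, s₁, h1, h2, h3⟩ := hstep i (by omega) s hI
    obtain ⟨t₂, s₂, h4, h5, h6⟩ := ih (i + 1) s₁ (by omega) h2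
    exact ⟨_, _, .loopStep hx h1 h4, h5, by nlinarith⟩

end Runs

@[simp] theorem State.reg_setReg (s : State) (r v q : ℕ) :
    (s.setReg r v).reg q = if q = r then v else s.reg q := by
  simp [State.setReg, Function.update_apply]

@[simp] theorem State.mem_setReg (s : State) (r v : ℕ) : (s.setReg r v).mem = s.mem := rfl

@[simp] theorem State.reg_setMem (s : State) (a v : ℕ) : (s.setMem a v).reg = s.reg := rfl

theorem State.mem_setMem (s : State) (a v x : ℕ) :
    (s.setMem a v).mem x = if x = a then v else s.mem x := by
  simp [State.setMem, Function.update_apply]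

/-! ### The abstract machine -/

/-- The states of the abstract machine: registers, a flat memory, two-dimensional arrays of words
and two-dimensional arrays of integers. -/
structure H where
  reg : ℕ → ℕ
  raw : ℕ → ℕ
  arr : Fin 32 → ℕ → ℕ → ℕ
  num : Fin 32 → ℕ → ℕ → ℤ

/-- Parameters of the memory layout: the word length `w`, the size `Z` of the flat
memory, the side length `N` of the arrays and the length `W` of the integers. -/
structure Env where
  w : ℕ
  Z : ℕ
  N : ℕ
  W : ℕ
  hW : 1 ≤ W
  hN : 1 < N
  hZ : Z < N
  hWN : W < N
  fits : Z + N * N * 64 * W < 2 ^ w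

/-- Number of the block of `W` cells that belongs to the entry `x, y` of the array `id`: the numbers
`0, …, 31` stand for the arrays of words, the numbers `32, …, 63` for those of integers. -/
def Env.blk (E : Env) (id x y : ℕ) : ℕ := (x * E.N + y) * 64 + id

/-- First cell of that block. -/
def Env.addr (E : Env) (id x y : ℕ) : ℕ := E.Z + E.blk id x y * E.W

/-- The `i`-th bit of an integer in two's complement. -/
def bit (x : ℤ) (i : ℕ) : ℕ := (x / 2 ^ i % 2).toNat

theorem bit_lt (x : ℤ) (i : ℕ) : bit x i < 2 := by unfold bit; omega

theorem bit_zero' (i : ℕ) : bit 0 i = 0 := by simp [bit]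

theorem cast_bit (x : ℤ) (i : ℕ) : (bit x i : ℤ) = x / 2 ^ i % 2 := by unfold bit; omega

/-- A machine state that represents a state of the abstract machine. The register `r` of the
abstract machine is the register `r + 14`; the registers `4, …, 8` hold constants. A word in an
array uses the first cell of its block, an integer is stored modulo `2 ^ W`. -/
structure Rep (E : Env) (h : H) (s : State) : Prop where
  reg : ∀ r, s.reg (r + 14) = h.reg r
  r4 : s.reg 4 = 0
  r5 : s.reg 5 = E.Z
  r6 : s.reg 6 = E.N
  r7 : s.reg 7 = E.W
  r8 : s.reg 8 = 1
  raw : ∀ x, x < E.Z → s.mem x = h.raw x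
  arr : ∀ a : Fin 32, ∀ x y, x < E.N → y < E.N → s.mem (E.addr a x y) = h.arr a x y
  num : ∀ a : Fin 32, ∀ x y, x < E.N → y < E.N → ∀ i, i < E.W →
    s.mem (E.addr (a + 32) x y + i) = bit (h.num a x y) i

namespace Env

variable (E : Env)

theorem blk_inj {id x y id' x' y' : ℕ} (h1 : id < 64) (h2 : id' < 64) (h3 : y < E.N)
    (h4 : y' < E.N) (h : E.blk id x y = E.blk id' x' y') : id = id' ∧ x = x' ∧ y = y' := by
  unfold blk at h
  have e1 : id = id' := by omega
  have e2 : x * E.N + y = x' * E.N + y' := by omega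
  have e3 : y = y' := by
    have := congrArg (· % E.N) e2
    simpa [Nat.add_mod, Nat.mod_eq_of_lt h3, Nat.mod_eq_of_lt h4] using this
  subst e3
  refine ⟨e1, ?_, rfl⟩
  have : x * E.N = x' * E.N := by omega
  exact Nat.eq_of_mul_eq_mul_right (by omega) this

theorem blk_lt {id x y : ℕ} (h1 : id < 64) (h2 : x < E.N) (h3 : y < E.N) :
    E.blk id x y < E.N * E.N * 64 := by
  unfold blk
  have : x * E.N + y + 1 ≤ E.N * E.N := by nlinarith
  omega

theorem addr_add_lt {id x y i : ℕ} (h1 : id < 64) (h2 : x < E.N) (h3 : y < E.N) (hi : i < E.W) :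
    E.addr id x y + i < 2 ^ E.w := by
  have := E.blk_lt h1 h2 h3
  have h4 := E.fits
  unfold addr
  have : (E.blk id x y + 1) * E.W ≤ E.N * E.N * 64 * E.W := Nat.mul_le_mul_right _ this
  nlinarith

theorem N_le : E.N * E.N * 64 ≤ 2 ^ E.w := by
  have := E.fits
  have h := E.hW
  nlinarith [Nat.mul_le_mul_left (E.N * E.N * 64) h]

theorem lt_of_lt_N {x : ℕ} (h : x ≤ E.N) : x < 2 ^ E.w := by
  have := E.N_le
  have := E.hN
  nlinarith

theorem const_lt {x : ℕ} (h : x ≤ 64) : x < 2 ^ E.w := by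
  have := E.N_le
  have := E.hN
  nlinarith

/-- Two cells coincide only if their blocks and their positions in the block do. -/
theorem cell_inj {p q i j : ℕ} (hi : i < E.W) (hj : j < E.W)
    (h : E.Z + p * E.W + i = E.Z + q * E.W + j) : p = q ∧ i = j := by
  have h' : p * E.W + i = q * E.W + j := by omega
  have e : i = j := by
    have := congrArg (· % E.W) h'
    simpa [Nat.add_mod, Nat.mod_eq_of_lt hi, Nat.mod_eq_of_lt hj] using this
  subst e
  exact ⟨Nat.eq_of_mul_eq_mul_right (by omega : 0 < E.W) (by omega), rfl⟩

end Env

/-- Computes the address of the entry `x, y` (numbers of registers) of the array `id` into the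
machine register `q`. -/
def addrP (q id x y : ℕ) : Program :=
  .op .mul q (x + 14) 6 ;; .op .add q q (y + 14) ;; .const 0 64 ;; .op .mul q q 0 ;;
  .const 0 id ;; .op .add q q 0 ;; .op .mul q q 7 ;; .op .add q q 5

theorem addrP_runs (E : Env) {h : H} {s : State} (hs : Rep E h s) {q id x y : ℕ}
    (hq : 9 ≤ q) (hq' : q < 14) (hid : id < 64) (hx : h.reg x < E.N) (hy : h.reg y < E.N) :
    Runs E.w (addrP q id x y) s fun s' t => t = 8 ∧ s'.mem = s.mem ∧
      s'.reg q = E.addr id (h.reg x) (h.reg y) ∧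
      ∀ r, r ≠ 0 → r ≠ q → s'.reg r = s.reg r := by
  have hb := E.blk_lt hid hx hy
  have ha := E.addr_add_lt hid hx hy (i := 0) E.hW
  have hN := E.N_le
  have e5 := hs.r5
  have e6 := hs.r6
  have e7 := hs.r7
  have ex := hs.reg x
  have ey := hs.reg y
  unfold Env.addr at ha
  have hb' : E.blk id (h.reg x) (h.reg y) = (h.reg x * E.N + h.reg y) * 64 + id := rfl
  have q0 : q ≠ 0 := by omega
  have q5 : 5 ≠ q := by omega
  have q6 : 6 ≠ q := by omega
  have q7 : 7 ≠ q := by omega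
  have qx : x + 14 ≠ q := by omega
  have qy : y + 14 ≠ q := by omega
  have hw : E.blk id (h.reg x) (h.reg y) * E.W < 2 ^ E.w := by omega
  refine .seq (.op ?_ (.seq (.op ?_ (.seq (.const ?_ (.seq (.op ?_ (.seq (.const ?_ (.seq (.op ?_
    (.seq (.op ?_ (.op ?_ ?_))))))))))))))
  · simp only [Op.eval, ex, e6]; omega
  · simp [Op.eval, ex, e6, ey, qy]; omega
  · exact E.const_lt le_rfl
  · simp [Op.eval, ex, e6, ey, qy, q0]; omega
  · exact E.const_lt (by omega)
  · simp [Op.eval, ex, e6, ey, qy, q0]; omega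
  · simp [Op.eval, ex, e6, e7, ey, qy, q0, q7]; rw [← hb']; exact hw
  · simp [Op.eval, ex, e6, e7, ey, qy, q0, q7, q5, e5]; rw [← hb']; omega
  · refine ⟨rfl, rfl, ?_, ?_⟩
    · simp [Op.eval, ex, e6, e7, ey, qy, q0, q7, q5, e5, Env.addr, hb']; ring
    · intro r h0 hr
      simp [h0, hr]

namespace H

/-- Overwrites a register. -/
def setReg (h : H) (r v : ℕ) : H :=
  { h with reg := fun q => if q = r then v else h.reg q }

/-- Overwrites a cell of the flat memory. -/
def setRaw (h : H) (x v : ℕ) : H :=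
  { h with raw := fun q => if q = x then v else h.raw q }

/-- Overwrites an entry of an array of words. -/
def setArr (h : H) (a : Fin 32) (x y v : ℕ) : H :=
  { h with arr := fun a' x' y' => if a' = a ∧ x' = x ∧ y' = y then v else h.arr a' x' y' }

/-- Overwrites an entry of an array of integers. -/
def setNum (h : H) (a : Fin 32) (x y : ℕ) (v : ℤ) : H :=
  { h with num := fun a' x' y' => if a' = a ∧ x' = x ∧ y' = y then v else h.num a' x' y' }

variable (h : H) (a a' : Fin 32) (r q x y x' y' v : ℕ) (z : ℤ)

@[simp] theorem reg_setReg : (h.setReg r v).reg q = if q = r then v else h.reg q := rfl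
@[simp] theorem arr_setReg : (h.setReg r v).arr = h.arr := rfl
@[simp] theorem num_setReg : (h.setReg r v).num = h.num := rfl
@[simp] theorem reg_setRaw : (h.setRaw x v).reg = h.reg := rfl
@[simp] theorem reg_setArr : (h.setArr a x y v).reg = h.reg := rfl
@[simp] theorem reg_setNum : (h.setNum a x y z).reg = h.reg := rfl
@[simp] theorem arr_setNum : (h.setNum a x y z).arr = h.arr := rfl
theorem raw_setRaw : (h.setRaw x v).raw q = if q = x then v else h.raw q := rfl
theorem arr_setArr : (h.setArr a x y v).arr a' x' y' =
    if a' = a ∧ x' = x ∧ y' = y then v else h.arr a' x' y' := rfl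
theorem num_setNum : (h.setNum a x y z).num a' x' y' =
    if a' = a ∧ x' = x ∧ y' = y then z else h.num a' x' y' := rfl
theorem arr_setArr_ne (ha : a' ≠ a) : (h.setArr a x y v).arr a' = h.arr a' := by
  funext x' y'; simp [arr_setArr, ha]
theorem num_setNum_ne (ha : a' ≠ a) : (h.setNum a x y z).num a' = h.num a' := by
  funext x' y'; simp [num_setNum, ha]
@[simp] theorem num_setNum_self : (h.setNum a x y z).num a x y = z := by simp [num_setNum]

end H

/-- The number of machine steps that bounds one step of the abstract machine. The addition of two
integers goes through their `W` bits; all other instructions take a bounded number of steps. -/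
def Env.unit (E : Env) : ℕ := 60 * E.W

/-- `Tri E P h Q`: started in any representation of `h`, the program halts in a representation of
some `h'` with `Q h' k`, after at most `k` units of time. -/
def Tri (E : Env) (P : Program) (h : H) (Q : H → ℕ → Prop) : Prop :=
  ∀ s, Rep E h s → Runs E.w P s fun s' t => ∃ h' k, t ≤ E.unit * k ∧ Rep E h' s' ∧ Q h' k

theorem Env.le_unit (E : Env) : 60 ≤ E.unit := by
  have := E.hW
  unfold Env.unit; omega

namespace Tri

variable {E : Env} {h : H} {Q : H → ℕ → Prop}

theorem mono {P : Program} {Q' : H → ℕ → Prop} (hP : Tri E P h Q)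
    (hQ : ∀ h' k, Q h' k → Q' h' k) : Tri E P h Q' := fun s hs =>
  (hP s hs).mono fun _ _ ⟨h', k, h1, h2, h3⟩ => ⟨h', k, h1, h2, hQ _ _ h3⟩

theorem seq {p q : Program} (hP : Tri E p h fun h₁ k₁ => Tri E q h₁ fun h₂ k₂ => Q h₂ (k₁ + k₂)) :
    Tri E (p ;; q) h Q := fun s hs => by
  refine .seq ((hP s hs).mono fun s₁ t₁ ⟨h₁, k₁, h1, h2, h3⟩ => (h3 s₁ h2).mono ?_)
  rintro s₂ t₂ ⟨h₂, k₂, h4, h5, h6⟩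
  exact ⟨h₂, k₁ + k₂, by rw [mul_add]; omega, h5, h6⟩

theorem seq_of {p q : Program} {R : H → ℕ → Prop} (hp : Tri E p h R)
    (hq : ∀ h₁ k₁, R h₁ k₁ → Tri E q h₁ fun h₂ k₂ => Q h₂ (k₁ + k₂)) : Tri E (p ;; q) h Q :=
  seq (hp.mono hq)

/-- A program whose execution takes at most one unit. -/
theorem of_runs {P : Program} {h' : H}
    (hP : ∀ s, Rep E h s → Runs E.w P s fun s' t => t ≤ E.unit ∧ Rep E h' s') (hQ : Q h' 1) :
    Tri E P h Q := fun s hs =>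
  (hP s hs).mono fun _ _ ⟨h1, h2⟩ => ⟨h', 1, by simpa using h1, h2, hQ⟩

end Tri

theorem Rep.setReg {E : Env} {h : H} {s : State} (hs : Rep E h s) (r v : ℕ) :
    Rep E (h.setReg r v) (s.setReg (r + 14) v) where
  reg q := by
    by_cases hq : q = r
    · simp [hq]
    · simp [hq, hs.reg]
  r4 := by simpa using hs.r4
  r5 := by simpa using hs.r5
  r6 := by simpa using hs.r6
  r7 := by simpa using hs.r7
  r8 := by simpa using hs.r8
  raw := hs.raw
  arr := hs.arr
  num := hs.num

/-- Whether a state represents `h` does not depend on the registers below `4` and on those from `9`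
to `13`, which serve as scratch space. -/
theorem Rep.congr {E : Env} {h : H} {s s' : State} (hs : Rep E h s) (hm : s'.mem = s.mem)
    (hr : ∀ r, 14 ≤ r ∨ (4 ≤ r ∧ r ≤ 8) → s'.reg r = s.reg r) : Rep E h s' where
  reg q := by rw [hr _ (by omega), hs.reg]
  r4 := by rw [hr _ (by omega), hs.r4]
  r5 := by rw [hr _ (by omega), hs.r5]
  r6 := by rw [hr _ (by omega), hs.r6]
  r7 := by rw [hr _ (by omega), hs.r7]
  r8 := by rw [hr _ (by omega), hs.r8]
  raw := by rw [hm]; exact hs.raw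
  arr := by rw [hm]; exact hs.arr
  num := by rw [hm]; exact hs.num

theorem Env.lt_addr (E : Env) {x : ℕ} (hx : x < E.Z) (id a b i : ℕ) : x ≠ E.addr id a b + i := by
  unfold Env.addr; have := Nat.zero_le (E.blk id a b * E.W); omega

theorem Env.addr_inj (E : Env) {id x y id' x' y' i j : ℕ} (h1 : id < 64) (h2 : id' < 64)
    (h3 : y < E.N) (h4 : y' < E.N) (hi : i < E.W) (hj : j < E.W)
    (h : E.addr id x y + i = E.addr id' x' y' + j) : id = id' ∧ x = x' ∧ y = y' ∧ i = j := by
  obtain ⟨h5, h6⟩ := E.cell_inj hi hj h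
  obtain ⟨h7, h8, h9⟩ := E.blk_inj h1 h2 h3 h4 h5
  exact ⟨h7, h8, h9, h6⟩

theorem Rep.setRaw {E : Env} {h : H} {s : State} (hs : Rep E h s) {x : ℕ} (hx : x < E.Z) (v : ℕ) :
    Rep E (h.setRaw x v) (s.setMem x v) where
  reg := hs.reg
  r4 := hs.r4
  r5 := hs.r5
  r6 := hs.r6
  r7 := hs.r7
  r8 := hs.r8
  raw q hq := by
    rw [State.mem_setMem, H.raw_setRaw, hs.raw q hq]
  arr a p q hp hq := by
    rw [State.mem_setMem, if_neg (show E.addr a p q ≠ x from (E.lt_addr hx a p q 0).symm)]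
    exact hs.arr a p q hp hq
  num a p q hp hq i hi := by
    rw [State.mem_setMem, if_neg (E.lt_addr hx _ _ _ i).symm]; exact hs.num a p q hp hq i hi

theorem Rep.setArr {E : Env} {h : H} {s : State} (hs : Rep E h s) (a : Fin 32) {x y : ℕ}
    (hy : y < E.N) (v : ℕ) :
    Rep E (h.setArr a x y v) (s.setMem (E.addr a x y) v) where
  reg := hs.reg
  r4 := hs.r4
  r5 := hs.r5
  r6 := hs.r6
  r7 := hs.r7
  r8 := hs.r8
  raw q hq := by
    rw [State.mem_setMem, if_neg (show q ≠ E.addr a x y from E.lt_addr hq a x y 0)]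
    exact hs.raw q hq
  arr a' p q hp hq := by
    rw [State.mem_setMem, H.arr_setArr, hs.arr a' p q hp hq]
    refine if_congr ⟨fun h => ?_, ?_⟩ rfl rfl
    · obtain ⟨h1, h2, h3, -⟩ := E.addr_inj (by omega) (by omega) hq hy E.hW E.hW h
      exact ⟨Fin.ext h1, h2, h3⟩
    · rintro ⟨rfl, rfl, rfl⟩; rfl
  num a' p q hp hq i hi := by
    rw [State.mem_setMem, if_neg]
    · exact hs.num a' p q hp hq i hi
    · intro h
      have := E.addr_inj (i := i) (j := 0) (by omega) (by omega) hq hy hi E.hW h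
      omega

/-- Writing the bits of an integer into its block. -/
theorem Rep.setNum {E : Env} {h : H} {s s' : State} (hs : Rep E h s) (a : Fin 32) {x y : ℕ}
    (hy : y < E.N) (v : ℤ)
    (hm : ∀ c, s'.mem c = if E.addr (a + 32) x y ≤ c ∧ c < E.addr (a + 32) x y + E.W then
      bit v (c - E.addr (a + 32) x y) else s.mem c)
    (hr : ∀ r, 14 ≤ r ∨ (4 ≤ r ∧ r ≤ 8) → s'.reg r = s.reg r) :
    Rep E (h.setNum a x y v) s' where
  reg q := by rw [hr _ (by omega), hs.reg]; rfl
  r4 := by rw [hr _ (by omega), hs.r4]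
  r5 := by rw [hr _ (by omega), hs.r5]
  r6 := by rw [hr _ (by omega), hs.r6]
  r7 := by rw [hr _ (by omega), hs.r7]
  r8 := by rw [hr _ (by omega), hs.r8]
  raw q hq := by
    rw [hm, if_neg]
    · exact hs.raw q hq
    · rintro ⟨h1, -⟩
      have := E.lt_addr hq (a + 32) x y (q - E.addr (a + 32) x y)
      omega
  arr a' p q hp hq := by
    rw [hm, if_neg]
    · exact hs.arr a' p q hp hq
    · rintro ⟨h1, h2⟩
      have := E.addr_inj (i := 0) (j := E.addr a' p q - E.addr (a + 32) x y) (id := a')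
        (id' := a + 32) (x := p) (y := q) (x' := x) (y' := y) (by omega) (by omega) hq hy E.hW
        (by omega) (by omega)
      omega
  num a' p q hp hq i hi := by
    rw [hm, H.num_setNum]
    by_cases hc : a' = a ∧ p = x ∧ q = y
    · obtain ⟨rfl, rfl, rfl⟩ := hc
      rw [if_pos ⟨by omega, by omega⟩, if_pos ⟨rfl, rfl, rfl⟩]
      congr 1; omega
    · rw [if_neg, if_neg hc]
      · exact hs.num a' p q hp hq i hi
      · rintro ⟨h1, h2⟩
        have := E.addr_inj (i := i) (j := E.addr (a' + 32) p q + i - E.addr (a + 32) x y)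
          (id := a' + 32) (id' := a + 32) (x := p) (y := q) (x' := x) (y' := y) (by omega) (by omega)
          hq hy hi (by omega) (by omega)
        exact hc ⟨Fin.ext (by omega), this.2.1, this.2.2.1⟩

/-! ### Instructions of the abstract machine -/

/-- `reg r := v` -/
def constH (r v : ℕ) : Program := .const (r + 14) v
/-- `reg r := o (reg x) (reg y)` -/
def opH (o : Op) (r x y : ℕ) : Program := .op o (r + 14) (x + 14) (y + 14)
/-- `reg r := reg r + 1` -/
def incH (r : ℕ) : Program := .op .add (r + 14) (r + 14) 8
/-- `reg r := reg x` -/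
def movH (r x : ℕ) : Program := .op .add (r + 14) (x + 14) 4
/-- `reg r := raw (reg x)` -/
def ldH (r x : ℕ) : Program := .load (r + 14) (x + 14)
/-- `raw (reg x) := reg y` -/
def stH (x y : ℕ) : Program := .store (x + 14) (y + 14)
/-- `reg r := arr a (reg x) (reg y)` -/
def getH (r : ℕ) (a : Fin 32) (x y : ℕ) : Program := addrP 9 a x y ;; .load (r + 14) 9
/-- `arr a (reg x) (reg y) := reg v` -/
def putH (a : Fin 32) (x y v : ℕ) : Program := addrP 9 a x y ;; .store 9 (v + 14)
/-- `reg r :=` the bit number `reg i` of `num a (reg x) (reg y)` -/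
def bitH (r : ℕ) (a : Fin 32) (x y i : ℕ) : Program :=
  addrP 9 (a + 32) x y ;; .op .add 9 9 (i + 14) ;; .load (r + 14) 9
/-- Replaces the lowest bit of `num a (reg x) (reg y)` by `reg v`. -/
def lowH (a : Fin 32) (x y v : ℕ) : Program := addrP 9 (a + 32) x y ;; .store 9 (v + 14)
/-- if `reg x ≠ 0` run `p`, otherwise run `q` -/
def condH (x : ℕ) (p q : Program) : Program := .cond (x + 14) p q

namespace Tri

variable {E : Env} {h : H} {Q : H → ℕ → Prop}

theorem nop (hQ : Q h 1) : Tri E .nop h Q :=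
  of_runs (fun _ hs => .nop ⟨by have := E.le_unit; omega, hs⟩) hQ

theorem const {r v : ℕ} (hv : v < 2 ^ E.w) (hQ : Q (h.setReg r v) 1) : Tri E (constH r v) h Q :=
  of_runs (fun _ hs => .const hv ⟨by have := E.le_unit; omega, hs.setReg r v⟩) hQ

theorem op {o : Op} {r x y : ℕ} (hv : o.eval (h.reg x) (h.reg y) < 2 ^ E.w)
    (hQ : Q (h.setReg r (o.eval (h.reg x) (h.reg y))) 1) : Tri E (opH o r x y) h Q :=
  of_runs (fun s hs => .op (by rw [hs.reg, hs.reg]; exact hv)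
    ⟨by have := E.le_unit; omega, by rw [hs.reg, hs.reg]; exact hs.setReg r _⟩) hQ

theorem inc {r : ℕ} (hv : h.reg r + 1 < 2 ^ E.w) (hQ : Q (h.setReg r (h.reg r + 1)) 1) :
    Tri E (incH r) h Q :=
  of_runs (fun s hs => .op (by rw [hs.reg, hs.r8]; exact hv)
    ⟨by have := E.le_unit; omega, by rw [hs.reg, hs.r8]; exact hs.setReg r _⟩) hQ

theorem mov {r x : ℕ} (hv : h.reg x < 2 ^ E.w) (hQ : Q (h.setReg r (h.reg x)) 1) :
    Tri E (movH r x) h Q :=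
  of_runs (fun s hs => .op (by rw [hs.reg, hs.r4]; exact hv)
    ⟨by have := E.le_unit; omega, by rw [hs.reg, hs.r4]; exact hs.setReg r _⟩) hQ

theorem ld {r x : ℕ} (hx : h.reg x < E.Z) (hQ : Q (h.setReg r (h.raw (h.reg x))) 1) :
    Tri E (ldH r x) h Q :=
  of_runs (fun s hs => .load
    ⟨by have := E.le_unit; omega, by rw [hs.reg, hs.raw _ hx]; exact hs.setReg r _⟩) hQ

theorem st {x y : ℕ} (hx : h.reg x < E.Z) (hQ : Q (h.setRaw (h.reg x) (h.reg y)) 1) :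
    Tri E (stH x y) h Q :=
  of_runs (fun s hs => .store
    ⟨by have := E.le_unit; omega, by rw [hs.reg, hs.reg]; exact hs.setRaw hx _⟩) hQ

theorem get {r : ℕ} {a : Fin 32} {x y : ℕ} (hx : h.reg x < E.N) (hy : h.reg y < E.N)
    (hQ : Q (h.setReg r (h.arr a (h.reg x) (h.reg y))) 1) : Tri E (getH r a x y) h Q := by
  refine of_runs (fun s hs => .seq ((addrP_runs E hs le_rfl (by omega) (by omega) hx hy).mono ?_)) hQ
  rintro s' _ ⟨rfl, hm, h9, hr⟩
  refine .load ⟨by have := E.le_unit; omega, ?_⟩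
  rw [h9, hm, hs.arr a _ _ hx hy]
  exact (hs.congr hm fun r hr' => hr r (by omega) (by omega)).setReg r _

theorem put {a : Fin 32} {x y v : ℕ} (hx : h.reg x < E.N) (hy : h.reg y < E.N)
    (hQ : Q (h.setArr a (h.reg x) (h.reg y) (h.reg v)) 1) : Tri E (putH a x y v) h Q := by
  refine of_runs (fun s hs => .seq ((addrP_runs E hs le_rfl (by omega) (by omega) hx hy).mono ?_)) hQ
  rintro s' _ ⟨rfl, hm, h9, hr⟩
  refine .store ⟨by have := E.le_unit; omega, ?_⟩
  rw [h9, hr _ (by omega) (by omega), hs.reg]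
  exact (hs.congr hm fun r hr' => hr r (by omega) (by omega)).setArr a hy _

theorem getBit {r : ℕ} {a : Fin 32} {x y i : ℕ} (hx : h.reg x < E.N) (hy : h.reg y < E.N)
    (hi : h.reg i < E.W)
    (hQ : Q (h.setReg r (bit (h.num a (h.reg x) (h.reg y)) (h.reg i))) 1) :
    Tri E (bitH r a x y i) h Q := by
  refine of_runs (fun s hs => .seq ((addrP_runs E hs le_rfl (by omega) (by omega) hx hy).mono ?_)) hQ
  rintro s' _ ⟨rfl, hm, h9, hr⟩
  have e1 : s'.reg (i + 14) = h.reg i := by rw [hr _ (by omega) (by omega), hs.reg]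
  refine .seq (.op ?_ (.load ⟨by have := E.le_unit; omega, ?_⟩))
  · rw [h9, e1]; exact E.addr_add_lt (by omega) hx hy hi
  · simp only [State.reg_setReg, State.mem_setReg, if_true, h9, e1, Op.eval, hm]
    rw [hs.num a _ _ hx hy _ hi]
    have hs' : Rep E h (s'.setReg 9 (E.addr (a + 32) (h.reg x) (h.reg y) + h.reg i)) := by
      refine hs.congr hm fun r hr' => ?_
      rw [State.reg_setReg, if_neg (by omega)]
      exact hr r (by omega) (by omega)
    exact hs'.setReg r _

theorem low {a : Fin 32} {x y v : ℕ} (hx : h.reg x < E.N) (hy : h.reg y < E.N)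
    (hv : h.reg v < 2)
    (hQ : Q (h.setNum a (h.reg x) (h.reg y)
      (h.num a (h.reg x) (h.reg y) / 2 * 2 + h.reg v)) 1) : Tri E (lowH a x y v) h Q := by
  refine of_runs (fun s hs => .seq ((addrP_runs E hs le_rfl (by omega) (by omega) hx hy).mono ?_)) hQ
  rintro s' _ ⟨rfl, hm, h9, hr⟩
  refine .store ⟨by have := E.le_unit; omega, ?_⟩
  rw [h9, hr _ (by omega) (by omega), hs.reg]
  refine (hs.congr hm fun r hr' => hr r (by omega) (by omega)).setNum a hy _ ?_ fun _ _ => rfl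
  intro c
  rw [State.mem_setMem]
  have hW := E.hW
  split_ifs with h1 h2 h2
  · subst h1
    simp only [MinPlus.bit, Nat.sub_self, pow_zero, Int.ediv_one]; omega
  · omega
  · rw [hm]
    obtain ⟨i, hi⟩ : ∃ i, c - E.addr (a + 32) (h.reg x) (h.reg y) = i + 1 :=
      ⟨c - E.addr (a + 32) (h.reg x) (h.reg y) - 1, by omega⟩
    have := hs.num a _ _ hx hy (i + 1) (by omega)
    rw [← hi, Nat.add_sub_cancel' h2.1] at this
    rw [this, hi]
    unfold MinPlus.bit
    rw [pow_succ', ← Int.ediv_ediv_of_nonneg (by norm_num), ← Int.ediv_ediv_of_nonneg (by norm_num)]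
    have key : (h.num a (h.reg x) (h.reg y) / 2 * 2 + (h.reg v : ℤ)) / 2 =
      h.num a (h.reg x) (h.reg y) / 2 := by omega
    rw [key]
  · rfl

theorem cond {x : ℕ} {p q : Program} (h1 : h.reg x ≠ 0 → Tri E p h fun h' k => Q h' (k + 1))
    (h2 : h.reg x = 0 → Tri E q h fun h' k => Q h' (k + 1)) : Tri E (condH x p q) h Q := by
  intro s hs
  have := E.le_unit
  by_cases hx : h.reg x = 0
  · obtain ⟨t, s', h3, h', k, h4, h5, h6⟩ := h2 hx s hs
    exact ⟨_, _, .condFalse (by rw [hs.reg, hx]) h3, h', k + 1, by rw [mul_add]; omega, h5, h6⟩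
  · obtain ⟨t, s', h3, h', k, h4, h5, h6⟩ := h1 hx s hs
    exact ⟨_, _, .condTrue (by rw [hs.reg]; exact hx) h3, h', k + 1, by rw [mul_add]; omega, h5, h6⟩

end Tri

/-! ### Addition and subtraction of integers -/

theorem bit_not (y : ℤ) (i : ℕ) : bit (-y - 1) i = bit y i ^^^ 1 := by
  have h : (-y - 1) / 2 ^ i = -(y / 2 ^ i) - 1 := by
    have h1 := Int.mul_ediv_add_emod y (2 ^ i)
    have h2 := Int.emod_nonneg y (b := 2 ^ i) (by positivity)
    have h3 := Int.emod_lt_of_pos y (b := 2 ^ i) (by positivity)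
    refine ((Int.ediv_emod_unique (r := 2 ^ i - y % 2 ^ i - 1) (by positivity)).2
      ⟨?_, by omega, by omega⟩).1
    linear_combination -h1
  unfold bit
  rw [h]
  obtain h0 | h0 : y / 2 ^ i % 2 = 0 ∨ y / 2 ^ i % 2 = 1 := by omega
  · rw [h0, show (-(y / 2 ^ i) - 1) % 2 = 1 by omega]; rfl
  · rw [h0, show (-(y / 2 ^ i) - 1) % 2 = 0 by omega]; rfl

/-- The carry into the bit number `i` of the sum `x + v + f`. -/
def carry (x v f : ℤ) (i : ℕ) : ℤ := (x + v + f) / 2 ^ i - x / 2 ^ i - v / 2 ^ i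

theorem ediv_two_pow_succ (x : ℤ) (i : ℕ) : x / 2 ^ (i + 1) = x / 2 ^ i / 2 := by
  rw [pow_succ, Int.ediv_ediv_of_nonneg (by positivity)]

theorem carry_succ (x v f : ℤ) (i : ℕ) :
    carry x v f (i + 1) = (x / 2 ^ i % 2 + v / 2 ^ i % 2 + carry x v f i) / 2 := by
  unfold carry
  simp only [ediv_two_pow_succ]
  omega

theorem carry_bound (x v f : ℤ) (h0 : 0 ≤ f) (h1 : f ≤ 1) (i : ℕ) :
    0 ≤ carry x v f i ∧ carry x v f i ≤ 1 := by
  induction i with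
  | zero => simp [carry]; omega
  | succ i ih => rw [carry_succ]; omega

theorem bit_sum (x v f : ℤ) (i : ℕ) :
    ((x + v + f) / 2 ^ i % 2) = (x / 2 ^ i % 2 + v / 2 ^ i % 2 + carry x v f i) % 2 := by
  unfold carry; omega

/-- One position of the addition with carry: the machine registers `9, 10, 11` point to the bits,
`12` counts, `13` is the carry. The bit of the second summand is flipped if `f = 1`. -/
def addBody (f : ℕ) : Program :=
  .load 0 10 ;; .load 1 11 ;; .const 2 f ;; .op .xor 1 1 2 ;; .op .add 0 0 1 ;; .op .add 0 0 13 ;;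
  .op .and 1 0 8 ;; .op .shr 13 0 8 ;; .store 9 1 ;; .op .add 9 9 8 ;; .op .add 10 10 8 ;;
  .op .add 11 11 8 ;; .op .sub 12 12 8

/-- The integer that is complemented by `addBody` if `f = 1`. -/
def flip (f : ℕ) (y : ℤ) : ℤ := if f = 1 then -y - 1 else y

theorem bit_flip {f : ℕ} (hf : f < 2) (y : ℤ) (i : ℕ) : bit y i ^^^ f = bit (flip f y) i := by
  obtain rfl | rfl : f = 0 ∨ f = 1 := by omega
  · simp [flip]
  · simp [flip, bit_not]

/-- The state in the middle of an addition of `x` and `v = flip f y` with target address `D`. -/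
structure AddInv (E : Env) (s : State) (D P R f : ℕ) (x v : ℤ) (i : ℕ) (s' : State) : Prop where
  hr : ∀ r, 14 ≤ r ∨ (4 ≤ r ∧ r ≤ 8) → s'.reg r = s.reg r
  r9 : s'.reg 9 = D + i
  r10 : s'.reg 10 = P + i
  r11 : s'.reg 11 = R + i
  r12 : s'.reg 12 = E.W - i
  r13 : (s'.reg 13 : ℤ) = carry x v f i
  mem : ∀ c, s'.mem c = if D ≤ c ∧ c < D + i then bit (x + v + f) (c - D) else s.mem c

theorem addBody_runs (E : Env) {s s' : State} {D P R f : ℕ} {x y : ℤ} {i : ℕ} (hi : i < E.W)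
    (hf : f < 2) (h8 : s.reg 8 = 1)
    (hD : D + E.W < 2 ^ E.w) (hP : P + E.W < 2 ^ E.w) (hR : R + E.W < 2 ^ E.w)
    (hDP : D = P ∨ D + E.W ≤ P ∨ P + E.W ≤ D) (hDR : D = R ∨ D + E.W ≤ R ∨ R + E.W ≤ D)
    (hx : s.mem (P + i) = bit x i) (hy : s.mem (R + i) = bit y i)
    (hs : AddInv E s D P R f x (flip f y) i s') :
    Runs E.w (addBody f) s' fun s₂ t => t = 13 ∧ AddInv E s D P R f x (flip f y) (i + 1) s₂ := by
  have e8 : s'.reg 8 = 1 := by rw [hs.hr 8 (by omega), h8]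
  have e0 : s'.mem (P + i) = bit x i := by rw [hs.mem, if_neg (by omega), hx]
  have e1 : s'.mem (R + i) = bit y i := by rw [hs.mem, if_neg (by omega), hy]
  have b1 := bit_lt x i
  have b2 := bit_lt (flip f y) i
  have b3 := carry_bound x (flip f y) f (by omega) (by omega) i
  have b4 := hs.r13
  have hbig := E.const_lt (x := 4) (by norm_num)
  have hsum := bit_sum x (flip f y) f i
  have hcar := carry_succ x (flip f y) f i
  rw [← cast_bit, ← cast_bit, ← b4] at hsum hcar
  refine .seq (.load (.seq (.load (.seq (.const (by omega) (.seq (.op ?_ (.seq (.op ?_ (.seq (.op ?_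
    (.seq (.op ?_ (.seq (.op ?_ (.seq (.store (.seq (.op ?_ (.seq (.op ?_ (.seq (.op ?_ (.op ?_
    ⟨rfl, ?_⟩))))))))))))))))))))))))
  all_goals simp only [State.reg_setReg, State.mem_setReg, State.reg_setMem, Op.eval, e8, hs.r9,
    hs.r10, hs.r11, hs.r12, e0, e1, if_true, Nat.reduceEqDiff, if_false,
    OfNat.ofNat_ne_zero, OfNat.zero_ne_ofNat, OfNat.ofNat_ne_one, one_ne_zero, zero_ne_one,
    OfNat.one_ne_ofNat, bit_flip hf, Nat.and_one_is_mod, Nat.shiftRight_one]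
  case refine_10 =>
    constructor
    · intro r hr
      have h1 := hs.hr r hr
      simp only [State.reg_setReg, State.reg_setMem]
      split_ifs <;> omega
    · simp; omega
    · simp; omega
    · simp; omega
    · simp; omega
    · simp
      rw [hcar]
    · intro c
      simp only [State.mem_setMem, State.mem_setReg]
      have h1 := hs.mem c
      by_cases hc : c = D + i
      · rw [if_pos hc, if_pos (by omega), hc, Nat.add_sub_cancel_left]
        unfold bit at hsum ⊢
        omega
      · rw [if_neg hc, h1]
        exact if_congr (by omega) rfl rfl
  all_goals omega

/-- Computes the addresses of three integers. -/
def addr3 (a x y b x₁ y₁ c x₂ y₂ : ℕ) : Program :=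
  addrP 9 (a + 32) x y ;; addrP 10 (b + 32) x₁ y₁ ;; addrP 11 (c + 32) x₂ y₂

/-- `num a := num b + num c` if `f = 0`, and `num a := num b - num c` if `f = 1`. -/
def addsubH (f : ℕ) (a : Fin 32) (x y : ℕ) (b : Fin 32) (x₁ y₁ : ℕ) (c : Fin 32) (x₂ y₂ : ℕ) :
    Program :=
  addr3 a x y b x₁ y₁ c x₂ y₂ ;; .const 13 f ;; .op .add 12 7 4 ;; .loop 12 (addBody f)

/-- `num a := num b + num c` -/
def addH := addsubH 0
/-- `num a := num b - num c`, as `num b + (-num c - 1) + 1` in two's complement -/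
def subH := addsubH 1

theorem Env.addr_add_W (E : Env) {id x y : ℕ} (h1 : id < 64) (h2 : x < E.N) (h3 : y < E.N) :
    E.addr id x y + E.W < 2 ^ E.w := by
  have h := E.blk_lt h1 h2 h3
  have h4 := E.fits
  unfold addr
  have : (E.blk id x y + 1) * E.W ≤ E.N * E.N * 64 * E.W := Nat.mul_le_mul_right _ h
  nlinarith

theorem Env.addr_sep (E : Env) (id x y id' x' y' : ℕ) :
    E.addr id x y = E.addr id' x' y' ∨ E.addr id x y + E.W ≤ E.addr id' x' y' ∨
      E.addr id' x' y' + E.W ≤ E.addr id x y := by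
  unfold addr
  rcases lt_trichotomy (E.blk id x y) (E.blk id' x' y') with h | h | h
  · right; left; nlinarith
  · left; rw [h]
  · right; right; nlinarith

theorem Tri.addsub {E : Env} {h : H} {Q : H → ℕ → Prop} {f : ℕ} (hf : f < 2) {a b c : Fin 32}
    {x y x₁ y₁ x₂ y₂ : ℕ} (hx : h.reg x < E.N) (hy : h.reg y < E.N) (hx₁ : h.reg x₁ < E.N)
    (hy₁ : h.reg y₁ < E.N) (hx₂ : h.reg x₂ < E.N) (hy₂ : h.reg y₂ < E.N)
    (hQ : Q (h.setNum a (h.reg x) (h.reg y) (h.num b (h.reg x₁) (h.reg y₁) +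
      flip f (h.num c (h.reg x₂) (h.reg y₂)) + f)) 1) :
    Tri E (addsubH f a x y b x₁ y₁ c x₂ y₂) h Q := by
  refine of_runs (fun s hs => ?_) hQ
  refine .seq (.seq ((addrP_runs E hs (q := 9) le_rfl (by omega) (by omega) hx hy).mono ?_))
  rintro s₁ _ ⟨rfl, hm1, h9, hr1⟩
  have hs1 : Rep E h s₁ := hs.congr hm1 fun r hr' => hr1 r (by omega) (by omega)
  refine .seq ((addrP_runs E hs1 (q := 10) (by omega) (by omega) (by omega) hx₁ hy₁).mono ?_)
  rintro s₂ _ ⟨rfl, hm2, h10, hr2⟩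
  have hs2 : Rep E h s₂ := hs1.congr hm2 fun r hr' => hr2 r (by omega) (by omega)
  refine (addrP_runs E hs2 (q := 11) (by omega) (by omega) (by omega) hx₂ hy₂).mono ?_
  rintro s₃ _ ⟨rfl, hm3, h11, hr3⟩
  have hs3 : Rep E h s₃ := hs2.congr hm3 fun r hr' => hr3 r (by omega) (by omega)
  refine .seq (.const (E.const_lt (by omega)) (.seq (.op ?_ ?_)))
  · simp [Op.eval, hs3.r7, hs3.r4]; exact E.lt_of_lt_N E.hWN.le
  set D := E.addr (a + 32) (h.reg x) (h.reg y) with hD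
  set P := E.addr (b + 32) (h.reg x₁) (h.reg y₁) with hP
  set R := E.addr (c + 32) (h.reg x₂) (h.reg y₂) with hR
  set X := h.num b (h.reg x₁) (h.reg y₁)
  set Y := h.num c (h.reg x₂) (h.reg y₂)
  have hWu : 60 * E.W = E.unit := rfl
  refine (Runs.loop_count (AddInv E s₃ D P R f X (flip f Y)) E.W 13 ?_ ?_ ?_).mono ?_
  · constructor
    · intro r hr
      simp only [State.reg_setReg]
      rw [if_neg (by omega), if_neg (by omega)]
    · simp [hr3, hr2, h9]
    · simp [hr3, h10]
    · simp [h11]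
    · simp [Op.eval, hs3.r7, hs3.r4]
    · simp [carry]; ring
    · intro c; rw [if_neg (by omega)]; rfl
  · intro i hi s' hI
    refine ⟨by rw [hI.r12]; omega, ?_⟩
    refine (addBody_runs E hi hf hs3.r8 ?_ ?_ ?_ ?_ ?_ ?_ ?_ hI).mono fun _ _ h => ⟨h.2, h.1.le⟩
    · exact E.addr_add_W (by omega) hx hy
    · exact E.addr_add_W (by omega) hx₁ hy₁
    · exact E.addr_add_W (by omega) hx₂ hy₂
    · exact E.addr_sep ..
    · exact E.addr_sep ..
    · exact hs3.num b _ _ hx₁ hy₁ i hi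
    · exact hs3.num c _ _ hx₂ hy₂ i hi
  · intro s' hI; rw [hI.r12]; omega
  · rintro s' t ⟨hI, ht⟩
    refine ⟨by have := E.hW; omega, ?_⟩
    exact hs3.setNum a hy _ hI.mem hI.hr

namespace Tri

variable {E : Env} {h : H} {Q : H → ℕ → Prop} {a b c : Fin 32} {x y x₁ y₁ x₂ y₂ : ℕ}

theorem add (hx : h.reg x < E.N) (hy : h.reg y < E.N) (hx₁ : h.reg x₁ < E.N)
    (hy₁ : h.reg y₁ < E.N) (hx₂ : h.reg x₂ < E.N) (hy₂ : h.reg y₂ < E.N)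
    (hQ : Q (h.setNum a (h.reg x) (h.reg y) (h.num b (h.reg x₁) (h.reg y₁) +
      h.num c (h.reg x₂) (h.reg y₂))) 1) :
    Tri E (addH a x y b x₁ y₁ c x₂ y₂) h Q :=
  addsub (by norm_num) hx hy hx₁ hy₁ hx₂ hy₂ (by simpa [flip] using hQ)

theorem sub (hx : h.reg x < E.N) (hy : h.reg y < E.N) (hx₁ : h.reg x₁ < E.N)
    (hy₁ : h.reg y₁ < E.N) (hx₂ : h.reg x₂ < E.N) (hy₂ : h.reg y₂ < E.N)
    (hQ : Q (h.setNum a (h.reg x) (h.reg y) (h.num b (h.reg x₁) (h.reg y₁) -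
      h.num c (h.reg x₂) (h.reg y₂))) 1) :
    Tri E (subH a x y b x₁ y₁ c x₂ y₂) h Q :=
  addsub (by norm_num) hx hy hx₁ hy₁ hx₂ hy₂ (by
    convert hQ using 2
    simp only [flip, if_true]; push_cast; ring)

end Tri

/-! ### Loops -/

/-- `while reg i < reg b do p` -/
def whileLt (i b : ℕ) (p : Program) : Program :=
  .op .sub 12 (b + 14) (i + 14) ;; .loop 12 (p ;; .op .sub 12 (b + 14) (i + 14))

/-- `for i = 0, …, reg b - 1 do p` -/
def forUp (i b : ℕ) (p : Program) : Program := constH i 0 ;; whileLt i b (p ;; incH i)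

/-- `for i = 0, …, reg r - 1 do for k = 0, …, reg c - 1 do p` -/
def for2 (i r k c : ℕ) (p : Program) : Program := forUp i r (forUp k c p)

theorem Rep.test {E : Env} {h : H} {s : State} (hs : Rep E h s) (v : ℕ) :
    Rep E h (s.setReg 12 v) :=
  hs.congr rfl fun r hr => by rw [State.reg_setReg, if_neg (by omega)]

namespace Tri

variable {E : Env} {h : H} {Q : H → ℕ → Prop}

/-- `I h k` is the invariant after `k` units of time, `μ` the termination measure. -/
theorem whileLt {i b : ℕ} {p : Program} (I : H → ℕ → Prop) (μ : H → ℕ) (h0 : I h 1)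
    (hb : ∀ h k, I h k → h.reg b < 2 ^ E.w)
    (step : ∀ h k, I h k → h.reg i < h.reg b →
      Tri E p h fun h' k' => I h' (k + k' + 1) ∧ μ h' < μ h)
    (hQ : ∀ h k, I h k → h.reg b ≤ h.reg i → Q h k) : Tri E (whileLt i b p) h Q := by
  have hu := E.le_unit
  suffices H : ∀ m h k s t, μ h = m → I h k → Rep E h s → s.reg 12 = h.reg b - h.reg i →
      t + 1 ≤ E.unit * k →
      Runs E.w (.loop 12 (p ;; .op .sub 12 (b + 14) (i + 14))) s fun s' t' =>
        ∃ h' k, t + t' ≤ E.unit * k ∧ Rep E h' s' ∧ Q h' k by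
    intro s hs
    refine .seq (.op (lt_of_le_of_lt (Nat.sub_le _ _) (by rw [hs.reg]; exact hb _ _ h0)) ?_)
    exact H _ h 1 _ 1 rfl h0 (hs.test _) (by simp [Op.eval, hs.reg]) (by omega)
  intro m
  induction m using Nat.strong_induction_on with
  | _ m ih =>
    intro h k s t hm hI hs h12 ht
    by_cases hlt : h.reg i < h.reg b
    · obtain ⟨t₁, s₁, e1, h₁, k₁, l1, r1, hI1, hμ⟩ := step h k hI hlt s hs
      have := ih (μ h₁) (hm ▸ hμ) h₁ (k + k₁ + 1) (s₁.setReg 12 (h₁.reg b - h₁.reg i))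
        (t + t₁ + 2) rfl hI1 (r1.test _) (by simp) (by rw [mul_add, mul_add]; omega)
      obtain ⟨t₂, s₂, e2, h₂, k₂, l2, r2, q2⟩ := this
      have e3 : Exec E.w (.op .sub 12 (b + 14) (i + 14)) s₁ 1
          (s₁.setReg 12 (h₁.reg b - h₁.reg i)) := by
        have := Exec.op (w := E.w) s₁ .sub 12 (b + 14) (i + 14) (lt_of_le_of_lt (Nat.sub_le _ _)
          (by rw [r1.reg]; exact hb _ _ hI1))
        simpa only [Op.eval, r1.reg] using this
      exact ⟨_, _, .loopStep (by omega) (.seq e1 e3) e2, h₂, k₂, by omega, r2, q2⟩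
    · exact ⟨1, s, .loopDone (by omega), h, k, ht, hs, hQ _ _ hI (by omega)⟩

/-- The invariant after `x` rounds is `J x`, the time is bounded by `F x`. -/
theorem forUp {i b : ℕ} {p : Program} {m : ℕ} (J : ℕ → H → Prop) (F : ℕ → H → ℕ)
    (hm : h.reg b = m) (hib : i ≠ b) (hmN : m ≤ E.N)
    (hJ : ∀ x h v, J x h → J x (h.setReg i v)) (hF : ∀ x h v, F x (h.setReg i v) = F x h)
    (h0 : J 0 h) (h0F : 2 ≤ F 0 h)
    (step : ∀ x < m, ∀ h, J x h → h.reg i = x → h.reg b = m → Tri E p h fun h' k' =>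
      h'.reg i = x ∧ h'.reg b = m ∧ J (x + 1) h' ∧ F x h + k' + 2 ≤ F (x + 1) h')
    (hQ : ∀ h k, J m h → k ≤ F m h → Q h k) : Tri E (forUp i b p) h Q := by
  have hlt := E.lt_of_lt_N hmN
  have hlt1 := E.lt_of_lt_N le_rfl
  refine seq (const (by omega) (whileLt
    (fun h' k => ∃ x, x ≤ m ∧ h'.reg i = x ∧ h'.reg b = m ∧ J x h' ∧ k + 1 ≤ F x h')
    (fun h' => m - h'.reg i) ?_ ?_ ?_ ?_))
  · exact ⟨0, by simp, by simp, by simp [hib.symm, hm], hJ _ _ _ h0, by rw [hF]; exact h0F⟩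
  · rintro h k ⟨x, -, -, h1, -⟩; omega
  · rintro h k ⟨x, h1, h2, h3, h4, h5⟩ h6
    refine seq_of (step x (by omega) h h4 h2 h3) ?_
    rintro h₁ k₁ ⟨e1, e2, e3, e4⟩
    refine inc (by omega) ⟨⟨x + 1, by omega, by simp [e1], by simp [hib.symm, e2], hJ _ _ _ e3, ?_⟩,
      ?_⟩
    · rw [hF]; omega
    · simp [e1]; omega
  · rintro h k ⟨x, h1, h2, h3, h4, h5⟩ h6
    obtain rfl : x = m := by omega
    exact hQ _ _ h4 (by omega)

/-- The nested loop over `p < R` and `q < C` with an invariant that is indexed by `p * C + q`. -/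
theorem for2 {i r k c : ℕ} {p : Program} {R C : ℕ} (J : ℕ → H → Prop) (F : ℕ → H → ℕ)
    (hr : h.reg r = R) (hc : h.reg c = C) (hne : [i, r, k, c].Nodup)
    (hC : 1 ≤ C) (hR' : R ≤ E.N) (hC' : C ≤ E.N)
    (hJ : ∀ x h q v, q = i ∨ q = k → J x h → J x (h.setReg q v))
    (hF : ∀ x h q v, q = i ∨ q = k → F x (h.setReg q v) = F x h)
    (h0 : J 0 h) (h0F : 2 ≤ F 0 h)
    (step : ∀ p' < R, ∀ q < C, ∀ h, J (p' * C + q) h → h.reg i = p' → h.reg k = q →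
      h.reg r = R → h.reg c = C →
      Tri E p h fun h' k' => h'.reg i = p' ∧ h'.reg k = q ∧ h'.reg r = R ∧ h'.reg c = C ∧
        J (p' * C + q + 1) h' ∧ F (p' * C + q) h + k' + 6 ≤ F (p' * C + q + 1) h')
    (hQ : ∀ h k, J (R * C) h → k ≤ F (R * C) h → Q h k) : Tri E (for2 i r k c p) h Q := by
  simp only [List.nodup_cons, List.mem_cons, List.not_mem_nil, or_false, not_or] at hne
  obtain ⟨⟨n1, n2, n3⟩, ⟨n4, n5⟩, n6, -⟩ := hne
  refine forUp (fun x h => J (x * C) h ∧ h.reg c = C) (fun x h => F (x * C) h) hr n1 hR' ?_ ?_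
    ⟨by simpa using h0, hc⟩ (by simpa using h0F) ?_ ?_
  · rintro x h v ⟨h1, h2⟩
    exact ⟨hJ _ _ _ _ (.inl rfl) h1, by simp [Ne.symm n3, h2]⟩
  · intro x h v; exact hF _ _ _ _ (.inl rfl)
  · rintro x hx h₁ ⟨h1, h2⟩ h3 h4
    refine forUp (fun y h => J (x * C + y) h ∧ h.reg i = x ∧ h.reg r = R ∧ h.reg c = C ∧
        F (x * C) h₁ + 6 * y ≤ F (x * C + y) h)
      (fun y h => F (x * C + y) h - F (x * C) h₁ + 2 - min y 1 * 4) h2 n6 hC' ?_ ?_ ?_ ?_ ?_ ?_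
    · rintro y h v ⟨e1, e2, e3, ec, e4⟩
      exact ⟨hJ _ _ _ _ (.inr rfl) e1, by simp [n2, e2], by simp [n4, e3],
        by simp [Ne.symm n6, ec],
        by rwa [hF _ _ _ _ (.inr rfl)]⟩
    · intro y h v; rw [hF _ _ _ _ (.inr rfl)]
    · exact ⟨h1, h3, h4, h2, by simp⟩
    · simp
    · rintro y hy h₂ ⟨e1, e2, e3, ec, e4⟩ e5 e6
      refine (step x hx y hy h₂ e1 e2 e5 e3 e6).mono ?_
      rintro h' k' ⟨f1, f2, f3, f4, f5, f6⟩
      refine ⟨f2, f4, ⟨f5, f1, f3, f4, by rw [← add_assoc]; omega⟩, ?_⟩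
      rw [← add_assoc]
      rcases Nat.eq_zero_or_pos y with rfl | hy0
      · simp at *; omega
      · rw [min_eq_right (by omega : 1 ≤ y), min_eq_right (by omega : 1 ≤ y + 1)]; omega
    · rintro h' k' ⟨e1, e2, e3, ec, e4⟩ e5
      rw [min_eq_right hC] at e5
      have : (x + 1) * C = x * C + C := by ring
      rw [this]
      refine ⟨e2, e3, ⟨e1, ec⟩, by omega⟩
  · intro h k h1 h2; exact hQ _ _ h1.1 h2

end Tri

/-! ### Frames -/

/-- `h'` arises from `h` by changes of the registers `m, …, 99`, of the word arrays in `A` and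
of the integer arrays in `B`. -/
structure Fr (m : ℕ) (A B : List (Fin 32)) (h h' : H) : Prop where
  reg : ∀ r, r < m ∨ 100 ≤ r → h'.reg r = h.reg r
  raw : h'.raw = h.raw
  arr : ∀ a, a ∉ A → h'.arr a = h.arr a
  num : ∀ a, a ∉ B → h'.num a = h.num a

namespace Fr

variable {m m' : ℕ} {A B A' B' : List (Fin 32)} {h h' h'' : H}

theorem refl (m : ℕ) (A B : List (Fin 32)) (h : H) : Fr m A B h h :=
  ⟨fun _ _ => rfl, rfl, fun _ _ => rfl, fun _ _ => rfl⟩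

theorem mono (hf : Fr m A B h h') (hm : m' ≤ m) (hA : A ⊆ A') (hB : B ⊆ B') : Fr m' A' B' h h' :=
  ⟨fun r hr => hf.reg r (by omega), hf.raw, fun a ha => hf.arr a fun h => ha (hA h),
    fun a ha => hf.num a fun h => ha (hB h)⟩

theorem trans (h1 : Fr m A B h h') (h2 : Fr m A B h' h'') : Fr m A B h h'' :=
  ⟨fun r hr => (h2.reg r hr).trans (h1.reg r hr), h2.raw.trans h1.raw,
    fun a ha => (h2.arr a ha).trans (h1.arr a ha), fun a ha => (h2.num a ha).trans (h1.num a ha)⟩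

/-- Transitivity with a smaller second frame. -/
theorem step (h1 : Fr m A B h h') (h2 : Fr m' A' B' h' h'') (hm : m ≤ m') (hA : A' ⊆ A)
    (hB : B' ⊆ B) : Fr m A B h h'' := h1.trans (h2.mono hm hA hB)

theorem setReg (hf : Fr m A B h h') {r : ℕ} (v : ℕ) (h1 : m ≤ r) (h2 : r < 100) :
    Fr m A B h (h'.setReg r v) :=
  ⟨fun q hq => by rw [H.reg_setReg, if_neg (by omega)]; exact hf.reg q hq, hf.raw, hf.arr, hf.num⟩

theorem setArr (hf : Fr m A B h h') {a : Fin 32} (ha : a ∈ A) (x y v : ℕ) :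
    Fr m A B h (h'.setArr a x y v) :=
  ⟨hf.reg, hf.raw, fun c hc => by
    rw [H.arr_setArr_ne]
    · exact hf.arr c hc
    · rintro rfl; exact hc ha, hf.num⟩

theorem setNum (hf : Fr m A B h h') {a : Fin 32} (ha : a ∈ B) (x y : ℕ) (v : ℤ) :
    Fr m A B h (h'.setNum a x y v) :=
  ⟨hf.reg, hf.raw, hf.arr, fun c hc => by
    rw [H.num_setNum_ne]
    · exact hf.num c hc
    · rintro rfl; exact hc ha⟩

end Fr

/-! ### Names of registers and arrays -/

/-- The register that holds `0`. -/
notation "rZ" => 0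
/-- The register that holds the dimension `n`. -/
notation "rN" => 1
/-- The register that holds the dimension `b`. -/
notation "rB" => 2
/-- The register that holds the length `W` of the integers. -/
notation "rW" => 4
/-- The register that holds the position `W - 1` of the sign bit. -/
notation "rTop" => 5

/-- The constants on which the basic subroutines rely: the register `rZ` is zero, the register
`rTop` points to the sign bit, the integer arrays `31` and `16` hold `0` and `1`. -/
structure Base (E : Env) (h : H) : Prop where
  z : h.reg rZ = 0
  top : h.reg rTop = E.W - 1
  n0 : h.num 31 0 0 = 0
  n1 : h.num 16 0 0 = 1

theorem Base.fr {E : Env} {h h' : H} (hb : Base E h) {m : ℕ} {A B : List (Fin 32)}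
    (hf : Fr m A B h h') (hm : 10 ≤ m) (h31 : (31 : Fin 32) ∉ B) (h16 : (16 : Fin 32) ∉ B) :
    Base E h' :=
  ⟨by rw [hf.reg _ (by omega), hb.z], by rw [hf.reg _ (by omega), hb.top],
    by rw [hf.num _ h31, hb.n0], by rw [hf.num _ h16, hb.n1]⟩

theorem Env.N_pos (E : Env) : 0 < E.N := by have := E.hN; omega

theorem bit_top {W : ℕ} {v : ℤ} (h1 : -2 ^ (W - 1) ≤ v) (h2 : v < 2 ^ (W - 1)) :
    bit v (W - 1) = if v < 0 then 1 else 0 := by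
  unfold bit
  split_ifs with h
  · have : v / 2 ^ (W - 1) = -1 := by
      rw [Int.ediv_eq_iff_of_pos (by positivity)]; constructor <;> linarith
    rw [this]; rfl
  · rw [Int.ediv_eq_zero_of_lt (by omega) h2]; rfl

/-! ### Basic subroutines -/

/-- The array of integers that carries the argument or the result of a subroutine. -/
notation "aX" => (24 : Fin 32)
/-- The array of integers that serves as scratch space. -/
notation "aY" => (25 : Fin 32)

/-- `reg r := 1` if `num a (reg x) (reg y) < 0`, and `reg r := 0` otherwise -/
def negH (r : ℕ) (a : Fin 32) (x y : ℕ) : Program := bitH r a x y rTop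

theorem Tri.neg {E : Env} {h : H} {Q : H → ℕ → Prop} {r : ℕ} {a : Fin 32} {x y : ℕ}
    (htop : h.reg rTop = E.W - 1) (hx : h.reg x < E.N) (hy : h.reg y < E.N)
    (h1 : -2 ^ (E.W - 1) ≤ h.num a (h.reg x) (h.reg y))
    (h2 : h.num a (h.reg x) (h.reg y) < 2 ^ (E.W - 1))
    (hQ : Q (h.setReg r (if h.num a (h.reg x) (h.reg y) < 0 then 1 else 0)) 1) :
    Tri E (negH r a x y) h Q := by
  refine .getBit hx hy (by have := E.hW; omega) ?_
  rw [htop, bit_top h1 h2]; exact hQ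

/-- `num c i j := min (num c i j) X` -/
def minH (c : Fin 32) (i j : ℕ) : Program :=
  subH aY rZ rZ aX rZ rZ c i j ;; negH 80 aY rZ rZ ;;
    condH 80 (addH c i j aX rZ rZ 31 rZ rZ) .nop

theorem Tri.minInto {E : Env} {h : H} (hb : Base E h) {c : Fin 32} {i j : ℕ} (hc : c ∉ [aY, aX, 31])
    (hi' : i < 80) (hj' : j < 80) (hi : h.reg i < E.N) (hj : h.reg j < E.N)
    (h1 : -2 ^ (E.W - 1) ≤ h.num aX 0 0 - h.num c (h.reg i) (h.reg j))
    (h2 : h.num aX 0 0 - h.num c (h.reg i) (h.reg j) < 2 ^ (E.W - 1)) :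
    Tri E (minH c i j) h fun h' k => k ≤ 4 ∧ Fr 80 [] [aY, c] h h' ∧
      h'.num c = fun x y => if x = h.reg i ∧ y = h.reg j then
        min (h.num c (h.reg i) (h.reg j)) (h.num aX 0 0) else h.num c x y := by
  have hz := hb.z
  have hN := E.N_pos
  simp only [List.mem_cons, List.not_mem_nil, or_false, not_or] at hc
  obtain ⟨c1, c2, c3⟩ := hc
  have e1 : ∀ v, (h.setNum aY 0 0 v).num c = h.num c := fun v => H.num_setNum_ne _ _ _ _ _ _ c1
  refine .seq (.sub (by omega) (by omega) (by omega) (by omega) hi hj (.seq (.neg ?_ ?_ ?_ ?_ ?_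
    (.cond (fun hx => .add ?_ ?_ ?_ ?_ ?_ ?_ ?_) fun hx => .nop ?_))))
  any_goals simp [hz, hN, hb.top, hi, hj, show i ≠ 80 by omega, show j ≠ 80 by omega]
  · linarith
  · linarith
  · simp [hz] at hx
    refine ⟨?_, ?_⟩
    · exact (((Fr.refl _ _ _ _).setNum (by simp) _ _ _).setReg _ (by omega) (by omega)).setNum
        (by simp) _ _ _
    · have e31 : ∀ v, (h.setNum aY 0 0 v).num 31 = h.num 31 :=
        fun v => H.num_setNum_ne _ _ _ _ _ _ (by decide)
      have eX : ∀ v, (h.setNum aY 0 0 v).num aX = h.num aX :=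
        fun v => H.num_setNum_ne _ _ _ _ _ _ (by decide)
      simp only [e31, eX, hb.n0]
      funext x y
      simp only [H.num_setNum, true_and, H.num_setReg, c1, false_and, if_false]
      split_ifs
      · rw [min_eq_right (by omega)]; ring
      · rfl
  · simp [hz] at hx
    refine ⟨?_, ?_⟩
    · exact (((Fr.refl _ _ _ _).setNum (by simp) _ _ _).setReg _ (by omega) (by omega))
    · rw [e1]
      funext x y
      split_ifs with h3
      · rw [min_eq_left (by omega), h3.1, h3.2]
      · rfl

/-- `num a 0 0 := 2 ^ reg r` -/
def powH (a : Fin 32) (r : ℕ) : Program :=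
  subH a rZ rZ a rZ rZ a rZ rZ ;; constH 82 1 ;; lowH a rZ rZ 82 ;;
    forUp 81 r (addH a rZ rZ a rZ rZ a rZ rZ)

theorem Tri.pow {E : Env} {h : H} (hz : h.reg rZ = 0) {a : Fin 32} {r : ℕ} (hr : r < 80)
    (hrN : h.reg r ≤ E.N) :
    Tri E (powH a r) h fun h' k => k ≤ 3 * h.reg r + 5 ∧ Fr 80 [] [a] h h' ∧
      h'.num a 0 0 = 2 ^ h.reg r := by
  have hN := E.N_pos
  refine .seq (.sub (by omega) (by omega) (by omega) (by omega) (by omega) (by omega)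
    (.seq (.const (E.const_lt (by omega)) (.seq (.low ?_ ?_ ?_ ?_)))))
  any_goals simp [hz, hN]
  refine Tri.forUp (m := h.reg r) (fun x h' => Fr 80 [] [a] h h' ∧ h'.num a 0 0 = 2 ^ x)
    (fun x _ => 3 * x + 2) ?_ (by omega) hrN ?_ (fun _ _ _ => rfl) ⟨?_, ?_⟩ le_rfl ?_ ?_
  · simp; omega
  · rintro x h v ⟨h1, h2⟩; exact ⟨h1.setReg _ (by omega) (by omega), h2⟩
  · exact (((Fr.refl _ _ _ _).setNum (by simp) _ _ _).setReg _ (by omega) (by omega)).setNum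
      (by simp) _ _ _
  · simp
  · rintro x hx h' ⟨h1, h2⟩ h3 h4
    have hz' : h'.reg 0 = 0 := by rw [h1.reg _ (by omega), hz]
    refine .add (by omega) (by omega) (by omega) (by omega) (by omega) (by omega)
      ⟨h3, h4, ⟨h1.setNum (by simp) _ _ _, ?_⟩, by omega⟩
    simp [hz', h2]; ring
  · rintro h' k ⟨h1, h2⟩ h3
    exact ⟨by omega, h1, h2⟩

/-! ### Encoded entries -/

/-- The word number `t` in the encoding of an entry. -/
def entryCell (e : WithTop ℤ) (t : ℕ) : ℕ :=
  if t = 0 then (if e = ⊤ then 1 else 0) else bit (e.untopD 0) (t - 1)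

/-- Reads the entry whose encoding starts at `reg p` in the row `reg x` of the word array `a` and
whose number has `reg b` bits: the flag goes to register `80`, the number to `X`. -/
def readEntry (a : Fin 32) (x p b : ℕ) : Program :=
  getH 80 a x p ;; subH aX rZ rZ aX rZ rZ aX rZ rZ ;; opH .add 81 p b ;; getH 82 a x 81 ;;
  condH 82 (subH aX rZ rZ aX rZ rZ 16 rZ rZ) .nop ;; constH 83 1 ;; opH .sub 84 b 83 ;;
  forUp 85 84 (opH .sub 81 81 83 ;; getH 82 a x 81 ;; addH aX rZ rZ aX rZ rZ aX rZ rZ ;;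
    lowH aX rZ rZ 82)

theorem ediv_two_pow_bit (v : ℤ) (j : ℕ) : v / 2 ^ j = v / 2 ^ (j + 1) * 2 + bit v j := by
  rw [cast_bit, ediv_two_pow_succ]; omega

theorem Tri.read {E : Env} {h : H} (hb : Base E h) {a : Fin 32} {x p b : ℕ} {e : WithTop ℤ}
    (hx' : x < 80) (hp' : p < 80) (hb' : b < 80) (hx : h.reg x < E.N)
    (hp : h.reg p + h.reg b < E.N) (h1 : 1 ≤ h.reg b)
    (he : ∀ t ≤ h.reg b, h.arr a (h.reg x) (h.reg p + t) = entryCell e t)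
    (hv : ∀ v : ℤ, e = v → -2 ^ (h.reg b - 1) ≤ v ∧ v < 2 ^ (h.reg b - 1)) :
    Tri E (readEntry a x p b) h fun h' k => k ≤ 6 * h.reg b + 20 ∧ Fr 80 [] [aX] h h' ∧
      h'.reg 80 = (if e = ⊤ then 1 else 0) ∧ h'.num aX 0 0 = e.untopD 0 := by
  have hz := hb.z
  have hN := E.N_pos
  have hn1 := hb.n1
  have hlt := fun {y : ℕ} (hy : y ≤ E.N) => E.lt_of_lt_N hy
  set P := h.reg p with hP
  set B := h.reg b with hB
  set u := e.untopD 0 with hu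
  have hu1 : -2 ^ (B - 1) ≤ u ∧ u < 2 ^ (B - 1) := by
    cases e with
    | top => simp [hu]
    | coe v => exact hv v rfl
  have hbit : ∀ t < B, h.arr a (h.reg x) (P + (t + 1)) = MinPlus.bit u t := fun t ht => by
    rw [he (t + 1) ht]; simp [entryCell, hu]
  have htop := bit_top (W := B) hu1.1 hu1.2
  refine .seq (.get hx (by omega) (.seq (.sub ?_ ?_ ?_ ?_ ?_ ?_ (.seq (.op ?_ (.seq (.get ?_ ?_
    ?_)))))))
  any_goals simp only [H.reg_setReg, H.reg_setNum, H.arr_setReg, H.arr_setNum, Op.eval]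
  any_goals simp [hz, hN, show x ≠ 80 by omega, show p ≠ 80 by omega, show b ≠ 80 by omega,
    show x ≠ 81 by omega, hx, ← hP, ← hB, hp, hlt hp.le]
  obtain ⟨B', hB'⟩ : ∃ B', B = B' + 1 := ⟨B - 1, by omega⟩
  have harr : h.arr a (h.reg x) (P + B) = if u < 0 then 1 else 0 := by
    rw [hB', hbit B' (by omega), ← htop, hB']; rfl
  rw [harr]
  refine .seq_of (R := fun h' k => k ≤ 2 ∧ Fr 80 [] [aX] h h' ∧ h'.reg 80 = (if e = ⊤ then 1 else 0)
    ∧ h'.reg 81 = P + B ∧ h'.num aX 0 0 = u / 2 ^ (B - 1)) ?_ ?_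
  · have hfr : ∀ q, Fr 80 [] [aX] h ((((h.setReg 80 (h.arr a (h.reg x) P)).setNum aX 0 0 0).setReg
        81 (P + B)).setReg 82 q) := fun q =>
      ((((Fr.refl _ _ _ _).setReg _ (by omega) (by omega)).setNum (by simp) _ _ _).setReg _
        (by omega) (by omega)).setReg _ (by omega) (by omega)
    have h80 : h.arr a (h.reg x) P = if e = ⊤ then 1 else 0 := by
      have := he 0 (by omega)
      simpa [entryCell] using this
    refine .cond (fun hc => .sub ?_ ?_ ?_ ?_ ?_ ?_ ?_) fun hc => .nop ?_
    any_goals simp [hz, hN]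
    · refine ⟨(hfr _).setNum (by simp) _ _ _, h80, ?_⟩
      have hneg : u < 0 := by
        by_contra h0; simp [h0] at hc
      rw [H.num_setNum_ne _ _ _ _ _ _ (by decide), H.num_setReg, hn1]
      symm
      rw [Int.ediv_eq_iff_of_pos (by positivity)]; constructor <;> linarith
    · refine ⟨hfr _, h80, ?_⟩
      have hneg : ¬ u < 0 := by
        intro h0; simp [h0] at hc
      rw [Int.ediv_eq_zero_of_lt (by omega) hu1.2]
  · rintro h₁ k₁ ⟨hk, hf, e80, e81, eX⟩
    have e0 : h₁.reg 0 = 0 := by rw [hf.reg _ (by omega), hz]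
    have eb : h₁.reg b = B := by rw [hf.reg _ (by omega)]
    refine .seq (.const (E.const_lt (by omega)) (.seq (.op ?_ ?_)))
    · simp [Op.eval, show b ≠ 83 by omega, eb]; exact lt_of_le_of_lt (Nat.sub_le _ _) (hlt (by omega))
    simp only [H.reg_setReg, Op.eval, show b ≠ 83 by omega, if_false, if_true, eb]
    refine Tri.forUp (m := B - 1) (fun y h' => Fr 80 [] [aX] h h' ∧
        h'.reg 80 = (if e = ⊤ then 1 else 0) ∧ h'.reg 81 = P + B - y ∧ h'.reg 83 = 1 ∧
        h'.num aX 0 0 = u / 2 ^ (B - 1 - y)) (fun y _ => 6 * y + 2) ?_ (by omega) (by omega) ?_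
        (fun _ _ _ => rfl) ⟨?_, ?_, ?_, ?_, ?_⟩ le_rfl ?_ ?_
    · simp
    · rintro y h' v ⟨f1, f2, f3, f4, f5⟩
      exact ⟨f1.setReg _ (by omega) (by omega), by simpa using f2, by simpa using f3,
        by simpa using f4, f5⟩
    · exact (hf.setReg _ (by omega) (by omega)).setReg _ (by omega) (by omega)
    · simpa using e80
    · simpa using e81
    · simp
    · simpa using eX
    · rintro y hy h' ⟨f1, f2, f3, f4, f5⟩ f6 f7
      have f0 : h'.reg 0 = 0 := by rw [f1.reg _ (by omega), hz]
      have fx : h'.reg x = h.reg x := by rw [f1.reg _ (by omega)]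
      have fa : h'.arr a = h.arr a := by rw [f1.arr _ (by simp)]
      have hread : h.arr a (h.reg x) (P + B - y - 1) = bit u (B - 2 - y) := by
        rw [← hbit _ (by omega)]; congr 1; omega
      refine .seq (.op ?_ (.seq (.get ?_ ?_ (.seq (.add ?_ ?_ ?_ ?_ ?_ ?_ (.low ?_ ?_ ?_ ?_))))))
      any_goals simp only [H.reg_setReg, H.reg_setNum, Op.eval, f3, f4]
      any_goals simp [f0, hN, show x ≠ 81 by omega, fx, hx, fa, hread]
      · exact hlt (by omega)
      · omega
      · exact Nat.le_of_lt_succ (bit_lt _ _)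
      · refine ⟨f6, f7, ⟨?_, f2, by omega, ?_⟩, by omega⟩
        · exact (((f1.setReg _ (by omega) (by omega)).setReg _ (by omega) (by omega)).setNum
            (by simp) _ _ _).setNum (by simp) _ _ _
        · rw [f5, show B - 1 - (y + 1) = B - 2 - y by omega, ediv_two_pow_bit u (B - 2 - y),
            show B - 2 - y + 1 = B - 1 - y by omega]
          omega
    · rintro h' k ⟨f1, f2, f3, f4, f5⟩ f6
      refine ⟨by omega, f1, f2, by simpa using f5⟩

/-- Writes an entry with the flag in register `80` and the number in `X`, of which `reg b` bits
are written. -/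
def writeEntry (a : Fin 32) (x p b : ℕ) : Program :=
  putH a x p 80 ;; movH 81 p ;;
    forUp 85 b (bitH 82 aX rZ rZ 85 ;; incH 81 ;; putH a x 81 82)

theorem Tri.write {E : Env} {h : H} (hz : h.reg rZ = 0) {a : Fin 32} {x p b : ℕ} {e : WithTop ℤ}
    (hx' : x < 80) (hb' : b < 80) (hx : h.reg x < E.N)
    (hp : h.reg p + h.reg b < E.N) (h1 : h.reg b ≤ E.W)
    (h80 : h.reg 80 = if e = ⊤ then 1 else 0) (hX : h.num aX 0 0 = e.untopD 0) :
    Tri E (writeEntry a x p b) h fun h' k => k ≤ 5 * h.reg b + 10 ∧ Fr 80 [a] [] h h' ∧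
      h'.arr a = fun x' y => if x' = h.reg x ∧ h.reg p ≤ y ∧ y ≤ h.reg p + h.reg b then
        entryCell e (y - h.reg p) else h.arr a x' y := by
  have hN := E.N_pos
  have hlt := fun {y : ℕ} (hy : y ≤ E.N) => E.lt_of_lt_N hy
  set P := h.reg p with hP
  set B := h.reg b with hB
  refine .seq (.put hx (by omega) (.seq (.mov (hlt ?_) ?_)))
  · simp only [H.reg_setArr]; omega
  simp only [H.reg_setArr, ← hP]
  refine Tri.forUp (m := B) (fun t h' => Fr 80 [a] [] h h' ∧ h'.reg 81 = P + t ∧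
      h'.arr a = fun x' y => if x' = h.reg x ∧ P ≤ y ∧ y ≤ P + t then
        entryCell e (y - P) else h.arr a x' y) (fun t _ => 5 * t + 2) ?_ (by omega) (by omega) ?_
      (fun _ _ _ => rfl) ⟨?_, ?_, ?_⟩ le_rfl ?_ ?_
  · simp [show b ≠ 81 by omega, hB]
  · rintro t h' v ⟨f1, f2, f3⟩
    exact ⟨f1.setReg _ (by omega) (by omega), by simpa using f2, f3⟩
  · exact ((Fr.refl _ _ _ _).setArr (by simp) _ _ _).setReg _ (by omega) (by omega)
  · simp
  · funext x' y
    simp only [H.arr_setReg, H.arr_setArr, true_and, add_zero]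
    refine if_ctx_congr (by constructor <;> rintro ⟨h1, h2⟩ <;> exact ⟨h1, by omega⟩) ?_
      fun _ => rfl
    rintro ⟨-, h2⟩
    rw [show y - P = 0 by omega, h80]; simp [entryCell]
  · rintro t ht h' ⟨f1, f2, f3⟩ f4 f5
    have f0 : h'.reg 0 = 0 := by rw [f1.reg _ (by omega), hz]
    have fx : h'.reg x = h.reg x := by rw [f1.reg _ (by omega)]
    have fX : h'.num aX 0 0 = e.untopD 0 := by rw [f1.num _ (by simp), hX]
    refine .seq (.getBit (by omega) (by omega) (by omega) (.seq (.inc ?_ (.put ?_ ?_ ?_))))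
    any_goals simp [f0, f2, show x ≠ 81 by omega, show x ≠ 82 by omega, fx, hx, f4, f5]
    · exact hlt (by omega)
    · omega
    · refine ⟨by rw [if_neg (by omega), if_neg (by omega)], ⟨?_, by omega, ?_⟩, by omega⟩
      · exact ((f1.setReg _ (by omega) (by omega)).setReg _ (by omega) (by omega)).setArr
          (by simp) _ _ _
      · funext x' y
        simp only [H.arr_setReg, H.arr_setArr, true_and, f3, fX]
        by_cases hc : x' = h.reg x ∧ y = P + t + 1
        · obtain ⟨rfl, rfl⟩ := hc
          rw [if_pos ⟨rfl, rfl⟩, if_pos ⟨rfl, by omega, by omega⟩]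
          rw [show P + t + 1 - P = t + 1 by omega]; simp [entryCell]
        · rw [if_neg hc]
          refine if_congr ?_ rfl rfl
          constructor
          · rintro ⟨h1, h2⟩; exact ⟨h1, by omega⟩
          · rintro ⟨h1, h2⟩
            refine ⟨h1, h2.1, ?_⟩
            by_contra h3; exact hc ⟨h1, by omega⟩
  · rintro h' k ⟨f1, f2, f3⟩ f4
    exact ⟨by omega, f1, f3⟩

/-! ### Greedy segments of a row -/

/-- The start of the greedy segment that contains `j`: a new segment of the row `f` starts when the
entry exceeds the first entry of the current segment by more than `d`. -/
def sst (d : ℤ) (f : ℕ → ℤ) : ℕ → ℕ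
  | 0 => 0
  | j + 1 => if f (sst d f j) + d < f (j + 1) then j + 1 else sst d f j

/-- The last position up to `m` in the segment that contains `j`. -/
def send (d : ℤ) (f : ℕ → ℤ) (m j : ℕ) : ℕ := Nat.findGreatest (fun x => sst d f x = sst d f j) m

section Segments

variable {d : ℤ} {f : ℕ → ℤ}

theorem sst_le (j : ℕ) : sst d f j ≤ j := by
  induction j with
  | zero => simp [sst]
  | succ j ih => rw [sst]; split_ifs <;> omega

theorem sst_succ (j : ℕ) : sst d f (j + 1) = j + 1 ∨ sst d f (j + 1) = sst d f j := by
  rw [sst]; split_ifs <;> simp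

theorem sst_sst (j : ℕ) : sst d f (sst d f j) = sst d f j := by
  induction j with
  | zero => simp [sst]
  | succ j ih => rcases sst_succ (d := d) (f := f) j with h | h <;> rw [h] <;> assumption

theorem sst_mono {i j : ℕ} (h : i ≤ j) : sst d f i ≤ sst d f j := by
  induction j, h using Nat.le_induction with
  | base => rfl
  | succ j hj ih =>
    have := sst_le (d := d) (f := f) j
    rcases sst_succ (d := d) (f := f) j with h | h <;> omega

/-- Positions between the start of a segment and a member belong to the segment. -/
theorem sst_eq_of_le {s x j : ℕ} (h1 : sst d f s = s) (h2 : s ≤ x) (h3 : x ≤ j)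
    (h4 : sst d f j = s) : sst d f x = s := by
  have a := sst_mono (d := d) (f := f) h2
  have b := sst_mono (d := d) (f := f) h3
  omega

theorem le_sst_add (hd : 0 ≤ d) (j : ℕ) : f j ≤ f (sst d f j) + d := by
  cases j with
  | zero => simp [sst, hd]
  | succ j => rw [sst]; split_ifs <;> omega

theorem send_le (m j : ℕ) : send d f m j ≤ m := Nat.findGreatest_le m

theorem le_send {m j : ℕ} (h : j ≤ m) : j ≤ send d f m j := Nat.le_findGreatest h rfl

theorem sst_send {m j : ℕ} (h : j ≤ m) : sst d f (send d f m j) = sst d f j :=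
  Nat.findGreatest_spec (P := fun x => sst d f x = sst d f j) h rfl

theorem send_congr {m i j : ℕ} (h : sst d f i = sst d f j) : send d f m i = send d f m j := by
  unfold send; rw [h]

theorem sst_send_succ {m j : ℕ} (h : j ≤ m) (h' : send d f m j < m) :
    sst d f (send d f m j + 1) = send d f m j + 1 := by
  have h1 := Nat.findGreatest_is_greatest (P := fun x => sst d f x = sst d f j)
    (k := send d f m j + 1) (Nat.lt_succ_self _) h'
  have h2 := sst_send (d := d) (f := f) h
  rcases sst_succ (d := d) (f := f) (send d f m j) with h3 | h3
  · exact h3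
  · exact absurd (h3.trans h2) h1

theorem send_succ (m j : ℕ) : send d f (m + 1) j =
    if sst d f (m + 1) = sst d f j then m + 1 else send d f m j := by
  unfold send; rw [Nat.findGreatest_succ]

/-- Number of segments that start before `j`. -/
def nst (d : ℤ) (f : ℕ → ℤ) (j : ℕ) : ℕ := ((Finset.range j).filter fun s => sst d f s = s).card

theorem starts_step {m s : ℕ} (hs : sst d f s = s) (hm : s ≤ m) :
    ((Finset.range (send d f m s + 1)).filter fun s => sst d f s = s) =
      insert s ((Finset.range s).filter fun s => sst d f s = s) := by
  have h1 := le_send (d := d) (f := f) hm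
  have h2 := sst_send (d := d) (f := f) hm
  rw [hs] at h2
  ext x
  simp only [Finset.mem_filter, Finset.mem_range, Finset.mem_insert]
  constructor
  · rintro ⟨h3, h4⟩
    by_cases h5 : s ≤ x
    · left; rw [← h4]; exact sst_eq_of_le hs h5 (by omega) h2
    · right; exact ⟨by omega, h4⟩
  · rintro (rfl | ⟨h3, h4⟩)
    · exact ⟨by omega, hs⟩
    · exact ⟨by omega, h4⟩

theorem nst_step {m s : ℕ} (hs : sst d f s = s) (hm : s ≤ m) :
    nst d f (send d f m s + 1) = nst d f s + 1 := by
  unfold nst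
  rw [starts_step hs hm, Finset.card_insert_of_notMem (by simp)]

theorem nst_succ (j : ℕ) : nst d f (j + 1) = nst d f j + if sst d f j = j then 1 else 0 := by
  unfold nst
  rw [Finset.range_add_one, Finset.filter_insert]
  split_ifs with h
  · rw [Finset.card_insert_of_notMem (by simp)]
  · rfl

theorem nst_one : nst d f 1 = 1 := by
  have := nst_succ (d := d) (f := f) 0
  rw [this]; simp [sst, nst]

/-- The entries at successive starts of segments differ by at least `d + 1`. -/
theorem nst_mul_le (j : ℕ) :
    (nst d f (j + 1) : ℤ) * (d + 1) ≤ f (sst d f j) - f 0 + (d + 1) := by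
  induction j with
  | zero => simp [nst_one, sst]
  | succ j ih =>
    rw [nst_succ]
    rcases lt_or_ge (f (sst d f j) + d) (f (j + 1)) with h | h
    · have h1 : sst d f (j + 1) = j + 1 := by rw [sst, if_pos h]
      rw [h1, if_pos rfl]; push_cast; linarith
    · have h1 : sst d f (j + 1) = sst d f j := by rw [sst, if_neg (by omega)]
      have h2 := sst_le (d := d) (f := f) j
      rw [if_neg (by omega), h1]; simpa using ih

/-- A row whose entries are at most `f 0 + R` or equal to one large value `I`, which stands for `∞`,
has at most `R / (d + 1) + 2` segments: the first one, one for each further `d + 1` units of the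
range, and one for the large value. -/
theorem nst_mul_le_range (hd : 0 ≤ d) {n : ℕ} {R I : ℤ} (hR : 0 ≤ R)
    (hmono : ∀ i j, i ≤ j → j < n → f i ≤ f j) (hf : ∀ j < n, f j ≤ f 0 + R ∨ f j = I) :
    (nst d f n : ℤ) * (d + 1) ≤ R + 2 * (d + 1) := by
  suffices H : ∀ j < n, (f j ≤ f 0 + R → (nst d f (j + 1) : ℤ) * (d + 1) ≤ R + (d + 1)) ∧
      (nst d f (j + 1) : ℤ) * (d + 1) ≤ R + 2 * (d + 1) by
    cases n with
    | zero => simp [nst]; omega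
    | succ n => exact (H n (by omega)).2
  intro j
  induction j with
  | zero =>
    intro _
    simp only [zero_add, nst_one]; push_cast; constructor <;> intros <;> omega
  | succ j ih =>
    intro hj
    obtain ⟨ih1, ih2⟩ := ih (by omega)
    have hm := hmono j (j + 1) (by omega) hj
    have h1 : f (j + 1) ≤ f 0 + R → (nst d f (j + 1 + 1) : ℤ) * (d + 1) ≤ R + (d + 1) := by
      intro h
      have := nst_mul_le (d := d) (f := f) (j + 1)
      have := hmono _ _ (sst_le (d := d) (f := f) (j + 1)) hj
      linarith
    refine ⟨h1, ?_⟩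
    rcases hf (j + 1) hj with h | h
    · have := h1 h; omega
    rcases hf j (by omega) with h' | h'
    · have h2 := ih1 h'
      rw [nst_succ]
      split_ifs <;> push_cast <;> linarith
    · -- the large value has been reached before, so no segment starts here
      have h2 := le_sst_add (f := f) hd j
      have h3 : sst d f (j + 1) = sst d f j := by rw [sst, if_neg (by omega)]
      have h4 := sst_le (d := d) (f := f) j
      rw [nst_succ, if_neg (by omega)]; simpa using ih2

end Segments

/-! ### Relevant triples -/

/-- The data of an instance with integer entries: the `n × b` matrix `A`, the `b × n` matrix `B`,
the rounding error `d`, the approximate product `CT` and the window starts `cst`. -/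
structure Data where
  n : ℕ
  b : ℕ
  A : ℕ → ℕ → ℤ
  B : ℕ → ℕ → ℤ
  d : ℤ
  CT : ℕ → ℕ → ℤ
  cst : ℕ → ℕ → ℕ

namespace Data

variable (I : Data)

/-- The start of the segment of the row `k` of `B` that contains `j`. -/
def ss (k j : ℕ) : ℕ := sst I.d (I.B k) j
/-- The end of the segment of the row `k` of `B` that contains `j`. -/
def se (k j : ℕ) : ℕ := send I.d (I.B k) (I.n - 1) j

/-- The end of the segment that starts at `s` satisfies the condition for relevance. -/
def SegRel (i k s : ℕ) : Prop := I.A i k + I.B k s ≤ I.CT i (I.se k s) + I.d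

instance (i k s : ℕ) : Decidable (I.SegRel i k s) := by unfold SegRel; infer_instance

/-- The first relevant position in the segment that starts at `s`. -/
def lo (i k s : ℕ) : ℕ := max s (I.cst i (I.se k s))

/-- The triple `(i, k, j)` may attain the minimum in the entry `(i, j)` of the product. The
condition is chosen such that, in each segment of the row `k`, the relevant positions `j` form an
interval that ends with the segment, and its start can be looked up. -/
def Rel (i k j : ℕ) : Prop := I.SegRel i k (I.ss k j) ∧ I.lo i k (I.ss k j) ≤ j

instance (i k j : ℕ) : Decidable (I.Rel i k j) := by unfold Rel; infer_instance

/-- The contribution at `x` of one segment to the difference array of a pair. -/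
def seg1 (i k s x : ℕ) : ℤ :=
  if I.SegRel i k s then
    (if x = I.lo i k s then 1 else 0) - (if x = I.se k s + 1 then 1 else 0) else 0

/-- The difference array of the pair `(i, k)`, restricted to the segments that start before `m`. -/
def dif (i k m x : ℕ) : ℤ :=
  ∑ s ∈ (Finset.range m).filter (fun s => I.ss k s = s), I.seg1 i k s x

/-- The properties of the data on which the correctness rests. The approximate product `CT i j` is a
minimum of sums in which the entries of `B` are rounded down to the start of their segment, but it
may run over later columns too, which makes it monotone. The position `cst i e` is the first one at
which `CT i` is at least `CT i e - d`. -/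
structure Good : Prop where
  dnn : 0 ≤ I.d
  mono : ∀ k < I.b, ∀ j j', j ≤ j' → j' < I.n → I.B k j ≤ I.B k j'
  ctMono : ∀ i < I.n, ∀ j j', j ≤ j' → j' < I.n → I.CT i j ≤ I.CT i j'
  ctLe : ∀ i < I.n, ∀ k < I.b, ∀ j < I.n, I.CT i j ≤ I.A i k + I.B k (I.ss k j)
  ctEx : ∀ i < I.n, ∀ j < I.n, ∃ k < I.b, I.A i k + I.B k (I.ss k j) ≤ I.CT i j
  cst : ∀ i < I.n, ∀ e < I.n, ∀ j ≤ e, I.cst i e ≤ j ↔ I.CT i e - I.d ≤ I.CT i j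

variable {I}

theorem ss_le (k j : ℕ) : I.ss k j ≤ j := sst_le j
theorem ss_ss (k j : ℕ) : I.ss k (I.ss k j) = I.ss k j := sst_sst j
theorem le_se {k j : ℕ} (h : j < I.n) : j ≤ I.se k j := le_send (by omega)
theorem se_lt {k j : ℕ} (h : j < I.n) : I.se k j < I.n := by
  have := send_le (d := I.d) (f := I.B k) (I.n - 1) j
  unfold se; omega
theorem ss_se {k j : ℕ} (h : j < I.n) : I.ss k (I.se k j) = I.ss k j := sst_send (by omega)
theorem se_ss (k j : ℕ) : I.se k (I.ss k j) = I.se k j := send_congr (sst_sst j)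
theorem ss_se_succ {k j : ℕ} (h : j < I.n) (h' : I.se k j + 1 < I.n) :
    I.ss k (I.se k j + 1) = I.se k j + 1 :=
  sst_send_succ (by omega) (by unfold se at h'; omega)

theorem ss_eq_of_mem {k s j : ℕ} (hs : I.ss k s = s) (hsn : s < I.n) (h1 : s ≤ j)
    (h2 : j ≤ I.se k s) : I.ss k j = s :=
  sst_eq_of_le hs h1 h2 ((ss_se hsn).trans hs)

theorem Good.lo_le (hI : I.Good) {i k s : ℕ} (hi : i < I.n) (hs : s < I.n) :
    I.lo i k s ≤ I.se k s := by
  refine max_le (le_se hs) ?_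
  rw [hI.cst i hi _ (se_lt hs) _ le_rfl]
  have := hI.dnn
  omega

/-- A minimizing index is relevant: its sum is at most `CT i j + d`, and its rounded sum, which is
the same in the whole segment, is at least `CT i e` for the end `e` of the segment. -/
theorem Good.rel_of_min (hI : I.Good) {i j k : ℕ} (hi : i < I.n) (hj : j < I.n) (hk : k < I.b)
    (hmin : ∀ k' < I.b, I.A i k + I.B k j ≤ I.A i k' + I.B k' j) : I.Rel i k j := by
  have hd := hI.dnn
  obtain ⟨k', hk', h1⟩ := hI.ctEx i hi j hj
  have h2 : I.B k' j ≤ I.B k' (I.ss k' j) + I.d := le_sst_add hd j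
  have h3 := hmin k' hk'
  have h4 : I.B k (I.ss k j) ≤ I.B k j := hI.mono k hk _ _ (ss_le k j) hj
  have h5 := hI.ctMono i hi j (I.se k j) (le_se hj) (se_lt hj)
  have h6 := hI.ctLe i hi k hk _ (se_lt (k := k) hj)
  rw [ss_se hj] at h6
  constructor
  · unfold SegRel; rw [se_ss]; omega
  · refine max_le (ss_le k j) ?_
    rw [se_ss, hI.cst i hi _ (se_lt hj) j (le_se hj)]
    omega

/-- The entries that correspond to relevant triples are close to the approximate product. -/
theorem Good.abs_of_rel (hI : I.Good) {i j k : ℕ} (hi : i < I.n) (hj : j < I.n) (hk : k < I.b)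
    (hr : I.Rel i k j) : -(2 * I.d) ≤ I.A i k + I.B k j - (I.CT i j + I.d) ∧
      I.A i k + I.B k j - (I.CT i j + I.d) ≤ 2 * I.d := by
  have hd := hI.dnn
  obtain ⟨h1, h2⟩ := hr
  unfold SegRel at h1
  unfold lo at h2
  rw [se_ss] at h1 h2
  have h3 := (hI.cst i hi _ (se_lt hj) j (le_se hj)).1 (le_trans (le_max_right _ _) h2)
  have h4 := hI.ctLe i hi k hk j hj
  have h5 : I.B k (I.ss k j) ≤ I.B k j := hI.mono k hk _ _ (ss_le k j) hj
  have h6 : I.B k j ≤ I.B k (I.ss k j) + I.d := le_sst_add hd j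
  constructor <;> linarith

theorem dif_step {i k s x : ℕ} (hs : I.ss k s = s) (hsn : s < I.n) :
    I.dif i k (I.se k s + 1) x = I.dif i k s x + I.seg1 i k s x := by
  unfold dif
  have : ((Finset.range (I.se k s + 1)).filter fun s => I.ss k s = s) =
    insert s ((Finset.range s).filter fun s => I.ss k s = s) := starts_step hs (by omega)
  rw [this, Finset.sum_insert (by simp), add_comm]

/-- The prefix sums of the contribution of a segment indicate its relevant positions. -/
theorem sum_seg1 (hI : I.Good) {i k s j : ℕ} (hi : i < I.n) (hs : I.ss k s = s) (hsn : s < I.n)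
    (hj : j < I.n) : ∑ x ∈ Finset.range (j + 1), I.seg1 i k s x =
      if s = I.ss k j then (if I.Rel i k j then 1 else 0) else 0 := by
  have h1 := hI.lo_le (k := k) hi hsn
  have h2 : s ≤ I.lo i k s := le_max_left _ _
  unfold seg1
  by_cases hr : I.SegRel i k s
  · simp only [if_pos hr]
    rw [Finset.sum_sub_distrib, Finset.sum_ite_eq', Finset.sum_ite_eq']
    simp only [Finset.mem_range]
    by_cases hsj : s = I.ss k j
    · have h3 : j ≤ I.se k s := by rw [hsj, se_ss]; exact le_se hj
      rw [if_pos hsj, if_neg (by omega : ¬ I.se k s + 1 < j + 1), sub_zero]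
      refine if_congr ?_ rfl rfl
      unfold Rel
      rw [← hsj]
      exact ⟨fun h => ⟨hr, by omega⟩, fun h => by omega⟩
    · rw [if_neg hsj]
      by_cases h3 : I.lo i k s ≤ j
      · have h4 : I.se k s < j := by
          by_contra h4
          exact hsj (ss_eq_of_mem hs hsn (by omega) (by omega)).symm
        rw [if_pos (by omega), if_pos (by omega), sub_self]
      · rw [if_neg (by omega), if_neg (by omega), sub_self]
  · simp only [if_neg hr, Finset.sum_const_zero]
    split_ifs with h3 h4
    · exact absurd (h3 ▸ h4.1) hr
    · rfl
    · rfl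

/-- The prefix sums of the difference array indicate the relevant positions. -/
theorem sum_dif (hI : I.Good) {i k j : ℕ} (hi : i < I.n) (hj : j < I.n) :
    ∑ x ∈ Finset.range (j + 1), I.dif i k I.n x = if I.Rel i k j then 1 else 0 := by
  unfold dif
  rw [Finset.sum_comm, Finset.sum_congr rfl fun s hs => sum_seg1 hI hi (Finset.mem_filter.1 hs).2
    (Finset.mem_range.1 (Finset.mem_filter.1 hs).1) hj, Finset.sum_ite_eq', if_pos]
  simp [ss_ss, lt_of_le_of_lt (ss_le k j) hj]

/-- Number of relevant positions before `m`. -/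
def nrel (I : Data) (i k m : ℕ) : ℕ := ((Finset.range m).filter fun j => I.Rel i k j).card

theorem rel_iff_of_mem {i k s j : ℕ} (hs : I.ss k s = s) (hsn : s < I.n) (h1 : s ≤ j)
    (h2 : j ≤ I.se k s) : I.Rel i k j ↔ I.SegRel i k s ∧ I.lo i k s ≤ j := by
  unfold Rel
  rw [ss_eq_of_mem hs hsn h1 h2]

theorem nrel_step (hI : I.Good) {i k s : ℕ} (hi : i < I.n) (hs : I.ss k s = s) (hsn : s < I.n) :
    I.nrel i k (I.se k s + 1) =
      I.nrel i k s + if I.SegRel i k s then I.se k s + 1 - I.lo i k s else 0 := by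
  have h1 := hI.lo_le (k := k) hi hsn
  have h2 : s ≤ I.lo i k s := le_max_left _ _
  have h3 : ∀ j, s ≤ j → j ≤ I.se k s → (I.Rel i k j ↔ I.SegRel i k s ∧ I.lo i k s ≤ j) :=
    fun j h4 h5 => rel_iff_of_mem hs hsn h4 h5
  unfold nrel
  have : (Finset.range (I.se k s + 1)).filter (fun j => I.Rel i k j) =
      (Finset.range s).filter (fun j => I.Rel i k j) ∪
        if I.SegRel i k s then Finset.Ico (I.lo i k s) (I.se k s + 1) else ∅ := by
    ext j
    simp only [Finset.mem_filter, Finset.mem_range, Finset.mem_union]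
    by_cases hj : s ≤ j
    · split_ifs with hr
      · rw [Finset.mem_Ico]
        refine ⟨fun h => .inr ⟨((h3 j hj (by omega)).1 h.2).2, h.1⟩, ?_⟩
        rintro (h | h)
        · omega
        · exact ⟨h.2, (h3 j hj (by omega)).2 ⟨hr, h.1⟩⟩
      · refine ⟨fun h => absurd ((h3 j hj (by omega)).1 h.2).1 hr, ?_⟩
        rintro (h | h)
        · omega
        · simp at h
    · refine ⟨fun h => .inl ⟨by omega, h.2⟩, ?_⟩
      rintro (h | h)
      · exact ⟨by omega, h.2⟩
      · split_ifs at h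
        · rw [Finset.mem_Ico] at h; omega
        · simp at h
  rw [this, Finset.card_union_of_disjoint]
  · split_ifs <;> simp
  · rw [Finset.disjoint_left]
    intro j hj
    simp only [Finset.mem_filter, Finset.mem_range] at hj
    split_ifs
    · rw [Finset.mem_Ico]; omega
    · simp

end Data

/-! ### Context of the main algorithm -/

/-- The matrix `A`, with large integers for `∞`. -/
notation "aA" => (0 : Fin 32)
/-- The matrix `B`, with large integers for `∞`. -/
notation "aB" => (1 : Fin 32)
/-- The current upper bounds of the entries of the product. -/
notation "aC" => (2 : Fin 32)
/-- The approximate product. -/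
notation "aCT" => (3 : Fin 32)
/-- The difference array of the number of uncovered relevant pairs in a column. -/
notation "aDif" => (4 : Fin 32)
/-- One column of the approximate product, shifted by `d`. -/
notation "aCol" => (5 : Fin 32)
/-- The rounding error `d`. -/
notation "aD" => (10 : Fin 32)
/-- The threshold `T` for a round. -/
notation "aT" => (11 : Fin 32)
/-- The integer that stands for `∞`. -/
notation "aInf" => (12 : Fin 32)
/-- The initial value of the entries of the product. -/
notation "aBig" => (13 : Fin 32)
/-- The bound that separates finite entries of the product from `∞`. -/
notation "aThr" => (14 : Fin 32)
/-- The factor `1` or `-1` with which difference arrays are added. -/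
notation "aG" => (15 : Fin 32)
/-- The number of uncovered relevant pairs in the current column. -/
notation "aCur" => (17 : Fin 32)
/-- The words of the input. -/
notation "wIn" => (0 : Fin 32)
/-- The ends of the segments, indexed by the row and the start. -/
notation "wSeg" => (1 : Fin 32)
/-- The window starts. -/
notation "wCst" => (2 : Fin 32)
/-- Marks for the covered pairs. -/
notation "wCov" => (3 : Fin 32)
/-- The memories of the calls of the bounded-entry algorithm, one row for each call. -/
notation "wOra" => (4 : Fin 32)
/-- The words of the output. -/
notation "wOut" => (5 : Fin 32)

/-- Bounds on the sizes of the numbers that occur: `M` bounds the entries of the matrices. The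
factor `64` leaves room for all sums that are formed, so that no integer overflows. -/
structure Bd (E : Env) (I : Data) (M : ℤ) : Prop where
  n1 : 1 ≤ I.n
  b1 : 1 ≤ I.b
  nN : I.n + 1 < E.N
  bN : I.b < E.N
  d0 : 0 ≤ I.d
  M1 : 1 ≤ M
  fit : 64 * M + 64 * I.d + 64 * (I.n * I.b) ≤ 2 ^ (E.W - 1)
  A : ∀ i < I.n, ∀ k < I.b, |I.A i k| ≤ M
  B : ∀ k < I.b, ∀ j < I.n, |I.B k j| ≤ M

/-- The machine holds the dimensions, the two matrices and the rounding error. -/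
structure Ctx (E : Env) (I : Data) (h : H) : Prop where
  base : Base E h
  n : h.reg rN = I.n
  b : h.reg rB = I.b
  A : h.num aA = I.A
  B : h.num aB = I.B
  d : h.num aD 0 0 = I.d

/-- In addition, the machine knows the ends of the segments. -/
structure CtxS (E : Env) (I : Data) (h : H) : Prop extends Ctx E I h where
  seg : ∀ k < I.b, ∀ j < I.n, h.arr wSeg k (I.ss k j) = I.se k j

/-- In addition, the machine holds the approximate product and the window starts. -/
structure CtxR (E : Env) (I : Data) (h : H) : Prop extends CtxS E I h where
  CT : h.num aCT = I.CT
  cst : h.arr wCst = I.cst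

theorem Ctx.fr {E : Env} {I : Data} {h h' : H} (hc : Ctx E I h) {m : ℕ} {A B : List (Fin 32)}
    (hf : Fr m A B h h') (hm : 20 ≤ m) (hB : ∀ a ∈ [aA, aB, aD, 16, 31], a ∉ B) : Ctx E I h' :=
  ⟨hc.base.fr hf (by omega) (hB _ (by simp)) (hB _ (by simp)),
    by rw [hf.reg _ (by omega), hc.n], by rw [hf.reg _ (by omega), hc.b],
    by rw [hf.num _ (hB _ (by simp)), hc.A], by rw [hf.num _ (hB _ (by simp)), hc.B],
    by rw [hf.num _ (hB _ (by simp)), hc.d]⟩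

theorem CtxS.fr {E : Env} {I : Data} {h h' : H} (hc : CtxS E I h) {m : ℕ} {A B : List (Fin 32)}
    (hf : Fr m A B h h') (hm : 20 ≤ m) (hA : wSeg ∉ A) (hB : ∀ a ∈ [aA, aB, aD, 16, 31], a ∉ B) :
    CtxS E I h' :=
  ⟨hc.toCtx.fr hf hm hB, by rw [hf.arr _ hA]; exact hc.seg⟩

theorem CtxR.fr {E : Env} {I : Data} {h h' : H} (hc : CtxR E I h) {m : ℕ} {A B : List (Fin 32)}
    (hf : Fr m A B h h') (hm : 20 ≤ m) (hA : ∀ a ∈ [wSeg, wCst], a ∉ A)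
    (hB : ∀ a ∈ [aA, aB, aCT, aD, 16, 31], a ∉ B) : CtxR E I h' :=
  ⟨hc.toCtxS.fr hf hm (hA _ (by simp)) fun a ha => hB a (by
      simp only [List.mem_cons, List.not_mem_nil, or_false] at ha ⊢; tauto),
    by rw [hf.num _ (hB _ (by simp)), hc.CT], by rw [hf.arr _ (hA _ (by simp)), hc.cst]⟩

/-! ### Iteration over the segments of a row -/

/-- For each segment of the row `reg k`, runs `p` with the start of the segment in register `60`
and its end in register `61`. -/
def forSegs (k : ℕ) (p : Program) : Program :=
  constH 60 0 ;; whileLt 60 rN (getH 61 wSeg k 60 ;; p ;; movH 60 61 ;; incH 60)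

/-- The invariant before the segment that starts at `s` is `J s`, the time is bounded by `F s`. -/
theorem Tri.forSegs {E : Env} {I : Data} {M : ℤ} {h : H} {Q : H → ℕ → Prop} (bd : Bd E I M)
    {k kk : ℕ} {p : Program} (hkk : kk < I.b) (J : ℕ → H → Prop) (F : ℕ → ℕ)
    (hJ : ∀ s h q v, q = 60 ∨ q = 61 → J s h → J s (h.setReg q v))
    (hctx : ∀ s h, J s h → CtxS E I h ∧ h.reg k = kk) (h0 : J 0 h) (h0F : 2 ≤ F 0)
    (step : ∀ s < I.n, I.ss kk s = s → ∀ h, J s h → h.reg 60 = s → h.reg 61 = I.se kk s →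
      Tri E p h fun h' k' => h'.reg 61 = I.se kk s ∧ J (I.se kk s + 1) h' ∧
        F s + k' + 4 ≤ F (I.se kk s + 1))
    (hQ : ∀ h k, J I.n h → k ≤ F I.n → Q h k) : Tri E (forSegs k p) h Q := by
  have hlt := fun {y : ℕ} (hy : y ≤ E.N) => E.lt_of_lt_N hy
  have hnN := bd.nN
  have hn1 := bd.n1
  refine .seq (.const (hlt (by omega)) (whileLt
    (fun h' t => ∃ s, h'.reg 60 = s ∧ (s = I.n ∨ s < I.n ∧ I.ss kk s = s) ∧ J s h' ∧ t + 1 ≤ F s)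
    (fun h' => I.n - h'.reg 60) ?_ ?_ ?_ ?_))
  · exact ⟨0, by simp, .inr ⟨by omega, rfl⟩, hJ _ _ _ _ (.inl rfl) h0, h0F⟩
  · rintro h t ⟨s, -, -, h1, -⟩
    rw [(hctx _ _ h1).1.n]; exact hlt (by omega)
  · rintro h t ⟨s, h1, h2, h3, h4⟩ h5
    obtain ⟨hc, hkr⟩ := hctx _ _ h3
    rw [hc.n] at h5
    have hs : I.ss kk s = s := by rcases h2 with h2 | h2 <;> omega
    have hsn : s < I.n := by omega
    have hg := hc.seg kk hkk s hsn
    rw [hs] at hg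
    refine .seq (.get (by rw [hkr]; have := bd.bN; omega) (by omega) ?_)
    rw [hkr, h1, hg]
    have hse := Data.se_lt (I := I) (k := kk) hsn
    have hles := Data.le_se (I := I) (k := kk) hsn
    refine .seq_of (step s hsn hs _ (hJ _ _ _ _ (.inr rfl) h3) (by simpa using h1) (by simp)) ?_
    rintro h₁ k₁ ⟨e1, e2, e3⟩
    refine .seq (.mov (hlt (by omega)) (.inc ?_ ⟨⟨I.se kk s + 1, by simp [e1], ?_, ?_, by omega⟩, ?_⟩))
    · simp [e1]; exact hlt (by omega)
    · by_cases h6 : I.se kk s + 1 < I.n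
      · exact .inr ⟨h6, Data.ss_se_succ hsn h6⟩
      · exact .inl (by omega)
    · exact hJ _ _ _ _ (.inl rfl) (hJ _ _ _ _ (.inl rfl) e2)
    · simp [e1]; omega
  · rintro h t ⟨s, h1, h2, h3, h4⟩ h5
    rw [(hctx _ _ h3).1.n] at h5
    obtain rfl : s = I.n := by omega
    exact hQ _ _ h3 (by omega)

/-- Tests whether the segment between the registers `60` and `61` is relevant: register `62` is `0`
if it is, and register `63` is the first relevant position. -/
def relTest (i k : ℕ) : Program :=
  addH aX rZ rZ aCT i 61 aD rZ rZ ;; subH aX rZ rZ aX rZ rZ aA i k ;;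
  subH aX rZ rZ aX rZ rZ aB k 60 ;; negH 62 aX rZ rZ ;; getH 63 wCst i 61 ;;
  opH .sub 64 60 63 ;; opH .add 63 63 64

/-- The approximate product is bounded. -/
def CTBd (I : Data) (M : ℤ) : Prop := ∀ i < I.n, ∀ j < I.n, |I.CT i j| ≤ 8 * M

theorem Tri.relTest {E : Env} {I : Data} {M : ℤ} {h : H} (bd : Bd E I M) (hct : CTBd I M)
    (hI : I.Good) (hc : CtxR E I h) {i k ii kk s : ℕ} (hi : i < 60)
    (hii : h.reg i = ii) (hkk : h.reg k = kk) (hin : ii < I.n) (hkb : kk < I.b) (hs : s < I.n)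
    (h60 : h.reg 60 = s) (h61 : h.reg 61 = I.se kk s) :
    Tri E (relTest i k) h fun h' t => t = 7 ∧ Fr 62 [] [aX] h h' ∧
      h'.reg 62 = (if I.SegRel ii kk s then 0 else 1) ∧ h'.reg 63 = I.lo ii kk s := by
  have hN := E.N_pos
  have hz := hc.base.z
  have hlt := fun {y : ℕ} (hy : y ≤ E.N) => E.lt_of_lt_N hy
  have hnN := bd.nN
  have hbN := bd.bN
  have hse := Data.se_lt (I := I) (k := kk) hs
  have hlo := hI.lo_le (k := kk) hin hs
  have b1 := abs_le.1 (bd.A ii hin kk hkb)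
  have b2 := abs_le.1 (bd.B kk hkb s hs)
  have b3 := abs_le.1 (hct ii hin _ hse)
  have hfit := bd.fit
  have hd := bd.d0
  have hM := bd.M1
  have hnb : (0 : ℤ) ≤ I.n * I.b := by positivity
  have hcst : I.cst ii (I.se kk s) ≤ I.lo ii kk s := le_max_right _ _
  refine .seq (.add ?_ ?_ ?_ ?_ ?_ ?_ (.seq (.sub ?_ ?_ ?_ ?_ ?_ ?_ (.seq (.sub ?_ ?_ ?_ ?_ ?_ ?_
    (.seq (.neg ?_ ?_ ?_ ?_ ?_ (.seq (.get ?_ ?_ (.seq (.op ?_ (.op ?_ ?_))))))))))))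
  any_goals simp only [H.reg_setReg, H.reg_setNum, H.arr_setReg, H.arr_setNum,
    H.num_setNum_self, hz, hii, hkk, h60, h61, hc.base.top, hc.cst, Op.eval,
    show i ≠ 62 by omega, if_false, Nat.reduceEqDiff, if_true]
  any_goals omega
  any_goals rw [H.num_setNum_ne _ _ _ _ _ _ (by decide), H.num_setNum_ne _ _ _ _ _ _ (by decide),
      H.num_setNum_ne _ _ _ _ _ _ (by decide), hc.CT, hc.d, hc.A, hc.B]
  · linarith
  · linarith
  · exact hlt (by omega)
  · exact hlt (by omega)
  · refine ⟨trivial, ?_, ?_, ?_⟩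
    · repeat first | exact Fr.refl _ _ _ _ | refine Fr.setNum ?_ (by simp) _ _ _ |
        refine Fr.setReg ?_ _ (by omega) (by omega)
    · by_cases hr : I.SegRel ii kk s
      · rw [if_pos hr, if_neg (by unfold Data.SegRel at hr; omega)]
      · rw [if_neg hr, if_pos (by unfold Data.SegRel at hr; omega)]
    · unfold Data.lo; omega

/-- Adds the difference array of the pair `(reg i, reg k)`, multiplied by `G`. -/
def addPair (i k : ℕ) : Program :=
  forSegs k (relTest i k ;; condH 62 .nop
    (addH aDif rZ 63 aDif rZ 63 aG rZ rZ ;; movH 64 61 ;; incH 64 ;;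
      subH aDif rZ 64 aDif rZ 64 aG rZ rZ))

theorem Tri.addPair {E : Env} {I : Data} {M : ℤ} {h : H} (bd : Bd E I M) (hct : CTBd I M)
    (hI : I.Good) (hc : CtxR E I h) {i k ii kk : ℕ} (hi : i < 60) (hk : k < 60)
    (hii : h.reg i = ii) (hkk : h.reg k = kk) (hin : ii < I.n) (hkb : kk < I.b) :
    Tri E (addPair i k) h fun h' t => t ≤ 20 * nst I.d (I.B kk) I.n + 2 ∧
      Fr 60 [] [aX, aDif] h h' ∧
      ∀ x, h'.num aDif 0 x = h.num aDif 0 x + h.num aG 0 0 * I.dif ii kk I.n x := by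
  have hN := E.N_pos
  have hlt := fun {y : ℕ} (hy : y ≤ E.N) => E.lt_of_lt_N hy
  have hnN := bd.nN
  refine Tri.forSegs bd hkb (fun s h' => Fr 60 [] [aX, aDif] h h' ∧
      ∀ x, h'.num aDif 0 x = h.num aDif 0 x + h.num aG 0 0 * I.dif ii kk s x)
    (fun s => 20 * nst I.d (I.B kk) s + 2) ?_ ?_ ⟨Fr.refl _ _ _ _, ?_⟩ (by omega) ?_ ?_
  · rintro s h' q v hq ⟨h1, h2⟩
    exact ⟨h1.setReg _ (by omega) (by omega), h2⟩
  · rintro s h' ⟨h1, -⟩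
    exact ⟨(hc.fr h1 (by omega) (by decide) (by decide)).toCtxS, by rw [h1.reg _ (by omega), hkk]⟩
  · intro x; simp [Data.dif]
  · rintro s hs hss h' ⟨h1, h2⟩ h60 h61
    have hc' := hc.fr h1 (by omega) (by decide) (by decide)
    have hse := Data.se_lt (I := I) (k := kk) hs
    have hlo := hI.lo_le (k := kk) hin hs
    have hns : nst I.d (I.B kk) (I.se kk s + 1) = nst I.d (I.B kk) s + 1 := nst_step hss (by omega)
    rw [hns]
    refine .seq_of (Tri.relTest bd hct hI hc' hi (by rw [h1.reg _ (by omega), hii])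
      (by rw [h1.reg _ (by omega), hkk]) hin hkb hs h60 h61) ?_
    rintro h₁ t₁ ⟨rfl, e1, e2, e3⟩
    have f61 : h₁.reg 61 = I.se kk s := by rw [e1.reg _ (by omega), h61]
    have fz : h₁.reg 0 = 0 := by rw [e1.reg _ (by omega), hc'.base.z]
    have fD : h₁.num aDif = h'.num aDif := e1.num _ (by decide)
    have fG : h₁.num aG = h.num aG := by rw [e1.num _ (by decide), h1.num _ (by decide)]
    have f1 : Fr 60 [] [aX, aDif] h h₁ := h1.step e1 (by omega) (by simp) (by simp)
    refine .cond (fun hx => .nop ⟨f61, ⟨f1, fun x => ?_⟩, by omega⟩) fun hx => ?_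
    · have hr : ¬ I.SegRel ii kk s := fun hr => by rw [e2, if_pos hr] at hx; exact hx rfl
      rw [fD, h2, Data.dif_step hss hs, Data.seg1, if_neg hr, add_zero]
    · have hr : I.SegRel ii kk s := by by_contra hr; rw [e2, if_neg hr] at hx; omega
      refine .seq (.add ?_ ?_ ?_ ?_ ?_ ?_ (.seq (.mov ?_ (.seq (.inc ?_ (.sub ?_ ?_ ?_ ?_ ?_ ?_
        ?_))))))
      any_goals simp only [H.reg_setReg, H.reg_setNum, H.num_setReg, fz, e3, f61, if_true, if_false,
        Nat.reduceEqDiff]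
      any_goals omega
      · exact hlt (by omega)
      · exact hlt (by omega)
      · refine ⟨by simp, ⟨?_, fun x => ?_⟩, by omega⟩
        · repeat first | exact f1 | refine Fr.setNum ?_ (by simp) _ _ _ |
            refine Fr.setReg ?_ _ (by omega) (by omega)
        · rw [Data.dif_step hss hs, Data.seg1, if_pos hr]
          have h2x := h2 x
          rw [← fD] at h2x
          simp only [H.num_setNum, H.num_setReg, true_and, fG, show (15 : Fin 32) ≠ 4 by decide,
            false_and, if_false]
          by_cases c1 : x = I.se kk s + 1
          · subst c1
            rw [if_pos rfl, if_neg (by omega), if_neg (by omega), if_pos rfl, h2x]; ring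
          · rw [if_neg c1, if_neg c1]
            by_cases c2 : x = I.lo ii kk s
            · rw [if_pos c2, if_pos c2, ← c2, h2x]; ring
            · rw [if_neg c2, if_neg c2, h2x]; ring
  · rintro h' t ⟨h1, h2⟩ h3
    exact ⟨h3, h1, h2⟩

/-- `C i j := min (C i j) (A i k + B k j)` -/
def relax (i k j : ℕ) : Program := addH aX rZ rZ aA i k aB k j ;; minH aC i j

/-- The entries of the current product are bounded. -/
def CBd (I : Data) (M : ℤ) (h : H) : Prop := ∀ i < I.n, ∀ j < I.n, |h.num aC i j| ≤ 8 * M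

theorem Tri.relax {E : Env} {I : Data} {M : ℤ} {h : H} (bd : Bd E I M) (hC : CBd I M h)
    (hc : Ctx E I h) {i k j ii kk jj : ℕ} (hi : i < 80) (hj : j < 80)
    (hii : h.reg i = ii) (hkk : h.reg k = kk) (hjj : h.reg j = jj) (hin : ii < I.n) (hkb : kk < I.b)
    (hjn : jj < I.n) :
    Tri E (relax i k j) h fun h' t => t ≤ 5 ∧ Fr 80 [] [aX, aY, aC] h h' ∧
      h'.num aC = fun x y => if x = ii ∧ y = jj then
        min (h.num aC ii jj) (I.A ii kk + I.B kk jj) else h.num aC x y := by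
  have hN := E.N_pos
  have hz := hc.base.z
  have hnN := bd.nN
  have hbN := bd.bN
  have b1 := abs_le.1 (bd.A ii hin kk hkb)
  have b2 := abs_le.1 (bd.B kk hkb jj hjn)
  have b3 := abs_le.1 (hC ii hin jj hjn)
  have hfit := bd.fit
  have hd := bd.d0
  have hM := bd.M1
  have hnb : (0 : ℤ) ≤ I.n * I.b := by positivity
  refine .seq (.add (by omega) (by omega) (by omega) (by omega) (by omega) (by omega) ?_)
  rw [hz, hii, hkk, hjj, hc.A, hc.B]
  have hf : Fr 80 [] [aX, aY, aC] h (h.setNum aX 0 0 (I.A ii kk + I.B kk jj)) :=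
    (Fr.refl _ _ _ _).setNum (by simp) _ _ _
  have eC : (h.setNum aX 0 0 (I.A ii kk + I.B kk jj)).num aC = h.num aC :=
    H.num_setNum_ne _ _ _ _ _ _ (by decide)
  refine (Tri.minInto (hc.base.fr hf (by omega) (by decide) (by decide)) (by decide) hi hj
    (by simp [hii]; omega) (by simp [hjj]; omega) ?_ ?_).mono ?_
  · simp only [H.num_setNum_self, H.reg_setNum, hii, hjj, eC]; linarith
  · simp only [H.num_setNum_self, H.reg_setNum, hii, hjj, eC]; linarith
  · rintro h' t ⟨h1, h2, h3⟩
    refine ⟨by omega, hf.step h2 le_rfl (by simp) (by simp), ?_⟩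
    rw [h3]
    simp only [H.num_setNum_self, H.reg_setNum, hii, hjj, eC]

/-- `C` arises from `C₀` by taking the minimum with the sums of the row `i` of `A` and the entry
`k` of the columns in `S`. -/
def Upd (I : Data) (i k : ℕ) (S : ℕ → Prop) (C₀ C : ℕ → ℕ → ℤ) : Prop :=
  ∀ x y, (x = i ∧ S y → C x y = min (C₀ x y) (I.A i k + I.B k y)) ∧
    (¬ (x = i ∧ S y) → C x y = C₀ x y)

theorem Upd.congr {I : Data} {i k : ℕ} {S S' : ℕ → Prop} {C₀ C : ℕ → ℕ → ℤ}
    (h : Upd I i k S C₀ C) (hS : ∀ y, S y ↔ S' y) : Upd I i k S' C₀ C := by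
  intro x y
  rw [← hS]
  exact h x y

theorem Upd.refl {I : Data} {i k : ℕ} {S : ℕ → Prop} {C : ℕ → ℕ → ℤ} (hS : ∀ y, ¬ S y) :
    Upd I i k S C C := fun _ y => ⟨fun h => absurd h.2 (hS y), fun _ => rfl⟩

theorem Upd.bd {E : Env} {I : Data} {M : ℤ} (bd : Bd E I M) {i k : ℕ} (hi : i < I.n)
    (hk : k < I.b) {S : ℕ → Prop} {h h' : H} (hu : Upd I i k S (h.num aC) (h'.num aC))
    (hC : CBd I M h) : CBd I M h' := by
  intro x hx y hy
  have b1 := abs_le.1 (bd.A i hi k hk)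
  have b2 := abs_le.1 (bd.B k hk y hy)
  have b3 := abs_le.1 (hC x hx y hy)
  have hM := bd.M1
  rw [abs_le]
  by_cases hc : x = i ∧ S y
  · rw [(hu x y).1 hc]
    rcases min_choice (h.num aC x y) (I.A i k + I.B k y) with h | h <;> rw [h] <;>
      constructor <;> linarith
  · rw [(hu x y).2 hc]; exact b3

/-- One more column. -/
theorem Upd.step {I : Data} {i k j : ℕ} {S : ℕ → Prop} {C₀ C C' : ℕ → ℕ → ℤ}
    (h : Upd I i k S C₀ C) (h' : C' = fun x y => if x = i ∧ y = j then
      min (C i j) (I.A i k + I.B k j) else C x y) : Upd I i k (fun y => S y ∨ y = j) C₀ C' := by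
  intro x y
  subst h'
  constructor
  · rintro ⟨rfl, h1⟩
    by_cases hy : y = j
    · subst hy
      simp only [and_self, if_true]
      by_cases hS : S y
      · rw [(h x y).1 ⟨rfl, hS⟩, min_assoc, min_self]
      · rw [(h x y).2 (by tauto)]
    · simp only [hy, and_false, if_false]
      exact (h x y).1 ⟨rfl, by tauto⟩
  · intro h1
    have h2 : ¬ (x = i ∧ y = j) := by tauto
    simp only [h2, if_false]
    exact (h x y).2 (by tauto)

/-- Takes the sums of the pair `(reg i, reg k)` into account in all columns. -/
def relaxAll (i k : ℕ) : Program := forUp 65 rN (relax i k 65)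

theorem Tri.relaxAll {E : Env} {I : Data} {M : ℤ} {h : H} (bd : Bd E I M) (hC : CBd I M h)
    (hc : Ctx E I h) {i k ii kk : ℕ} (hi : i < 60) (hk : k < 60)
    (hii : h.reg i = ii) (hkk : h.reg k = kk) (hin : ii < I.n) (hkb : kk < I.b) :
    Tri E (relaxAll i k) h fun h' t => t ≤ 7 * I.n + 2 ∧ Fr 60 [] [aX, aY, aC] h h' ∧
      Upd I ii kk (· < I.n) (h.num aC) (h'.num aC) := by
  have hnN := bd.nN
  refine Tri.forUp (m := I.n) (fun y h' => Fr 60 [] [aX, aY, aC] h h' ∧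
    Upd I ii kk (· < y) (h.num aC) (h'.num aC)) (fun y _ => 7 * y + 2) hc.n (by decide)
    (by omega) ?_ (fun _ _ _ => rfl) ⟨Fr.refl _ _ _ _, .refl (by simp)⟩ le_rfl ?_ ?_
  · rintro y h' v ⟨h1, h2⟩
    exact ⟨h1.setReg _ (by omega) (by omega), h2⟩
  · rintro y hy h' ⟨h1, h2⟩ h3 h4
    refine (Tri.relax bd (h2.bd bd hin hkb hC) (hc.fr h1 (by omega) (by decide)) (i := i) (k := k)
      (j := 65) (by omega) (by omega) (by rw [h1.reg _ (by omega), hii])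
      (by rw [h1.reg _ (by omega), hkk]) h3 hin hkb hy).mono ?_
    rintro h₁ t ⟨e1, e2, e3⟩
    refine ⟨by rw [e2.reg _ (by omega), h3], by rw [e2.reg _ (by omega), h4],
      ⟨h1.step e2 (by omega) (by simp) (by simp), (h2.step e3).congr fun y => by omega⟩, by omega⟩
  · rintro h' t ⟨h1, h2⟩ h3
    exact ⟨h3, h1, h2⟩

/-- Takes the sums of the pair `(reg i, reg k)` into account in all relevant columns. -/
def relaxRel (i k : ℕ) : Program :=
  forSegs k (relTest i k ;; condH 62 .nop (movH 65 63 ;; movH 66 61 ;; incH 66 ;;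
    whileLt 65 66 (relax i k 65 ;; incH 65)))

theorem Tri.relaxRel {E : Env} {I : Data} {M : ℤ} {h : H} (bd : Bd E I M) (hct : CTBd I M)
    (hI : I.Good) (hC : CBd I M h) (hc : CtxR E I h) {i k ii kk : ℕ} (hi : i < 60) (hk : k < 60)
    (hii : h.reg i = ii) (hkk : h.reg k = kk) (hin : ii < I.n) (hkb : kk < I.b) :
    Tri E (relaxRel i k) h fun h' t =>
      t ≤ 20 * nst I.d (I.B kk) I.n + 8 * I.nrel ii kk I.n + 2 ∧
      Fr 60 [] [aX, aY, aC] h h' ∧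
      Upd I ii kk (fun y => y < I.n ∧ I.Rel ii kk y) (h.num aC) (h'.num aC) := by
  have hN := E.N_pos
  have hlt := fun {y : ℕ} (hy : y ≤ E.N) => E.lt_of_lt_N hy
  have hnN := bd.nN
  refine Tri.forSegs bd hkb (fun s h' => Fr 60 [] [aX, aY, aC] h h' ∧
      Upd I ii kk (fun y => y < s ∧ I.Rel ii kk y) (h.num aC) (h'.num aC))
    (fun s => 20 * nst I.d (I.B kk) s + 8 * I.nrel ii kk s + 2) ?_ ?_
    ⟨Fr.refl _ _ _ _, .refl (by simp)⟩ (by omega) ?_ ?_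
  · rintro s h' q v hq ⟨h1, h2⟩
    exact ⟨h1.setReg _ (by omega) (by omega), h2⟩
  · rintro s h' ⟨h1, -⟩
    exact ⟨(hc.fr h1 (by omega) (by decide) (by decide)).toCtxS, by rw [h1.reg _ (by omega), hkk]⟩
  · rintro s hs hss h' ⟨h1, h2⟩ h60 h61
    have hc' := hc.fr h1 (by omega) (by decide) (by decide)
    have hse := Data.se_lt (I := I) (k := kk) hs
    have hlo := hI.lo_le (k := kk) hin hs
    have hslo : s ≤ I.lo ii kk s := le_max_left _ _
    have hns : nst I.d (I.B kk) (I.se kk s + 1) = nst I.d (I.B kk) s + 1 := nst_step hss (by omega)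
    have hri : ∀ y, s ≤ y → y ≤ I.se kk s → (I.Rel ii kk y ↔ I.SegRel ii kk s ∧ I.lo ii kk s ≤ y) :=
      fun y hy1 hy2 => Data.rel_iff_of_mem hss hs hy1 hy2
    rw [hns, Data.nrel_step hI hin hss hs]
    refine .seq_of (Tri.relTest bd hct hI hc' hi (by rw [h1.reg _ (by omega), hii])
      (by rw [h1.reg _ (by omega), hkk]) hin hkb hs h60 h61) ?_
    rintro h₁ t₁ ⟨rfl, e1, e2, e3⟩
    have f61 : h₁.reg 61 = I.se kk s := by rw [e1.reg _ (by omega), h61]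
    have fC : h₁.num aC = h'.num aC := e1.num _ (by decide)
    have f1 : Fr 60 [] [aX, aY, aC] h h₁ := h1.step e1 (by omega) (by simp) (by simp)
    refine .cond (fun hx => .nop ⟨f61, ⟨f1, ?_⟩, by omega⟩) fun hx => ?_
    · have hr : ¬ I.SegRel ii kk s := fun hr => by rw [e2, if_pos hr] at hx; exact hx rfl
      rw [fC]
      refine h2.congr fun y => ⟨fun h => ⟨by have := Data.le_se (I := I) (k := kk) hs; omega, h.2⟩,
        fun h => ⟨?_, h.2⟩⟩
      by_contra h3
      exact hr ((hri y (by omega) (by omega)).1 h.2).1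
    · have hr : I.SegRel ii kk s := by by_contra hr; rw [e2, if_neg hr] at hx; omega
      rw [if_pos hr]
      refine .seq (.mov (hlt (by omega)) (.seq (.mov ?_ (.seq (.inc ?_ ?_)))))
      · simp [f61]; exact hlt (by omega)
      · simp [f61]; exact hlt (by omega)
      refine .whileLt (fun h₂ t => ∃ y, h₂.reg 65 = y ∧ I.lo ii kk s ≤ y ∧ y ≤ I.se kk s + 1 ∧
          h₂.reg 66 = I.se kk s + 1 ∧ h₂.reg 61 = I.se kk s ∧ Fr 60 [] [aX, aY, aC] h h₂ ∧
          Upd I ii kk (fun z => (z < s ∧ I.Rel ii kk z) ∨ (I.lo ii kk s ≤ z ∧ z < y)) (h.num aC)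
            (h₂.num aC) ∧ t ≤ 7 * (y - I.lo ii kk s) + 1) (fun h => I.se kk s + 1 - h.reg 65)
          ?_ ?_ ?_ ?_
      · refine ⟨I.lo ii kk s, by simp [e3], le_rfl, by omega, by simp [f61], by simp [f61], ?_, ?_,
          by omega⟩
        · repeat first | exact f1 | refine Fr.setReg ?_ _ (by omega) (by omega)
        · simp only [H.num_setReg, fC]
          exact h2.congr fun z => ⟨.inl, fun h => h.elim id fun h => by omega⟩
      · rintro h₂ t ⟨y, -, -, -, g1, -⟩
        rw [g1]; exact hlt (by omega)
      · rintro h₂ t ⟨y, g1, g2, g3, g4, g5, g6, g7, g8⟩ g9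
        refine .seq_of (Tri.relax bd (g7.bd bd hin hkb hC)
          (hc.toCtx.fr g6 (by omega) (by decide)) (i := i) (k := k)
          (j := 65) (by omega) (by omega) (by rw [g6.reg _ (by omega), hii])
          (by rw [g6.reg _ (by omega), hkk]) g1 hin hkb (by omega)) ?_
        rintro h₃ t' ⟨k1, k2, k3⟩
        have k65 : h₃.reg 65 = y := by rw [k2.reg _ (by omega), g1]
        refine .inc (by rw [k65]; exact hlt (by omega)) ⟨⟨y + 1, by simp [k65], by omega, by omega,
          ?_, ?_, ?_, ?_, by omega⟩, by simp [k65, g1]; omega⟩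
        · simp [k2.reg, g4]
        · simp [k2.reg, g5]
        · exact (g6.step k2 (by omega) (by simp) (by simp)).setReg _ (by omega) (by omega)
        · exact (g7.step k3).congr fun z => by
            constructor
            · rintro ((h | h) | h)
              · exact .inl h
              · exact .inr ⟨h.1, by omega⟩
              · exact .inr ⟨by omega, by omega⟩
            · rintro (h | h)
              · exact .inl (.inl h)
              · by_cases hz : z = y
                · exact .inr hz
                · exact .inl (.inr ⟨h.1, by omega⟩)
      · rintro h₂ t ⟨y, g1, g2, g3, g4, g5, g6, g7, g8⟩ g9
        obtain rfl : y = I.se kk s + 1 := by omega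
        refine ⟨g5, ⟨g6, g7.congr fun z => ?_⟩, by omega⟩
        constructor
        · rintro (h | h)
          · exact ⟨by omega, h.2⟩
          · exact ⟨h.2, (hri z (by omega) (by omega)).2 ⟨hr, h.1⟩⟩
        · rintro ⟨h3, h4⟩
          by_cases hz : z < s
          · exact .inl ⟨hz, h4⟩
          · exact .inr ⟨((hri z (by omega) (by omega)).1 h4).2, h3⟩
  · rintro h' t ⟨h1, h2⟩ h3
    exact ⟨h3, h1, h2⟩

/-! ### Sums over pairs in linear order -/

/-- The sum of `f` over the first `x` pairs. -/
def psum (b : ℕ) (f : ℕ → ℕ → ℕ) (x : ℕ) : ℕ := ∑ y ∈ Finset.range x, f (y / b) (y % b)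

theorem psum_succ {b : ℕ} (f : ℕ → ℕ → ℕ) {p q : ℕ} (hq : q < b) :
    psum b f (p * b + q + 1) = psum b f (p * b + q) + f p q := by
  unfold psum
  rw [Finset.sum_range_succ]
  have h1 : (p * b + q) / b = p := by
    rw [add_comm, Nat.add_mul_div_right _ _ (by omega), Nat.div_eq_of_lt hq, zero_add]
  have h2 : (p * b + q) % b = q := by
    rw [add_comm, Nat.add_mul_mod_self_right, Nat.mod_eq_of_lt hq]
  rw [h1, h2]

theorem psum_mul {b : ℕ} (f : ℕ → ℕ → ℕ) (n : ℕ) :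
    psum b f (n * b) = ∑ p ∈ Finset.range n, ∑ q ∈ Finset.range b, f p q := by
  have key : ∀ p q, q ≤ b → psum b f (p * b + q) = psum b f (p * b) + ∑ q ∈ Finset.range q, f p q := by
    intro p q
    induction q with
    | zero => simp
    | succ q ih =>
      intro hq
      rw [← add_assoc, psum_succ f (by omega), ih (by omega), Finset.sum_range_succ, add_assoc]
  induction n with
  | zero => simp [psum]
  | succ n ih => rw [add_mul, one_mul, key n b le_rfl, ih, Finset.sum_range_succ]

/-- Whether the pair `x, k` comes before position `m` in the linear order. -/
theorem lin_lt_succ {b p q x k : ℕ} (hq : q < b) (hk : k < b) :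
    x * b + k < p * b + q + 1 ↔ x * b + k < p * b + q ∨ (x = p ∧ k = q) := by
  constructor
  · intro h
    rcases Nat.lt_or_ge (x * b + k) (p * b + q) with h1 | h1
    · exact .inl h1
    · right
      have h2 : x * b + k = p * b + q := by omega
      have h3 : k = q := by
        have := congrArg (· % b) h2
        simpa [Nat.add_mod, Nat.mod_eq_of_lt hq, Nat.mod_eq_of_lt hk] using this
      refine ⟨Nat.eq_of_mul_eq_mul_right (by omega : 0 < b) (by omega), h3⟩
  · rintro (h | ⟨rfl, rfl⟩) <;> omega

theorem lin_lt {n b x k : ℕ} (hx : x < n) (hk : k < b) : x * b + k < n * b := by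
  nlinarith

/-! ### Computing the segments -/

/-- Stores the ends of the segments: each column overwrites the end of the segment that contains it.
-/
def segPhase : Program :=
  forUp 20 rB (constH 60 0 ;; forUp 21 rN (addH aX rZ rZ aB 20 60 aD rZ rZ ;;
    subH aX rZ rZ aX rZ rZ aB 20 21 ;; negH 62 aX rZ rZ ;; condH 62 (movH 60 21) .nop ;;
    putH wSeg 20 60 21))

theorem Tri.segPhase {E : Env} {I : Data} {M : ℤ} {h : H} (bd : Bd E I M) (hc : Ctx E I h) :
    Tri E segPhase h fun h' t => t ≤ I.b * (9 * I.n + 5) + 2 ∧ Fr 20 [wSeg] [aX] h h' ∧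
      CtxS E I h' := by
  have hN := E.N_pos
  have hlt := fun {y : ℕ} (hy : y ≤ E.N) => E.lt_of_lt_N hy
  have hnN := bd.nN
  have hbN := bd.bN
  have hM := bd.M1
  have hd := bd.d0
  have hfit := bd.fit
  have hnb : (0 : ℤ) ≤ I.n * I.b := by positivity
  refine Tri.forUp (m := I.b) (fun k h' => Fr 20 [wSeg] [aX] h h' ∧
    ∀ k' < k, ∀ j < I.n, h'.arr wSeg k' (I.ss k' j) = I.se k' j)
    (fun k _ => k * (9 * I.n + 5) + 2) hc.b (by decide) (by omega) ?_ (fun _ _ _ => rfl)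
    ⟨Fr.refl _ _ _ _, by simp⟩ (by omega) ?_ ?_
  · rintro k h' v ⟨h1, h2⟩
    exact ⟨h1.setReg _ (by omega) (by omega), h2⟩
  · rintro k hk h₀ ⟨h1, h2⟩ h20 hrb
    have hc0 := hc.fr h1 (by omega) (by decide)
    refine .seq (.const (hlt (by omega)) ?_)
    refine Tri.forUp (m := I.n) (fun j h' => Fr 20 [wSeg] [aX] h h' ∧ h'.reg 20 = k ∧
      (∀ k' < k, ∀ j < I.n, h'.arr wSeg k' (I.ss k' j) = I.se k' j) ∧
      h'.reg 60 = I.ss k (j - 1) ∧ ∀ y < j, h'.arr wSeg k (I.ss k y) = send I.d (I.B k) (j - 1) y)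
      (fun j _ => 9 * j + 2) ?_ (by decide) (by omega) ?_ (fun _ _ _ => rfl) ?_ le_rfl ?_ ?_
    · simpa using hc0.n
    · rintro j h' v ⟨g1, g2, g3, g4, g5⟩
      exact ⟨g1.setReg _ (by omega) (by omega), by simpa using g2, g3, by simpa using g4, g5⟩
    · exact ⟨h1.setReg _ (by omega) (by omega), by simpa using h20, h2, by simp [Data.ss, sst],
        by simp⟩
    · rintro j hj h' ⟨g1, g2, g3, g4, g5⟩ g21 gn
      have hc' := hc.fr g1 (by omega) (by decide)
      have gz := hc'.base.z
      have hsj : I.ss k (j - 1) < I.n := by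
        have := Data.ss_le (I := I) k (j - 1); omega
      have b1 := abs_le.1 (bd.B k hk _ hsj)
      have b2 := abs_le.1 (bd.B k hk j hj)
      have hssj := Data.ss_le (I := I) k j
      have hss : I.ss k j = if I.B k (I.ss k (j - 1)) + I.d < I.B k j then j else I.ss k (j - 1) := by
        cases j with
        | zero =>
          have : ¬ I.B k (I.ss k 0) + I.d < I.B k 0 := by
            have : I.ss k 0 = 0 := rfl
            rw [this]; omega
          rw [if_neg this]
        | succ j => rfl
      refine .seq (.add ?_ ?_ ?_ ?_ ?_ ?_ (.seq (.sub ?_ ?_ ?_ ?_ ?_ ?_ (.seq (.neg ?_ ?_ ?_ ?_ ?_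
        ?_)))))
      any_goals simp only [H.reg_setNum, H.num_setNum_self, gz, g2, g4, g21,
        hc'.base.top]
      any_goals omega
      any_goals rw [H.num_setNum_ne _ _ _ _ _ _ (by decide), hc'.B, hc'.d]
      · linarith
      · linarith
      set v : ℤ := I.B k (I.ss k (j - 1)) + I.d - I.B k j with hv
      refine .seq_of (R := fun h₁ t => t ≤ 2 ∧ Fr 20 [wSeg] [aX] h h₁ ∧ h₁.reg 60 = I.ss k j ∧
        h₁.reg 20 = k ∧ h₁.reg 21 = j ∧ h₁.reg 1 = I.n ∧ h₁.arr wSeg = h'.arr wSeg) ?_ ?_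
      · refine .cond (fun hx => .mov ?_ ?_) fun hx => .nop ?_
        · simp [g21]; exact hlt (by omega)
        · have : v < 0 := by
            by_contra hneg; simp [hneg] at hx
          refine ⟨le_rfl, ?_, ?_, by simp [g2], by simp [g21], by simp [hc'.n], rfl⟩
          · repeat first | exact g1 | refine Fr.setNum ?_ (by simp) _ _ _ |
              refine Fr.setReg ?_ _ (by omega) (by omega)
          · simp [g21]; rw [hss, if_pos (by omega)]
        · have : ¬ v < 0 := by
            intro hneg; simp [hneg] at hx
          refine ⟨le_rfl, ?_, ?_, by simp [g2], by simp [g21], by simp [hc'.n], rfl⟩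
          · repeat first | exact g1 | refine Fr.setNum ?_ (by simp) _ _ _ |
              refine Fr.setReg ?_ _ (by omega) (by omega)
          · simp [g4]; rw [hss, if_neg (by omega)]
      · rintro h₁ t ⟨e1, e2, e3, e4, e5, e6, e7⟩
        refine .put (by omega) (by omega) ⟨by simpa using e5, by simpa using e6,
          ⟨e2.setArr (by simp) _ _ _, by simpa using e4, ?_, by simpa using e3, ?_⟩, by omega⟩
        · intro k' hk' y hy
          rw [H.arr_setArr, if_neg (by omega), e7]; exact g3 k' hk' y hy
        · intro y hy
          rw [H.arr_setArr, e3, e4, e5, e7]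
          simp only [true_and, Nat.add_sub_cancel]
          cases j with
          | zero =>
            obtain rfl : y = 0 := by omega
            rw [if_pos rfl]; rfl
          | succ j =>
            rw [send_succ]
            by_cases h3 : I.ss k y = I.ss k (j + 1)
            · rw [if_pos h3, if_pos (show sst I.d (I.B k) (j + 1) = sst I.d (I.B k) y from h3.symm)]
            · rw [if_neg h3,
                if_neg (show ¬ sst I.d (I.B k) (j + 1) = sst I.d (I.B k) y from Ne.symm h3)]
              refine g5 y ?_
              by_contra h4
              obtain rfl : y = j + 1 := by omega
              exact h3 rfl
    · rintro h' t ⟨g1, g2, g3, g4, g5⟩ g6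
      have hc' := hc.fr g1 (by omega) (by decide)
      refine ⟨g2, hc'.b, ⟨g1, fun k' hk' y hy => ?_⟩, ?_⟩
      · rcases Nat.lt_succ_iff_lt_or_eq.1 hk' with h3 | rfl
        · exact g3 k' h3 y hy
        · exact g5 y hy
      · rw [add_mul]; omega
  · rintro h' t ⟨h1, h2⟩ h3
    exact ⟨h3, h1, hc.fr h1 (by omega) (by decide), h2⟩

/-! ### Computing the approximate product -/

/-- For each segment of the row `k`, the sum of `A i k` and the first entry of the segment is
taken into account at the end of the segment only. This needs one step for each row `i` of `A` and
each segment; the other columns follow by suffix minima. -/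
def ctPhase : Program :=
  for2 20 rN 21 rB (forSegs 21 (addH aX rZ rZ aA 20 21 aB 21 60 ;; minH aCT 20 61))

/-- The entries of `CT` are sums of entries of `A` and of rounded entries of `B`; for the triples
`(x, k, y)` in `P`, the end of the segment of `y` has been treated. -/
def CTInv (I : Data) (M : ℤ) (P : ℕ → ℕ → ℕ → Prop) (CT : ℕ → ℕ → ℤ) : Prop :=
  (∀ x < I.n, ∀ y < I.n, CT x y = 4 * M ∨ ∃ k < I.b, CT x y = I.A x k + I.B k (I.ss k y)) ∧
    ∀ x < I.n, ∀ k < I.b, ∀ y < I.n, P x k y → CT x (I.se k y) ≤ I.A x k + I.B k (I.ss k y)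

theorem CTInv.step {I : Data} {M : ℤ} {P P' : ℕ → ℕ → ℕ → Prop} {C C' : ℕ → ℕ → ℤ}
    (hC : CTInv I M P C) {i k s : ℕ} (hk : k < I.b) (hs : I.ss k s = s) (hsn : s < I.n)
    (hC' : C' = fun x y => if x = i ∧ y = I.se k s then min (C i (I.se k s)) (I.A i k + I.B k s)
      else C x y)
    (hP : ∀ x < I.n, ∀ k' < I.b, ∀ y < I.n, P' x k' y →
      P x k' y ∨ (x = i ∧ k' = k ∧ s ≤ y ∧ y ≤ I.se k s)) :
    CTInv I M P' C' := by
  subst hC'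
  have hle : ∀ x y, (if x = i ∧ y = I.se k s then min (C i (I.se k s)) (I.A i k + I.B k s)
      else C x y) ≤ C x y := by
    intro x y
    split_ifs with h
    · rw [h.1, h.2]; exact min_le_left _ _
    · rfl
  constructor
  · intro x hx y hy
    by_cases h : x = i ∧ y = I.se k s
    · obtain ⟨rfl, rfl⟩ := h
      simp only [and_self, if_true]
      rcases min_choice (C x (I.se k s)) (I.A x k + I.B k s) with h | h <;> rw [h]
      · exact hC.1 x hx _ hy
      · exact .inr ⟨k, hk, by rw [Data.ss_se hsn, hs]⟩
    · simp only [h, if_false]; exact hC.1 x hx y hy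
  · intro x hx k' hk' y hy hp
    rcases hP x hx k' hk' y hy hp with h | ⟨rfl, rfl, h1, h2⟩
    · exact (hle _ _).trans (hC.2 x hx k' hk' y hy h)
    · have h3 := Data.ss_eq_of_mem hs hsn h1 h2
      have h4 : I.se k' y = I.se k' s := by rw [← Data.se_ss k' y, h3]
      rw [h3, h4]
      simp only [and_self, if_true]
      exact min_le_right _ _

theorem CTInv.bd {E : Env} {I : Data} {M : ℤ} (bd : Bd E I M) {P : ℕ → ℕ → ℕ → Prop}
    {C : ℕ → ℕ → ℤ} (hC : CTInv I M P C) {x y : ℕ} (hx : x < I.n) (hy : y < I.n) :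
    |C x y| ≤ 4 * M := by
  have hM := bd.M1
  rcases hC.1 x hx y hy with h | ⟨k, hk, h⟩
  · rw [h, abs_le]; constructor <;> linarith
  · have b1 := abs_le.1 (bd.A x hx k hk)
    have b2 := abs_le.1 (bd.B k hk _ (lt_of_le_of_lt (Data.ss_le (I := I) k y) hy))
    rw [h, abs_le]; constructor <;> linarith

theorem Tri.ctPhase {E : Env} {I : Data} {M : ℤ} {h : H} (bd : Bd E I M) (hc : CtxS E I h)
    (hCT : ∀ x < I.n, ∀ y < I.n, h.num aCT x y = 4 * M) :
    Tri E ctPhase h fun h' t =>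
      t ≤ psum I.b (fun _ k => 20 * nst I.d (I.B k) I.n + 8) (I.n * I.b) + 2 ∧
      Fr 20 [] [aX, aY, aCT] h h' ∧ CTInv I M (fun _ _ _ => True) (h'.num aCT) := by
  have hN := E.N_pos
  have hnN := bd.nN
  have hbN := bd.bN
  have hM := bd.M1
  have hfit := bd.fit
  have hd := bd.d0
  have hnb : (0 : ℤ) ≤ I.n * I.b := by positivity
  refine Tri.for2 (R := I.n) (C := I.b) (fun m h' => Fr 20 [] [aX, aY, aCT] h h' ∧
    CTInv I M (fun x k _ => x * I.b + k < m) (h'.num aCT))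
    (fun m _ => psum I.b (fun _ k => 20 * nst I.d (I.B k) I.n + 8) m + 2) hc.n hc.b (by decide)
    bd.b1 (by omega) (by omega) ?_ (fun _ _ _ _ _ => rfl) ⟨Fr.refl _ _ _ _, ?_⟩ (by simp) ?_ ?_
  · rintro m h' q v hq ⟨h1, h2⟩
    exact ⟨h1.setReg _ (by omega) (by omega), h2⟩
  · exact ⟨fun x hx y hy => .inl (hCT x hx y hy), by simp⟩
  · rintro i hi k hk h₀ ⟨h1, h2⟩ e20 e21 en eb
    rw [psum_succ _ hk]
    refine Tri.forSegs bd hk (fun s h' => Fr 20 [] [aX, aY, aCT] h h' ∧ h'.reg 20 = i ∧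
        h'.reg 21 = k ∧
        CTInv I M (fun x k' y => x * I.b + k' < i * I.b + k ∨ (x = i ∧ k' = k ∧ y < s)) (h'.num aCT))
      (fun s => 20 * nst I.d (I.B k) s + 2) ?_ ?_ ⟨h1, e20, e21, h2.1, ?_⟩ (by omega) ?_ ?_
    · rintro s h' q v hq ⟨g1, g2, g3, g4⟩
      exact ⟨g1.setReg _ (by omega) (by omega), by simpa [show 20 ≠ q by omega] using g2,
        by simpa [show 21 ≠ q by omega] using g3, g4⟩
    · rintro s h' ⟨g1, g2, g3, g4⟩
      exact ⟨hc.fr g1 (by omega) (by decide) (by decide), g3⟩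
    · intro x hx k' hk' y hy h3
      exact h2.2 x hx k' hk' y hy (by simpa using h3)
    · rintro s hs hss h' ⟨g1, g2, g3, g4⟩ h60 h61
      have hc' := hc.toCtx.fr g1 (by omega) (by decide)
      have gz := hc'.base.z
      have hse := Data.se_lt (I := I) (k := k) hs
      have b1 := abs_le.1 (bd.A i hi k hk)
      have b2 := abs_le.1 (bd.B k hk s hs)
      have b3 := abs_le.1 (g4.bd bd hi hse)
      have hns : nst I.d (I.B k) (I.se k s + 1) = nst I.d (I.B k) s + 1 :=
        nst_step hss (by omega)
      rw [hns]
      refine .seq (.add (by omega) (by omega) (by omega) (by omega) (by omega) (by omega) ?_)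
      rw [gz, g2, g3, h60, hc'.A, hc'.B]
      have hf : Fr 20 [] [aX, aY, aCT] h (h'.setNum aX 0 0 (I.A i k + I.B k s)) :=
        g1.setNum (by simp) _ _ _
      have eC : (h'.setNum aX 0 0 (I.A i k + I.B k s)).num aCT = h'.num aCT :=
        H.num_setNum_ne _ _ _ _ _ _ (by decide)
      refine (Tri.minInto (hc.base.fr hf (by omega) (by decide) (by decide)) (by decide)
        (by omega) (by omega) (by simp [g2]; omega) (by simp [h61]; omega) ?_ ?_).mono ?_
      · simp only [H.num_setNum_self, H.reg_setNum, g2, h61, eC]; linarith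
      · simp only [H.num_setNum_self, H.reg_setNum, g2, h61, eC]; linarith
      · rintro h₂ t ⟨k1, k2, k3⟩
        simp only [H.num_setNum_self, H.reg_setNum, g2, h61, eC] at k3
        refine ⟨by simp [k2.reg, h61], ⟨hf.step k2 (by omega) (by simp) (by simp),
          by simp [k2.reg, g2], by simp [k2.reg, g3], ?_⟩, by omega⟩
        refine g4.step hk hss hs k3 fun x hx k' hk' y hy h3 => ?_
        rcases h3 with h3 | ⟨rfl, rfl, h3⟩
        · exact .inl (.inl h3)
        · by_cases hys : y < s
          · exact .inl (.inr ⟨rfl, rfl, hys⟩)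
          · exact .inr ⟨rfl, rfl, by omega, by omega⟩
    · rintro h' t ⟨g1, g2, g3, g4⟩ g5
      have hc' := hc.toCtx.fr g1 (by omega) (by decide)
      refine ⟨g2, g3, hc'.n, hc'.b, ⟨g1, g4.1, fun x hx k' hk' y hy h3 => g4.2 x hx k' hk' y hy ?_⟩,
        by omega⟩
      rcases (lin_lt_succ hk hk').1 h3 with h3 | ⟨rfl, rfl⟩
      · exact .inl h3
      · exact .inr ⟨rfl, rfl, hy⟩
  · rintro h' t ⟨h1, h2⟩ h3
    exact ⟨h3, h1, h2.1, fun x hx k hk y hy _ => h2.2 x hx k hk y hy (lin_lt hx hk)⟩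

/-- `g y` is the minimum of `f` over the positions from `y` to `n - 1`. -/
def SufMin (n : ℕ) (f g : ℕ → ℤ) (y : ℕ) : Prop :=
  (∀ y', y ≤ y' → y' < n → g y ≤ f y') ∧ ∃ y', y ≤ y' ∧ y' < n ∧ g y = f y'

theorem SufMin.step {n y : ℕ} {f g : ℕ → ℤ} (hy : y + 1 < n) (h : SufMin n f g (y + 1))
    {g' : ℕ → ℤ} (hg' : g' y = min (f y) (g (y + 1))) : SufMin n f g' y := by
  obtain ⟨h1, z, h2, h3, h4⟩ := h
  constructor
  · intro y' hy1 hy2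
    rw [hg']
    rcases Nat.eq_or_lt_of_le hy1 with rfl | h5
    · exact min_le_left _ _
    · exact (min_le_right _ _).trans (h1 y' h5 hy2)
  · rcases min_choice (f y) (g (y + 1)) with h5 | h5 <;> rw [hg', h5]
    · exact ⟨y, le_rfl, by omega, rfl⟩
    · exact ⟨z, by omega, h3, h4⟩

theorem SufMin.congr {n y : ℕ} {f f' g g' : ℕ → ℤ} (h : SufMin n f g y) (hf : f = f')
    (hg : g' y = g y) : SufMin n f' g' y := by
  subst hf; unfold SufMin; rw [hg]; exact h

/-- Replaces each row of `CT` by its suffix minima, from right to left. -/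
def sufPhase : Program :=
  constH 23 1 ;; opH .sub 22 rN 23 ;; forUp 20 rN (forUp 21 22 (opH .sub 24 22 21 ;;
    opH .sub 25 24 23 ;; addH aX rZ rZ aCT 20 24 31 rZ rZ ;; minH aCT 20 25))

theorem Tri.sufPhase {E : Env} {I : Data} {M : ℤ} {h : H} (bd : Bd E I M) (hc : Ctx E I h)
    (hCT : ∀ x < I.n, ∀ y < I.n, |h.num aCT x y| ≤ 4 * M) :
    Tri E sufPhase h fun h' t => t ≤ I.n * (9 * I.n + 4) + 4 ∧ Fr 20 [] [aX, aY, aCT] h h' ∧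
      ∀ x < I.n, ∀ y < I.n, SufMin I.n (h.num aCT x) (h'.num aCT x) y := by
  have hN := E.N_pos
  have hlt := fun {y : ℕ} (hy : y ≤ E.N) => E.lt_of_lt_N hy
  have hnN := bd.nN
  have hn1 := bd.n1
  have hM := bd.M1
  have hfit := bd.fit
  have hd := bd.d0
  have hnb : (0 : ℤ) ≤ I.n * I.b := by positivity
  have hz := hc.base.z
  have hn := hc.n
  refine .seq (.const (hlt (by omega)) (.seq (.op ?_ ?_)))
  · simp [Op.eval, hc.n]; exact hlt (by omega)
  simp only [H.reg_setReg, Op.eval, if_false, if_true, hn, OfNat.one_ne_ofNat]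
  refine Tri.forUp (m := I.n) (fun x h' => Fr 20 [] [aX, aY, aCT] h h' ∧ h'.reg 22 = I.n - 1 ∧
    h'.reg 23 = 1 ∧ (∀ x' < I.n, x' < x → ∀ y < I.n, SufMin I.n (h.num aCT x') (h'.num aCT x') y) ∧
    ∀ x', x ≤ x' → h'.num aCT x' = h.num aCT x') (fun x _ => x * (9 * I.n + 4) + 2) (by simp [hn])
    (by decide) (by omega) ?_ (fun _ _ _ => rfl) ⟨?_, by simp, by simp, by simp, by simp⟩
    (by simp) ?_ ?_
  · rintro x h' v ⟨h1, h2, h3, h4⟩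
    exact ⟨h1.setReg _ (by omega) (by omega), by simpa using h2, by simpa using h3, h4⟩
  · repeat first | exact Fr.refl _ _ _ _ | refine Fr.setReg ?_ _ (by omega) (by omega)
  · rintro x hx h₀ ⟨h1, h2, h3, h4, h5⟩ h20 -
    refine Tri.forUp (m := I.n - 1) (fun z h' => Fr 20 [] [aX, aY, aCT] h h' ∧
      h'.reg 22 = I.n - 1 ∧ h'.reg 23 = 1 ∧ h'.reg 20 = x ∧
      (∀ x', x' ≠ x → h'.num aCT x' = h₀.num aCT x') ∧
      (∀ y, y + 1 + z < I.n → h'.num aCT x y = h.num aCT x y) ∧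
      (∀ y < I.n, I.n ≤ y + 1 + z → SufMin I.n (h.num aCT x) (h'.num aCT x) y))
      (fun z _ => 9 * z + 2) h2 (by decide) (by omega) ?_ (fun _ _ _ => rfl) ?_ le_rfl ?_ ?_
    · rintro z h' v ⟨g1, g2, g3, g4, g5⟩
      exact ⟨g1.setReg _ (by omega) (by omega), by simpa using g2, by simpa using g3,
        by simpa using g4, g5⟩
    · refine ⟨h1, h2, h3, h20, fun _ _ => rfl, fun y _ => by rw [h5 x le_rfl], fun y hy hy' => ?_⟩
      rw [h5 x le_rfl]
      refine ⟨fun y' h6 h7 => ?_, y, le_rfl, hy, rfl⟩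
      obtain rfl : y = y' := by omega
      rfl
    · rintro z hz' h' ⟨g1, g2, g3, g4, g5, g6, g7⟩ g21 -
      have gz : h'.reg 0 = 0 := by rw [g1.reg _ (by omega), hz]
      have g31 : h'.num 31 0 0 = 0 := by rw [g1.num _ (by decide), hc.base.n0]
      obtain ⟨j, hj⟩ : ∃ j, I.n - 1 - z = j + 1 := ⟨I.n - 2 - z, by omega⟩
      have b1 : ∀ y < I.n, |h'.num aCT x y| ≤ 4 * M := by
        intro y hy
        by_cases hyz : y + 1 + z < I.n
        · rw [g6 y hyz]; exact hCT x hx y hy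
        · obtain ⟨-, y', -, h6, h7⟩ := g7 y hy (by omega)
          rw [h7]; exact hCT x hx y' h6
      have b2 := abs_le.1 (b1 j (by omega))
      have b3 := abs_le.1 (b1 (j + 1) (by omega))
      refine .seq (.op ?_ (.seq (.op ?_ (.seq (.add ?_ ?_ ?_ ?_ ?_ ?_ ?_)))))
      any_goals simp only [H.reg_setReg, H.num_setReg, Op.eval, gz, g2, g3, g4, g21, hj, g31,
        Nat.reduceEqDiff, if_true, if_false, OfNat.zero_ne_ofNat, Nat.add_sub_cancel, add_zero]
      any_goals first | omega | exact hlt (by omega)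
      set h₁ := (((h'.setReg 24 (j + 1)).setReg 25 j).setNum aX 0 0 (h'.num aCT x (j + 1))) with hh₁
      have hf : Fr 20 [] [aX, aY, aCT] h h₁ := by
        repeat first | exact g1 | refine Fr.setNum ?_ (by simp) _ _ _ |
          refine Fr.setReg ?_ _ (by omega) (by omega)
      have eC : h₁.num aCT = h'.num aCT := H.num_setNum_ne _ _ _ _ _ _ (by decide)
      have eX : h₁.num aX 0 0 = h'.num aCT x (j + 1) := by simp [hh₁]
      have e20 : h₁.reg 20 = x := by simp [hh₁, g4]
      have e25 : h₁.reg 25 = j := by simp [hh₁]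
      refine (Tri.minInto (hc.base.fr hf (by omega) (by decide) (by decide)) (by decide)
        (by omega) (by omega) (by omega) (by omega) ?_ ?_).mono ?_
      · rw [eX, eC, e20, e25]; linarith
      · rw [eX, eC, e20, e25]; linarith
      · rintro h₂ t ⟨k1, k2, k3⟩
        rw [eX, eC, e20, e25] at k3
        refine ⟨by rw [k2.reg _ (by omega)]; simp [hh₁, g21],
          by rw [k2.reg _ (by omega)]; simp [hh₁, g2],
          ⟨hf.step k2 (by omega) (by simp) (by simp), by rw [k2.reg _ (by omega)]; simp [hh₁, g2],
          by rw [k2.reg _ (by omega)]; simp [hh₁, g3], by rw [k2.reg _ (by omega), e20],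
          ?_, ?_, ?_⟩, by omega⟩
        · intro x' hx'
          rw [← g5 x' hx', k3]
          funext y; simp [hx']
        · intro y hy
          rw [k3, ← g6 y (by omega)]
          simp only [true_and]
          rw [if_neg (by omega)]
        · intro y hy hy'
          by_cases hyj : y = j
          · subst hyj
            refine (g7 (y + 1) (by omega) (by omega)).step (by omega) ?_
            rw [k3, ← g6 y (by omega)]; simp
          · refine (g7 y hy (by omega)).congr rfl ?_
            rw [k3]; simp [hyj]
    · rintro h' t ⟨g1, g2, g3, g4, g5, g6, g7⟩ g8
      have e1 : h'.reg 1 = I.n := by rw [g1.reg _ (by omega), hn]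
      refine ⟨g4, e1, ⟨g1, g2, g3, fun x' hx' hx y hy => ?_, fun x' hx' => ?_⟩, ?_⟩
      · by_cases h6 : x' = x
        · subst h6; exact g7 y hy (by omega)
        · rw [g5 x' h6]; exact h4 x' hx' (by omega) y hy
      · rw [g5 x' (by omega), h5 x' (by omega)]
      · rw [add_mul]; omega
  · rintro h' t ⟨h1, h2, h3, h4, h5⟩ h6
    exact ⟨by omega, h1, fun x hx y hy => h4 x hx hx y hy⟩

/-- For each `i` and `j`, finds the first position at which `CT i` is at least `CT i j - d`. As
`CT i` is monotone, this position does not decrease in `j`, so that linear time per row suffices. -/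
def cstPhase : Program :=
  forUp 20 rN (constH 21 0 ;; constH 22 0 ;; whileLt 21 rN (addH aX rZ rZ aCT 20 22 aD rZ rZ ;;
    subH aX rZ rZ aX rZ rZ aCT 20 21 ;; negH 62 aX rZ rZ ;;
    condH 62 (incH 22) (putH wCst 20 21 22 ;; incH 21)))

theorem Tri.cstPhase {E : Env} {I : Data} {M : ℤ} {h : H} (bd : Bd E I M) (hc : Ctx E I h)
    (hCT : ∀ x < I.n, ∀ y < I.n, |h.num aCT x y| ≤ 4 * M)
    (hmono : ∀ x < I.n, ∀ y y', y ≤ y' → y' < I.n → h.num aCT x y ≤ h.num aCT x y') :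
    Tri E cstPhase h fun h' t => t ≤ I.n * (14 * I.n + 5) + 2 ∧ Fr 20 [wCst] [aX] h h' ∧
      ∀ x < I.n, ∀ e < I.n, ∀ y ≤ e,
        h'.arr wCst x e ≤ y ↔ h.num aCT x e - I.d ≤ h.num aCT x y := by
  have hN := E.N_pos
  have hlt := fun {y : ℕ} (hy : y ≤ E.N) => E.lt_of_lt_N hy
  have hnN := bd.nN
  have hn1 := bd.n1
  have hM := bd.M1
  have hfit := bd.fit
  have hd := bd.d0
  have hnb : (0 : ℤ) ≤ I.n * I.b := by positivity
  refine Tri.forUp (m := I.n) (fun x h' => Fr 20 [wCst] [aX] h h' ∧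
    ∀ x' < x, ∀ e < I.n, ∀ y ≤ e,
        h'.arr wCst x' e ≤ y ↔ h.num aCT x' e - I.d ≤ h.num aCT x' y)
    (fun x _ => x * (14 * I.n + 5) + 2) hc.n
    (by decide) (by omega) ?_ (fun _ _ _ => rfl) ⟨Fr.refl _ _ _ _, by simp⟩ (by simp) ?_ ?_
  · rintro x h' v ⟨h1, h2⟩
    exact ⟨h1.setReg _ (by omega) (by omega), h2⟩
  · rintro x hx h₀ ⟨h1, h2⟩ h20 -
    refine .seq (.const (hlt (by omega)) (.seq (.const (hlt (by omega)) ?_)))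
    refine .whileLt (fun h' t => Fr 20 [wCst] [aX] h h' ∧ h'.reg 20 = x ∧
      (∀ x' < x, ∀ e < I.n, ∀ y ≤ e,
        h'.arr wCst x' e ≤ y ↔ h.num aCT x' e - I.d ≤ h.num aCT x' y) ∧
      h'.reg 21 ≤ I.n ∧ h'.reg 22 ≤ h'.reg 21 ∧
      (h'.reg 21 < I.n → ∀ y < h'.reg 22, h.num aCT x y < h.num aCT x (h'.reg 21) - I.d) ∧
      (∀ e < h'.reg 21, ∀ y ≤ e,
        h'.arr wCst x e ≤ y ↔ h.num aCT x e - I.d ≤ h.num aCT x y) ∧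
      t ≤ 7 * (h'.reg 21 + h'.reg 22) + 1) (fun h' => (I.n - h'.reg 21) + (I.n - h'.reg 22))
      ?_ ?_ ?_ ?_
    · refine ⟨?_, by simpa using h20, h2, by simp, by simp, by simp, by simp, by simp⟩
      repeat first | exact h1 | refine Fr.setReg ?_ _ (by omega) (by omega)
    · rintro h' t ⟨g1, -⟩
      rw [(hc.fr g1 (by omega) (by decide)).n]; exact hlt (by omega)
    · rintro h' t ⟨g1, g2, g3, g4, g5, g6, g7, g8⟩ g9
      have hc' := hc.fr g1 (by omega) (by decide)
      have gz := hc'.base.z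
      have gCT : h'.num aCT = h.num aCT := g1.num _ (by decide)
      rw [hc'.n] at g9
      generalize hj : h'.reg 21 = j at *
      generalize hp : h'.reg 22 = p at *
      have b1 := abs_le.1 (hCT x hx j (by omega))
      have b2 := abs_le.1 (hCT x hx p (by omega))
      refine .seq (.add ?_ ?_ ?_ ?_ ?_ ?_ (.seq (.sub ?_ ?_ ?_ ?_ ?_ ?_ (.seq (.neg ?_ ?_ ?_ ?_ ?_
        (.cond (fun hneg => .inc ?_ ?_) fun hneg => .seq (.put ?_ ?_ (.inc ?_ ?_))))))))
      any_goals simp only [H.reg_setReg, H.reg_setNum, H.num_setNum_self, gz, g2, hj, hp,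
        hc'.base.top, Nat.reduceEqDiff, if_false, H.reg_setArr]
      any_goals first | omega | exact hlt (by omega)
      any_goals rw [H.num_setNum_ne _ _ _ _ _ _ (by decide), hc'.d, gCT]
      · linarith
      · linarith
      · have hlt' : h.num aCT x p + I.d - h.num aCT x j < 0 := by
          by_contra h0
          simp [gz, g2, hj, hp, H.num_setNum, hc'.d, gCT] at hneg
          omega
        have hpj : p < j := by
          rcases Nat.lt_or_ge p j with h0 | h0
          · exact h0
          · obtain rfl : p = j := by omega
            omega
        refine ⟨⟨?_, ?_, g3, ?_, ?_, ?_, ?_, ?_⟩, ?_⟩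
        · repeat first | exact g1 | refine Fr.setNum ?_ (by simp) _ _ _ |
            refine Fr.setReg ?_ _ (by omega) (by omega)
        · simp
        · omega
        · first | omega | (simp; omega)
        · simp only [if_true]
          intro _ y hy
          rcases Nat.lt_succ_iff_lt_or_eq.1 hy with h0 | rfl
          · exact g6 g9 y h0
          · omega
        · simpa [hj] using g7
        · first | omega | (simp; omega)
        · first | omega | (simp; omega)
      · have hlt' : ¬ h.num aCT x p + I.d - h.num aCT x j < 0 := by
          intro h0
          simp [gz, g2, hj, hp, H.num_setNum, hc'.d, gCT] at hneg
          omega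
        refine ⟨⟨?_, ?_, ?_, ?_, ?_, ?_, ?_, ?_⟩, ?_⟩
        · repeat first | exact g1 | refine Fr.setNum ?_ (by simp) _ _ _ |
            refine Fr.setArr ?_ (by simp) _ _ _ | refine Fr.setReg ?_ _ (by omega) (by omega)
        · simp
        · intro x' hx' e he y hy
          simp only [H.arr_setReg, H.arr_setArr, H.arr_setNum]
          rw [if_neg (by omega)]
          exact g3 x' hx' e he y hy
        · first | omega | (simp; omega)
        · first | omega | (simp; omega)
        · simp only [if_true]
          intro h0 y hy
          have := g6 g9 y hy
          have := hmono x hx j (j + 1) (by omega) h0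
          omega
        · simp only [if_true]
          intro e he y hy
          simp only [H.arr_setReg, H.arr_setArr, H.arr_setNum, true_and]
          by_cases hej : e = j
          · subst hej
            rw [if_pos rfl]
            constructor
            · intro h0
              have := hmono x hx p y h0 (by omega)
              omega
            · intro h0
              by_contra h00
              have := g6 g9 y (by omega)
              omega
          · rw [if_neg hej]
            exact g7 e (by omega) y hy
        · first | omega | (simp; omega)
        · first | omega | (simp; omega)
    · rintro h' t ⟨g1, g2, g3, g4, g5, g6, g7, g8⟩ g9
      have hc' := hc.fr g1 (by omega) (by decide)
      rw [hc'.n] at g9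
      refine ⟨g2, hc'.n, ⟨g1, fun x' hx' e he y hy => ?_⟩, ?_⟩
      · rcases Nat.lt_succ_iff_lt_or_eq.1 hx' with h0 | rfl
        · exact g3 x' h0 e he y hy
        · exact g7 e (by omega) y hy
      · rw [add_mul]; omega
  · rintro h' t ⟨h1, h2⟩ h3
    exact ⟨h3, h1, h2⟩

/-! ### Uncovered pairs -/

namespace Data

variable (I : Data)

/-- The pairs `(i, k)` that are marked by `0`. -/
def unc (cov : ℕ → ℕ → ℕ) : Finset (ℕ × ℕ) :=
  (Finset.range I.n ×ˢ Finset.range I.b).filter fun p => cov p.1 p.2 = 0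

/-- Number of uncovered pairs that are relevant for the column `j`. The algorithm keeps the
difference array of this function, because covering a pair changes only two entries for each
segment. -/
def cnt (cov : ℕ → ℕ → ℕ) (j : ℕ) : ℕ := ((I.unc cov).filter fun p => I.Rel p.1 p.2 j).card

/-- The difference array of `cnt`. -/
def difSum (cov : ℕ → ℕ → ℕ) (x : ℕ) : ℤ := ∑ p ∈ I.unc cov, I.dif p.1 p.2 I.n x

/-- Number of covered pairs. -/
def ncov (cov : ℕ → ℕ → ℕ) : ℕ :=
  ((Finset.range I.n ×ˢ Finset.range I.b).filter fun p => cov p.1 p.2 ≠ 0).card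

variable {I}

theorem mem_unc {cov : ℕ → ℕ → ℕ} {p : ℕ × ℕ} :
    p ∈ I.unc cov ↔ (p.1 < I.n ∧ p.2 < I.b) ∧ cov p.1 p.2 = 0 := by
  simp [unc]

theorem sum_difSum (hI : I.Good) (cov : ℕ → ℕ → ℕ) {j : ℕ} (hj : j < I.n) :
    ∑ x ∈ Finset.range (j + 1), I.difSum cov x = I.cnt cov j := by
  unfold difSum cnt
  rw [Finset.sum_comm, Finset.card_filter, Finset.sum_congr rfl fun p hp =>
    sum_dif hI (mem_unc.1 hp).1.1 hj]
  push_cast; rfl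

theorem sum_nrel (cov : ℕ → ℕ → ℕ) :
    ∑ p ∈ I.unc cov, I.nrel p.1 p.2 I.n = ∑ j ∈ Finset.range I.n, I.cnt cov j := by
  unfold nrel cnt
  simp only [Finset.card_filter]
  exact Finset.sum_comm

theorem ncov_le (cov : ℕ → ℕ → ℕ) : I.ncov cov ≤ I.n * I.b :=
  (Finset.card_filter_le _ _).trans (by simp)

theorem cnt_anti {cov cov' : ℕ → ℕ → ℕ}
    (h : ∀ i k, i < I.n → k < I.b → cov i k ≠ 0 → cov' i k ≠ 0) (j : ℕ) :
    I.cnt cov' j ≤ I.cnt cov j := by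
  refine Finset.card_le_card fun p hp => ?_
  simp only [Finset.mem_filter, mem_unc] at hp ⊢
  exact ⟨⟨hp.1.1, by by_contra h0; exact h _ _ hp.1.1.1 hp.1.1.2 h0 hp.1.2⟩, hp.2⟩

theorem cnt_le (cov : ℕ → ℕ → ℕ) (j : ℕ) : I.cnt cov j ≤ I.n * I.b :=
  ((Finset.card_filter_le _ _).trans (Finset.card_filter_le _ _)).trans (by simp)

/-- If the uncovered pairs that are relevant for `j` become covered, the number of covered pairs
grows by at least their number. -/
theorem ncov_add_cnt {cov cov' : ℕ → ℕ → ℕ}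
    (h : ∀ i k, i < I.n → k < I.b → cov i k ≠ 0 → cov' i k ≠ 0) {j : ℕ}
    (hj : ∀ i < I.n, ∀ k < I.b, I.Rel i k j → cov' i k ≠ 0) :
    I.ncov cov + I.cnt cov j ≤ I.ncov cov' := by
  unfold ncov cnt
  rw [← Finset.card_union_of_disjoint]
  · refine Finset.card_le_card fun p hp => ?_
    simp only [Finset.mem_union, Finset.mem_filter, mem_unc, Finset.mem_product,
      Finset.mem_range] at hp ⊢
    rcases hp with hp | hp
    · exact ⟨hp.1, h _ _ hp.1.1 hp.1.2 hp.2⟩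
    · exact ⟨hp.1.1, hj _ hp.1.1.1 _ hp.1.1.2 hp.2⟩
  · rw [Finset.disjoint_left]
    intro p hp hp'
    simp only [Finset.mem_filter, mem_unc] at hp hp'
    exact hp.2 hp'.1.2

theorem cnt_eq_zero {cov : ℕ → ℕ → ℕ} {j : ℕ}
    (hj : ∀ i < I.n, ∀ k < I.b, I.Rel i k j → cov i k ≠ 0) : I.cnt cov j = 0 := by
  rw [cnt, Finset.card_eq_zero, Finset.filter_eq_empty_iff]
  intro p hp hr
  have := mem_unc.1 hp
  exact hj _ this.1.1 _ this.1.2 hr this.2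

/-- Covering one more pair. -/
theorem unc_update {cov cov' : ℕ → ℕ → ℕ} {i k : ℕ} (hi : i < I.n) (hk : k < I.b)
    (h0 : cov i k = 0) (h : ∀ x y, cov' x y = if x = i ∧ y = k then 1 else cov x y) :
    I.unc cov = insert (i, k) (I.unc cov') ∧ (i, k) ∉ I.unc cov' := by
  constructor
  · ext ⟨x, y⟩
    simp only [Finset.mem_insert, mem_unc, h, Prod.mk.injEq]
    by_cases hc : x = i ∧ y = k
    · obtain ⟨rfl, rfl⟩ := hc; simp [hi, hk, h0]
    · simp [hc]
  · simp [mem_unc, h]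

theorem difSum_update {cov cov' : ℕ → ℕ → ℕ} {i k : ℕ} (hi : i < I.n) (hk : k < I.b)
    (h0 : cov i k = 0) (h : ∀ x y, cov' x y = if x = i ∧ y = k then 1 else cov x y) (x : ℕ) :
    I.difSum cov' x = I.difSum cov x - I.dif i k I.n x := by
  obtain ⟨h1, h2⟩ := unc_update hi hk h0 h
  unfold difSum
  rw [h1, Finset.sum_insert h2]; ring

/-- The sum of a cost over the covered pairs. It serves as a potential: each pair is covered at most
once, so the total cost of covering is bounded by the sum over all pairs. -/
def covCost (I : Data) (f : ℕ → ℕ) (cov : ℕ → ℕ → ℕ) : ℕ :=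
  ∑ p ∈ (Finset.range I.n ×ˢ Finset.range I.b).filter (fun p => cov p.1 p.2 ≠ 0), f p.2

theorem covCost_update {f : ℕ → ℕ} {cov cov' : ℕ → ℕ → ℕ} {i k : ℕ} (hi : i < I.n) (hk : k < I.b)
    (h0 : cov i k = 0) (h : ∀ x y, cov' x y = if x = i ∧ y = k then 1 else cov x y) :
    I.covCost f cov' = I.covCost f cov + f k := by
  unfold covCost
  have : (Finset.range I.n ×ˢ Finset.range I.b).filter (fun p => cov' p.1 p.2 ≠ 0) =
      insert (i, k) ((Finset.range I.n ×ˢ Finset.range I.b).filter fun p => cov p.1 p.2 ≠ 0) := by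
    ext ⟨x, y⟩
    simp only [Finset.mem_insert, Finset.mem_filter, Finset.mem_product, Finset.mem_range, h,
      Prod.mk.injEq]
    by_cases hc : x = i ∧ y = k
    · obtain ⟨rfl, rfl⟩ := hc; simp [hi, hk]
    · simp [hc]
  rw [this, Finset.sum_insert (by simp [h0]), add_comm]

theorem covCost_le (f : ℕ → ℕ) (cov : ℕ → ℕ → ℕ) :
    I.covCost f cov ≤ I.n * ∑ k ∈ Finset.range I.b, f k := by
  unfold covCost
  refine (Finset.sum_le_sum_of_subset (Finset.filter_subset _ _)).trans ?_
  rw [Finset.sum_product]; simp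

end Data

/-! ### Frames that allow changes of the high registers -/

/-- As `Fr`, but the registers from `100` on, which belong to the bounded-entry algorithm, may
change as well. -/
structure Fro (m : ℕ) (A B : List (Fin 32)) (h h' : H) : Prop where
  reg : ∀ r, r < m → h'.reg r = h.reg r
  raw : h'.raw = h.raw
  arr : ∀ a, a ∉ A → h'.arr a = h.arr a
  num : ∀ a, a ∉ B → h'.num a = h.num a

namespace Fro

variable {m m' : ℕ} {A B A' B' : List (Fin 32)} {h h' h'' : H}

theorem refl (m : ℕ) (A B : List (Fin 32)) (h : H) : Fro m A B h h :=
  ⟨fun _ _ => rfl, rfl, fun _ _ => rfl, fun _ _ => rfl⟩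

theorem of_fr (hf : Fr m A B h h') : Fro m A B h h' :=
  ⟨fun r hr => hf.reg r (.inl hr), hf.raw, hf.arr, hf.num⟩

theorem mono (hf : Fro m A B h h') (hm : m' ≤ m) (hA : A ⊆ A') (hB : B ⊆ B') :
    Fro m' A' B' h h' :=
  ⟨fun r hr => hf.reg r (by omega), hf.raw, fun a ha => hf.arr a fun h => ha (hA h),
    fun a ha => hf.num a fun h => ha (hB h)⟩

theorem trans (h1 : Fro m A B h h') (h2 : Fro m A B h' h'') : Fro m A B h h'' :=
  ⟨fun r hr => (h2.reg r hr).trans (h1.reg r hr), h2.raw.trans h1.raw,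
    fun a ha => (h2.arr a ha).trans (h1.arr a ha), fun a ha => (h2.num a ha).trans (h1.num a ha)⟩

theorem setReg (hf : Fro m A B h h') {r : ℕ} (v : ℕ) (h1 : m ≤ r) : Fro m A B h (h'.setReg r v) :=
  ⟨fun q hq => by rw [H.reg_setReg, if_neg (by omega)]; exact hf.reg q hq, hf.raw, hf.arr, hf.num⟩

theorem setArr (hf : Fro m A B h h') {a : Fin 32} (ha : a ∈ A) (x y v : ℕ) :
    Fro m A B h (h'.setArr a x y v) :=
  ⟨hf.reg, hf.raw, fun c hc => by
    rw [H.arr_setArr_ne]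
    · exact hf.arr c hc
    · rintro rfl; exact hc ha, hf.num⟩

theorem setNum (hf : Fro m A B h h') {a : Fin 32} (ha : a ∈ B) (x y : ℕ) (v : ℤ) :
    Fro m A B h (h'.setNum a x y v) :=
  ⟨hf.reg, hf.raw, hf.arr, fun c hc => by
    rw [H.num_setNum_ne]
    · exact hf.num c hc
    · rintro rfl; exact hc ha⟩

end Fro

theorem CtxR.fro {E : Env} {I : Data} {h h' : H} (hc : CtxR E I h) {m : ℕ} {A B : List (Fin 32)}
    (hf : Fro m A B h h') (hm : 20 ≤ m) (hA : ∀ a ∈ [wSeg, wCst], a ∉ A)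
    (hB : ∀ a ∈ [aA, aB, aCT, aD, 16, 31], a ∉ B) : CtxR E I h' := by
  have e : Fr m A B h { h' with reg := fun r => if r < m then h'.reg r else h.reg r } :=
    ⟨fun r hr => by
      by_cases h1 : r < m
      · simp only [h1, if_true]; exact hf.reg r h1
      · simp only [h1, if_false], hf.raw, hf.arr, hf.num⟩
  have c := hc.fr e hm hA hB
  have e' : ∀ r < 20, (if r < m then h'.reg r else h.reg r) = h'.reg r :=
    fun r hr => if_pos (by omega)
  exact ⟨⟨⟨⟨(e' 0 (by omega)).symm.trans c.base.z, (e' 5 (by omega)).symm.trans c.base.top,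
    c.base.n0, c.base.n1⟩, (e' 1 (by omega)).symm.trans c.n, (e' 2 (by omega)).symm.trans c.b,
    c.A, c.B, c.d⟩, c.seg⟩, c.CT, c.cst⟩

/-! ### Reading and writing encoded matrices -/

/-- The word number `z` in the encoding of a matrix with `c` columns and entries of `nb` bits. -/
def encCell (nb c : ℕ) (f : ℕ → ℕ → WithTop ℤ) (z : ℕ) : ℕ :=
  entryCell (f (z / (nb + 1) / c) (z / (nb + 1) % c)) (z % (nb + 1))

theorem encCell_add {nb c : ℕ} (f : ℕ → ℕ → WithTop ℤ) {i j t : ℕ} (hj : j < c) (ht : t ≤ nb) :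
    encCell nb c f ((i * c + j) * (nb + 1) + t) = entryCell (f i j) t := by
  have h1 : ((i * c + j) * (nb + 1) + t) / (nb + 1) = i * c + j := by
    rw [add_comm, Nat.add_mul_div_right _ _ (by omega), Nat.div_eq_of_lt (by omega), zero_add]
  have h2 : ((i * c + j) * (nb + 1) + t) % (nb + 1) = t := by
    rw [add_comm, Nat.add_mul_mod_self_right, Nat.mod_eq_of_lt (by omega)]
  have h3 : (i * c + j) / c = i := by
    rw [add_comm, Nat.add_mul_div_right _ _ (by omega), Nat.div_eq_of_lt hj, zero_add]
  have h4 : (i * c + j) % c = j := by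
    rw [add_comm, Nat.add_mul_mod_self_right, Nat.mod_eq_of_lt hj]
  unfold encCell
  rw [h1, h2, h3, h4]

/-- Writes a matrix of encoded entries; `p` computes the flag and the number of one entry. The
register `pos` is the position in the row `reg x` of the array `a`, the register `nb` is the number
of bits of an entry and the register `st` exceeds it by one. -/
def writeMat (a : Fin 32) (x pos nb st i r k c : ℕ) (p : Program) : Program :=
  for2 i r k c (p ;; writeEntry a x pos nb ;; opH .add pos pos st)

theorem Tri.writeMat {E : Env} {h : H} {Q : H → ℕ → Prop} {a : Fin 32}
    {x pos nb st i r k c : ℕ} {p : Program} {R C row nbv p0 : ℕ} (f : ℕ → ℕ → WithTop ℤ)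
    (J : ℕ → H → Prop) (F : ℕ → H → ℕ)
    (hr : h.reg r = R) (hc : h.reg c = C) (hpos : h.reg pos = p0)
    (hne : [i, r, k, c].Nodup) (hpne : pos ∉ [i, k, r, c, x, nb, st])
    (hsmall : ∀ q ∈ [i, r, k, c, x, pos, nb, st], q < 80)
    (hC : 1 ≤ C) (hR' : R ≤ E.N) (hC' : C ≤ E.N) (hnb : nbv ≤ E.W)
    (hrow : row < E.N) (hfit : p0 + R * C * (nbv + 1) < E.N)
    (hJ : ∀ m h q v, q = i ∨ q = k ∨ q = pos → J m h → J m (h.setReg q v))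
    (hJ' : ∀ m h h', J m h → Fr 80 [a] [] h h' → J m h')
    (hJreg : ∀ m h, J m h → h.reg rZ = 0 ∧ h.reg x = row ∧ h.reg nb = nbv ∧ h.reg st = nbv + 1)
    (hF : ∀ m h q v, q = i ∨ q = k ∨ q = pos → F m (h.setReg q v) = F m h)
    (hF' : ∀ m h h', Fr 80 [a] [] h h' → F m h' = F m h)
    (h0 : J 0 h) (h0F : 2 ≤ F 0 h)
    (step : ∀ p' < R, ∀ q < C, ∀ h, J (p' * C + q) h → h.reg i = p' → h.reg k = q →
      h.reg r = R → h.reg c = C → h.reg pos = p0 + (p' * C + q) * (nbv + 1) →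
      Tri E p h fun h' t => Fr 60 [] [aX, aY] h h' ∧
        h'.reg 80 = (if f p' q = ⊤ then 1 else 0) ∧ h'.num aX 0 0 = (f p' q).untopD 0 ∧
        J (p' * C + q + 1) h' ∧ F (p' * C + q) h + t + 5 * nbv + 17 ≤ F (p' * C + q + 1) h')
    (hsm60 : ∀ q ∈ [i, r, k, c, pos], q < 60)
    (hQ : ∀ h' t, J (R * C) h' → t ≤ F (R * C) h' → h'.reg pos = p0 + R * C * (nbv + 1) →
      (h'.arr a = fun x' y => if x' = row ∧ p0 ≤ y ∧ y < p0 + R * C * (nbv + 1) then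
        encCell nbv C f (y - p0) else h.arr a x' y) → Q h' t) :
    Tri E (writeMat a x pos nb st i r k c p) h Q := by
  simp only [List.mem_cons, List.not_mem_nil, or_false, not_or] at hpne
  obtain ⟨n1, n2, n3, n4, n5, n6, n7⟩ := hpne
  have s1 := hsm60 i (by simp)
  have s2 := hsm60 r (by simp)
  have s3 := hsm60 k (by simp)
  have s4 := hsm60 c (by simp)
  have s5 := hsm60 pos (by simp)
  have s6 := hsmall x (by simp)
  have s7 := hsmall nb (by simp)
  have s8 := hsmall st (by simp)
  have hlt := fun {y : ℕ} (hy : y ≤ E.N) => E.lt_of_lt_N hy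
  refine Tri.for2 (R := R) (C := C) (fun m h' => J m h' ∧ h'.reg pos = p0 + m * (nbv + 1) ∧
    h'.arr a = fun x' y => if x' = row ∧ p0 ≤ y ∧ y < p0 + m * (nbv + 1) then
        encCell nbv C f (y - p0) else h.arr a x' y) F hr hc hne hC hR' hC' ?_
    (fun m h q v hq => hF m h q v (by tauto)) ⟨h0, by simp [hpos], ?_⟩ h0F ?_
    (fun h' t h1 h2 => hQ h' t h1.1 h2 h1.2.1 h1.2.2)
  · rintro m h' q v hq ⟨h1, h2, h3⟩
    refine ⟨hJ _ _ _ _ (by tauto) h1, ?_, h3⟩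
    rw [H.reg_setReg, if_neg (by rcases hq with rfl | rfl <;> assumption)]; exact h2
  · funext x' y
    rw [if_neg]; rintro ⟨-, h1, h2⟩; omega
  · rintro p' hp' q hq h₀ ⟨h1, h2, h3⟩ e1 e2 e3 e4
    have hlin := lin_lt hp' hq
    have hmul : (p' * C + q + 1) * (nbv + 1) ≤ R * C * (nbv + 1) := Nat.mul_le_mul_right _ hlin
    rw [add_mul, one_mul] at hmul
    refine .seq_of (step p' hp' q hq h₀ h1 e1 e2 e3 e4 h2) ?_
    rintro h₁ t₁ ⟨g1, g2, g3, g4, g5⟩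
    obtain ⟨z1, z2, z3, z4⟩ := hJreg _ _ g4
    have gp : h₁.reg pos = p0 + (p' * C + q) * (nbv + 1) := by rw [g1.reg _ (by omega), h2]
    refine .seq_of (Tri.write (x := x) (p := pos) (b := nb) (e := f p' q) z1 s6 s7
      (by omega) (by omega) (by omega) g2 g3) ?_
    rintro h₂ t₂ ⟨k1, k2, k3⟩
    have j2 := hJ' _ _ _ g4 k2
    obtain ⟨y1, y2, y3, y4⟩ := hJreg _ _ j2
    have kp : h₂.reg pos = p0 + (p' * C + q) * (nbv + 1) := by rw [k2.reg _ (by omega), gp]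
    refine .op ?_ ?_
    · rw [kp, y4, Op.eval]; exact hlt (by omega)
    · rw [kp, y4, Op.eval]
      have r1 : ∀ v, ∀ q' < 60, q' ≠ pos → (h₂.setReg pos v).reg q' = h₀.reg q' := by
        intro v q' hq1 hq2
        rw [H.reg_setReg, if_neg hq2, k2.reg _ (by omega), g1.reg _ (by omega)]
      refine ⟨by rw [r1 _ _ s1 (Ne.symm n1), e1], by rw [r1 _ _ s3 (Ne.symm n2), e2],
        by rw [r1 _ _ s2 (Ne.symm n3), e3], by rw [r1 _ _ s4 (Ne.symm n4), e4],
        ⟨hJ _ _ _ _ (by tauto) j2, by simp; ring, ?_⟩, ?_⟩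
      · rw [H.arr_setReg, k3, gp, z2, z3, g1.arr _ (by simp), h3]
        funext x' y
        by_cases hx : x' = row
        · simp only [hx, true_and]
          by_cases hy : p0 + (p' * C + q) * (nbv + 1) ≤ y ∧
              y ≤ p0 + (p' * C + q) * (nbv + 1) + nbv
          · rw [if_pos hy, if_pos ⟨by omega, by rw [add_mul, one_mul]; omega⟩]
            rw [← encCell_add (nb := nbv) (i := p') f hq
              (t := y - (p0 + (p' * C + q) * (nbv + 1))) (by omega)]
            congr 1; omega
          · rw [if_neg hy]
            refine if_congr ?_ rfl rfl
            rw [add_mul _ 1, one_mul]; omega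
        · simp [hx]
      · rw [hF _ _ _ _ (by tauto), hF' _ _ _ k2]; omega

/-- Reads a matrix of encoded entries; `p` processes one entry, whose flag is in register `80` and
whose number is in `X`. -/
def readMat (a : Fin 32) (x pos nb st i r k c : ℕ) (p : Program) : Program :=
  for2 i r k c (readEntry a x pos nb ;; p ;; opH .add pos pos st)

theorem Tri.readMat {E : Env} {h : H} {Q : H → ℕ → Prop} {a : Fin 32}
    {x pos nb st i r k c : ℕ} {p : Program} {R C nbv p0 : ℕ} (f : ℕ → ℕ → WithTop ℤ)
    (J : ℕ → H → Prop) (s : ℕ)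
    (hr : h.reg r = R) (hc : h.reg c = C) (hpos : h.reg pos = p0)
    (hne : [i, r, k, c].Nodup) (hpne : pos ∉ [i, k, r, c, x, nb, st])
    (hsmall : ∀ q ∈ [i, r, k, c, x, pos, nb, st], q < 80)
    (hC : 1 ≤ C) (hR' : R ≤ E.N) (hC' : C ≤ E.N) (hnb : 1 ≤ nbv)
    (hfit : p0 + R * C * (nbv + 1) < E.N)
    (hJ : ∀ m h q v, q = i ∨ q = k ∨ q = pos → J m h → J m (h.setReg q v))
    (hJ' : ∀ m h h', J m h → Fr 80 [] [aX] h h' → J m h')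
    (hJreg : ∀ m h, J m h → Base E h ∧ h.reg x < E.N ∧ h.reg nb = nbv ∧ h.reg st = nbv + 1 ∧
      ∀ z < R * C * (nbv + 1), h.arr a (h.reg x) (p0 + z) = encCell nbv C f z)
    (hv : ∀ p < R, ∀ q < C, ∀ v : ℤ, f p q = v → -2 ^ (nbv - 1) ≤ v ∧ v < 2 ^ (nbv - 1))
    (h0 : J 0 h)
    (step : ∀ p' < R, ∀ q < C, ∀ h, J (p' * C + q) h → h.reg i = p' → h.reg k = q →
      h.reg r = R → h.reg c = C →
      h.reg 80 = (if f p' q = ⊤ then 1 else 0) → h.num aX 0 0 = (f p' q).untopD 0 →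
      Tri E p h fun h' t => (∀ q ∈ [i, r, k, c, pos], h'.reg q = h.reg q) ∧
        J (p' * C + q + 1) h' ∧ t ≤ s)
    (hQ : ∀ h' t, J (R * C) h' → t ≤ R * C * (s + 6 * nbv + 27) + 2 →
      h'.reg pos = p0 + R * C * (nbv + 1) → Q h' t) :
    Tri E (readMat a x pos nb st i r k c p) h Q := by
  simp only [List.mem_cons, List.not_mem_nil, or_false, not_or] at hpne
  obtain ⟨n1, n2, n3, n4, n5, n6, n7⟩ := hpne
  have s1 := hsmall i (by simp)
  have s2 := hsmall r (by simp)
  have s3 := hsmall k (by simp)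
  have s4 := hsmall c (by simp)
  have s5 := hsmall pos (by simp)
  have s6 := hsmall x (by simp)
  have s7 := hsmall nb (by simp)
  have s8 := hsmall st (by simp)
  have hlt := fun {y : ℕ} (hy : y ≤ E.N) => E.lt_of_lt_N hy
  refine Tri.for2 (R := R) (C := C) (fun m h' => J m h' ∧ h'.reg pos = p0 + m * (nbv + 1))
    (fun m _ => m * (s + 6 * nbv + 27) + 2) hr hc hne hC hR' hC' ?_
    (fun _ _ _ _ _ => rfl) ⟨h0, by simp [hpos]⟩ (by simp) ?_
    (fun h' t h1 h2 => hQ h' t h1.1 h2 h1.2)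
  · rintro m h' q v hq ⟨h1, h2⟩
    refine ⟨hJ _ _ _ _ (by tauto) h1, ?_⟩
    rw [H.reg_setReg, if_neg (by rcases hq with rfl | rfl <;> assumption)]; exact h2
  · rintro p' hp' q hq h₀ ⟨h1, h2⟩ e1 e2 e3 e4
    have hlin := lin_lt hp' hq
    have hmul : (p' * C + q + 1) * (nbv + 1) ≤ R * C * (nbv + 1) := Nat.mul_le_mul_right _ hlin
    rw [add_mul, one_mul] at hmul
    obtain ⟨z1, z2, z3, z4, z5⟩ := hJreg _ _ h1
    refine .seq_of (Tri.read (x := x) (p := pos) (b := nb) (e := f p' q) z1 s6 (by omega) s7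
      (by omega) (by omega) (by omega) (fun t ht => ?_) ?_) ?_
    · rw [h2, add_assoc, z5 _ (by omega), encCell_add f hq (by omega)]
    · rw [z3]; exact hv p' hp' q hq
    rintro h₁ t₁ ⟨g1, g2, g3, g4⟩
    have j1 := hJ' _ _ _ h1 g2
    refine .seq_of (step p' hp' q hq h₁ j1 ?_ ?_ ?_ ?_ g3 g4) ?_
    any_goals rw [g2.reg _ (by omega)]; assumption
    rintro h₂ t₂ ⟨k2, k3, k4⟩
    obtain ⟨y1, y2, y3, y4, y5⟩ := hJreg _ _ k3
    have r2 : ∀ q' ∈ [i, r, k, c, pos], h₂.reg q' = h₀.reg q' := by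
      intro q' hq'
      rw [k2 q' hq', g2.reg]
      simp only [List.mem_cons, List.not_mem_nil, or_false] at hq'
      rcases hq' with rfl | rfl | rfl | rfl | rfl <;> omega
    have kp : h₂.reg pos = p0 + (p' * C + q) * (nbv + 1) := by rw [r2 _ (by simp), h2]
    refine .op ?_ ?_
    · rw [kp, y4, Op.eval]; exact hlt (by omega)
    · rw [kp, y4, Op.eval]
      refine ⟨?_, ?_, ?_, ?_, ⟨hJ _ _ _ _ (by tauto) k3, by simp; ring⟩, ?_⟩
      · rw [H.reg_setReg, if_neg (Ne.symm n1), r2 _ (by simp), e1]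
      · rw [H.reg_setReg, if_neg (Ne.symm n2), r2 _ (by simp), e2]
      · rw [H.reg_setReg, if_neg (Ne.symm n3), r2 _ (by simp), e3]
      · rw [H.reg_setReg, if_neg (Ne.symm n4), r2 _ (by simp), e4]
      · rw [add_mul _ 1, one_mul]; rw [z3] at g1; omega

/-! ### One call of the bounded-entry algorithm -/

/-- The min-plus product of matrices that are given as functions. -/
def mpF (b : ℕ) (A B : ℕ → ℕ → WithTop ℤ) (i j : ℕ) : WithTop ℤ :=
  (Finset.range b).inf fun k => A i k + B k j

/-- The memory contents of an instance whose entries have `nb` bits. -/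
def inCell (n b nb : ℕ) (A B : ℕ → ℕ → WithTop ℤ) (z : ℕ) : ℕ :=
  if z < n * b * (nb + 1) then encCell nb b A z
  else if z < n * b * (nb + 1) + b * n * (nb + 1) then encCell nb n B (z - n * b * (nb + 1)) else 0

/-- The program `P` multiplies an `n × b` matrix with entries between `-δ` and `δ` by a `b × n`
matrix in time `t₀`. Its registers are those from `100` on, its memory is the row `reg 20` of the
array `wOra`; it does not touch the registers from `100 + R` on. -/
def OracleOK (E : Env) (n b : ℕ) (δ : ℤ) (R t₀ : ℕ) (P : Program) : Prop :=
  ∀ (h : H) (A B : ℕ → ℕ → WithTop ℤ),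
    (∀ i < n, ∀ k < b, ∀ v : ℤ, A i k = v → |v| ≤ δ) →
    (∀ k < b, ∀ j < n, ∀ v : ℤ, B k j = v → |v| < 2 ^ (E.W - 1)) →
    (∀ r, h.reg (100 + r) = [n, b, n, E.W - 1].getD r 0) → h.reg 20 < E.N →
    (∀ z, h.arr wOra (h.reg 20) z = inCell n b E.W A B z) →
    Tri E P h fun h' t => t ≤ t₀ ∧ Fro 100 [wOra] [] h h' ∧
      (∀ r, 100 + R ≤ r → h'.reg r = h.reg r) ∧
      (∀ x, x ≠ h.reg 20 → h'.arr wOra x = h.arr wOra x) ∧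
      ∀ z < n * n * (E.W + 2), h'.arr wOra (h.reg 20)
        (n * b * (E.W + 1) + b * n * (E.W + 1) + z) = encCell (E.W + 1) n (mpF b A B) z

/-- The entry of the pair `(i, k)` in the column `j` is close to the approximate product. -/
def Data.Win (I : Data) (j i k : ℕ) : Prop :=
  -(2 * I.d) ≤ I.A i k + I.B k j - (I.CT i j + I.d) ∧ I.A i k + I.B k j - (I.CT i j + I.d) ≤ 2 * I.d

instance (I : Data) (j i k : ℕ) : Decidable (I.Win j i k) := by unfold Data.Win; infer_instance

/-- Register `70` is `0` if the pair `(reg 22, reg 23)` is close to the approximate product in the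
column `reg 21`; the difference is put into `X`. -/
def winTest : Program :=
  addH aX rZ rZ aA 22 23 aB 23 21 ;; subH aX rZ rZ aX rZ rZ aCol 22 rZ ;;
  addH aY rZ rZ aX rZ rZ aD rZ rZ ;; addH aY rZ rZ aY rZ rZ aD rZ rZ ;; negH 70 aY rZ rZ ;;
  addH aY rZ rZ aD rZ rZ aD rZ rZ ;; subH aY rZ rZ aY rZ rZ aX rZ rZ ;; negH 71 aY rZ rZ ;;
  opH .add 70 70 71

/-- The array `aCol` holds the column `j` of the approximate product, shifted by `d`. -/
def ColOK (I : Data) (j : ℕ) (h : H) : Prop := ∀ i < I.n, h.num aCol i 0 = I.CT i j + I.d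

theorem Tri.winTest {E : Env} {I : Data} {M : ℤ} {h : H} (bd : Bd E I M) (hct : CTBd I M)
    (hc : CtxR E I h) {i j k : ℕ} (hcol : ColOK I j h) (h22 : h.reg 22 = i) (h23 : h.reg 23 = k)
    (h21 : h.reg 21 = j) (hi : i < I.n) (hk : k < I.b) (hj : j < I.n) :
    Tri E winTest h fun h' t => t = 9 ∧ Fr 60 [] [aX, aY] h h' ∧
      h'.reg 70 = (if I.Win j i k then 0 else 1) ∧
      h'.num aX 0 0 = I.A i k + I.B k j - (I.CT i j + I.d) := by
  have hN := E.N_pos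
  have hz := hc.base.z
  have hnN := bd.nN
  have hbN := bd.bN
  have b1 := abs_le.1 (bd.A i hi k hk)
  have b2 := abs_le.1 (bd.B k hk j hj)
  have b3 := abs_le.1 (hct i hi j hj)
  have hfit := bd.fit
  have hd := bd.d0
  have hM := bd.M1
  have hnb : (0 : ℤ) ≤ I.n * I.b := by positivity
  refine .seq (.add ?_ ?_ ?_ ?_ ?_ ?_ (.seq (.sub ?_ ?_ ?_ ?_ ?_ ?_ (.seq (.add ?_ ?_ ?_ ?_ ?_ ?_
    (.seq (.add ?_ ?_ ?_ ?_ ?_ ?_ (.seq (.neg ?_ ?_ ?_ ?_ ?_ (.seq (.add ?_ ?_ ?_ ?_ ?_ ?_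
    (.seq (.sub ?_ ?_ ?_ ?_ ?_ ?_ (.seq (.neg ?_ ?_ ?_ ?_ ?_ (.op ?_ ?_))))))))))))))))
  any_goals simp only [H.reg_setReg, H.reg_setNum, H.num_setReg, H.num_setNum_self, hz, h21, h22,
    h23, hc.base.top, Op.eval, Nat.reduceEqDiff, if_false, if_true, H.num_setNum,
    and_self, and_true, true_and, false_and, hc.A, hc.B, hc.d, hcol i hi,
    OfNat.zero_ne_ofNat,
    show (24 : Fin 32) ≠ 25 by decide, show (10 : Fin 32) ≠ 25 by decide,
    show (10 : Fin 32) ≠ 24 by decide, show (5 : Fin 32) ≠ 24 by decide]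
  any_goals omega
  · split_ifs <;> exact E.lt_of_lt_N (by omega)
  · refine ⟨?_, ?_⟩
    · repeat first | exact Fr.refl _ _ _ _ | refine Fr.setNum ?_ (by simp) _ _ _ |
        refine Fr.setReg ?_ _ (by omega) (by omega)
    · by_cases hw : I.Win j i k
      · rw [if_pos hw]; unfold Data.Win at hw
        rw [if_neg (by omega), if_neg (by omega)]
      · rw [if_neg hw]; unfold Data.Win at hw
        split_ifs <;> omega

/-- Stores a column of the approximate product. -/
def colPhase : Program := forUp 22 rN (addH aCol 22 rZ aCT 22 21 aD rZ rZ)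

theorem Tri.colPhase {E : Env} {I : Data} {M : ℤ} {h : H} (bd : Bd E I M)
    (hc : CtxR E I h) {j : ℕ} (h21 : h.reg 21 = j) (hj : j < I.n) :
    Tri E colPhase h fun h' t => t ≤ 3 * I.n + 2 ∧ Fr 22 [] [aCol] h h' ∧ ColOK I j h' := by
  have hN := E.N_pos
  have hnN := bd.nN
  refine Tri.forUp (m := I.n) (fun x h' => Fr 22 [] [aCol] h h' ∧
    ∀ i < x, h'.num aCol i 0 = I.CT i j + I.d) (fun x _ => 3 * x + 2) hc.n (by decide) (by omega)
    ?_ (fun _ _ _ => rfl) ⟨Fr.refl _ _ _ _, by simp⟩ le_rfl ?_ ?_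
  · rintro x h' v ⟨h1, h2⟩
    exact ⟨h1.setReg _ (by omega) (by omega), h2⟩
  · rintro x hx h' ⟨h1, h2⟩ h3 h4
    have hc' := hc.fr h1 (by omega) (by decide) (by decide)
    have g21 : h'.reg 21 = j := by rw [h1.reg _ (by omega), h21]
    have hz := hc'.base.z
    refine .add ?_ ?_ ?_ ?_ ?_ ?_ ⟨by simpa using h3, by simpa using h4,
      ⟨h1.setNum (by simp) _ _ _, ?_⟩, by omega⟩
    any_goals omega
    intro i hi
    rw [H.num_setNum, hz, g21, h3, hc'.CT, hc'.d]
    by_cases hix : i = x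
    · subst hix; simp
    · rw [if_neg (by omega)]; exact h2 i (by omega)
  · rintro h' t ⟨h1, h2⟩ h3
    exact ⟨h3, h1, h2⟩

/-- Covers the uncovered pairs that are close to the approximate product in the column `reg 21`. -/
def coverPhase : Program :=
  for2 22 rN 23 rB (winTest ;; condH 70 .nop (getH 72 wCov 22 23 ;;
    condH 72 .nop (addPair 22 23 ;; constH 73 1 ;; putH wCov 22 23 73)))

/-- The cost of covering a pair. -/
def pairCost (I : Data) (k : ℕ) : ℕ := 20 * nst I.d (I.B k) I.n + 10

theorem Tri.coverPhase {E : Env} {I : Data} {M : ℤ} {h : H} (bd : Bd E I M) (hct : CTBd I M)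
    (hI : I.Good) (hc : CtxR E I h) (hG : h.num aG 0 0 = -1) {j : ℕ} (hcol : ColOK I j h)
    (h21 : h.reg 21 = j) (hj : j < I.n) (hdif : ∀ x, h.num aDif 0 x = I.difSum (h.arr wCov) x) :
    Tri E coverPhase h fun h' t =>
      t + I.covCost (pairCost I) (h.arr wCov) ≤
        20 * (I.n * I.b) + 2 + I.covCost (pairCost I) (h'.arr wCov) ∧
      Fr 22 [wCov] [aX, aY, aDif] h h' ∧
      (∀ x, h'.num aDif 0 x = I.difSum (h'.arr wCov) x) ∧
      ∀ i < I.n, ∀ k < I.b, h'.arr wCov i k ≠ 0 ↔ h.arr wCov i k ≠ 0 ∨ I.Win j i k := by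
  have hN := E.N_pos
  have hlt := fun {y : ℕ} (hy : y ≤ E.N) => E.lt_of_lt_N hy
  have hnN := bd.nN
  have hbN := bd.bN
  refine Tri.for2 (R := I.n) (C := I.b) (fun m h' => Fr 22 [wCov] [aX, aY, aDif] h h' ∧
      (∀ x, h'.num aDif 0 x = I.difSum (h'.arr wCov) x) ∧
      (I.covCost (pairCost I) (h.arr wCov) ≤ I.covCost (pairCost I) (h'.arr wCov)) ∧
      ∀ i < I.n, ∀ k < I.b, h'.arr wCov i k ≠ 0 ↔
        h.arr wCov i k ≠ 0 ∨ (i * I.b + k < m ∧ I.Win j i k))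
    (fun m h' => 20 * m + 2 + (I.covCost (pairCost I) (h'.arr wCov) -
      I.covCost (pairCost I) (h.arr wCov))) hc.n hc.b (by decide)
    bd.b1 (by omega) (by omega) ?_ (fun _ _ _ _ _ => rfl)
    ⟨Fr.refl _ _ _ _, hdif, le_rfl, by simp⟩ (by simp) ?_ ?_
  · rintro m h' q v hq ⟨h1, h2⟩
    exact ⟨h1.setReg _ (by omega) (by omega), h2⟩
  · rintro i hi k hk h₀ ⟨h1, h2, h2', h3⟩ e22 e23 en eb
    have hc' := hc.fr h1 (by omega) (by decide) (by decide)
    have e21 : h₀.reg 21 = j := by rw [h1.reg _ (by omega), h21]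
    have hcol' : ColOK I j h₀ := by
      intro i hi; rw [h1.num _ (by decide)]; exact hcol i hi
    refine .seq_of (Tri.winTest bd hct hc' hcol' e22 e23 e21 hi hk hj) ?_
    rintro h₁ t₁ ⟨rfl, g1, g2, -⟩
    have f1 : Fr 22 [wCov] [aX, aY, aDif] h h₁ := h1.step g1 (by omega) (by simp) (by simp)
    have gc : h₁.arr wCov = h₀.arr wCov := g1.arr _ (by decide)
    have gd : h₁.num aDif = h₀.num aDif := g1.num _ (by decide)
    have hr : ∀ q < 60, h₁.reg q = h₀.reg q := fun q hq => g1.reg _ (.inl hq)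
    -- the conclusion in the cases in which nothing has to be covered
    have stay : ∀ h₂ : H, Fr 60 [] [aX, aY] h₀ h₂ → (I.Win j i k → h₀.arr wCov i k ≠ 0) →
        ∀ t ≤ 14, h₂.reg 22 = i ∧ h₂.reg 23 = k ∧ h₂.reg 1 = I.n ∧ h₂.reg 2 = I.b ∧
        (Fr 22 [wCov] [aX, aY, aDif] h h₂ ∧
          (∀ x, h₂.num aDif 0 x = I.difSum (h₂.arr wCov) x) ∧
          (I.covCost (pairCost I) (h.arr wCov) ≤ I.covCost (pairCost I) (h₂.arr wCov)) ∧
          ∀ i' < I.n, ∀ k' < I.b, h₂.arr wCov i' k' ≠ 0 ↔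
            h.arr wCov i' k' ≠ 0 ∨ (i' * I.b + k' < i * I.b + k + 1 ∧ I.Win j i' k')) ∧
        20 * (i * I.b + k) + 2 + (I.covCost (pairCost I) (h₀.arr wCov) -
            I.covCost (pairCost I) (h.arr wCov)) + t + 6 ≤
          20 * (i * I.b + k + 1) + 2 + (I.covCost (pairCost I) (h₂.arr wCov) -
            I.covCost (pairCost I) (h.arr wCov)) := by
      intro h₂ hf hw t ht
      have ec : h₂.arr wCov = h₀.arr wCov := hf.arr _ (by decide)
      refine ⟨by rw [hf.reg _ (by omega), e22], by rw [hf.reg _ (by omega), e23],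
        by rw [hf.reg _ (by omega), en], by rw [hf.reg _ (by omega), eb],
        ⟨h1.step hf (by omega) (by simp) (by simp), ?_, by rw [ec]; exact h2', ?_⟩, ?_⟩
      · rw [hf.num _ (by decide), ec]; exact h2
      · intro i' hi' k' hk'
        rw [ec, h3 i' hi' k' hk', lin_lt_succ hk hk']
        constructor
        · rintro (h | h)
          · exact .inl h
          · exact .inr ⟨.inl h.1, h.2⟩
        · rintro (h | ⟨h | ⟨rfl, rfl⟩, h'⟩)
          · exact .inl h
          · exact .inr ⟨h, h'⟩
          · exact (h3 i' hi' k' hk').1 (hw h')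
      · rw [ec]; omega
    refine .cond (fun hx => .nop ?_) fun hx => ?_
    · have hw : ¬ I.Win j i k := fun hw => by rw [g2, if_pos hw] at hx; exact hx rfl
      exact stay h₁ g1 (fun h => absurd h hw) _ (by omega)
    · have hw : I.Win j i k := by by_contra hw; rw [g2, if_neg hw] at hx; omega
      refine .seq (.get (by rw [hr _ (by omega), e22]; omega) (by rw [hr _ (by omega), e23]; omega)
        (.cond (fun hy => .nop ?_) fun hy => ?_))
      · refine stay _ (g1.setReg _ (by omega) (by omega)) (fun _ => ?_) _ (by omega)
        simpa [hr, e22, e23, gc] using hy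
      · have hc0 : h₀.arr wCov i k = 0 := by simpa [hr, e22, e23, gc] using hy
        set h₂ := h₁.setReg 72 (h₁.arr wCov (h₁.reg 22) (h₁.reg 23)) with hh₂
        have f2 : Fr 22 [wCov] [aX, aY, aDif] h h₂ := f1.setReg _ (by omega) (by omega)
        have hc2 := hc.fr f2 (by omega) (by decide) (by decide)
        have r2 : ∀ q < 60, h₂.reg q = h₀.reg q := fun q hq => by
          rw [hh₂, H.reg_setReg, if_neg (by omega), hr q hq]
        refine .seq_of (Tri.addPair bd hct hI hc2 (i := 22) (k := 23) (by omega) (by omega)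
          ((r2 _ (by omega)).trans e22) ((r2 _ (by omega)).trans e23) hi hk) ?_
        rintro h₃ t₃ ⟨k1, k2, k3⟩
        have r3 : ∀ q < 60, h₃.reg q = h₀.reg q := fun q hq => by
          rw [k2.reg _ (.inl hq), r2 q hq]
        have c3 : h₃.arr wCov = h₀.arr wCov := (k2.arr _ (by decide)).trans gc
        have hG2 : h₂.num aG 0 0 = -1 := by rw [f2.num _ (by decide), hG]
        refine .seq (.const (E.const_lt (by omega)) (.put ?_ ?_ ?_))
        · simp [r3, e22]; omega
        · simp [r3, e23]; omega
        · simp only [H.reg_setReg, Nat.reduceEqDiff, if_false, if_true,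
            r3 _ (show 22 < 60 by omega), r3 _ (show 23 < 60 by omega), e22, e23]
          set h₄ := (h₃.setReg 73 1).setArr wCov i k 1 with hh₄
          have upd : ∀ x y, h₄.arr wCov x y = if x = i ∧ y = k then 1 else h₀.arr wCov x y := by
            intro x y; rw [hh₄, H.arr_setArr, H.arr_setReg, c3]; simp
          have cost := Data.covCost_update (I := I) (f := pairCost I) hi hk hc0 upd
          refine ⟨by simp [hh₄, r3, e22], by simp [hh₄, r3, e23], by simp [hh₄, r3, en],
            by simp [hh₄, r3, eb], ⟨?_, ?_, by omega, ?_⟩, ?_⟩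
          · refine ((f2.step k2 (by omega) (by simp) (by simp)).setReg _ (by omega)
              (by omega)).setArr (by simp) _ _ _
          · intro x
            rw [Data.difSum_update hi hk hc0 upd, ← h2 x]
            have : h₄.num aDif 0 x = h₃.num aDif 0 x := rfl
            rw [this, k3, hG2, ← gd]
            have : h₂.num aDif 0 x = h₁.num aDif 0 x := rfl
            rw [this]; ring
          · intro i' hi' k' hk'
            rw [upd]
            by_cases hc : i' = i ∧ k' = k
            · obtain ⟨rfl, rfl⟩ := hc
              simp [hw]
            · rw [if_neg hc, h3 i' hi' k' hk', lin_lt_succ hk hk']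
              tauto
          · rw [cost]; unfold pairCost; unfold pairCost at h2'; omega
  · rintro h' t ⟨h1, h2, h2', h3⟩ h4
    refine ⟨by omega, h1, h2, fun i hi k hk => ?_⟩
    rw [h3 i hi k hk]
    have := lin_lt hi hk
    tauto

/-- The matrix `A` of the call for the column `j`: the differences between the sums in this column
and the approximate product. They are at most `2 d` in absolute value, because pairs outside the
window are replaced by `∞`. -/
def callA (I : Data) (j i k : ℕ) : WithTop ℤ :=
  if I.Win j i k then ((I.A i k + I.B k j - (I.CT i j + I.d) : ℤ) : WithTop ℤ) else ⊤

/-- The matrix `B` of the call for the column `j`: the differences to this column. They are not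
bounded in terms of `d`. -/
def callB (I : Data) (j k y : ℕ) : WithTop ℤ := ((I.B k y - I.B k j : ℤ) : WithTop ℤ)

/-- The sums of a call are the true sums, up to a shift that depends on the row only. -/
theorem callA_add_callB (I : Data) (j i k y : ℕ) : callA I j i k + callB I j k y =
    if I.Win j i k then ((I.A i k + I.B k y - (I.CT i j + I.d) : ℤ) : WithTop ℤ) else ⊤ := by
  unfold callA callB
  split_ifs
  · rw [← WithTop.coe_add]; congr 1; ring
  · rfl

theorem mpF_call_le {I : Data} {j i k y : ℕ} (hk : k < I.b) (hw : I.Win j i k) :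
    mpF I.b (callA I j) (callB I j) i y ≤ ((I.A i k + I.B k y - (I.CT i j + I.d) : ℤ) : WithTop ℤ) := by
  have := Finset.inf_le (f := fun k => callA I j i k + callB I j k y) (Finset.mem_range.2 hk)
  refine le_trans this ?_
  simp only [callA_add_callB, if_pos hw]; exact le_rfl

theorem mpF_call_cases (I : Data) (j i y : ℕ) :
    mpF I.b (callA I j) (callB I j) i y = ⊤ ∨ ∃ k < I.b, mpF I.b (callA I j) (callB I j) i y =
      ((I.A i k + I.B k y - (I.CT i j + I.d) : ℤ) : WithTop ℤ) := by
  by_cases hb : (Finset.range I.b).Nonempty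
  · obtain ⟨k, hk, h⟩ := Finset.exists_mem_eq_inf (Finset.range I.b) hb
      (fun k => callA I j i k + callB I j k y)
    rw [callA_add_callB] at h
    by_cases hw : I.Win j i k
    · rw [if_pos hw] at h
      exact .inr ⟨k, Finset.mem_range.1 hk, h⟩
    · rw [if_neg hw] at h; exact .inl h
  · left
    unfold mpF
    rw [Finset.not_nonempty_iff_eq_empty.1 hb, Finset.inf_empty]

/-- Clears the registers `100, …, 99 + R`, as a program expects registers that are zero. -/
def clearRegs : ℕ → Program
  | 0 => .nop
  | R + 1 => clearRegs R ;; constH (100 + R) 0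

theorem Tri.clearRegs {E : Env} {h : H} (R : ℕ) :
    Tri E (clearRegs R) h fun h' t => t ≤ R + 1 ∧ Fro 100 [] [] h h' ∧ h'.arr = h.arr ∧
      (∀ r, 100 + R ≤ r → h'.reg r = h.reg r) ∧ ∀ r < R, h'.reg (100 + r) = 0 := by
  induction R with
  | zero => exact .nop ⟨by omega, .refl _ _ _ _, rfl, fun _ _ => rfl, by simp⟩
  | succ R ih =>
    refine .seq_of ih ?_
    rintro h₁ t₁ ⟨h1, h2, h3, h4, h5⟩
    refine .const (E.lt_of_lt_N (by omega)) ⟨by omega, h2.setReg _ (by omega), h3, fun r hr => ?_,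
      fun r hr => ?_⟩
    · rw [H.reg_setReg, if_neg (by omega), h4 r (by omega)]
    · rw [H.reg_setReg]
      split_ifs with h6
      · rfl
      · exact h5 r (by omega)

/-- Writes the matrices of a call into the row `reg 20` of `wOra`, and runs the bounded-entry
algorithm on them. -/
def askPhase (R : ℕ) (P : Program) : Program :=
  constH 30 0 ;;
  writeMat wOra 20 30 rW 12 22 rN 23 rB (winTest ;;
    condH 70 (subH aX rZ rZ aX rZ rZ aX rZ rZ ;; constH 80 1) (constH 80 0)) ;;
  writeMat wOra 20 30 rW 12 23 rB 22 rN (subH aX rZ rZ aB 23 22 aB 23 21 ;; constH 80 0) ;;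
  clearRegs R ;; movH 100 rN ;; movH 101 rB ;; movH 102 rN ;; movH 103 rTop ;; P

/-- What the calls of the bounded-entry algorithm need. The number `r` of the call is the row of
`wOra` that serves as its memory; as every call uses a new row, it finds its memory cleared. -/
structure CallCtx (E : Env) (I : Data) (R r : ℕ) (h : H) : Prop where
  w : h.reg rW = E.W
  w1 : h.reg 12 = E.W + 1
  w2 : h.reg 13 = E.W + 2
  n : h.reg 14 = I.n
  row : h.reg 20 = r
  hi : ∀ q, 100 + R ≤ q → h.reg q = 0
  ora : ∀ x ≥ r, ∀ z, h.arr wOra x z = 0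

theorem CallCtx.fr {E : Env} {I : Data} {R r : ℕ} {h h' : H} (hc : CallCtx E I R r h) {m : ℕ}
    {A B : List (Fin 32)} (hf : Fr m A B h h') (hm : 21 ≤ m) (hA : wOra ∉ A) :
    CallCtx E I R r h' :=
  ⟨by rw [hf.reg _ (by omega), hc.w], by rw [hf.reg _ (by omega), hc.w1],
    by rw [hf.reg _ (by omega), hc.w2], by rw [hf.reg _ (by omega), hc.n],
    by rw [hf.reg _ (by omega), hc.row],
    fun q hq => by rw [hf.reg _ (by omega), hc.hi q hq], by rw [hf.arr _ hA]; exact hc.ora⟩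

theorem Tri.askPhase {E : Env} {I : Data} {M : ℤ} {h : H} {R r t₀ : ℕ} {P : Program}
    (bd : Bd E I M) (hct : CTBd I M)
    (hc : CtxR E I h) (hcc : CallCtx E I R r h) {j : ℕ} (hcol : ColOK I j h)
    (h21 : h.reg 21 = j) (hj : j < I.n) (hR : 4 ≤ R) (hr : r < E.N)
    (hfit : I.n * I.b * (E.W + 1) + I.b * I.n * (E.W + 1) < E.N)
    (hP : OracleOK E I.n I.b (2 * I.d) R t₀ P) :
    Tri E (askPhase R P) h fun h' t => t ≤ I.n * I.b * (10 * E.W + 80) + t₀ + R + 15 ∧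
      Fro 22 [wOra] [aX, aY] h h' ∧
      h'.reg 30 = I.n * I.b * (E.W + 1) + I.b * I.n * (E.W + 1) ∧
      (∀ q, 100 + R ≤ q → h'.reg q = 0) ∧ (∀ x, r < x → ∀ z, h'.arr wOra x z = 0) ∧
      ∀ z < I.n * I.n * (E.W + 2), h'.arr wOra r
        (I.n * I.b * (E.W + 1) + I.b * I.n * (E.W + 1) + z) =
          encCell (E.W + 1) I.n (mpF I.b (callA I j) (callB I j)) z := by
  have hN := E.N_pos
  have hz := hc.base.z
  have hnN := bd.nN
  have hbN := bd.bN
  have hbf := bd.fit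
  have hd := bd.d0
  have hM := bd.M1
  have hnb : (0 : ℤ) ≤ I.n * I.b := by positivity
  have hWN := E.hWN
  have hlt := fun {y : ℕ} (hy : y ≤ E.N) => E.lt_of_lt_N hy
  refine .seq (.const (hlt (by omega)) ?_)
  set h₀ := h.setReg 30 0 with hh₀
  have f0 : Fr 22 [wOra] [aX, aY] h h₀ := (Fr.refl _ _ _ _).setReg _ (by omega) (by omega)
  refine .seq (Tri.writeMat (R := I.n) (C := I.b) (row := r) (nbv := E.W) (p0 := 0) (callA I j)
    (fun _ h' => Fr 22 [wOra] [aX, aY] h h') (fun m _ => m * (5 * E.W + 40) + 2)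
    ((f0.reg 1 (by omega)).trans hc.n) ((f0.reg 2 (by omega)).trans hc.b) (by simp [hh₀])
    (by decide) (by decide) (by decide) bd.b1 (by omega) (by omega) le_rfl hr (by omega) ?_ ?_ ?_
    (fun _ _ _ _ _ => rfl) (fun _ _ _ _ => rfl) f0 (by simp) ?_ (by decide) ?_)
  · rintro m h' q v hq h1
    rcases hq with rfl | rfl | rfl <;> exact h1.setReg _ (by omega) (by omega)
  · rintro m h' h'' h1 h2
    exact h1.step h2 (by omega) (by simp) (by simp)
  · rintro m h' h1
    exact ⟨(h1.reg _ (by omega)).trans hz, (h1.reg _ (by omega)).trans hcc.row,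
      (h1.reg _ (by omega)).trans hcc.w, (h1.reg _ (by omega)).trans hcc.w1⟩
  · rintro i hi k hk h' h1 e22 e23 - - -
    have hc' := hc.fr h1 (by omega) (by decide) (by decide)
    have hcol' : ColOK I j h' := by
      intro i hi; rw [h1.num _ (by decide)]; exact hcol i hi
    refine .seq_of (Tri.winTest bd hct hc' hcol' e22 e23 ((h1.reg _ (by omega)).trans h21) hi hk hj)
      ?_
    rintro h₁ t₁ ⟨rfl, g1, g2, g3⟩
    have gz : h₁.reg 0 = 0 := (g1.reg _ (by omega)).trans hc'.base.z
    have hf : Fr 22 [wOra] [aX, aY] h h₁ := h1.step g1 (by omega) (by simp) (by simp)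
    refine .cond (fun hx => .seq (.sub ?_ ?_ ?_ ?_ ?_ ?_ (.const (E.const_lt (by omega)) ?_)))
      fun hx => .const (hlt (by omega)) ?_
    any_goals omega
    · have hw : ¬ I.Win j i k := fun hw => by rw [g2, if_pos hw] at hx; exact hx rfl
      refine ⟨?_, ?_, ?_, ?_, by rw [add_mul _ 1]; omega⟩
      · repeat first | exact g1 | refine Fr.setNum ?_ (by simp) _ _ _ |
          refine Fr.setReg ?_ _ (by omega) (by omega)
      · simp [callA, hw]
      · simp [callA, hw, gz]
      · repeat first | exact hf | refine Fr.setNum ?_ (by simp) _ _ _ |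
          refine Fr.setReg ?_ _ (by omega) (by omega)
    · have hw : I.Win j i k := by by_contra hw; rw [g2, if_neg hw] at hx; omega
      refine ⟨g1.setReg _ (by omega) (by omega), ?_, ?_, hf.setReg _ (by omega) (by omega),
        by rw [add_mul _ 1]; omega⟩
      · simp [callA, hw]
      · rw [callA, if_pos hw, H.num_setReg, g3]; rfl
  rintro h₁ t₁ f1 ht1 r1 ar1
  refine .seq (Tri.writeMat (R := I.b) (C := I.n) (row := r) (nbv := E.W)
    (p0 := 0 + I.n * I.b * (E.W + 1)) (callB I j)
    (fun _ h' => Fr 22 [wOra] [aX, aY] h h') (fun m _ => m * (5 * E.W + 40) + 2)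
    ((f1.reg 2 (by omega)).trans hc.b) ((f1.reg 1 (by omega)).trans hc.n) r1
    (by decide) (by decide) (by decide) bd.n1 (by omega) (by omega) le_rfl hr (by omega) ?_ ?_ ?_
    (fun _ _ _ _ _ => rfl) (fun _ _ _ _ => rfl) f1 (by simp) ?_ (by decide) ?_)
  · rintro m h' q v hq h1
    rcases hq with rfl | rfl | rfl <;> exact h1.setReg _ (by omega) (by omega)
  · rintro m h' h'' h1 h2
    exact h1.step h2 (by omega) (by simp) (by simp)
  · rintro m h' h1
    exact ⟨(h1.reg _ (by omega)).trans hz, (h1.reg _ (by omega)).trans hcc.row,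
      (h1.reg _ (by omega)).trans hcc.w, (h1.reg _ (by omega)).trans hcc.w1⟩
  · rintro k hk y hy h' h1 e23 e22 - - -
    have hc' := hc.fr h1 (by omega) (by decide) (by decide)
    have gz := hc'.base.z
    have e21 := (h1.reg 21 (by omega)).trans h21
    refine .seq (.sub ?_ ?_ ?_ ?_ ?_ ?_ (.const (hlt (by omega)) ?_))
    any_goals omega
    refine ⟨?_, ?_, ?_, ?_, by rw [add_mul _ 1]; omega⟩
    · repeat first | exact Fr.refl _ _ _ _ | refine Fr.setNum ?_ (by simp) _ _ _ |
        refine Fr.setReg ?_ _ (by omega) (by omega)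
    · simp [callB]
    · simp only [H.num_setReg, gz, H.num_setNum_self, callB, e22, e23, e21, hc'.B]
      rfl
    · repeat first | exact h1 | refine Fr.setNum ?_ (by simp) _ _ _ |
        refine Fr.setReg ?_ _ (by omega) (by omega)
  rintro h₂ t₂ f2 ht2 r2 ar2
  refine .seq_of (Tri.clearRegs R) ?_
  rintro h₃ t₃ ⟨ht3, f3, ar3, k1, k2⟩
  have q1 : h₃.reg 1 = I.n := by rw [f3.reg _ (by omega), f2.reg _ (by omega), hc.n]
  have q2 : h₃.reg 2 = I.b := by rw [f3.reg _ (by omega), f2.reg _ (by omega), hc.b]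
  have q5 : h₃.reg 5 = E.W - 1 := by rw [f3.reg _ (by omega), f2.reg _ (by omega), hc.base.top]
  have q20 : h₃.reg 20 = r := by rw [f3.reg _ (by omega), f2.reg _ (by omega), hcc.row]
  have hw1 := E.hW
  refine .seq (.mov ?_ (.seq (.mov ?_ (.seq (.mov ?_ (.seq (.mov ?_ ?_)))))))
  any_goals simp only [H.reg_setReg, Nat.reduceEqDiff, if_false, OfNat.one_ne_ofNat,
    q1, q2, q5]
  any_goals exact hlt (by omega)
  set h₄ := (((h₃.setReg 100 I.n).setReg 101 I.b).setReg 102 I.n).setReg 103 (E.W - 1) with hh₄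
  have f4 : Fro 22 [wOra] [aX, aY] h h₄ := by
    refine (((Fro.trans (Fro.of_fr f2) (f3.mono (by omega) (by simp) (by simp))).setReg _
      (by omega)).setReg _ (by omega) |>.setReg _ (by omega)).setReg _ (by omega)
  have e20 : h₄.reg 20 = r := by simp [hh₄, q20]
  have ar4 : h₄.arr = h₂.arr := ar3
  refine (hP h₄ (callA I j) (callB I j) ?_ ?_ ?_ (by omega) ?_).mono ?_
  · intro i hi k hk v hv
    unfold callA at hv
    split_ifs at hv with hw
    · obtain rfl := WithTop.coe_injective hv
      exact abs_le.2 hw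
    · exact absurd hv.symm (WithTop.coe_ne_top)
  · intro k hk y hy v hv
    obtain rfl := WithTop.coe_injective hv
    have b1 := abs_le.1 (bd.B k hk y hy)
    have b2 := abs_le.1 (bd.B k hk j hj)
    rw [abs_lt]; constructor <;> linarith
  · intro q
    rcases Nat.lt_or_ge q 4 with h4 | h4
    · interval_cases q <;> simp [hh₄]
    · have : [I.n, I.b, I.n, E.W - 1].getD q 0 = 0 := by
        rw [List.getD_eq_default]; simpa using h4
      rw [this]
      simp only [hh₄, H.reg_setReg]
      rw [if_neg (by omega), if_neg (by omega), if_neg (by omega), if_neg (by omega)]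
      by_cases hq : q < R
      · exact k2 q hq
      · rw [k1 _ (by omega), f2.reg _ (by omega), hcc.hi _ (by omega)]
  · intro z
    rw [ar4, e20, ar2, ar1]
    simp only [true_and, zero_add, Nat.zero_le, Nat.sub_zero]
    unfold inCell
    have : h₀.arr wOra r z = 0 := hcc.ora r le_rfl z
    rw [this]
    by_cases c1 : z < I.n * I.b * (E.W + 1)
    · rw [if_neg (by omega), if_pos c1, if_pos c1]
    · rw [if_neg c1, if_neg c1]
      refine if_congr (by omega) rfl rfl
  · rintro h₅ t₅ ⟨g1, g2, g3, g4, g5⟩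
    rw [e20] at g4 g5
    refine ⟨?_, f4.trans (g2.mono (by omega) (by simp) (by simp)), ?_, ?_, ?_, g5⟩
    · have : I.b * I.n = I.n * I.b := Nat.mul_comm _ _
      rw [this] at ht2
      have : I.n * I.b * (10 * E.W + 80) = 2 * (I.n * I.b * (5 * E.W + 40)) := by ring
      omega
    · rw [g2.reg _ (by omega)]
      simp [hh₄, f3.reg _ (show 30 < 100 by omega), r2]
    · intro q hq
      rw [g3 q hq]
      simp only [hh₄, H.reg_setReg]
      rw [if_neg (by omega), if_neg (by omega), if_neg (by omega), if_neg (by omega),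
        k1 _ hq, f2.reg _ (by omega), hcc.hi _ hq]
    · intro x hx z
      have hxr : x ≠ r := by omega
      rw [g4 x hxr, ar4, ar2, ar1]
      simp only [hxr, false_and, if_false]
      exact hcc.ora x (by omega) z

/-- Takes the result of a call into account. -/
def takePhase : Program :=
  readMat wOra 20 30 12 13 22 rN 23 14 (condH 80 .nop (addH aX rZ rZ aX rZ rZ aCol 22 rZ ;;
    minH aC 22 23))

/-- The entries of the current product are attained sums or the initial value. -/
def Sound (I : Data) (M : ℤ) (C : ℕ → ℕ → ℤ) : Prop :=
  ∀ i < I.n, ∀ j < I.n, C i j = 4 * M ∨ ∃ k < I.b, C i j = I.A i k + I.B k j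

theorem Sound.bd {E : Env} {I : Data} {M : ℤ} {C : ℕ → ℕ → ℤ} (bd : Bd E I M)
    (hC : Sound I M C) {i j : ℕ} (hi : i < I.n) (hj : j < I.n) : |C i j| ≤ 8 * M := by
  have hM := bd.M1
  rw [abs_le]
  rcases hC i hi j hj with h | ⟨k, hk, h⟩ <;> rw [h]
  · constructor <;> linarith
  · have b1 := abs_le.1 (bd.A i hi k hk)
    have b2 := abs_le.1 (bd.B k hk j hj)
    constructor <;> linarith

/-- The value of an entry after the result of a call has been taken into account. -/
def takeVal (I : Data) (j : ℕ) (C : ℕ → ℕ → ℤ) (x y : ℕ) : ℤ :=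
  if mpF I.b (callA I j) (callB I j) x y = ⊤ then C x y else
    min (C x y) ((mpF I.b (callA I j) (callB I j) x y).untopD 0 + (I.CT x j + I.d))

theorem takeVal_sound {I : Data} {M : ℤ} {C : ℕ → ℕ → ℤ} (hC : Sound I M C) (j : ℕ) :
    Sound I M (takeVal I j C) := by
  intro x hx y hy
  unfold takeVal
  rcases mpF_call_cases I j x y with h | ⟨k, hk, h⟩
  · rw [if_pos h]; exact hC x hx y hy
  · rw [if_neg (by rw [h]; exact WithTop.coe_ne_top), h, WithTop.untopD_coe]
    rcases min_choice (C x y) (I.A x k + I.B k y - (I.CT x j + I.d) + (I.CT x j + I.d)) with h1 | h1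
    · rw [h1]; exact hC x hx y hy
    · rw [h1]; exact .inr ⟨k, hk, by ring⟩

theorem takeVal_le (I : Data) (j : ℕ) (C : ℕ → ℕ → ℤ) (x y : ℕ) : takeVal I j C x y ≤ C x y := by
  unfold takeVal
  split_ifs
  · rfl
  · exact min_le_left _ _

theorem takeVal_le_of_win {I : Data} {j x k y : ℕ} (C : ℕ → ℕ → ℤ) (hk : k < I.b)
    (hw : I.Win j x k) : takeVal I j C x y ≤ I.A x k + I.B k y := by
  have h := mpF_call_le (y := y) hk hw
  unfold takeVal
  rcases mpF_call_cases I j x y with h' | ⟨k', hk', h'⟩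
  · rw [h'] at h; exact absurd h (not_le.2 (WithTop.coe_lt_top _))
  · rw [h'] at h
    rw [if_neg (by rw [h']; exact WithTop.coe_ne_top), h', WithTop.untopD_coe]
    have := WithTop.coe_le_coe.1 h
    refine (min_le_right _ _).trans ?_
    linarith

theorem Tri.takePhase {E : Env} {I : Data} {M : ℤ} {h : H} {r j : ℕ} (bd : Bd E I M)
    (hct : CTBd I M) (hc : CtxR E I h) (hcol : ColOK I j h) (hj : j < I.n)
    (hw1 : h.reg 12 = E.W + 1) (hw2 : h.reg 13 = E.W + 2) (hn : h.reg 14 = I.n)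
    (h20 : h.reg 20 = r) (hr : r < E.N)
    (hC : Sound I M (h.num aC)) (p0 : ℕ) (h30 : h.reg 30 = p0)
    (hfit : p0 + I.n * I.n * (E.W + 2) < E.N)
    (hrow : ∀ z < I.n * I.n * (E.W + 2), h.arr wOra r (p0 + z) =
      encCell (E.W + 1) I.n (mpF I.b (callA I j) (callB I j)) z) :
    Tri E takePhase h fun h' t => t ≤ I.n * I.n * (6 * E.W + 43) + 2 ∧
      Fr 22 [] [aX, aY, aC] h h' ∧
      ∀ x < I.n, ∀ y < I.n, h'.num aC x y = takeVal I j (h.num aC) x y := by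
  have hN := E.N_pos
  have hnN := bd.nN
  have hbf := bd.fit
  have hd := bd.d0
  have hM := bd.M1
  have hnb : (0 : ℤ) ≤ I.n * I.b := by positivity
  have hpow : (2 : ℤ) ^ (E.W - 1) ≤ 2 ^ (E.W + 1 - 1) :=
    pow_le_pow_right₀ (by norm_num) (by omega)
  have bA := fun {x k : ℕ} (hx : x < I.n) (hk : k < I.b) => abs_le.1 (bd.A x hx k hk)
  have bB := fun {y k : ℕ} (hk : k < I.b) (hy : y < I.n) => abs_le.1 (bd.B k hk y hy)
  have bT := fun {x : ℕ} (hx : x < I.n) => abs_le.1 (hct x hx j hj)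
  refine Tri.readMat (R := I.n) (C := I.n) (nbv := E.W + 1) (p0 := p0)
    (mpF I.b (callA I j) (callB I j)) (fun m h' => Fr 22 [] [aX, aY, aC] h h' ∧
      ∀ x < I.n, ∀ y < I.n, h'.num aC x y =
        if x * I.n + y < m then takeVal I j (h.num aC) x y else h.num aC x y)
    10 hc.n hn h30 (by decide) (by decide) (by decide) bd.n1 (by omega) (by omega) (by omega)
    hfit ?_ ?_ ?_ ?_ ⟨Fr.refl _ _ _ _, by simp⟩ ?_ ?_
  · rintro m h' q v hq ⟨h1, h2⟩
    refine ⟨?_, h2⟩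
    rcases hq with rfl | rfl | rfl <;> exact h1.setReg _ (by omega) (by omega)
  · rintro m h' h'' ⟨h1, h2⟩ h3
    exact ⟨h1.step h3 (by omega) (by simp) (by simp), by rw [h3.num _ (by decide)]; exact h2⟩
  · rintro m h' ⟨h1, -⟩
    refine ⟨(hc.fr h1 (by omega) (by decide) (by decide)).base, ?_, ?_, ?_, ?_⟩
    · rw [h1.reg _ (by omega), h20]; exact hr
    · rw [h1.reg _ (by omega), hw1]
    · rw [h1.reg _ (by omega), hw2]
    · intro z hz
      rw [h1.arr _ (by simp), h1.reg _ (by omega), h20]; exact hrow z hz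
  · intro x hx y hy v hv
    rcases mpF_call_cases I j x y with h' | ⟨k, hk, h'⟩
    · rw [h'] at hv; exact absurd hv.symm WithTop.coe_ne_top
    · rw [h'] at hv
      obtain rfl := WithTop.coe_injective hv
      have b1 := bA hx hk
      have b2 := bB hk hy
      have b3 := bT hx
      constructor <;> linarith
  · rintro x hx y hy h' ⟨h1, h2⟩ e22 e23 e1 e14 e80 eX
    have hc' := hc.fr h1 (by omega) (by decide) (by decide)
    have gz := hc'.base.z
    have h2' := h2 x hx y hy
    rw [if_neg (lt_irrefl _)] at h2'
    have old := Sound.bd bd hC hx hy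
    refine .cond (fun hx0 => .nop ?_) fun hx0 => .seq (.add ?_ ?_ ?_ ?_ ?_ ?_ ?_)
    any_goals omega
    · have htop : mpF I.b (callA I j) (callB I j) x y = ⊤ := by
        by_contra h0; rw [if_neg h0] at e80; exact hx0 e80
      refine ⟨fun _ _ => rfl, ⟨h1, fun x' hx' y' hy' => ?_⟩, by omega⟩
      rw [h2 x' hx' y' hy']
      by_cases hc : x' = x ∧ y' = y
      · obtain ⟨rfl, rfl⟩ := hc
        rw [if_neg (by omega), if_pos (by omega), takeVal, if_pos htop]
      · refine if_congr ?_ rfl rfl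
        rw [lin_lt_succ hy hy']; tauto
    · have htop : ¬ mpF I.b (callA I j) (callB I j) x y = ⊤ := by
        intro h0; rw [if_pos h0] at e80; omega
      obtain ⟨k, hk, hv⟩ := (mpF_call_cases I j x y).resolve_left htop
      have b1 := bA hx hk
      have b2 := bB hk hy
      have b3 := bT hx
      have eX' : h'.num aX 0 0 = I.A x k + I.B k y - (I.CT x j + I.d) := by
        rw [eX, hv, WithTop.untopD_coe]
      have ecol : h'.num aCol x 0 = I.CT x j + I.d := by rw [h1.num _ (by decide)]; exact hcol x hx
      rw [gz, e22, ecol, eX']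
      set h₁ := h'.setNum aX 0 0 (I.A x k + I.B k y - (I.CT x j + I.d) + (I.CT x j + I.d)) with hh₁
      have f1 : Fr 22 [] [aX, aY, aC] h h₁ := h1.setNum (by simp) _ _ _
      have eC : h₁.num aC = h'.num aC := H.num_setNum_ne _ _ _ _ _ _ (by decide)
      have eX1 : h₁.num aX 0 0 = I.A x k + I.B k y - (I.CT x j + I.d) + (I.CT x j + I.d) :=
        H.num_setNum_self _ _ _ _ _
      have e22' : h₁.reg 22 = x := e22
      have e23' : h₁.reg 23 = y := e23
      refine (Tri.minInto (hc.base.fr f1 (by omega) (by decide) (by decide)) (c := aC) (i := 22)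
        (j := 23) (by decide) (by omega) (by omega) (by omega) (by omega) ?_ ?_).mono ?_
      · rw [eC, e22', e23', eX1, h2']; have := abs_le.1 old; linarith
      · rw [eC, e22', e23', eX1, h2']; have := abs_le.1 old; linarith
      · rintro h₂ t ⟨k1, k2, k3⟩
        rw [eC, e22', e23', eX1] at k3
        refine ⟨fun q hq => ?_, ⟨f1.step k2 (by omega) (by simp) (by simp), fun x' hx' y' hy' => ?_⟩,
          by omega⟩
        · rw [k2.reg]
          · rfl
          · simp only [List.mem_cons, List.not_mem_nil, or_false] at hq; omega
        · rw [k3]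
          by_cases hc : x' = x ∧ y' = y
          · obtain ⟨rfl, rfl⟩ := hc
            simp only [and_self, if_true]
            rw [if_pos (by omega), takeVal, if_neg htop, hv, WithTop.untopD_coe, h2']
          · simp only [hc, if_false]
            rw [h2 x' hx' y' hy']
            refine if_congr ?_ rfl rfl
            rw [lin_lt_succ hy hy']; tauto
  · rintro h' t ⟨h1, h2⟩ h3 -
    refine ⟨?_, h1, fun x hx y hy => ?_⟩
    · refine h3.trans (le_of_eq ?_); ring
    · rw [h2 x hx y hy, if_pos (lin_lt hx hy)]

/-- The invariants of the sweep over the columns after `r` calls. In the current product, all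
entries are attained (`sound`), and the sums of the covered pairs have been taken into account
(`compl`). -/
structure SW (E : Env) (I : Data) (M T : ℤ) (R r : ℕ) (h : H) : Prop where
  ctx : CtxR E I h
  call : CallCtx E I R r h
  T : h.num aT 0 0 = T
  G : h.num aG 0 0 = -1
  dif : ∀ x, h.num aDif 0 x = I.difSum (h.arr wCov) x
  sound : Sound I M (h.num aC)
  compl : ∀ i < I.n, ∀ k < I.b, h.arr wCov i k ≠ 0 → ∀ j < I.n, h.num aC i j ≤ I.A i k + I.B k j

/-- One round: covers all pairs that are close to the approximate product in the column `reg 21`.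
These include all pairs that are relevant for this column, so the number of uncovered ones becomes
`0`. -/
def round (R : ℕ) (P : Program) : Program :=
  colPhase ;; coverPhase ;; askPhase R P ;; takePhase ;;
    subH aCur rZ rZ aCur rZ rZ aCur rZ rZ ;; incH 20

/-- The time of one round, without the amortized cost of covering. -/
def roundTime (E : Env) (I : Data) (R t₀ : ℕ) : ℕ :=
  3 * I.n + I.n * I.b * (10 * E.W + 100) + I.n * I.n * (6 * E.W + 43) + t₀ + R + 30

/-- A round keeps the invariants, and all pairs that are relevant for its column are covered
afterwards. The time for covering is accounted for by the growth of the potential `covCost`. -/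
theorem Tri.round {E : Env} {I : Data} {M T : ℤ} {h : H} {R r t₀ : ℕ} {P : Program}
    (bd : Bd E I M) (hct : CTBd I M) (hI : I.Good) (hs : SW E I M T R r h) {j : ℕ}
    (h21 : h.reg 21 = j) (hj : j < I.n) (hR : 4 ≤ R) (hr : r < E.N)
    (hfit : I.n * I.b * (E.W + 1) + I.b * I.n * (E.W + 1) + I.n * I.n * (E.W + 2) < E.N)
    (hP : OracleOK E I.n I.b (2 * I.d) R t₀ P) :
    Tri E (round R P) h fun h' t =>
      t + I.covCost (pairCost I) (h.arr wCov) ≤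
        roundTime E I R t₀ + I.covCost (pairCost I) (h'.arr wCov) ∧
      SW E I M T R (r + 1) h' ∧ h'.reg 21 = j ∧ h'.num aCur 0 0 = 0 ∧
      (∀ i k, i < I.n → k < I.b → h.arr wCov i k ≠ 0 → h'.arr wCov i k ≠ 0) ∧
      (∀ i < I.n, ∀ k < I.b, I.Rel i k j → h'.arr wCov i k ≠ 0) ∧
      Fro 20 [wOra, wCov] [aX, aY, aCol, aDif, aC, aCur] h h' := by
  have hN := E.N_pos
  refine .seq_of (Tri.colPhase bd hs.ctx h21 hj) ?_
  rintro h₁ t₁ ⟨ht1, f1, col1⟩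
  have c1 := hs.ctx.fr f1 (by omega) (by decide) (by decide)
  refine .seq_of (Tri.coverPhase bd hct hI c1 (by rw [f1.num _ (by decide), hs.G]) col1
    (by rw [f1.reg _ (by omega), h21]) hj
    (by rw [f1.num _ (by decide), f1.arr _ (by decide)]; exact hs.dif)) ?_
  rintro h₂ t₂ ⟨ht2, f2, dif2, cov2⟩
  rw [f1.arr _ (by decide)] at ht2 cov2
  have c2 := c1.fr f2 (by omega) (by decide) (by decide)
  have col2 : ColOK I j h₂ := by intro i hi; rw [f2.num _ (by decide)]; exact col1 i hi
  have g21 : h₂.reg 21 = j := by rw [f2.reg _ (by omega), f1.reg _ (by omega), h21]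
  have cc2 := (hs.call.fr f1 (by omega) (by decide)).fr f2 (by omega) (by decide)
  refine .seq_of (Tri.askPhase bd hct c2 cc2 col2 g21 hj hR hr (by omega) hP) ?_
  rintro h₃ t₃ ⟨ht3, f3, r30, hi3, ora3, row3⟩
  have c3 := c2.fro f3 (by omega) (by decide) (by decide)
  have col3 : ColOK I j h₃ := by intro i hi; rw [f3.num _ (by decide)]; exact col2 i hi
  have C3 : h₃.num aC = h.num aC := by
    rw [f3.num _ (by decide), f2.num _ (by decide), f1.num _ (by decide)]
  refine .seq_of (Tri.takePhase bd hct c3 col3 hj (by rw [f3.reg _ (by omega), cc2.w1])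
    (by rw [f3.reg _ (by omega), cc2.w2]) (by rw [f3.reg _ (by omega), cc2.n])
    (by rw [f3.reg _ (by omega), cc2.row]) hr (by rw [C3]; exact hs.sound) _ r30 (by omega) row3) ?_
  rintro h₄ t₄ ⟨ht4, f4, C4⟩
  rw [C3] at C4
  have c4 := c3.fr f4 (by omega) (by decide) (by decide)
  have g20 : h₄.reg 20 = r := by rw [f4.reg _ (by omega), f3.reg _ (by omega), cc2.row]
  refine .seq (.sub ?_ ?_ ?_ ?_ ?_ ?_ (.inc ?_ ?_))
  any_goals rw [c4.base.z]; exact hN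
  · rw [H.reg_setNum, g20]; exact E.lt_of_lt_N hr
  rw [c4.base.z, sub_self, H.reg_setNum, g20]
  set h₅ := (h₄.setNum aCur 0 0 0).setReg 20 (r + 1) with hh₅
  have ff1 : Fro 20 [wOra, wCov] [aX, aY, aCol, aDif, aC, aCur] h h₄ :=
    Fro.trans (Fro.trans (Fro.trans ((Fro.of_fr f1).mono (by omega) (by simp) (by simp))
      ((Fro.of_fr f2).mono (by omega) (by simp) (by simp)))
      (f3.mono (by omega) (by simp) (by simp)))
      ((Fro.of_fr f4).mono (by omega) (by simp) (by simp))
  have ff : Fro 20 [wOra, wCov] [aX, aY, aCol, aDif, aC, aCur] h h₅ :=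
    (ff1.setNum (by simp) _ _ _).setReg _ (by omega)
  have cov5 : h₅.arr wCov = h₂.arr wCov := by
    rw [← f3.arr wCov (by decide), ← f4.arr wCov (by decide)]; rfl
  have C5 : h₅.num aC = h₄.num aC := H.num_setNum_ne h₄ aCur aC 0 0 0 (by decide)
  have bdw := hs.call
  refine ⟨?_, ⟨hs.ctx.fro ff (by omega) (by decide) (by decide),
    ⟨by rw [ff.reg _ (by omega), bdw.w], by rw [ff.reg _ (by omega), bdw.w1],
      by rw [ff.reg _ (by omega), bdw.w2], by rw [ff.reg _ (by omega), bdw.n], by simp [hh₅],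
      ?_, ?_⟩, by rw [ff.num _ (by decide), hs.T], by rw [ff.num _ (by decide), hs.G],
      ?_, ?_, ?_⟩, ?_, by simp [hh₅], ?_, ?_, ff⟩
  · rw [cov5]; unfold roundTime
    have e1 : I.n * I.b * (10 * E.W + 100) = I.n * I.b * (10 * E.W + 80) + 20 * (I.n * I.b) := by
      ring
    omega
  · intro q hq
    rw [hh₅, H.reg_setReg, if_neg (by omega), H.reg_setNum, f4.reg _ (by omega), hi3 q hq]
  · intro x hx z
    have : h₅.arr wOra = h₃.arr wOra := f4.arr _ (by decide)
    rw [this]; exact ora3 x (by omega) z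
  · intro x
    rw [cov5, ← dif2 x]
    have : h₅.num aDif = h₂.num aDif := by
      rw [← f3.num aDif (by decide), ← f4.num aDif (by decide)]
      exact H.num_setNum_ne h₄ aCur aDif 0 0 0 (by decide)
    rw [this]
  · rw [C5]
    intro x hx y hy
    rw [C4 x hx y hy]
    exact takeVal_sound hs.sound j x hx y hy
  · rw [C5, cov5]
    intro i hi k hk hcv y hy
    rw [C4 i hi y hy]
    rcases (cov2 i hi k hk).1 hcv with h0 | h0
    · exact (takeVal_le I j _ i y).trans (hs.compl i hi k hk h0 y hy)
    · exact takeVal_le_of_win _ hk h0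
  · simp only [hh₅, H.reg_setReg, H.reg_setNum]
    rw [if_neg (by omega), f4.reg _ (by omega), f3.reg _ (by omega), g21]
  · rw [cov5]
    intro i k hi hk h0
    exact (cov2 i hi k hk).2 (.inl h0)
  · rw [cov5]
    intro i hi k hk h0
    exact (cov2 i hi k hk).2 (.inr (hI.abs_of_rel hi hj hk h0))

/-! ### The sweep over the columns -/

theorem SW.setReg {E : Env} {I : Data} {M T : ℤ} {R r : ℕ} {h : H} (hs : SW E I M T R r h)
    {q : ℕ} (hq : 21 ≤ q) (hq' : q < 100) (v : ℕ) : SW E I M T R r (h.setReg q v) :=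
  ⟨hs.ctx.fr (m := 20) (A := []) (B := []) ((Fr.refl _ _ _ _).setReg _ (by omega) hq') le_rfl
      (by decide) (by decide),
    hs.call.fr (m := 21) (A := []) (B := []) ((Fr.refl _ _ _ _).setReg _ hq hq') le_rfl (by decide),
    hs.T, hs.G, hs.dif, hs.sound, hs.compl⟩

theorem SW.fr {E : Env} {I : Data} {M T : ℤ} {R r : ℕ} {h h' : H} (hs : SW E I M T R r h)
    (hf : Fr 21 [] [aCur, aY] h h') : SW E I M T R r h' :=
  ⟨hs.ctx.fr hf (by omega) (by decide) (by decide), hs.call.fr hf le_rfl (by decide),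
    by rw [hf.num _ (by decide), hs.T], by rw [hf.num _ (by decide), hs.G],
    by rw [hf.num _ (by decide), hf.arr _ (by decide)]; exact hs.dif,
    by rw [hf.num _ (by decide)]; exact hs.sound,
    by rw [hf.num _ (by decide), hf.arr _ (by decide)]; exact hs.compl⟩

/-- Sweeps over the columns; a round takes place when more than `T` uncovered pairs are relevant. -/
def sweep (R : ℕ) (P : Program) : Program :=
  constH 20 0 ;; subH aCur rZ rZ aCur rZ rZ aCur rZ rZ ;;
  forUp 21 rN (addH aCur rZ rZ aCur rZ rZ aDif rZ 21 ;; subH aY rZ rZ aT rZ rZ aCur rZ rZ ;;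
    negH 24 aY rZ rZ ;; condH 24 (round R P) .nop)

/-- After the sweep, at most `T` uncovered pairs are relevant for each column. There are at most
`n b / (T + 1)` rounds, because each of them covers more than `T` new pairs. -/
theorem Tri.sweep {E : Env} {I : Data} {M : ℤ} {T : ℕ} {h : H} {R t₀ : ℕ} {P : Program}
    (bd : Bd E I M) (hct : CTBd I M) (hI : I.Good)
    (hs : SW E I M T R 0 (h.setReg 20 0)) (hR : 4 ≤ R)
    (hT : 64 * (T : ℤ) ≤ 2 ^ (E.W - 1)) (hnbN : I.n * I.b < E.N)
    (hfit : I.n * I.b * (E.W + 1) + I.b * I.n * (E.W + 1) + I.n * I.n * (E.W + 2) < E.N)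
    (hP : OracleOK E I.n I.b (2 * I.d) R t₀ P) :
    Tri E (sweep R P) h fun h' t => ∃ r, t ≤ 8 * I.n + 4 + r * roundTime E I R t₀ +
        I.covCost (pairCost I) (h'.arr wCov) ∧ r * (T + 1) ≤ I.n * I.b ∧
      SW E I M T R r h' ∧ (∀ j < I.n, I.cnt (h'.arr wCov) j ≤ T) ∧
      Fro 20 [wOra, wCov] [aX, aY, aCol, aDif, aC, aCur] h h' := by
  have hN := E.N_pos
  have hnN := bd.nN
  have hbf := bd.fit
  have hd := bd.d0
  have hM := bd.M1
  have hz : h.reg 0 = 0 := by have := hs.ctx.base.z; simpa using this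
  refine .seq (.const (E.lt_of_lt_N (by omega)) (.seq (.sub ?_ ?_ ?_ ?_ ?_ ?_ ?_)))
  any_goals simp only [H.reg_setReg, if_false, OfNat.zero_ne_ofNat, hz, hN]
  set h₀ := (h.setReg 20 0).setNum aCur 0 0 ((h.setReg 20 0).num aCur 0 0 -
    (h.setReg 20 0).num aCur 0 0) with hh₀
  have f0 : Fr 21 [] [aCur, aY] (h.setReg 20 0) h₀ :=
    (Fr.refl _ _ _ _).setNum (by simp) _ _ _
  have s0 := hs.fr f0
  refine Tri.forUp (m := I.n) (fun j h' => ∃ r, SW E I M T R r h' ∧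
      h'.num aCur 0 0 = ∑ x ∈ Finset.range j, I.difSum (h'.arr wCov) x ∧
      (∀ j' < j, I.cnt (h'.arr wCov) j' ≤ T) ∧ r * (T + 1) ≤ I.ncov (h'.arr wCov) ∧
      Fro 20 [wOra, wCov] [aX, aY, aCol, aDif, aC, aCur] h h')
    (fun j h' => 8 * j + 2 + h'.reg 20 * roundTime E I R t₀ +
      I.covCost (pairCost I) (h'.arr wCov)) s0.ctx.n (by decide) (by omega) ?_ ?_ ?_ (by omega) ?_ ?_
  · rintro j h' v ⟨r, h1, h2, h3, h4, h5⟩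
    exact ⟨r, h1.setReg (by omega) (by omega) v, h2, h3, h4, h5.setReg _ (by omega)⟩
  · intro j h' v; simp
  · refine ⟨0, s0, by simp [hh₀], by simp, by simp, ?_⟩
    exact ((Fro.refl _ _ _ _).setReg _ (by omega)).setNum (by simp) _ _ _
  · rintro j hj h' ⟨r, h1, h2, h3, h4, h5⟩ h21 hn
    have hz' := h1.ctx.base.z
    have e1 : h'.num aCur 0 0 + h'.num aDif 0 j = I.cnt (h'.arr wCov) j := by
      rw [h2, h1.dif, ← Data.sum_difSum hI _ hj, Finset.sum_range_succ]
    have hcl := Data.cnt_le (I := I) (h'.arr wCov) j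
    have hcl' : (I.cnt (h'.arr wCov) j : ℤ) ≤ I.n * I.b := by exact_mod_cast hcl
    refine .seq (.add ?_ ?_ ?_ ?_ ?_ ?_ (.seq (.sub ?_ ?_ ?_ ?_ ?_ ?_ (.seq (.neg ?_ ?_ ?_ ?_ ?_
      ?_)))))
    any_goals simp only [H.reg_setNum, hz', h21, e1, H.num_setNum_self, h1.ctx.base.top]
    any_goals omega
    any_goals rw [H.num_setNum_ne _ _ _ _ _ _ (by decide), h1.T]
    · omega
    · omega
    set h₁ := ((h'.setNum aCur 0 0 (I.cnt (h'.arr wCov) j)).setNum aY 0 0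
      ((T : ℤ) - I.cnt (h'.arr wCov) j)).setReg 24
        (if (T : ℤ) - I.cnt (h'.arr wCov) j < 0 then 1 else 0) with hh₁
    have f1 : Fr 21 [] [aCur, aY] h' h₁ :=
      (((Fr.refl _ _ _ _).setNum (by simp) _ _ _).setNum (by simp) _ _ _).setReg _ (by omega)
        (by omega)
    have s1 := h1.fr f1
    have cov1 : h₁.arr wCov = h'.arr wCov := rfl
    have g20 := h1.call.row
    have ff : Fro 20 [wOra, wCov] [aX, aY, aCol, aDif, aC, aCur] h h₁ :=
      h5.trans ((Fro.of_fr f1).mono (by omega) (by simp) (by simp))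
    refine .cond (fun hx => ?_) fun hx => .nop ?_
    · have hlt : T < I.cnt (h'.arr wCov) j := by
        by_contra h0
        simp only [hh₁, H.reg_setReg, if_true] at hx
        rw [if_neg (by omega)] at hx; exact hx rfl
      have hrN : r < E.N := by
        have := Data.ncov_le (I := I) (h'.arr wCov)
        nlinarith
      refine (Tri.round bd hct hI s1 (j := j) (by simp [hh₁, h21]) hj hR hrN hfit hP).mono ?_
      rintro h₂ t ⟨k1, k2, k3, k4, k5, k6, k7⟩
      rw [cov1] at k1 k5
      have hcov := Data.ncov_add_cnt k5 k6
      refine ⟨k3, k2.ctx.n, ⟨r + 1, k2, ?_, ?_, ?_, ff.trans k7⟩, ?_⟩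
      · rw [k4, Data.sum_difSum hI _ hj, Data.cnt_eq_zero k6]; rfl
      · intro j' hj'
        rcases Nat.lt_succ_iff_lt_or_eq.1 hj' with h0 | rfl
        · exact (Data.cnt_anti k5 j').trans (h3 j' h0)
        · rw [Data.cnt_eq_zero k6]; omega
      · rw [add_mul]; omega
      · rw [k2.call.row, g20, add_mul r 1]; omega
    · have hle : I.cnt (h'.arr wCov) j ≤ T := by
        by_contra h0
        simp only [hh₁, H.reg_setReg, if_true] at hx
        rw [if_pos (by omega)] at hx; omega
      refine ⟨by simp [hh₁, h21], by simp [hh₁, hn], ⟨r, s1, ?_, ?_, h4, ff⟩, ?_⟩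
      · rw [cov1, Data.sum_difSum hI _ hj]
        simp only [hh₁, H.num_setReg]
        rw [H.num_setNum_ne _ _ _ _ _ _ (by decide), H.num_setNum_self]
      · intro j' hj'
        rcases Nat.lt_succ_iff_lt_or_eq.1 hj' with h0 | rfl
        · exact h3 j' h0
        · exact hle
      · have : h₁.reg 20 = h'.reg 20 := by simp [hh₁]
        rw [this, cov1]; omega
  · rintro h' t ⟨r, h1, h2, h3, h4, h5⟩ h6
    rw [h1.call.row] at h6
    exact ⟨r, by omega, h4.trans (Data.ncov_le _), h1, h3, h5⟩

/-! ### Counting the relevant triples -/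

/-- Adds up the difference arrays of all pairs. -/
def countPhase : Program := for2 20 rN 21 rB (addPair 20 21)

theorem Tri.countPhase {E : Env} {I : Data} {M : ℤ} {h : H} (bd : Bd E I M) (hct : CTBd I M)
    (hI : I.Good) (hc : CtxR E I h) (hG : h.num aG 0 0 = 1) (hD : ∀ x, h.num aDif 0 x = 0) :
    Tri E countPhase h fun h' t =>
      t ≤ psum I.b (fun _ k => 20 * nst I.d (I.B k) I.n + 8) (I.n * I.b) + 2 ∧
      Fr 20 [] [aX, aDif] h h' ∧ ∀ x, h'.num aDif 0 x = I.difSum (fun _ _ => 0) x := by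
  have hN := E.N_pos
  have hnN := bd.nN
  have hbN := bd.bN
  -- the pairs that have not been treated count as covered
  refine Tri.for2 (R := I.n) (C := I.b) (fun m h' => Fr 20 [] [aX, aDif] h h' ∧
      ∀ x, h'.num aDif 0 x = I.difSum (fun i k => if i < I.n ∧ k < I.b ∧ i * I.b + k < m
        then 0 else 1) x)
    (fun m _ => psum I.b (fun _ k => 20 * nst I.d (I.B k) I.n + 8) m + 2) hc.n hc.b (by decide)
    bd.b1 (by omega) (by omega) ?_ (fun _ _ _ _ _ => rfl) ⟨Fr.refl _ _ _ _, ?_⟩ (by simp) ?_ ?_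
  · rintro m h' q v hq ⟨h1, h2⟩
    exact ⟨h1.setReg _ (by omega) (by omega), h2⟩
  · intro x; rw [hD]; simp [Data.difSum, Data.unc]
  · rintro i hi k hk h₀ ⟨h1, h2⟩ e20 e21 en eb
    have hc' := hc.fr h1 (by omega) (by decide) (by decide)
    refine (Tri.addPair bd hct hI hc' (i := 20) (k := 21) (by omega) (by omega) e20 e21 hi hk).mono ?_
    rintro h' t ⟨g1, g2, g3⟩
    refine ⟨by rw [g2.reg _ (by omega), e20], by rw [g2.reg _ (by omega), e21],
      by rw [g2.reg _ (by omega), en], by rw [g2.reg _ (by omega), eb],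
      ⟨h1.step g2 (by omega) (by simp) (by simp), fun x => ?_⟩, ?_⟩
    · have hG' : h₀.num aG 0 0 = 1 := by rw [h1.num _ (by decide), hG]
      rw [g3, h2, hG', Data.difSum_update (I := I) (i := i) (k := k)
        (cov := fun i' k' => if i' < I.n ∧ k' < I.b ∧ i' * I.b + k' < i * I.b + k + 1 then 0 else 1)
        (cov' := fun i' k' => if i' < I.n ∧ k' < I.b ∧ i' * I.b + k' < i * I.b + k then 0 else 1)
        hi hk (by simp [hi, hk])]
      · ring
      · intro x y
        by_cases hc : x = i ∧ y = k
        · obtain ⟨rfl, rfl⟩ := hc; simp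
        · rw [if_neg hc]
          by_cases hx : x < I.n
          · by_cases hy : y < I.b
            · have := lin_lt_succ (p := i) (x := x) hk hy
              simp only [hx, hy, true_and, this, hc, or_false]
            · simp [hy]
          · simp [hx]
    · rw [psum_succ _ hk]; omega
  · rintro h' t ⟨h1, h2⟩ h3
    refine ⟨h3, h1, fun x => ?_⟩
    rw [h2]
    unfold Data.difSum
    congr 1
    ext ⟨i, k⟩
    simp only [Data.mem_unc]
    constructor
    · rintro ⟨g1, g2⟩; exact ⟨g1, trivial⟩
    · rintro ⟨g1, -⟩
      refine ⟨g1, ?_⟩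
      have := lin_lt g1.1 g1.2
      simp [g1.1, g1.2, this]

/-! ### The remaining pairs -/

/-- Takes the relevant triples of the uncovered pairs into account. -/
def restPhase : Program :=
  for2 20 rN 21 rB (getH 22 wCov 20 21 ;; condH 22 .nop (relaxRel 20 21))

/-- The time that the pair `(i, k)` needs at the end. -/
def restCost (I : Data) (cov : ℕ → ℕ → ℕ) (i k : ℕ) : ℕ :=
  12 + if cov i k = 0 then 20 * nst I.d (I.B k) I.n + 8 * I.nrel i k I.n else 0

theorem Tri.restPhase {E : Env} {I : Data} {M : ℤ} {h : H} (bd : Bd E I M) (hct : CTBd I M)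
    (hI : I.Good) (hc : CtxR E I h) (hsnd : Sound I M (h.num aC))
    (hcov : ∀ i < I.n, ∀ k < I.b, h.arr wCov i k ≠ 0 →
      ∀ j < I.n, h.num aC i j ≤ I.A i k + I.B k j) :
    Tri E restPhase h fun h' t =>
      t ≤ psum I.b (restCost I (h.arr wCov)) (I.n * I.b) + 2 ∧
      Fr 20 [] [aX, aY, aC] h h' ∧
      ∀ i < I.n, ∀ j < I.n, (∀ k < I.b, h'.num aC i j ≤ I.A i k + I.B k j) ∧
        ∃ k < I.b, h'.num aC i j = I.A i k + I.B k j := by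
  have hN := E.N_pos
  have hnN := bd.nN
  have hbN := bd.bN
  have hM := bd.M1
  refine Tri.for2 (R := I.n) (C := I.b) (fun m h' => Fr 20 [] [aX, aY, aC] h h' ∧
      Sound I M (h'.num aC) ∧ (∀ x y, h'.num aC x y ≤ h.num aC x y) ∧
      ∀ i < I.n, ∀ k < I.b, i * I.b + k < m → ∀ y < I.n, h.arr wCov i k = 0 → I.Rel i k y →
        h'.num aC i y ≤ I.A i k + I.B k y)
    (fun m _ => psum I.b (restCost I (h.arr wCov)) m + 2) hc.n hc.b (by decide)
    bd.b1 (by omega) (by omega) ?_ (fun _ _ _ _ _ => rfl)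
    ⟨Fr.refl _ _ _ _, hsnd, fun _ _ => le_rfl, by simp⟩ (by simp) ?_ ?_
  · rintro m h' q v hq ⟨h1, h2⟩
    exact ⟨h1.setReg _ (by omega) (by omega), h2⟩
  · rintro i hi k hk h₀ ⟨h1, h2, h3, h4⟩ e20 e21 en eb
    have hc' := hc.fr h1 (by omega) (by decide) (by decide)
    have ecov : h₀.arr wCov = h.arr wCov := h1.arr _ (by decide)
    rw [psum_succ _ hk]
    refine .seq (.get (by omega) (by omega) ?_)
    rw [e20, e21, ecov]
    set h₁ := h₀.setReg 22 (h.arr wCov i k) with hh₁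
    have f1 : Fr 20 [] [aX, aY, aC] h h₁ := h1.setReg _ (by omega) (by omega)
    refine .cond (fun hx => .nop ?_) fun hx => ?_
    · have hx' : h.arr wCov i k ≠ 0 := by simpa [hh₁] using hx
      refine ⟨by simp [hh₁, e20], by simp [hh₁, e21], by simp [hh₁, en], by simp [hh₁, eb],
        ⟨f1, h2, h3, fun i' hi' k' hk' hlin => ?_⟩, ?_⟩
      · rcases (lin_lt_succ hk hk').1 hlin with h0 | ⟨rfl, rfl⟩
        · exact h4 i' hi' k' hk' h0
        · intro y _ h0; exact absurd h0 hx'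
      · unfold restCost; omega
    · have hx' : h.arr wCov i k = 0 := by simpa [hh₁] using hx
      have hcb : CBd I M h₁ := fun x hx y hy => Sound.bd bd h2 hx hy
      refine (Tri.relaxRel bd hct hI hcb (hc.fr f1 (by omega) (by decide) (by decide)) (i := 20)
        (k := 21) (by omega) (by omega) (by simp [hh₁, e20]) (by simp [hh₁, e21]) hi hk).mono ?_
      rintro h₂ t ⟨g1, g2, g3⟩
      have hle : ∀ x y, h₂.num aC x y ≤ h₀.num aC x y := by
        intro x y
        by_cases hc : x = i ∧ (y < I.n ∧ I.Rel i k y)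
        · rw [(g3 x y).1 hc]; exact min_le_left _ _
        · rw [(g3 x y).2 hc]; exact le_rfl
      refine ⟨by rw [g2.reg _ (by omega)]; simp [hh₁, e20],
        by rw [g2.reg _ (by omega)]; simp [hh₁, e21], by rw [g2.reg _ (by omega)]; simp [hh₁, en],
        by rw [g2.reg _ (by omega)]; simp [hh₁, eb],
        ⟨f1.step g2 (by omega) (by simp) (by simp), ?_, fun x y => (hle x y).trans (h3 x y), ?_⟩, ?_⟩
      · intro x hx y hy
        by_cases hc : x = i ∧ (y < I.n ∧ I.Rel i k y)
        · rw [(g3 x y).1 hc]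
          rcases min_choice (h₁.num aC x y) (I.A i k + I.B k y) with h0 | h0 <;> rw [h0]
          · exact h2 x hx y hy
          · rw [hc.1]; exact .inr ⟨k, hk, rfl⟩
        · rw [(g3 x y).2 hc]; exact h2 x hx y hy
      · intro i' hi' k' hk' hlin y hy h0 hr
        rcases (lin_lt_succ hk hk').1 hlin with h5 | ⟨rfl, rfl⟩
        · exact (hle _ _).trans (h4 i' hi' k' hk' h5 y hy h0 hr)
        · rw [(g3 i' y).1 ⟨rfl, hy, hr⟩]; exact min_le_right _ _
      · unfold restCost; rw [if_pos hx']; omega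
  · rintro h' t ⟨h1, h2, h3, h4⟩ h5
    refine ⟨h5, h1, fun i hi j hj => ?_⟩
    obtain ⟨k, hk, hmin⟩ := Finset.exists_min_image (Finset.range I.b) (fun k => I.A i k + I.B k j)
      ⟨0, Finset.mem_range.2 bd.b1⟩
    rw [Finset.mem_range] at hk
    have hmin' : ∀ k' < I.b, I.A i k + I.B k j ≤ I.A i k' + I.B k' j := fun k' hk' =>
      hmin k' (Finset.mem_range.2 hk')
    have key : h'.num aC i j ≤ I.A i k + I.B k j := by
      by_cases hcv : h.arr wCov i k = 0
      · exact h4 i hi k hk (lin_lt hi hk) j hj hcv (hI.rel_of_min hi hj hk hmin')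
      · exact (h3 i j).trans (hcov i hi k hk hcv j hj)
    refine ⟨fun k' hk' => key.trans (hmin' k' hk'), ?_⟩
    rcases h2 i hi j hj with h0 | h0
    · have b1 := abs_le.1 (bd.A i hi k hk)
      have b2 := abs_le.1 (bd.B k hk j hj)
      linarith
    · exact h0

/-! ### The algorithm on integer matrices -/

/-- Fills the current product and the approximate product with a large number. -/
def fillPhase : Program :=
  for2 20 rN 21 14 (addH aC 20 21 31 rZ rZ aBig rZ rZ ;; addH aCT 20 21 31 rZ rZ aBig rZ rZ)

theorem Tri.fillPhase {E : Env} {I : Data} {M : ℤ} {h : H} (bd : Bd E I M) (hc : Ctx E I h)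
    (h14 : h.reg 14 = I.n) (hbig : h.num aBig 0 0 = 4 * M) :
    Tri E fillPhase h fun h' t => t ≤ 8 * (I.n * I.n) + 2 ∧ Fr 20 [] [aC, aCT] h h' ∧
      ∀ x < I.n, ∀ y < I.n, h'.num aC x y = 4 * M ∧ h'.num aCT x y = 4 * M := by
  have hN := E.N_pos
  have hnN := bd.nN
  refine Tri.for2 (R := I.n) (C := I.n) (fun m h' => Fr 20 [] [aC, aCT] h h' ∧
      ∀ x < I.n, ∀ y < I.n, x * I.n + y < m → h'.num aC x y = 4 * M ∧ h'.num aCT x y = 4 * M)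
    (fun m _ => 8 * m + 2) hc.n h14 (by decide) bd.n1 (by omega) (by omega) ?_
    (fun _ _ _ _ _ => rfl) ⟨Fr.refl _ _ _ _, by simp⟩ (by simp) ?_ ?_
  · rintro m h' q v hq ⟨h1, h2⟩
    exact ⟨h1.setReg _ (by omega) (by omega), h2⟩
  · rintro x hx y hy h' ⟨h1, h2⟩ e20 e21 en e14
    have hc' := hc.fr h1 (by omega) (by decide)
    have gz := hc'.base.z
    have g31 := hc'.base.n0
    have gbig : h'.num aBig 0 0 = 4 * M := by rw [h1.num _ (by decide), hbig]
    refine .seq (.add ?_ ?_ ?_ ?_ ?_ ?_ (.add ?_ ?_ ?_ ?_ ?_ ?_ ?_))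
    any_goals simp only [H.reg_setNum, gz, e20, e21]
    any_goals omega
    refine ⟨trivial, trivial, en, e14, ⟨(h1.setNum (by simp) _ _ _).setNum (by simp) _ _ _, ?_⟩, by omega⟩
    intro x' hx' y' hy' hlin
    simp only [H.num_setNum, Fin.reduceEq, false_and, if_false, true_and, g31, gbig, zero_add]
    rcases (lin_lt_succ hy hy').1 hlin with h0 | ⟨rfl, rfl⟩
    · have := h2 x' hx' y' hy' h0
      split_ifs
      · exact ⟨rfl, rfl⟩
      · exact this
    · simp
  · rintro h' t ⟨h1, h2⟩ h3
    exact ⟨h3, h1, fun x hx y hy => h2 x hx y hy (lin_lt hx hy)⟩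

/-- The approximate product of the algorithm has the required properties. -/
theorem good_of_phases {E : Env} {I : Data} {M : ℤ} (bd : Bd E I M)
    (hmono : ∀ k < I.b, ∀ j j', j ≤ j' → j' < I.n → I.B k j ≤ I.B k j')
    {CT₀ CT : ℕ → ℕ → ℤ} {cst : ℕ → ℕ → ℕ} (h₀ : CTInv I M (fun _ _ _ => True) CT₀)
    (hs : ∀ x < I.n, ∀ y < I.n, SufMin I.n (CT₀ x) (CT x) y)
    (hcst : ∀ x < I.n, ∀ e < I.n, ∀ y ≤ e, cst x e ≤ y ↔ CT x e - I.d ≤ CT x y) :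
    ({ I with CT := CT, cst := cst } : Data).Good where
  dnn := bd.d0
  mono := hmono
  ctMono i hi j j' hjj hj' := by
    obtain ⟨-, z, h1, h2, h3⟩ := hs i hi j' hj'
    show CT i j ≤ CT i j'
    rw [h3]; exact (hs i hi j (lt_of_le_of_lt hjj hj')).1 z (by omega) h2
  ctLe i hi k hk j hj := by
    refine ((hs i hi j hj).1 (I.se k j) (Data.le_se hj) (Data.se_lt hj)).trans ?_
    exact h₀.2 i hi k hk j hj trivial
  ctEx i hi j hj := by
    obtain ⟨h4, z, h1, h2, h3⟩ := hs i hi j hj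
    rcases h₀.1 i hi z h2 with h5 | ⟨k, hk, h5⟩
    · exfalso
      have h6 := (h4 _ (Data.le_se (k := 0) hj) (Data.se_lt hj)).trans (h₀.2 i hi 0 bd.b1 j hj trivial)
      have b1 := abs_le.1 (bd.A i hi 0 bd.b1)
      have b2 := abs_le.1 (bd.B 0 bd.b1 _ (lt_of_le_of_lt (Data.ss_le (I := I) 0 j) hj))
      have := bd.M1
      linarith
    · refine ⟨k, hk, ?_⟩
      show I.A i k + I.B k (I.ss k j) ≤ CT i j
      rw [h3, h5]
      have := hmono k hk _ _ (sst_mono (d := I.d) (f := I.B k) h1)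
        (lt_of_le_of_lt (Data.ss_le (I := I) k z) h2)
      unfold Data.ss; linarith
  cst := hcst

/-- The main algorithm on integer matrices: it computes the approximate product, counts the relevant
pairs of each column, sweeps over the columns, and enumerates the remaining relevant triples. -/
def core (R : ℕ) (P : Program) : Program :=
  fillPhase ;; segPhase ;; ctPhase ;; sufPhase ;; cstPhase ;;
    addH aG rZ rZ 31 rZ rZ 16 rZ rZ ;; countPhase ;; subH aG rZ rZ 31 rZ rZ 16 rZ rZ ;;
    sweep R P ;; restPhase

/-- The state in which the main algorithm starts. -/
structure CoreCtx (E : Env) (I : Data) (M : ℤ) (T R : ℕ) (h : H) : Prop where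
  ctx : Ctx E I h
  w : h.reg rW = E.W
  w1 : h.reg 12 = E.W + 1
  w2 : h.reg 13 = E.W + 2
  n : h.reg 14 = I.n
  hi : ∀ q, 100 + R ≤ q → h.reg q = 0
  ora : ∀ x z, h.arr wOra x z = 0
  cov : ∀ x z, h.arr wCov x z = 0
  dif : ∀ x, h.num aDif 0 x = 0
  T : h.num aT 0 0 = T
  big : h.num aBig 0 0 = 4 * M

/-- The number of segments of all rows of `B`. -/
def nseg (I : Data) : ℕ := ∑ k ∈ Finset.range I.b, nst I.d (I.B k) I.n

theorem psum_nst (I : Data) (c e : ℕ) :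
    psum I.b (fun _ k => c * nst I.d (I.B k) I.n + e) (I.n * I.b) =
      c * (I.n * nseg I) + e * (I.n * I.b) := by
  rw [psum_mul]
  simp only [Finset.sum_const, Finset.card_range, smul_eq_mul, Finset.sum_add_distrib]
  rw [← Finset.mul_sum]
  unfold nseg
  ring

/-- The time for the remaining pairs: in each column, at most `T` of them are relevant. -/
theorem psum_restCost (I : Data) (cov : ℕ → ℕ → ℕ) {T : ℕ} (hT : ∀ j < I.n, I.cnt cov j ≤ T) :
    psum I.b (restCost I cov) (I.n * I.b) ≤
      12 * (I.n * I.b) + 20 * (I.n * nseg I) + 8 * (I.n * T) := by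
  rw [psum_mul]
  have h1 : ∑ p ∈ Finset.range I.n, ∑ q ∈ Finset.range I.b, restCost I cov p q =
      12 * (I.n * I.b) + ∑ p ∈ I.unc cov, (20 * nst I.d (I.B p.2) I.n + 8 * I.nrel p.1 p.2 I.n) := by
    unfold Data.unc
    rw [Finset.sum_filter, Finset.sum_product]
    unfold restCost
    simp only [Finset.sum_add_distrib, Finset.sum_const, Finset.card_range, smul_eq_mul]
    ring
  rw [h1, Finset.sum_add_distrib, ← Finset.mul_sum, ← Finset.mul_sum, Data.sum_nrel]
  have h2 : ∑ p ∈ I.unc cov, nst I.d (I.B p.2) I.n ≤ I.n * nseg I := by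
    unfold Data.unc
    refine (Finset.sum_le_sum_of_subset (Finset.filter_subset _ _)).trans ?_
    rw [Finset.sum_product]; simp [nseg]
  have h3 : ∑ j ∈ Finset.range I.n, I.cnt cov j ≤ I.n * T := by
    refine (Finset.sum_le_card_nsmul _ _ T fun j hj => hT j (Finset.mem_range.1 hj)).trans ?_
    simp
  omega

/-- The main algorithm computes the product. The time is expressed by the number `nseg I` of
segments, the threshold `T`, the number `r ≤ n b / (T + 1)` of rounds and the time `t₀` of a call.
-/
theorem Tri.core {E : Env} {I : Data} {M : ℤ} {T : ℕ} {h : H} {R t₀ : ℕ} {P : Program}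
    (bd : Bd E I M) (hs : CoreCtx E I M T R h) (hR : 4 ≤ R)
    (hmono : ∀ k < I.b, ∀ j j', j ≤ j' → j' < I.n → I.B k j ≤ I.B k j')
    (hT : 64 * (T : ℤ) ≤ 2 ^ (E.W - 1)) (hnbN : I.n * I.b < E.N)
    (hfit : I.n * I.b * (E.W + 1) + I.b * I.n * (E.W + 1) + I.n * I.n * (E.W + 2) < E.N)
    (hP : OracleOK E I.n I.b (2 * I.d) R t₀ P) :
    Tri E (core R P) h fun h' t =>
      (∃ r, t ≤ 100 * (I.n * nseg I) + 100 * (I.n * I.b) + 100 * (I.n * I.n) + 8 * (I.n * T) +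
        r * roundTime E I R t₀ ∧ r * (T + 1) ≤ I.n * I.b) ∧
      Fro 20 [wSeg, wCst, wCov, wOra] [aX, aY, aC, aCT, aCol, aDif, aCur, aG] h h' ∧
      ∀ i < I.n, ∀ j < I.n, (∀ k < I.b, h'.num aC i j ≤ I.A i k + I.B k j) ∧
        ∃ k < I.b, h'.num aC i j = I.A i k + I.B k j := by
  have hN := E.N_pos
  have hM := bd.M1
  refine .seq_of (Tri.fillPhase bd hs.ctx hs.n hs.big) ?_
  rintro h₁ t₁ ⟨ht1, f1, v1⟩
  have c1 := hs.ctx.fr f1 le_rfl (by decide)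
  refine .seq_of (Tri.segPhase bd c1) ?_
  rintro h₂ t₂ ⟨ht2, f2, c2⟩
  refine .seq_of (Tri.ctPhase bd c2 (by
    intro x hx y hy; rw [f2.num _ (by decide)]; exact (v1 x hx y hy).2)) ?_
  rintro h₃ t₃ ⟨ht3, f3, ct3⟩
  have c3 := c2.fr f3 le_rfl (by decide) (by decide)
  refine .seq_of (Tri.sufPhase bd c3.toCtx fun x hx y hy => ct3.bd bd hx hy) ?_
  rintro h₄ t₄ ⟨ht4, f4, suf4⟩
  have c4 := c3.fr f4 le_rfl (by decide) (by decide)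
  have b4 : ∀ x < I.n, ∀ y < I.n, |h₄.num aCT x y| ≤ 4 * M := by
    intro x hx y hy
    obtain ⟨-, z, -, h1, h2⟩ := suf4 x hx y hy
    rw [h2]; exact ct3.bd bd hx h1
  have m4 : ∀ x < I.n, ∀ y y', y ≤ y' → y' < I.n → h₄.num aCT x y ≤ h₄.num aCT x y' := by
    intro x hx y y' hy hy'
    obtain ⟨-, z, h1, h2, h3⟩ := suf4 x hx y' hy'
    rw [h3]; exact (suf4 x hx y (by omega)).1 z (by omega) h2
  refine .seq_of (Tri.cstPhase bd c4.toCtx b4 m4) ?_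
  rintro h₅ t₅ ⟨ht5, f5, cst5⟩
  have c5 := c4.fr f5 le_rfl (by decide) (by decide)
  have hI := good_of_phases bd hmono ct3 suf4 cst5
  set I' : Data := { I with CT := h₄.num aCT, cst := h₅.arr wCst } with hI'
  have bd' : Bd E I' M := ⟨bd.n1, bd.b1, bd.nN, bd.bN, bd.d0, bd.M1, bd.fit, bd.A, bd.B⟩
  have c5' : CtxR E I' h₅ := ⟨⟨⟨c5.base, c5.n, c5.b, c5.A, c5.B, c5.d⟩, c5.seg⟩,
    f5.num _ (by decide), rfl⟩
  have hct : CTBd I' M := fun x hx y hy => (b4 x hx y hy).trans (by linarith)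
  refine .seq (.add ?_ ?_ ?_ ?_ ?_ ?_ ?_)
  any_goals rw [c5.base.z]; exact hN
  rw [c5.base.z, c5.base.n0, c5.base.n1, zero_add]
  have F5 : Fr 20 [wSeg, wCst] [aX, aY, aC, aCT] h h₅ :=
    Fr.trans (Fr.trans (Fr.trans (Fr.trans (f1.mono le_rfl (by simp) (by simp))
      (f2.mono le_rfl (by simp) (by simp))) (f3.mono le_rfl (by simp) (by simp)))
      (f4.mono le_rfl (by simp) (by simp))) (f5.mono le_rfl (by simp) (by simp))
  set h₆ := h₅.setNum aG 0 0 1 with hh₆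
  have f6 : Fr 20 [] [aG] h₅ h₆ := (Fr.refl _ _ _ _).setNum (by simp) _ _ _
  have c6 := c5'.fr f6 le_rfl (by decide) (by decide)
  refine .seq_of (Tri.countPhase bd' hct hI c6 (by simp [hh₆]) fun x => ?_) ?_
  · rw [f6.num _ (by decide), F5.num _ (by decide)]; exact hs.dif x
  rintro h₇ t₇ ⟨ht7, f7, dif7⟩
  have c7 := c6.fr f7 le_rfl (by decide) (by decide)
  refine .seq (.sub ?_ ?_ ?_ ?_ ?_ ?_ ?_)
  any_goals rw [c7.base.z]; exact hN
  rw [c7.base.z, c7.base.n0, c7.base.n1, zero_sub]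
  set h₈ := h₇.setNum aG 0 0 (-1) with hh₈
  have f8 : Fr 20 [] [aG] h₇ h₈ := (Fr.refl _ _ _ _).setNum (by simp) _ _ _
  have F8 : Fr 20 [wSeg, wCst] [aX, aY, aC, aCT, aDif, aG] h h₈ :=
    Fr.trans (Fr.trans (Fr.trans (F5.mono le_rfl (by simp) (by simp))
      (f6.mono le_rfl (by simp) (by simp))) (f7.mono le_rfl (by simp) (by simp)))
      (f8.mono le_rfl (by simp) (by simp))
  have c8 := c7.fr f8 le_rfl (by decide) (by decide)
  have C8 : ∀ x < I.n, ∀ y < I.n, h₈.num aC x y = 4 * M := by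
    intro x hx y hy
    rw [f8.num _ (by decide), f7.num _ (by decide), f6.num _ (by decide), f5.num _ (by decide),
      f4.num _ (by decide), f3.num _ (by decide), f2.num _ (by decide)]
    exact (v1 x hx y hy).1
  have cov8 : h₈.arr wCov = fun _ _ => 0 := by
    funext x z; rw [F8.arr _ (by decide)]; exact hs.cov x z
  have s8 : SW E I' M T R 0 (h₈.setReg 20 0) := by
    have f9 : Fr 20 [] [] h₈ (h₈.setReg 20 0) := (Fr.refl _ _ _ _).setReg _ (by omega) (by omega)
    refine ⟨c8.fr f9 le_rfl (by decide) (by decide), ⟨?_, ?_, ?_, ?_, by simp, ?_, ?_⟩, ?_, ?_, ?_,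
      ?_, ?_⟩
    · simp [F8.reg, hs.w]
    · simp [F8.reg, hs.w1]
    · simp [F8.reg, hs.w2]
    · simp [F8.reg, hs.n]; rfl
    · intro q hq; simp only [H.reg_setReg]; rw [if_neg (by omega), F8.reg _ (by omega), hs.hi q hq]
    · intro x _ z; rw [H.arr_setReg, F8.arr _ (by decide)]; exact hs.ora x z
    · rw [H.num_setReg, F8.num _ (by decide), hs.T]
    · simp [hh₈]
    · intro x; rw [H.num_setReg, H.arr_setReg, cov8, ← dif7 x, f8.num _ (by decide)]
    · intro x hx y hy; exact .inl (C8 x hx y hy)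
    · intro i _ k _ h0; rw [H.arr_setReg, cov8] at h0; exact absurd rfl h0
  refine .seq_of (Tri.sweep bd' hct hI s8 hR hT hnbN hfit hP) ?_
  rintro h₉ t₉ ⟨r, ht9, hr, s9, cnt9, f9⟩
  refine (Tri.restPhase bd' hct hI s9.ctx s9.sound s9.compl).mono ?_
  rintro h' t' ⟨ht', f', res⟩
  refine ⟨⟨r, ?_, hr⟩, ?_, res⟩
  · have e1 := psum_nst I 20 8
    have e2 := psum_restCost I' (h₉.arr wCov) cnt9
    have e3 : I'.covCost (pairCost I') (h₉.arr wCov) ≤ 20 * (I.n * nseg I) + 10 * (I.n * I.b) := by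
      refine (Data.covCost_le _ _).trans (le_of_eq ?_)
      unfold pairCost nseg
      rw [Finset.sum_add_distrib, ← Finset.mul_sum]
      simp only [Finset.sum_const, Finset.card_range, smul_eq_mul, hI']
      ring
    have e4 : nseg I' = nseg I := rfl
    have e5 : roundTime E I' R t₀ = roundTime E I R t₀ := rfl
    have e6 : psum I'.b (fun _ k => 20 * nst I'.d (I'.B k) I'.n + 8) (I'.n * I'.b) =
      20 * (I.n * nseg I) + 8 * (I.n * I.b) := e1
    have n1 := bd.n1
    have b1 := bd.b1
    have m1 : I.n ≤ I.n * I.n := Nat.le_mul_of_pos_left _ n1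
    have m2 : I.b ≤ I.n * I.b := Nat.le_mul_of_pos_left _ n1
    have a1 : I.b * (9 * I.n + 5) = 9 * (I.n * I.b) + 5 * I.b := by ring
    have a2 : I.n * (9 * I.n + 4) = 9 * (I.n * I.n) + 4 * I.n := by ring
    have a3 : I.n * (14 * I.n + 5) = 14 * (I.n * I.n) + 5 * I.n := by ring
    have hn' : I'.n = I.n := rfl
    have hb' : I'.b = I.b := rfl
    rw [e6] at ht7
    rw [e1] at ht3
    rw [e5] at ht9
    rw [e4] at e2
    rw [hn', hb'] at *
    omega
  · refine Fro.trans (Fro.trans ((Fro.of_fr F8).mono le_rfl (by simp) (by simp))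
      (f9.mono le_rfl (by simp) (by simp))) ((Fro.of_fr f').mono le_rfl (by simp) (by simp))

/-! ### Encodings of matrices -/

/-- The extension of a matrix to all pairs of natural numbers. -/
def ext {r c : ℕ} (X : Matrix (Fin r) (Fin c) (WithTop ℤ)) (i j : ℕ) : WithTop ℤ :=
  if h : i < r ∧ j < c then X ⟨i, h.1⟩ ⟨j, h.2⟩ else ⊤

theorem ext_fin {r c : ℕ} (X : Matrix (Fin r) (Fin c) (WithTop ℤ)) (i : Fin r) (j : Fin c) :
    ext X i j = X i j := by simp [ext]

theorem flatten_ofFn {α : Type*} (r m : ℕ) (f : ℕ → ℕ → α) :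
    (List.ofFn fun i : Fin r => (List.range m).map (f i)).flatten =
      (List.range (r * m)).map fun z => f (z / m) (z % m) := by
  induction r with
  | zero => simp
  | succ r ih =>
    rw [List.ofFn_succ_last, List.flatten_append, add_mul, one_mul, List.range_add, List.map_append]
    simp only [Fin.val_castSucc, ih, Fin.val_last, List.flatten_cons, List.flatten_nil,
      List.append_nil, List.map_map]
    congr 1
    refine List.map_congr_left fun z hz => ?_
    have hz' := List.mem_range.1 hz
    simp only [Function.comp]
    rw [add_comm, Nat.add_mul_div_right _ _ (by omega), Nat.div_eq_of_lt hz', zero_add,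
      Nat.add_mul_mod_self_right, Nat.mod_eq_of_lt hz']

theorem encodeEntry_eq (b : ℕ) (e : WithTop ℤ) :
    encodeEntry b e = (List.range (b + 1)).map (entryCell e) := by
  rw [List.range_succ_eq_map, List.map_cons, List.map_map]
  cases e with
  | top =>
    refine List.cons_eq_cons.2 ⟨by simp [entryCell], ?_⟩
    have : (entryCell ⊤ ∘ Nat.succ) = fun _ => 0 := by
      funext t; simp [entryCell, bit_zero']
    rw [this, List.map_const', List.length_range]
  | coe x =>
    refine List.cons_eq_cons.2 ⟨by simp [entryCell], ?_⟩
    refine List.map_congr_left fun t _ => ?_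
    simp [entryCell, bit]

theorem encodeMatrix_eq {r c : ℕ} (b : ℕ) (X : Matrix (Fin r) (Fin c) (WithTop ℤ)) :
    encodeMatrix b X = (List.range (r * c * (b + 1))).map (encCell b c (ext X)) := by
  unfold encodeMatrix
  have h1 : ∀ i : Fin r, (List.ofFn fun j => encodeEntry b (X i j)).flatten =
      (List.range (c * (b + 1))).map fun z => entryCell (ext X i (z / (b + 1))) (z % (b + 1)) := by
    intro i
    rw [← flatten_ofFn c (b + 1) fun j t => entryCell (ext X i j) t]
    congr 2
    funext j
    rw [encodeEntry_eq, ext_fin]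
  simp only [h1]
  rw [flatten_ofFn r (c * (b + 1)) fun i z => entryCell (ext X i (z / (b + 1))) (z % (b + 1)),
    mul_assoc]
  refine List.map_congr_left fun z _ => ?_
  unfold encCell
  rw [Nat.div_div_eq_div_mul, Nat.mul_comm c (b + 1), Nat.mod_mul_right_mod,
    Nat.mod_mul_right_div_self]

theorem length_encodeMatrix {r c : ℕ} (b : ℕ) (X : Matrix (Fin r) (Fin c) (WithTop ℤ)) :
    (encodeMatrix b X).length = r * c * (b + 1) := by
  rw [encodeMatrix_eq]; simp

theorem length_inputWords {n b c l : ℕ} (A : Matrix (Fin n) (Fin b) (WithTop ℤ))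
    (B : Matrix (Fin b) (Fin c) (WithTop ℤ)) :
    (inputWords l A B).length = n * b * (l + 2) + b * c * (l + 2) := by
  unfold inputWords
  rw [List.length_append, length_encodeMatrix, length_encodeMatrix]

theorem inputWords_getD {n b l : ℕ} (A : Matrix (Fin n) (Fin b) (WithTop ℤ))
    (B : Matrix (Fin b) (Fin n) (WithTop ℤ)) (z : ℕ) :
    (inputWords l A B).getD z 0 = inCell n b (l + 1) (ext A) (ext B) z := by
  unfold inputWords inCell
  rw [encodeMatrix_eq, encodeMatrix_eq]
  by_cases h1 : z < n * b * (l + 1 + 1)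
  · rw [if_pos h1, List.getD_append _ _ _ _ (by simpa using h1), List.getD_eq_getElem _ _ (by simpa using h1)]
    simp
  · rw [if_neg h1, List.getD_append_right _ _ _ _ (by simpa using h1)]
    by_cases h2 : z < n * b * (l + 1 + 1) + b * n * (l + 1 + 1)
    · rw [if_pos h2, List.getD_eq_getElem _ _ (by simp; omega)]
      simp
    · rw [if_neg h2, List.getD_eq_default]
      simp; omega

theorem ext_minPlus {n b c : ℕ} (A : Matrix (Fin n) (Fin b) (WithTop ℤ))
    (B : Matrix (Fin b) (Fin c) (WithTop ℤ)) {i j : ℕ} (hi : i < n) (hj : j < c) :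
    ext (minPlus A B) i j = mpF b (ext A) (ext B) i j := by
  rw [ext, dif_pos ⟨hi, hj⟩, minPlus, mpF]
  refine le_antisymm (Finset.le_inf fun k hk => ?_) (Finset.le_inf fun k _ => ?_)
  · have hk' := Finset.mem_range.1 hk
    refine (Finset.inf_le (Finset.mem_univ (⟨k, hk'⟩ : Fin b))).trans (le_of_eq ?_)
    simp [ext, hi, hj, hk']
  · refine (Finset.inf_le (Finset.mem_range.2 k.2)).trans (le_of_eq ?_)
    simp [ext, hi, hj]

/-- The encoding depends on the entries inside the matrix only. -/
theorem encCell_congr {nb r c : ℕ} {f f' : ℕ → ℕ → WithTop ℤ}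
    (h : ∀ i < r, ∀ j < c, f i j = f' i j) {z : ℕ} (hz : z < r * c * (nb + 1)) :
    encCell nb c f z = encCell nb c f' z := by
  unfold encCell
  have h1 : z / (nb + 1) < r * c := Nat.div_lt_of_lt_mul (by rw [mul_comm]; exact hz)
  have hc : 0 < c := by
    rcases Nat.eq_zero_or_pos c with rfl | hc
    · simp at h1
    · exact hc
  rw [h _ (Nat.div_lt_of_lt_mul (by rw [mul_comm]; exact h1)) _ (Nat.mod_lt _ hc)]

theorem inCell_congr {n b nb : ℕ} {A A' B B' : ℕ → ℕ → WithTop ℤ}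
    (hA : ∀ i < n, ∀ k < b, A i k = A' i k) (hB : ∀ k < b, ∀ j < n, B k j = B' k j) (z : ℕ) :
    inCell n b nb A B z = inCell n b nb A' B' z := by
  unfold inCell
  split_ifs with h1 h2
  · exact encCell_congr hA h1
  · exact encCell_congr hB (by omega)
  · rfl

/-! ### Simulating a program on the abstract machine -/

/-- The program with its registers shifted by `100` and its memory in the row `reg 20` of `wOra`. -/
def sim : Program → Program
  | .nop => .nop
  | .const r v => constH (100 + r) v
  | .op o r x y => opH o (100 + r) (100 + x) (100 + y)
  | .load r x => getH (100 + r) wOra 20 (100 + x)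
  | .store x y => putH wOra 20 (100 + x) (100 + y)
  | .seq p q => .seq (sim p) (sim q)
  | .cond x p q => condH (100 + x) (sim p) (sim q)
  | .loop x p => .loop (100 + x + 14) (sim p)

/-- A number that exceeds the numbers of all registers that a program writes. -/
def regBound : Program → ℕ
  | .nop => 0
  | .const r _ => r + 1
  | .op _ r _ _ => r + 1
  | .load r _ => r + 1
  | .store _ _ => 0
  | .seq p q => max (regBound p) (regBound q)
  | .cond _ p q => max (regBound p) (regBound q)
  | .loop _ p => regBound p

/-- The registers from `100` on and the row `row` of `wOra` hold the state `s`. -/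
def Agree (N row : ℕ) (s : State) (h : H) : Prop :=
  h.reg 20 = row ∧ (∀ r, h.reg (100 + r) = s.reg r) ∧ ∀ z < N, h.arr wOra row z = s.mem z

/-- What a simulated program leaves unchanged. -/
structure SimFr (R row : ℕ) (h h' : H) : Prop where
  fro : Fro 100 [wOra] [] h h'
  hi : ∀ r, R ≤ r → h'.reg (100 + r) = h.reg (100 + r)
  row : ∀ x, x ≠ row → h'.arr wOra x = h.arr wOra x

theorem SimFr.refl (R row : ℕ) (h : H) : SimFr R row h h :=
  ⟨Fro.refl _ _ _ _, fun _ _ => rfl, fun _ _ => rfl⟩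

theorem SimFr.trans {R R' R'' row : ℕ} {h h' h'' : H} (h1 : SimFr R row h h')
    (h2 : SimFr R' row h' h'') (hR : R ≤ R'') (hR' : R' ≤ R'') : SimFr R'' row h h'' :=
  ⟨h1.fro.trans h2.fro, fun r hr => (h2.hi r (by omega)).trans (h1.hi r (by omega)),
    fun x hx => (h2.row x hx).trans (h1.row x hx)⟩

theorem SimFr.setReg {r v row : ℕ} {h : H} : SimFr (r + 1) row h (h.setReg (100 + r) v) :=
  ⟨(Fro.refl _ _ _ _).setReg _ (by omega), fun q hq => by rw [H.reg_setReg, if_neg (by omega)],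
    fun _ _ => rfl⟩

theorem Agree.setReg {N row : ℕ} {s : State} {h : H} (ha : Agree N row s h) (r v : ℕ) :
    Agree N row (s.setReg r v) (h.setReg (100 + r) v) := by
  refine ⟨?_, fun q => ?_, ha.2.2⟩
  · rw [H.reg_setReg, if_neg (by omega), ha.1]
  · rw [H.reg_setReg, State.reg_setReg, ha.2.1]
    exact if_congr (by omega) rfl rfl

theorem State.Fits.setReg {w : ℕ} {s : State} (hs : s.Fits w) (r : ℕ) {v : ℕ} (hv : v < 2 ^ w) :
    (s.setReg r v).Fits w := by
  refine ⟨fun q => ?_, hs.2⟩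
  rw [State.reg_setReg]
  split_ifs
  · exact hv
  · exact hs.1 q

theorem Tri.sim {E : Env} {w row : ℕ} (hw : 2 ^ w ≤ E.N) (hrow : row < E.N) {P : Program}
    {s s' : State} {t : ℕ} (he : Exec w P s t s') :
    ∀ h, s.Fits w → Agree E.N row s h → Tri E (sim P) h fun h' k => k ≤ t ∧ s'.Fits w ∧
      Agree E.N row s' h' ∧ SimFr (regBound P) row h h' := by
  have hlt := E.lt_of_lt_N (le_refl E.N)
  induction he with
  | nop s => exact fun h hs ha => .nop ⟨le_rfl, hs, ha, .refl _ _ _⟩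
  | const s r v hv =>
    exact fun h hs ha => .const (by omega) ⟨le_rfl, hs.setReg r hv, ha.setReg r v, .setReg⟩
  | op s o r x y hv =>
    intro h hs ha
    refine .op ?_ ?_
    · rw [ha.2.1, ha.2.1]; omega
    · rw [ha.2.1, ha.2.1]
      exact ⟨le_rfl, hs.setReg r hv, ha.setReg r _, .setReg⟩
  | load s r x =>
    intro h hs ha
    have hx := hs.1 x
    refine .get (by rw [ha.1]; exact hrow) (by rw [ha.2.1]; omega) ?_
    rw [ha.1, ha.2.1, ha.2.2 _ (by omega)]
    exact ⟨le_rfl, hs.setReg r (hs.2 _), ha.setReg r _, .setReg⟩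
  | store s x y =>
    intro h hs ha
    have hx := hs.1 x
    refine .put (by rw [ha.1]; exact hrow) (by rw [ha.2.1]; omega) ?_
    rw [ha.1, ha.2.1, ha.2.1]
    refine ⟨le_rfl, ⟨hs.1, fun z => ?_⟩, ⟨ha.1, ha.2.1, fun z hz => ?_⟩,
      (Fro.refl _ _ _ _).setArr (by simp) _ _ _, fun _ _ => rfl, fun q hq => ?_⟩
    · rw [State.mem_setMem]
      split_ifs
      · exact hs.1 y
      · exact hs.2 z
    · rw [State.mem_setMem, H.arr_setArr]
      simp only [true_and, ha.2.2 z hz]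
    · funext z
      rw [H.arr_setArr, if_neg (by tauto)]
  | seq h1 h2 ih1 ih2 =>
    intro h hs ha
    refine .seq_of (ih1 h hs ha) ?_
    rintro h₁ k₁ ⟨g1, g2, g3, g4⟩
    refine (ih2 h₁ g2 g3).mono ?_
    rintro h₂ k₂ ⟨k1, k2, k3, k4⟩
    exact ⟨by omega, k2, k3, g4.trans k4 (le_max_left _ _) (le_max_right _ _)⟩
  | condTrue hx h1 ih =>
    intro h hs ha
    refine .cond (fun _ => (ih h hs ha).mono ?_) fun hx' => absurd ((ha.2.1 _).symm.trans hx') hx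
    rintro h₂ k₂ ⟨k1, k2, k3, k4⟩
    exact ⟨by omega, k2, k3, (SimFr.refl 0 _ _).trans k4 (by omega) (le_max_left _ _)⟩
  | condFalse hx h1 ih =>
    intro h hs ha
    refine .cond (fun hx' => absurd ((ha.2.1 _).trans hx) hx') fun _ => (ih h hs ha).mono ?_
    rintro h₂ k₂ ⟨k1, k2, k3, k4⟩
    exact ⟨by omega, k2, k3, (SimFr.refl 0 _ _).trans k4 (by omega) (le_max_right _ _)⟩
  | loopDone hx =>
    intro h hs ha
    have := E.le_unit
    exact .of_runs (h' := h) (fun σ hσ => ⟨1, σ, .loopDone (by rw [hσ.reg, ha.2.1, hx]), by omega, hσ⟩)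
      ⟨le_rfl, hs, ha, .refl _ _ _⟩
  | loopStep hx h1 h2 ih1 ih2 =>
    intro h hs ha σ hσ
    have := E.le_unit
    obtain ⟨t₁, σ₁, e1, h₁, k₁, l1, r1, g1, g2, g3, g4⟩ := ih1 h hs ha σ hσ
    obtain ⟨t₂, σ₂, e2, h₂, k₂, l2, r2, k1, k2, k3, k4⟩ := ih2 h₁ g2 g3 σ₁ r1
    refine ⟨_, _, .loopStep (by rw [hσ.reg, ha.2.1]; exact hx) e1 e2, h₂, k₁ + k₂ + 1, ?_, r2,
      by omega, k2, k3, g4.trans k4 le_rfl le_rfl⟩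
    rw [mul_add, mul_add]; omega

/-- A program for the bounded-entry problem serves as an oracle: its simulation computes the same
product in at most as many steps of the abstract machine. -/
theorem oracleOK_sim {E : Env} {n b w : ℕ} {δ : ℤ} {t₀ : ℕ} {P : Program} (hw : 2 ^ w ≤ E.N)
    (hfit : n * b * (E.W + 1) + b * n * (E.W + 1) + n * n * (E.W + 2) ≤ E.N)
    (hδ : δ < 2 ^ (E.W - 1))
    (hP : ∀ (A : Matrix (Fin n) (Fin b) (WithTop ℤ)) (B : Matrix (Fin b) (Fin n) (WithTop ℤ)),
      (∀ i k, ∀ v : ℤ, A i k = v → |v| ≤ δ) → HasBits (E.W - 1) A → HasBits (E.W - 1) B →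
        ∃ t, ComputesIn w P (E.W - 1) A B t ∧ t ≤ t₀) :
    OracleOK E n b δ (max (regBound P) 4) t₀ (sim P) := by
  intro h A B hA hB hreg hrow hmem
  have hW := E.hW
  set A' : Matrix (Fin n) (Fin b) (WithTop ℤ) := fun i k => A i k with hA'
  set B' : Matrix (Fin b) (Fin n) (WithTop ℤ) := fun k j => B k j with hB'
  have eA : ∀ i < n, ∀ k < b, ext A' i k = A i k := fun i hi k hk => by simp [ext, hi, hk, hA']
  have eB : ∀ k < b, ∀ j < n, ext B' k j = B k j := fun i hi k hk => by simp [ext, hi, hk, hB']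
  obtain ⟨t, ⟨hfits, s, hs, hout⟩, ht⟩ := hP A' B' (fun i k => hA i i.2 k k.2)
    (fun i k v hv => (hA i i.2 k k.2 v hv).trans_lt hδ) (fun k j => hB k k.2 j j.2)
  have eW : E.W - 1 + 1 = E.W := by omega
  have eW2 : E.W - 1 + 2 = E.W + 1 := by omega
  refine (Tri.sim hw hrow hs h hfits ⟨rfl, hreg, fun z _ => ?_⟩).mono ?_
  · rw [hmem]
    show _ = (inputWords (E.W - 1) A' B').getD z 0
    rw [inputWords_getD, eW]
    exact (inCell_congr eA eB z).symm
  · rintro h' k ⟨h1, -, h3, h4⟩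
    refine ⟨by omega, h4.fro, fun r hr => ?_, h4.row, fun z hz => ?_⟩
    · have := h4.hi (r - 100) (by omega)
      rwa [Nat.add_sub_cancel' (by omega)] at this
    · have h5 := h3.2.2 (n * b * (E.W + 1) + b * n * (E.W + 1) + z) (by omega)
      rw [h5]
      have h6 : z < (encodeMatrix (E.W - 1 + 2) (minPlus A' B')).length := by
        rw [length_encodeMatrix, eW2]; exact hz
      have h7 := hout z h6
      rw [length_inputWords] at h7
      simp only [encodeMatrix_eq, List.getElem_map, List.getElem_range, eW2] at h7
      rw [h7]
      refine encCell_congr (r := n) (fun i hi j hj => ?_) hz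
      rw [ext_minPlus _ _ hi hj]
      unfold mpF
      refine Finset.inf_congr rfl fun k hk => ?_
      rw [eA i hi k (Finset.mem_range.1 hk), eB k (Finset.mem_range.1 hk) j hj]

/-! ### Input and output -/

/-- The state after the memory layout has been fixed: the constants, and the input in the flat
memory. The exponents `tE` and `eE` determine the threshold and the rounding error. -/
structure Init (E : Env) (n b l tE eE : ℕ) (A B : ℕ → ℕ → WithTop ℤ) (h : H) : Prop where
  z : h.reg rZ = 0
  rn : h.reg rN = n
  rb : h.reg rB = b
  w : h.reg rW = E.W
  top : h.reg rTop = E.W - 1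
  rtE : h.reg 6 = tE
  reE : h.reg 7 = eE
  inl : h.reg 8 = n * b * (l + 2) + b * n * (l + 2)
  outl : h.reg 9 = n * n * (l + 3)
  l1 : h.reg 10 = l + 1
  l2 : h.reg 11 = l + 2
  w1 : h.reg 12 = E.W + 1
  w2 : h.reg 13 = E.W + 2
  n' : h.reg 14 = n
  l3 : h.reg 15 = l + 3
  hi : ∀ q, 100 ≤ q → h.reg q = 0
  arr : ∀ a x y, h.arr a x y = 0
  num : ∀ a x y, h.num a x y = 0
  raw : ∀ z < n * b * (l + 2) + b * n * (l + 2), h.raw z = inCell n b (l + 1) A B z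

/-- The sizes that the algorithm needs. -/
structure Sizes (E : Env) (n b l tE eE : ℕ) : Prop where
  n1 : 1 ≤ n
  b1 : 1 ≤ b
  nN : n + 1 < E.N
  bN : b < E.N
  lW : l + 5 ≤ E.W
  io : n * b * (l + 2) + b * n * (l + 2) + n * n * (l + 3) ≤ E.Z
  tN : tE ≤ E.N
  eN : eE ≤ E.N

/-- Copies the input into a row of an array. -/
def copyIn : Program := forUp 20 8 (ldH 21 20 ;; putH wIn rZ 20 21)

theorem Tri.copyIn {E : Env} {n b l tE eE : ℕ} {A B : ℕ → ℕ → WithTop ℤ} {h : H}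
    (hs : Sizes E n b l tE eE) (hi : Init E n b l tE eE A B h) :
    Tri E copyIn h fun h' t => t ≤ 4 * (n * b * (l + 2) + b * n * (l + 2)) + 2 ∧
      Fr 20 [wIn] [] h h' ∧ ∀ z < n * b * (l + 2) + b * n * (l + 2),
        h'.arr wIn 0 z = inCell n b (l + 1) A B z := by
  have hZ := E.hZ
  have hio := hs.io
  have hN := E.N_pos
  refine Tri.forUp (m := n * b * (l + 2) + b * n * (l + 2)) (fun x h' => Fr 20 [wIn] [] h h' ∧
    ∀ z < x, h'.arr wIn 0 z = inCell n b (l + 1) A B z) (fun x _ => 4 * x + 2) hi.inl (by decide)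
    (by omega) ?_ (fun _ _ _ => rfl) ⟨Fr.refl _ _ _ _, by simp⟩ le_rfl ?_ ?_
  · rintro x h' v ⟨h1, h2⟩
    exact ⟨h1.setReg _ (by omega) (by omega), h2⟩
  · rintro x hx h' ⟨h1, h2⟩ h3 h4
    have hz : h'.reg 0 = 0 := by rw [h1.reg _ (by omega), hi.z]
    have hraw : h'.raw x = inCell n b (l + 1) A B x := by rw [h1.raw]; exact hi.raw x hx
    refine .seq (.ld (by omega) (.put ?_ ?_ ?_))
    any_goals simp only [H.reg_setReg, Nat.reduceEqDiff, if_false, if_true, hz, h3,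
      OfNat.zero_ne_ofNat, hraw]
    any_goals omega
    refine ⟨by simpa using h3, by simpa using h4, ⟨(h1.setReg _ (by omega) (by omega)).setArr
      (by simp) _ _ _, fun z hz => ?_⟩, by omega⟩
    rw [H.arr_setArr, H.arr_setReg]
    by_cases hzx : z = x
    · subst hzx; simp
    · simp only [hzx, and_false, if_false]; exact h2 z (by omega)
  · rintro h' t ⟨h1, h2⟩ h3
    exact ⟨h3, h1, h2⟩

/-- Computes the constants: the number one, the threshold `T`, the rounding error, the integer that
stands for `∞`, a larger number and the bound on the finite entries of the result. -/
def constPhase : Program :=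
  powH 16 rZ ;; powH aT 6 ;; condH 7 (constH 21 1 ;; opH .sub 22 7 21 ;; powH aD 22) .nop ;;
    powH aInf 11 ;; addH aBig rZ rZ aInf rZ rZ aInf rZ rZ ;;
    addH aBig rZ rZ aBig rZ rZ aBig rZ rZ ;; powH aThr 10

/-- The rounding error that belongs to the exponent `e`: half of `2 ^ e`, and `0` for `e = 0`. The
entries in the calls are at most twice the rounding error, hence at most `2 ^ e`. -/
def errOf (e : ℕ) : ℤ := if e = 0 then 0 else 2 ^ (e - 1)

/-- The machine holds the integer constants. With `l`-bit entries, `∞` becomes `2 ^ (l + 2)`, and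
the finite entries of the product are those below `2 ^ (l + 1)`. -/
structure Consts (E : Env) (l tE eE : ℕ) (h : H) : Prop where
  base : Base E h
  T : h.num aT 0 0 = 2 ^ tE
  d : h.num aD 0 0 = errOf eE
  inf : h.num aInf 0 0 = 2 ^ (l + 2)
  big : h.num aBig 0 0 = 4 * 2 ^ (l + 2)
  thr : h.num aThr 0 0 = 2 ^ (l + 1)

theorem Consts.fr {E : Env} {l tE eE : ℕ} {h h' : H} (hc : Consts E l tE eE h) {m : ℕ}
    {A B : List (Fin 32)} (hf : Fro m A B h h') (hm : 10 ≤ m)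
    (hB : ∀ a ∈ [aT, aD, aInf, aBig, aThr, 16, 31], a ∉ B) : Consts E l tE eE h' :=
  ⟨⟨by rw [hf.reg _ (by omega), hc.base.z], by rw [hf.reg _ (by omega), hc.base.top],
    by rw [hf.num _ (hB _ (by simp)), hc.base.n0], by rw [hf.num _ (hB _ (by simp)), hc.base.n1]⟩,
    by rw [hf.num _ (hB _ (by simp)), hc.T],
    by rw [hf.num _ (hB _ (by simp)), hc.d], by rw [hf.num _ (hB _ (by simp)), hc.inf],
    by rw [hf.num _ (hB _ (by simp)), hc.big], by rw [hf.num _ (hB _ (by simp)), hc.thr]⟩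

theorem Tri.constPhase {E : Env} {n b l tE eE : ℕ} {A B : ℕ → ℕ → WithTop ℤ} {h h₀ : H}
    (hs : Sizes E n b l tE eE) (hi : Init E n b l tE eE A B h₀) (hf : Fr 20 [wIn] [] h₀ h) :
    Tri E constPhase h fun h' t => t ≤ 3 * tE + 3 * eE + 6 * l + 50 ∧
      Fr 20 [] [16, aT, aD, aInf, aBig, aThr] h h' ∧ Consts E l tE eE h' := by
  have hN := E.N_pos
  have hlt := fun {y : ℕ} (hy : y ≤ E.N) => E.lt_of_lt_N hy
  have hz : h.reg 0 = 0 := by rw [hf.reg _ (by omega), hi.z]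
  have htN := hs.tN
  have heN := hs.eN
  have hlW := hs.lW
  have hWN := E.hWN
  refine .seq_of (Tri.pow hz (a := 16) (by omega) (by omega)) ?_
  rintro h₁ t₁ ⟨ht1, f1, v1⟩
  have z1 : h₁.reg 0 = 0 := by rw [f1.reg _ (by omega), hz]
  have r1 : ∀ q < 20, h₁.reg q = h₀.reg q := fun q hq => by
    rw [f1.reg _ (by omega), hf.reg _ (by omega)]
  refine .seq_of (Tri.pow z1 (a := aT) (r := 6) (by omega) (by rw [r1 _ (by omega), hi.rtE]; omega)) ?_
  rintro h₂ t₂ ⟨ht2, f2, v2⟩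
  rw [r1 _ (by omega), hi.rtE] at ht2 v2
  have F2 : Fr 20 [] [16, aT, aD, aInf, aBig, aThr] h h₂ :=
    (f1.mono (by omega) (by simp) (by simp)).step f2 (by omega) (by simp) (by simp)
  refine .seq_of (R := fun h₃ t₃ => t₃ ≤ 3 * eE + 10 ∧ Fr 20 [] [aD] h₂ h₃ ∧
    h₃.num aD 0 0 = errOf eE) ?_ ?_
  · have e7 : h₂.reg 7 = eE := by rw [f2.reg _ (by omega), r1 _ (by omega), hi.reE]
    have e0 : h₂.reg 0 = 0 := by rw [f2.reg _ (by omega), z1]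
    refine .cond (fun hx => .seq (.const (hlt (by omega)) (.seq (.op ?_ ?_)))) fun hx => .nop ?_
    · simp [Op.eval, e7]; exact hlt (by omega)
    · simp only [H.reg_setReg, Op.eval, Nat.reduceEqDiff, if_false, if_true, e7]
      refine (Tri.pow (by simpa using e0) (a := aD) (r := 22) (by omega) (by simp; omega)).mono ?_
      rintro h₃ t₃ ⟨ht3, f3, v3⟩
      simp only [H.reg_setReg, if_true] at ht3 v3
      refine ⟨by omega, ?_, ?_⟩
      · exact (((Fr.refl _ _ _ _).setReg _ (by omega) (by omega)).setReg _ (by omega)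
          (by omega)).step f3 (by omega) (by simp) (by simp)
      · rw [v3, errOf, if_neg (by omega)]
    · refine ⟨by omega, Fr.refl _ _ _ _, ?_⟩
      rw [errOf, if_pos (by omega)]
      have : h₂.num aD = h₀.num aD := by
        rw [f2.num _ (by decide), f1.num _ (by decide), hf.num _ (by simp)]
      rw [this]; exact hi.num _ _ _
  rintro h₃ t₃ ⟨ht3, f3, v3⟩
  have F3 : Fr 20 [] [16, aT, aD, aInf, aBig, aThr] h h₃ := F2.step f3 (by omega) (by simp) (by simp)
  have z3 : h₃.reg 0 = 0 := by rw [F3.reg _ (by omega), hz]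
  have r3 : ∀ q < 20, h₃.reg q = h₀.reg q := fun q hq => by
    rw [F3.reg _ (by omega), hf.reg _ (by omega)]
  refine .seq_of (Tri.pow z3 (a := aInf) (r := 11) (by omega) (by rw [r3 _ (by omega), hi.l2]; omega)) ?_
  rintro h₄ t₄ ⟨ht4, f4, v4⟩
  rw [r3 _ (by omega), hi.l2] at ht4 v4
  have z4 : h₄.reg 0 = 0 := by rw [f4.reg _ (by omega), z3]
  refine .seq (.add ?_ ?_ ?_ ?_ ?_ ?_ (.seq (.add ?_ ?_ ?_ ?_ ?_ ?_ ?_)))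
  any_goals simp only [H.reg_setNum, z4, H.num_setNum_self, v4]
  any_goals exact hN
  set h₅ := (h₄.setNum aBig 0 0 (2 ^ (l + 2) + 2 ^ (l + 2))).setNum aBig 0 0
    (2 ^ (l + 2) + 2 ^ (l + 2) + (2 ^ (l + 2) + 2 ^ (l + 2))) with hh₅
  have f5 : Fr 20 [] [aBig] h₄ h₅ :=
    ((Fr.refl _ _ _ _).setNum (by simp) _ _ _).setNum (by simp) _ _ _
  have F5 : Fr 20 [] [16, aT, aD, aInf, aBig, aThr] h h₅ :=
    (F3.step f4 (by omega) (by simp) (by simp)).step f5 (by omega) (by simp) (by simp)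
  have z5 : h₅.reg 0 = 0 := z4
  have r5 : ∀ q < 20, h₅.reg q = h₀.reg q := fun q hq => by
    rw [F5.reg _ (by omega), hf.reg _ (by omega)]
  refine (Tri.pow z5 (a := aThr) (r := 10) (by omega) (by rw [r5 _ (by omega), hi.l1]; omega)).mono ?_
  rintro h' t ⟨ht, f', v'⟩
  rw [r5 _ (by omega), hi.l1] at ht v'
  have F' := F5.step f' (by omega : 20 ≤ 80) (by simp) (by simp)
  rw [hz] at ht1 v1
  refine ⟨by omega, F', ⟨⟨by rw [F'.reg _ (by omega), hz], ?_, ?_, ?_⟩, ?_, ?_, ?_, ?_, v'⟩⟩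
  · rw [F'.reg _ (by omega), hf.reg _ (by omega), hi.top]
  · rw [F'.num _ (by decide), hf.num _ (by simp)]; exact hi.num _ _ _
  · rw [f'.num _ (by decide), f5.num _ (by decide), f4.num _ (by decide), f3.num _ (by decide),
      f2.num _ (by decide), v1, pow_zero]
  · rw [f'.num _ (by decide), f5.num _ (by decide), f4.num _ (by decide), f3.num _ (by decide), v2]
  · rw [f'.num _ (by decide), f5.num _ (by decide), f4.num _ (by decide), v3]
  · rw [f'.num _ (by decide), f5.num _ (by decide), v4]
  · rw [f'.num _ (by decide), hh₅, H.num_setNum_self]; ring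

/-- Reads a matrix, replacing `∞` by a large integer. -/
def loadMat (a : Fin 32) (r c : ℕ) : Program :=
  readMat wIn rZ 30 10 11 22 r 23 c (condH 80 (addH a 22 23 31 rZ rZ aInf rZ rZ)
    (addH a 22 23 31 rZ rZ aX rZ rZ))

theorem Tri.loadMat {E : Env} {h : H} {l tE eE : ℕ} {a : Fin 32} {r c R C p0 : ℕ}
    (ha : a ∉ [wIn, aX, aT, aD, aInf, aBig, aThr, 16, 31] ∨ a = aA)
    (ha' : a ≠ aX ∧ a ≠ aInf ∧ a ≠ 31 ∧ a ≠ 16 ∧ a ≠ aT ∧ a ≠ aD ∧ a ≠ aBig ∧ a ≠ aThr)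
    (f : ℕ → ℕ → WithTop ℤ) (hc : Consts E l tE eE h)
    (hr : h.reg r = R) (hcc : h.reg c = C) (hpos : h.reg 30 = p0) (hrc : r ≠ c) (hr20 : r < 20)
    (hr0 : 1 ≤ r) (hc0 : 1 ≤ c) (hc20 : c < 20)
    (hl1 : h.reg 10 = l + 1) (hl2 : h.reg 11 = l + 2) (hC : 1 ≤ C) (hR' : R < E.N) (hC' : C < E.N)
    (hfit : p0 + R * C * (l + 2) < E.N)
    (hrow : ∀ z < R * C * (l + 2), h.arr wIn 0 (p0 + z) = encCell (l + 1) C f z)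
    (hv : ∀ p < R, ∀ q < C, ∀ v : ℤ, f p q = v → |v| < 2 ^ l) :
    Tri E (loadMat a r c) h fun h' t => t ≤ R * C * (6 * l + 43) + 2 ∧ Fr 20 [] [aX, a] h h' ∧
      h'.reg 30 = p0 + R * C * (l + 2) ∧
      ∀ x < R, ∀ y < C, h'.num a x y = (f x y).untopD (2 ^ (l + 2)) := by
  have hN := E.N_pos
  obtain ⟨a1, a2, a3, a4, a5, a6, a7, a8⟩ := ha'
  have keep : ∀ h', Fr 20 [] [aX, a] h h' → Consts E l tE eE h' := fun h' hf =>
    hc.fr (Fro.of_fr hf) (by omega) (by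
      intro b hb
      simp only [List.mem_cons, List.not_mem_nil, or_false] at hb ⊢
      rintro (h0 | h0)
      · subst h0; revert hb; decide
      · subst h0; tauto)
  refine Tri.readMat (R := R) (C := C) (nbv := l + 1) (p0 := p0) f (fun m h' =>
      Fr 20 [] [aX, a] h h' ∧ ∀ x < R, ∀ y < C, x * C + y < m →
        h'.num a x y = (f x y).untopD (2 ^ (l + 2))) 10 hr hcc hpos ?_ ?_ ?_ hC hR'.le hC'.le
    (by omega) hfit ?_ ?_ ?_ ?_ ⟨Fr.refl _ _ _ _, by simp⟩ ?_ ?_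
  · simp only [List.nodup_cons, List.mem_cons, List.not_mem_nil, or_false, not_or, List.nodup_nil,
      not_false_eq_true, and_true]; omega
  · simp only [List.mem_cons, List.not_mem_nil, or_false, not_or]; omega
  · simp only [List.mem_cons, List.not_mem_nil, or_false, forall_eq_or_imp, forall_eq]; omega
  · rintro m h' q v hq ⟨h1, h2⟩
    exact ⟨h1.setReg _ (by omega) (by omega), h2⟩
  · rintro m h' h'' ⟨h1, h2⟩ h3
    exact ⟨h1.step h3 (by omega) (by simp) (by simp),
      by rw [h3.num _ (by simpa using a1)]; exact h2⟩
  · rintro m h' ⟨h1, -⟩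
    have c' := keep h' h1
    refine ⟨c'.base, by rw [c'.base.z]; exact hN, by rw [h1.reg _ (by omega), hl1],
      by rw [h1.reg _ (by omega), hl2], fun z hz => ?_⟩
    rw [h1.arr _ (by simp), c'.base.z]; exact hrow z hz
  · intro p hp q hq v hv'
    have := abs_lt.1 (hv p hp q hq v hv')
    rw [Nat.add_sub_cancel]; constructor <;> linarith
  · rintro x hx y hy h' ⟨h1, h2⟩ e22 e23 er ec e80 eX
    have c' := keep h' h1
    have gz := c'.base.z
    have key : ∀ v, v = (f x y).untopD (2 ^ (l + 2)) → ∀ x' < R, ∀ y' < C,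
        x' * C + y' < x * C + y + 1 → (h'.setNum a x y v).num a x' y' =
          (f x' y').untopD (2 ^ (l + 2)) := by
      intro v hv x' hx' y' hy' hlin
      rw [H.num_setNum]
      split_ifs with h3
      · rw [hv, h3.2.1, h3.2.2]
      · rcases (lin_lt_succ hy hy').1 hlin with h0 | h0
        · exact h2 x' hx' y' hy' h0
        · tauto
    refine .cond (fun hx0 => .add ?_ ?_ ?_ ?_ ?_ ?_ ?_) fun hx0 => .add ?_ ?_ ?_ ?_ ?_ ?_ ?_
    any_goals simp only [gz, e22, e23, c'.base.n0, c'.inf, eX, zero_add]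
    any_goals omega
    · have htop : f x y = ⊤ := by
        by_contra h0; rw [if_neg h0] at e80; exact hx0 e80
      exact ⟨fun _ _ => rfl, ⟨h1.setNum (by simp) _ _ _, key _ (by rw [htop]; rfl)⟩, by omega⟩
    · have htop : ¬ f x y = ⊤ := by
        intro h0; rw [if_pos h0] at e80; omega
      obtain ⟨v, hv'⟩ := WithTop.ne_top_iff_exists.1 htop
      refine ⟨fun _ _ => rfl, ⟨h1.setNum (by simp) _ _ _, key _ (by rw [← hv']; rfl)⟩, by omega⟩
  · rintro h' t ⟨h1, h2⟩ h3 h4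
    exact ⟨h3.trans (le_of_eq (by ring)), h1, h4, fun x hx y hy => h2 x hx y hy (lin_lt hx hy)⟩

/-- Reads the input. -/
def readPhase : Program :=
  copyIn ;; constPhase ;; constH 30 0 ;; loadMat aA rN rB ;; loadMat aB rB rN

theorem Tri.readPhase {E : Env} {n b l tE eE : ℕ} {A B : ℕ → ℕ → WithTop ℤ} {h : H}
    (hs : Sizes E n b l tE eE) (hi : Init E n b l tE eE A B h)
    (hA : ∀ i < n, ∀ k < b, ∀ v : ℤ, A i k = v → |v| < 2 ^ l)
    (hB : ∀ k < b, ∀ j < n, ∀ v : ℤ, B k j = v → |v| < 2 ^ l) :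
    Tri E readPhase h fun h' t => t ≤ 40 * (n * b * (l + 3)) + 3 * tE + 3 * eE + 6 * l + 100 ∧
      Fr 20 [wIn] [16, aT, aD, aInf, aBig, aThr, aX, aA, aB] h h' ∧ Consts E l tE eE h' ∧
      (∀ i < n, ∀ k < b, h'.num aA i k = (A i k).untopD (2 ^ (l + 2))) ∧
      ∀ k < b, ∀ j < n, h'.num aB k j = (B k j).untopD (2 ^ (l + 2)) := by
  have hN := E.N_pos
  have hZ := E.hZ
  have hio := hs.io
  refine .seq_of (Tri.copyIn hs hi) ?_
  rintro h₁ t₁ ⟨ht1, f1, v1⟩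
  refine .seq_of (Tri.constPhase hs hi f1) ?_
  rintro h₂ t₂ ⟨ht2, f2, c2⟩
  refine .seq (.const (E.lt_of_lt_N (by omega)) ?_)
  set h₃ := h₂.setReg 30 0 with hh₃
  have f3 : Fr 20 [] [] h₂ h₃ := (Fr.refl _ _ _ _).setReg _ (by omega) (by omega)
  have c3 := c2.fr (Fro.of_fr f3) (by omega) (by decide)
  have F3 : Fr 20 [wIn] [16, aT, aD, aInf, aBig, aThr, aX, aA, aB] h h₃ :=
    ((f1.mono le_rfl (by simp) (by simp)).step f2 le_rfl (by simp) (by simp)).step f3 le_rfl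
      (by simp) (by simp)
  have r3 : ∀ q < 20, h₃.reg q = h.reg q := fun q hq => F3.reg _ (.inl hq)
  have w3 : h₃.arr wIn = h₁.arr wIn := f2.arr _ (by simp)
  refine .seq_of (Tri.loadMat (a := aA) (R := n) (C := b) (p0 := 0) (.inr rfl) (by decide) A c3
    (by rw [r3 _ (by omega), hi.rn]) (by rw [r3 _ (by omega), hi.rb]) (by simp [hh₃]) (by omega)
    (by omega) (by omega) (by omega) (by omega) (by rw [r3 _ (by omega), hi.l1])
    (by rw [r3 _ (by omega), hi.l2]) hs.b1 (by have := hs.nN; omega) hs.bN (by omega)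
    (fun z hz => ?_) hA) ?_
  · rw [w3, zero_add, v1 z (by omega), inCell, if_pos hz]
  rintro h₄ t₄ ⟨ht4, f4, p4, v4⟩
  have c4 := c3.fr (Fro.of_fr f4) (by omega) (by decide)
  have F4 := F3.step f4 le_rfl (by simp) (by simp)
  have r4 : ∀ q < 20, h₄.reg q = h.reg q := fun q hq => F4.reg _ (.inl hq)
  refine (Tri.loadMat (a := aB) (R := b) (C := n) (p0 := 0 + n * b * (l + 2)) (.inl (by decide))
    (by decide) B c4
    (by rw [r4 _ (by omega), hi.rb]) (by rw [r4 _ (by omega), hi.rn]) p4 (by omega)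
    (by omega) (by omega) (by omega) (by omega) (by rw [r4 _ (by omega), hi.l1])
    (by rw [r4 _ (by omega), hi.l2]) hs.n1 hs.bN (by have := hs.nN; omega) (by omega)
    (fun z hz => ?_) hB).mono ?_
  · rw [f4.arr _ (by simp), w3, v1 _ (by omega), inCell]
    simp only [Nat.add_assoc, Nat.reduceAdd] at hz ⊢
    rw [if_neg (by omega), if_pos (by omega)]
    congr 1; omega
  rintro h₅ t₅ ⟨ht5, f5, -, v5⟩
  refine ⟨?_, F4.step f5 le_rfl (by simp) (by simp), c4.fr (Fro.of_fr f5) (by omega) (by decide),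
    fun i hi k hk => ?_, v5⟩
  · have e : b * n = n * b := Nat.mul_comm _ _
    rw [e] at ht5 ht1
    have n1 := hs.n1
    have b1 := hs.b1
    have e1 : 40 * (n * b * (l + 3)) = 40 * (n * b * l) + 120 * (n * b) := by ring
    have e2 : n * b * (6 * l + 43) = 6 * (n * b * l) + 43 * (n * b) := by ring
    have e3 : n * b * (l + 2) = (n * b * l) + 2 * (n * b) := by ring
    have : 1 ≤ n * b := Nat.mul_pos n1 b1
    omega
  · rw [f5.num _ (by decide)]; exact v4 i hi k hk

/-- Writes the result behind the input. -/
def outPhase : Program :=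
  constH 30 0 ;; writeMat wOut rZ 30 11 15 22 rN 23 14 (addH aX rZ rZ 31 rZ rZ aC 22 23 ;;
    subH aY rZ rZ aX rZ rZ aThr rZ rZ ;; negH 70 aY rZ rZ ;;
    condH 70 (constH 80 0) (subH aX rZ rZ aX rZ rZ aX rZ rZ ;; constH 80 1)) ;;
  forUp 20 9 (getH 21 wOut rZ 20 ;; opH .add 22 8 20 ;; stH 22 21)

/-- The entry that belongs to an integer: large integers stand for `∞`. -/
def outVal (l : ℕ) (v : ℤ) : WithTop ℤ := if v < 2 ^ (l + 1) then (v : WithTop ℤ) else ⊤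

theorem Tri.outPhase {E : Env} {n b l tE eE : ℕ} {A B : ℕ → ℕ → WithTop ℤ} {h h₀ : H}
    {L₁ L₂ : List (Fin 32)}
    (hs : Sizes E n b l tE eE) (hi : Init E n b l tE eE A B h₀) (hf : Fro 20 L₁ L₂ h₀ h)
    (hc : Consts E l tE eE h)
    (hC : ∀ i < n, ∀ j < n, |h.num aC i j| ≤ 2 ^ (l + 3)) :
    Tri E outPhase h fun h' t => t ≤ 40 * (n * n * (l + 3)) + 10 ∧
      ∀ z < n * n * (l + 3), h'.raw (n * b * (l + 2) + b * n * (l + 2) + z) =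
        encCell (l + 2) n (fun i j => outVal l (h.num aC i j)) z := by
  have hN := E.N_pos
  have hZ := E.hZ
  have hio := hs.io
  have hio' : n * n * (l + 2 + 1) ≤ E.Z := by exact (Nat.le_add_left _ _).trans hs.io
  have hlW := hs.lW
  have hnN := hs.nN
  have n1 := hs.n1
  have hlt := fun {y : ℕ} (hy : y ≤ E.N) => E.lt_of_lt_N hy
  have hr : ∀ q < 20, h.reg q = h₀.reg q := fun q hq => hf.reg _ hq
  have hW4 : (2 : ℤ) ^ (l + 4) ≤ 2 ^ (E.W - 1) := pow_le_pow_right₀ (by norm_num) (by omega)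
  have p1 : (2 : ℤ) ^ (l + 3) = 4 * 2 ^ (l + 1) := by ring
  have p2 : (2 : ℤ) ^ (l + 4) = 8 * 2 ^ (l + 1) := by ring
  have p3 : (0 : ℤ) < 2 ^ (l + 1) := by positivity
  set f : ℕ → ℕ → WithTop ℤ := fun i j => outVal l (h.num aC i j) with hfdef
  refine .seq (.const (hlt (by omega)) ?_)
  set h₁ := h.setReg 30 0 with hh₁
  have f1 : Fr 20 [wOut] [aX, aY] h h₁ := (Fr.refl _ _ _ _).setReg _ (by omega) (by omega)
  refine .seq (Tri.writeMat (R := n) (C := n) (row := 0) (nbv := l + 2) (p0 := 0) f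
    (fun _ h' => Fr 20 [wOut] [aX, aY] h h') (fun m _ => m * (5 * l + 40) + 2)
    (by simp [hh₁, hr, hi.rn]) (by simp [hh₁, hr, hi.n']) (by simp [hh₁])
    (by decide) (by decide) (by decide) hs.n1 (by omega) (by omega) (by omega) hN (by omega) ?_ ?_ ?_
    (fun _ _ _ _ _ => rfl) (fun _ _ _ _ => rfl) f1 (by simp) ?_ (by decide) ?_)
  · rintro m h' q v hq h1
    rcases hq with rfl | rfl | rfl <;> exact h1.setReg _ (by omega) (by omega)
  · rintro m h' h'' h1 h2
    exact h1.step h2 (by omega) (by simp) (by simp)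
  · rintro m h' h1
    exact ⟨by rw [h1.reg _ (by omega), hr _ (by omega), hi.z],
      by rw [h1.reg _ (by omega), hr _ (by omega), hi.z],
      by rw [h1.reg _ (by omega), hr _ (by omega), hi.l2],
      by rw [h1.reg _ (by omega), hr _ (by omega), hi.l3]⟩
  · rintro i hi' j hj h' h1 e22 e23 - - -
    have c' := hc.fr (Fro.of_fr h1) (by omega) (by decide)
    have gz := c'.base.z
    have eC : h'.num aC = h.num aC := h1.num _ (by decide)
    have bC := abs_le.1 (hC i hi' j hj)
    refine .seq (.add ?_ ?_ ?_ ?_ ?_ ?_ (.seq (.sub ?_ ?_ ?_ ?_ ?_ ?_ (.seq (.neg ?_ ?_ ?_ ?_ ?_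
      (.cond (fun hx => .const (hlt (by omega)) ?_)
        fun hx => .seq (.sub ?_ ?_ ?_ ?_ ?_ ?_ (.const (E.const_lt (by omega)) ?_))))))))
    any_goals simp only [H.reg_setReg, H.reg_setNum, H.num_setReg, gz, e22, e23, c'.base.n0, eC,
      c'.base.top, H.num_setNum, zero_add, and_self, if_true, Fin.reduceEq, false_and, if_false,
      c'.thr, OfNat.zero_ne_ofNat, Nat.reduceEqDiff] at *
    any_goals omega
    · have hv : h.num aC i j < 2 ^ (l + 1) := by
        by_contra h0
        rw [if_neg (by omega)] at hx; exact hx rfl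
      refine ⟨?_, ?_, ?_, ?_, ?_⟩
      · repeat first | exact Fr.refl _ _ _ _ | refine Fr.setNum ?_ (by simp) _ _ _ |
          refine Fr.setReg ?_ _ (by omega) (by omega)
      · simp [hfdef, outVal, hv]
      · simp only [hfdef, outVal, hv, if_true]; rfl
      · repeat first | exact h1 | refine Fr.setNum ?_ (by simp) _ _ _ |
          refine Fr.setReg ?_ _ (by omega) (by omega)
      · rw [add_mul _ 1]; omega
    · have hv : ¬ h.num aC i j < 2 ^ (l + 1) := by
        intro h0
        rw [if_pos (by omega)] at hx; omega
      refine ⟨?_, ?_, ?_, ?_, ?_⟩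
      · repeat first | exact Fr.refl _ _ _ _ | refine Fr.setNum ?_ (by simp) _ _ _ |
          refine Fr.setReg ?_ _ (by omega) (by omega)
      · simp [hfdef, outVal, hv]
      · simp [hfdef, outVal, hv]
      · repeat first | exact h1 | refine Fr.setNum ?_ (by simp) _ _ _ |
          refine Fr.setReg ?_ _ (by omega) (by omega)
      · rw [add_mul _ 1]; omega
  rintro h₂ t₂ f2 ht2 - ar2
  have r2 : ∀ q < 20, h₂.reg q = h₀.reg q := fun q hq => by rw [f2.reg _ (by omega), hr q hq]
  refine Tri.forUp (m := n * n * (l + 3)) (fun x h' => (∀ q < 20, h'.reg q = h₀.reg q) ∧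
    h'.arr = h₂.arr ∧ ∀ z < x, h'.raw (n * b * (l + 2) + b * n * (l + 2) + z) =
      encCell (l + 2) n f z) (fun x _ => 5 * x + 2) (by rw [r2 _ (by omega), hi.outl]) (by decide)
    (by omega) ?_ (fun _ _ _ => rfl) ⟨r2, rfl, by simp⟩ le_rfl ?_ ?_
  · rintro x h' v ⟨h1, h2⟩
    exact ⟨fun q hq => by rw [H.reg_setReg, if_neg (by omega), h1 q hq], h2⟩
  · rintro x hx h' ⟨h1, h2, h3⟩ h4 h5
    have gz : h'.reg 0 = 0 := by rw [h1 _ (by omega), hi.z]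
    have g8 : h'.reg 8 = n * b * (l + 2) + b * n * (l + 2) := by rw [h1 _ (by omega), hi.inl]
    refine .seq (.get ?_ ?_ (.seq (.op ?_ (.st ?_ ?_))))
    any_goals simp only [H.reg_setReg, Op.eval, Nat.reduceEqDiff, if_false, if_true, gz, h4, g8]
    any_goals omega
    · exact hlt (by omega)
    refine ⟨h4, h5, ⟨fun q hq => ?_, h2, fun z hz => ?_⟩, by omega⟩
    · rw [H.reg_setRaw, H.reg_setReg, if_neg (by omega), H.reg_setReg, if_neg (by omega), h1 q hq]
    · rw [H.raw_setRaw]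
      by_cases hzx : z = x
      · subst hzx
        rw [if_pos rfl, h2, ar2]
        simp [show z < n * n * (l + 2 + 1) from hx]
      · rw [if_neg (by omega)]; exact h3 z (by omega)
  · rintro h' t ⟨h1, h2, h3⟩ h4
    refine ⟨?_, h3⟩
    have e1 : 40 * (n * n * (l + 3)) = 40 * (n * n * l) + 120 * (n * n) := by ring
    have e2 : n * n * (5 * l + 40) = 5 * (n * n * l) + 40 * (n * n) := by ring
    have e3 : n * n * (l + 3) = (n * n * l) + 3 * (n * n) := by ring
    omega

/-! ### The complete algorithms -/

/-- Large integers as entries have the same effect as `∞`: sums of two finite entries are below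
`2 ^ (l + 1)`, and all other sums are above. -/
theorem outVal_min {b l : ℕ} {A B : ℕ → ℕ → WithTop ℤ} {i j : ℕ} {c : ℤ}
    (hA : ∀ k < b, ∀ v : ℤ, A i k = v → |v| < 2 ^ l)
    (hB : ∀ k < b, ∀ v : ℤ, B k j = v → |v| < 2 ^ l)
    (h1 : ∀ k < b, c ≤ (A i k).untopD (2 ^ (l + 2)) + (B k j).untopD (2 ^ (l + 2)))
    (h2 : ∃ k < b, c = (A i k).untopD (2 ^ (l + 2)) + (B k j).untopD (2 ^ (l + 2))) :
    outVal l c = mpF b A B i j := by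
  have p1 : (2 : ℤ) ^ (l + 1) = 2 * 2 ^ l := by ring
  have p2 : (2 : ℤ) ^ (l + 2) = 4 * 2 ^ l := by ring
  have p0 : (0 : ℤ) < 2 ^ l := by positivity
  -- a sum is finite if and only if its integer version is small
  have key : ∀ k < b, outVal l ((A i k).untopD (2 ^ (l + 2)) + (B k j).untopD (2 ^ (l + 2))) =
      A i k + B k j := by
    intro k hk
    have hA' := hA k hk
    have hB' := hB k hk
    unfold outVal
    cases hx : A i k with
    | top =>
      cases hy : B k j with
      | top => rw [if_neg (by simp only [WithTop.untopD_top]; omega)]; rfl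
      | coe y =>
        have := abs_lt.1 (hB' y hy)
        rw [if_neg (by simp only [WithTop.untopD_top, WithTop.untopD_coe]; omega)]; rfl
    | coe x =>
      have a1 := abs_lt.1 (hA' x hx)
      cases hy : B k j with
      | top => rw [if_neg (by simp only [WithTop.untopD_top, WithTop.untopD_coe]; omega)]; rfl
      | coe y =>
        have a2 := abs_lt.1 (hB' y hy)
        rw [if_pos (by simp only [WithTop.untopD_coe]; omega)]; rfl
  have mono : ∀ x y : ℤ, x ≤ y → outVal l x ≤ outVal l y := by
    intro x y hxy
    unfold outVal
    split_ifs
    · exact_mod_cast hxy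
    · exact le_top
    · omega
    · exact le_rfl
  refine le_antisymm (Finset.le_inf fun k hk => ?_) ?_
  · rw [← key k (Finset.mem_range.1 hk)]; exact mono _ _ (h1 k (Finset.mem_range.1 hk))
  · obtain ⟨k, hk, h3⟩ := h2
    rw [h3, key k hk]
    exact Finset.inf_le (Finset.mem_range.2 hk)

/-- Input, the computation of the product of integer matrices, and output. -/
def solve (p : Program) : Program := readPhase ;; p ;; outPhase

theorem Tri.solve {E : Env} {n b l tE eE : ℕ} {A B : ℕ → ℕ → WithTop ℤ} {h : H} {p : Program}
    {K : ℕ → Prop} {L₁ L₂ : List (Fin 32)}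
    (hs : Sizes E n b l tE eE) (hi : Init E n b l tE eE A B h)
    (hA : ∀ i < n, ∀ k < b, ∀ v : ℤ, A i k = v → |v| < 2 ^ l)
    (hB : ∀ k < b, ∀ j < n, ∀ v : ℤ, B k j = v → |v| < 2 ^ l)
    (hL : ∀ a ∈ [aT, aD, aInf, aBig, aThr, 16, 31], a ∉ L₂)
    (hp : ∀ h', Fr 20 [wIn] [16, aT, aD, aInf, aBig, aThr, aX, aA, aB] h h' →
      Consts E l tE eE h' →
      (∀ i < n, ∀ k < b, h'.num aA i k = (A i k).untopD (2 ^ (l + 2))) →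
      (∀ k < b, ∀ j < n, h'.num aB k j = (B k j).untopD (2 ^ (l + 2))) →
      Tri E p h' fun h'' t => K t ∧ Fro 20 L₁ L₂ h' h'' ∧ ∀ i < n, ∀ j < n,
        (∀ k < b, h''.num aC i j ≤ h'.num aA i k + h'.num aB k j) ∧
          ∃ k < b, h''.num aC i j = h'.num aA i k + h'.num aB k j) :
    Tri E (solve p) h fun h' t => (∃ t₁, K t₁ ∧
        t ≤ t₁ + 40 * (n * b * (l + 3)) + 40 * (n * n * (l + 3)) + 3 * tE + 3 * eE + 6 * l + 110) ∧
      ∀ z < n * n * (l + 3), h'.raw (n * b * (l + 2) + b * n * (l + 2) + z) =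
        encCell (l + 2) n (mpF b A B) z := by
  refine .seq_of (Tri.readPhase hs hi hA hB) ?_
  rintro h₁ t₁ ⟨ht1, f1, c1, vA, vB⟩
  refine .seq_of (hp h₁ f1 c1 vA vB) ?_
  rintro h₂ t₂ ⟨ht2, f2, vC⟩
  have p3 : (2 : ℤ) ^ (l + 3) = 8 * 2 ^ l := by ring
  have p2 : (2 : ℤ) ^ (l + 2) = 4 * 2 ^ l := by ring
  have p0 : (0 : ℤ) < 2 ^ l := by positivity
  have bnd : ∀ x : WithTop ℤ, (∀ v : ℤ, x = v → |v| < 2 ^ l) → |x.untopD (2 ^ (l + 2))| ≤ 4 * 2 ^ l := by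
    intro x hx
    cases x with
    | top => rw [WithTop.untopD_top, p2, abs_of_nonneg (by omega)]
    | coe x => have := hx x rfl; rw [WithTop.untopD_coe]; omega
  refine (Tri.outPhase hs hi (L₁ := wIn :: L₁)
    (L₂ := [16, aT, aD, aInf, aBig, aThr, aX, aA, aB] ++ L₂)
    (((Fro.of_fr f1).mono le_rfl (by simp) (by simp)).trans (f2.mono le_rfl (by simp) (by
      exact List.subset_append_right _ _)))
    (c1.fr f2 (by omega) hL) ?_).mono ?_
  · intro i hi j hj
    obtain ⟨k, hk, h3⟩ := (vC i hi j hj).2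
    have a1 := abs_le.1 (bnd _ (hA i hi k hk))
    have a2 := abs_le.1 (bnd _ (hB k hk j hj))
    rw [h3, vA i hi k hk, vB k hk j hj, abs_le]
    constructor <;> omega
  · rintro h₃ t₃ ⟨ht3, v3⟩
    refine ⟨⟨t₂, ht2, by omega⟩, fun z hz => ?_⟩
    rw [v3 z hz]
    refine encCell_congr (r := n) (fun i hi j hj => ?_) hz
    refine outVal_min (hA i hi) (fun k hk => hB k hk j hj) ?_ ?_
    · intro k hk; rw [← vA i hi k hk, ← vB k hk j hj]; exact (vC i hi j hj).1 k hk
    · obtain ⟨k, hk, h3⟩ := (vC i hi j hj).2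
      exact ⟨k, hk, by rw [← vA i hi k hk, ← vB k hk j hj]; exact h3⟩

/-- The state after reading belongs to integer matrices with bounded entries. -/
theorem bd_of_read {E : Env} {n b l tE eE : ℕ} {A B : ℕ → ℕ → WithTop ℤ} {h h' : H}
    (hs : Sizes E n b l tE eE) (hi : Init E n b l tE eE A B h)
    (hfit : 64 * 2 ^ (l + 2) + 64 * 2 ^ eE + 64 * (n * b) ≤ 2 ^ (E.W - 1))
    (hA : ∀ i < n, ∀ k < b, ∀ v : ℤ, A i k = v → |v| < 2 ^ l)
    (hB : ∀ k < b, ∀ j < n, ∀ v : ℤ, B k j = v → |v| < 2 ^ l)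
    (f1 : Fr 20 [wIn] [16, aT, aD, aInf, aBig, aThr, aX, aA, aB] h h') (c1 : Consts E l tE eE h')
    (vA : ∀ i < n, ∀ k < b, h'.num aA i k = (A i k).untopD (2 ^ (l + 2)))
    (vB : ∀ k < b, ∀ j < n, h'.num aB k j = (B k j).untopD (2 ^ (l + 2))) :
    Bd E ⟨n, b, h'.num aA, h'.num aB, errOf eE, 0, 0⟩ (2 ^ (l + 2)) ∧
      Ctx E ⟨n, b, h'.num aA, h'.num aB, errOf eE, 0, 0⟩ h' := by
  have p2 : (2 : ℤ) ^ (l + 2) = 4 * 2 ^ l := by ring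
  have p0 : (0 : ℤ) < 2 ^ l := by positivity
  have bnd : ∀ x : WithTop ℤ, (∀ v : ℤ, x = v → |v| < 2 ^ l) →
      |x.untopD (2 ^ (l + 2))| ≤ 2 ^ (l + 2) := by
    intro x hx
    cases x with
    | top => rw [WithTop.untopD_top, p2, abs_of_nonneg (by omega)]
    | coe x => have := hx x rfl; rw [WithTop.untopD_coe]; omega
  have e0 : 0 ≤ errOf eE := by unfold errOf; positivity
  have e1 : errOf eE ≤ 2 ^ eE := by
    unfold errOf
    split_ifs
    · positivity
    · exact pow_le_pow_right₀ (by norm_num) (by omega)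
  refine ⟨⟨hs.n1, hs.b1, hs.nN, hs.bN, e0, ?_, ?_, ?_, ?_⟩, ⟨c1.base, ?_, ?_, rfl, rfl, c1.d⟩⟩
  · omega
  · have : (64 : ℤ) * 2 ^ (l + 2) + 64 * 2 ^ eE + 64 * (n * b) ≤ 2 ^ (E.W - 1) := by
      exact_mod_cast hfit
    show (64 : ℤ) * 2 ^ (l + 2) + 64 * errOf eE + 64 * (n * b) ≤ 2 ^ (E.W - 1)
    linarith
  · intro i hi k hk
    show |h'.num aA i k| ≤ _
    rw [vA i hi k hk]; exact bnd _ (hA i hi k hk)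
  · intro k hk j hj
    show |h'.num aB k j| ≤ _
    rw [vB k hk j hj]; exact bnd _ (hB k hk j hj)
  · rw [f1.reg _ (by omega), hi.rn]
  · rw [f1.reg _ (by omega), hi.rb]

/-- The number of segments in a monotone matrix in terms of the ranges of its rows. -/
theorem nseg_mul_le {n b l eE : ℕ} {A : ℕ → ℕ → ℤ} {B : ℕ → ℕ → WithTop ℤ} {B' : ℕ → ℕ → ℤ}
    {ρ : ℕ → ℕ} (hmono : ∀ k < b, ∀ j j', j ≤ j' → j' < n → B' k j ≤ B' k j')
    (hB' : ∀ k < b, ∀ j < n, B' k j = (B k j).untopD (2 ^ (l + 2)))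
    (hρ : ∀ k < b, ∀ j < n, B k j ≠ ⊤ → B' k j ≤ B' k 0 + ρ k) :
    nseg ⟨n, b, A, B', errOf eE, 0, 0⟩ * 2 ^ eE ≤ 2 * (∑ k ∈ Finset.range b, ρ k) + 4 * b * 2 ^ eE := by
  have e0 : 0 ≤ errOf eE := by unfold errOf; positivity
  have e1 : errOf eE + 1 ≤ 2 ^ eE ∧ (2 : ℤ) ^ eE ≤ 2 * (errOf eE + 1) := by
    unfold errOf
    split_ifs with h
    · subst h; simp
    · obtain ⟨e, rfl⟩ : ∃ e, eE = e + 1 := ⟨eE - 1, by omega⟩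
      have : (1 : ℤ) ≤ 2 ^ e := one_le_pow₀ (by norm_num)
      rw [Nat.add_sub_cancel, pow_succ]; constructor <;> linarith
  have main : ∀ k ∈ Finset.range b, nst (errOf eE) (B' k) n * 2 ^ eE ≤ 2 * ρ k + 4 * 2 ^ eE := by
    intro k hk
    have hk' := Finset.mem_range.1 hk
    have h1 := nst_mul_le_range (d := errOf eE) (f := B' k) e0 (n := n) (R := ρ k)
      (I := 2 ^ (l + 2)) (by positivity) (hmono k hk') (fun j hj => by
        by_cases h : B k j = ⊤
        · right; rw [hB' k hk' j hj, h]; rfl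
        · left; exact hρ k hk' j hj h)
    zify
    have h2 : (nst (errOf eE) (B' k) n : ℤ) * 2 ^ eE ≤
        nst (errOf eE) (B' k) n * (2 * (errOf eE + 1)) :=
      mul_le_mul_of_nonneg_left e1.2 (by positivity)
    linarith
  unfold nseg
  rw [Finset.sum_mul]
  refine (Finset.sum_le_sum main).trans (le_of_eq ?_)
  rw [Finset.sum_add_distrib, ← Finset.mul_sum]
  simp only [Finset.sum_const, Finset.card_range, smul_eq_mul]
  ring

/-- The algorithm for monotone matrices, which uses the program `P` as an oracle for matrices with
small entries. -/
theorem Tri.solveMonotone {E : Env} {n b l tE eE : ℕ} {A B : ℕ → ℕ → WithTop ℤ} {h : H}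
    {R t₀ : ℕ} {P : Program} {ρ : ℕ → ℕ}
    (hs : Sizes E n b l tE eE) (hi : Init E n b l tE eE A B h)
    (hfit : 64 * 2 ^ (l + 2) + 64 * 2 ^ eE + 64 * (n * b) ≤ 2 ^ (E.W - 1))
    (hT : 64 * 2 ^ tE ≤ 2 ^ (E.W - 1)) (hR : 4 ≤ R)
    (hfit' : n * b * (E.W + 1) + b * n * (E.W + 1) + n * n * (E.W + 2) < E.N)
    (hP : OracleOK E n b (2 * errOf eE) R t₀ P)
    (hA : ∀ i < n, ∀ k < b, ∀ v : ℤ, A i k = v → |v| < 2 ^ l)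
    (hB : ∀ k < b, ∀ j < n, ∀ v : ℤ, B k j = v → |v| < 2 ^ l)
    (hmono : ∀ k < b, ∀ j j', j ≤ j' → j' < n → B k j ≤ B k j')
    (hρ : ∀ k < b, ∀ j < n, B k j ≠ ⊤ → (B k j).untopD 0 ≤ (B k 0).untopD 0 + ρ k) :
    Tri E (MinPlus.solve (MinPlus.core R P)) h fun h' t => (∃ S r,
        t ≤ 100 * (n * S) + 140 * (n * b * (l + 3)) + 140 * (n * n * (l + 3)) + 8 * (n * 2 ^ tE) +
          r * (3 * n + n * b * (10 * E.W + 100) + n * n * (6 * E.W + 43) + t₀ + R + 30) +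
          3 * tE + 3 * eE + 6 * l + 110 ∧
        S * 2 ^ eE ≤ 2 * (∑ k ∈ Finset.range b, ρ k) + 4 * b * 2 ^ eE ∧ r * 2 ^ tE ≤ n * b) ∧
      ∀ z < n * n * (l + 3), h'.raw (n * b * (l + 2) + b * n * (l + 2) + z) =
        encCell (l + 2) n (mpF b A B) z := by
  have hN := E.N_pos
  refine (Tri.solve (K := fun t => ∃ S r, t ≤ 100 * (n * S) + 100 * (n * b) + 100 * (n * n) +
    8 * (n * 2 ^ tE) +
          r * (3 * n + n * b * (10 * E.W + 100) + n * n * (6 * E.W + 43) + t₀ + R + 30) ∧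
        S * 2 ^ eE ≤ 2 * (∑ k ∈ Finset.range b, ρ k) + 4 * b * 2 ^ eE ∧ r * 2 ^ tE ≤ n * b)
    (L₁ := [wSeg, wCst, wCov, wOra]) (L₂ := [aX, aY, aC, aCT, aCol, aDif, aCur, aG])
    hs hi hA hB (by decide) ?_).mono ?_
  · intro h' f1 c1 vA vB
    obtain ⟨bd, cx⟩ := bd_of_read hs hi hfit hA hB f1 c1 vA vB
    have mono' : ∀ k < b, ∀ j j', j ≤ j' → j' < n → h'.num aB k j ≤ h'.num aB k j' := by
      intro k hk j j' hj hj'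
      have h1 := hmono k hk j j' hj hj'
      rw [vB k hk j (by omega), vB k hk j' hj']
      cases hx : B k j' with
      | top =>
        have p2 : (2 : ℤ) ^ (l + 2) = 4 * 2 ^ l := by ring
        have p0 : (0 : ℤ) < 2 ^ l := by positivity
        rw [WithTop.untopD_top]
        cases hy : B k j with
        | top => rfl
        | coe y => have := abs_lt.1 (hB k hk j (by omega) y hy); rw [WithTop.untopD_coe]; omega
      | coe x =>
        rw [hx] at h1
        cases hy : B k j with
        | top => rw [hy] at h1; exact absurd h1 (by simp)
        | coe y => rw [hy] at h1; simpa using h1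
    refine (Tri.core (T := 2 ^ tE) (h := h') (R := R) (t₀ := t₀) (P := P) bd ⟨cx, ?_, ?_, ?_, ?_,
      ?_, ?_, ?_, ?_, ?_, ?_⟩ hR mono' ?_ ?_ hfit' hP).mono ?_
    · rw [f1.reg _ (by omega), hi.w]
    · rw [f1.reg _ (by omega), hi.w1]
    · rw [f1.reg _ (by omega), hi.w2]
    · rw [f1.reg _ (by omega), hi.n']
    · intro q hq; rw [f1.reg _ (by omega), hi.hi q (by omega)]
    · intro x z; rw [f1.arr _ (by decide), hi.arr]
    · intro x z; rw [f1.arr _ (by decide), hi.arr]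
    · intro x; rw [f1.num _ (by decide), hi.num]
    · rw [c1.T]; push_cast; rfl
    · exact c1.big
    · exact_mod_cast hT
    · refine lt_of_le_of_lt ?_ hfit'
      have : n * b ≤ n * b * (E.W + 1) := Nat.le_mul_of_pos_right _ (by omega)
      exact (this.trans (Nat.le_add_right _ _)).trans (Nat.le_add_right _ _)
    rintro h'' t ⟨⟨r, h1, h2⟩, h3, h4⟩
    refine ⟨⟨_, r, h1, nseg_mul_le (ρ := ρ) mono' vB ?_, ?_⟩, h3, h4⟩
    · intro k hk j hj hne
      have h5 := hρ k hk j hj hne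
      have h6 := hmono k hk 0 j (Nat.zero_le _) hj
      rw [vB k hk j hj, vB k hk 0 (by omega)]
      obtain ⟨x, hx⟩ := WithTop.ne_top_iff_exists.1 hne
      have h7 : B k 0 ≠ ⊤ := fun h0 => hne (top_le_iff.1 (h0 ▸ h6))
      obtain ⟨y, hy⟩ := WithTop.ne_top_iff_exists.1 h7
      rw [← hx, ← hy] at h5 ⊢
      simpa using h5
    · exact (Nat.mul_le_mul_left r (Nat.le_succ _)).trans h2
  · rintro h' t ⟨⟨t₁, ⟨S, r, h1, h2, h3⟩, h4⟩, h5⟩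
    refine ⟨⟨S, r, ?_, h2, h3⟩, h5⟩
    have a1 : n * b * (l + 3) = n * b * l + 3 * (n * b) := by ring
    have a2 : n * n * (l + 3) = n * n * l + 3 * (n * n) := by ring
    omega

/-- The trivial algorithm on integer matrices. -/
def naive : Program := fillPhase ;; for2 20 rN 21 rB (relaxAll 20 21)

/-- The trivial algorithm. -/
theorem Tri.solveNaive {E : Env} {n b l tE eE : ℕ} {A B : ℕ → ℕ → WithTop ℤ} {h : H}
    (hs : Sizes E n b l tE eE) (hi : Init E n b l tE eE A B h)
    (hfit : 64 * 2 ^ (l + 2) + 64 * 2 ^ eE + 64 * (n * b) ≤ 2 ^ (E.W - 1))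
    (hA : ∀ i < n, ∀ k < b, ∀ v : ℤ, A i k = v → |v| < 2 ^ l)
    (hB : ∀ k < b, ∀ j < n, ∀ v : ℤ, B k j = v → |v| < 2 ^ l) :
    Tri E (MinPlus.solve naive) h fun h' t => t ≤ 200 * (n * b * n * (l + 3)) + 200 * (n * n * (l + 3)) +
        3 * tE + 3 * eE + 6 * l + 110 ∧
      ∀ z < n * n * (l + 3), h'.raw (n * b * (l + 2) + b * n * (l + 2) + z) =
        encCell (l + 2) n (mpF b A B) z := by
  have hN := E.N_pos
  have n1 := hs.n1
  have b1 := hs.b1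
  have hnN := hs.nN
  refine (Tri.solve (K := fun t => t ≤ 20 * (n * b * n) + 20 * (n * n))
    (L₁ := []) (L₂ := [aX, aY, aC, aCT]) hs hi hA hB (by decide) ?_).mono ?_
  · intro h' f1 c1 vA vB
    obtain ⟨bd, cx⟩ := bd_of_read hs hi hfit hA hB f1 c1 vA vB
    set I : Data := ⟨n, b, h'.num aA, h'.num aB, errOf eE, 0, 0⟩ with hI
    have hM := bd.M1
    refine .seq_of (Tri.fillPhase bd cx (by rw [f1.reg _ (by omega), hi.n']) c1.big) ?_
    rintro h₁ t₁ ⟨ht1, f2, v1⟩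
    refine Tri.for2 (R := n) (C := b) (fun m h'' => Fr 20 [] [aX, aY, aC] h₁ h'' ∧
      CBd I (2 ^ (l + 2)) h'' ∧ ∀ i < n, ∀ j < n,
        (∀ k < b, i * b + k < m → h''.num aC i j ≤ I.A i k + I.B k j) ∧
        (h''.num aC i j = 4 * 2 ^ (l + 2) ∨
          ∃ k < b, i * b + k < m ∧ h''.num aC i j = I.A i k + I.B k j))
      (fun m _ => m * (7 * n + 10) + 2) (by rw [f2.reg _ (by omega), cx.n])
      (by rw [f2.reg _ (by omega), cx.b]) (by decide) b1 (by omega) hs.bN.le ?_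
      (fun _ _ _ _ _ => rfl) ⟨Fr.refl _ _ _ _, ?_, fun i hi j hj => ⟨by simp, .inl (v1 i hi j hj).1⟩⟩
      (by simp) ?_ ?_
    · rintro m h'' q v hq ⟨h2, h3⟩
      exact ⟨h2.setReg _ (by omega) (by omega), h3⟩
    · intro i hi j hj
      rw [(v1 i hi j hj).1, abs_of_nonneg (by linarith)]; linarith
    · rintro x hx y hy h'' ⟨h2, h3, h4⟩ e20 e21 en eb
      have c2 := (cx.fr f2 le_rfl (by decide)).fr h2 le_rfl (by decide)
      refine (Tri.relaxAll bd h3 c2 (i := 20) (k := 21) (by omega) (by omega) e20 e21 hx hy).mono ?_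
      rintro g t ⟨ht, g1, g2⟩
      refine ⟨by rw [g1.reg _ (by omega), e20], by rw [g1.reg _ (by omega), e21],
        by rw [g1.reg _ (by omega), en], by rw [g1.reg _ (by omega), eb],
        ⟨h2.step g1 (by omega) (by simp) (by simp), g2.bd bd hx hy h3, fun i hi j hj => ?_⟩, ?_⟩
      · have h5 := h4 i hi j hj
        have h6 := g2 i j
        by_cases hix : i = x
        · subst hix
          rw [h6.1 ⟨rfl, hj⟩]
          refine ⟨fun k hk hlin => ?_, ?_⟩
          · rcases (lin_lt_succ hy hk).1 hlin with h0 | ⟨-, rfl⟩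
            · exact (min_le_left _ _).trans (h5.1 k hk h0)
            · exact min_le_right _ _
          · rcases min_choice (h''.num aC i j) (I.A i y + I.B y j) with h7 | h7 <;> rw [h7]
            · rcases h5.2 with h8 | ⟨k, hk, h8, h9⟩
              · exact .inl h8
              · exact .inr ⟨k, hk, by omega, h9⟩
            · exact .inr ⟨y, hy, by omega, rfl⟩
        · rw [h6.2 (by tauto)]
          refine ⟨fun k hk hlin => ?_, ?_⟩
          · rcases (lin_lt_succ hy hk).1 hlin with h0 | ⟨h0, -⟩
            · exact h5.1 k hk h0
            · exact absurd h0 hix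
          · rcases h5.2 with h8 | ⟨k, hk, h8, h9⟩
            · exact .inl h8
            · exact .inr ⟨k, hk, by omega, h9⟩
      · have hIn : I.n = n := rfl
        rw [hIn] at ht
        have : (x * b + y + 1) * (7 * n + 10) = (x * b + y) * (7 * n + 10) + (7 * n + 10) := by ring
        omega
    · rintro g t ⟨g1, -, g3⟩ ht
      refine ⟨?_, ?_, fun i hi j hj => ?_⟩
      · have hIn : I.n = n := rfl
        rw [hIn] at ht1
        have e1 : n * b * (7 * n + 10) = 7 * (n * b * n) + 10 * (n * b) := by ring
        have e2 : n * b ≤ n * b * n := Nat.le_mul_of_pos_right _ n1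
        have e3 : 1 ≤ n * n := Nat.mul_pos n1 n1
        omega
      · exact ((Fro.of_fr f2).mono le_rfl (by simp) (by simp)).trans
          ((Fro.of_fr g1).mono le_rfl (by simp) (by simp))
      · have h5 := g3 i hi j hj
        refine ⟨fun k hk => h5.1 k hk (lin_lt hi hk), ?_⟩
        rcases h5.2 with h8 | ⟨k, hk, h8, h9⟩
        · exfalso
          have h6 := h5.1 0 b1 (lin_lt hi b1)
          have a1 := abs_le.1 (bd.A i hi 0 b1)
          have a2 := abs_le.1 (bd.B 0 b1 j hj)
          linarith
        · exact ⟨k, hk, h9⟩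
  · rintro h' t ⟨⟨t₁, h1, h4⟩, h5⟩
    refine ⟨?_, h5⟩
    have a1 : n * b * n * (l + 3) = n * b * n * l + 3 * (n * b * n) := by ring
    have a2 : n * n * (l + 3) = n * n * l + 3 * (n * n) := by ring
    have a3 : n * b * (l + 3) ≤ n * b * n * (l + 3) :=
      Nat.mul_le_mul_right _ (Nat.le_mul_of_pos_right _ n1)
    omega

/-! ### Fixing the memory layout -/

/-- Arithmetic expressions in registers. -/
inductive Ex
  | lit (v : ℕ)
  | reg (q : ℕ)
  | bin (o : Op) (x y : Ex)

namespace Ex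

/-- The value of an expression. -/
def eval (ρ : ℕ → ℕ) : Ex → ℕ
  | lit v => v
  | reg q => ρ q
  | bin o x y => o.eval (x.eval ρ) (y.eval ρ)

/-- The number of nodes of an expression. -/
def size : Ex → ℕ
  | lit _ => 1
  | reg _ => 1
  | bin _ x y => x.size + y.size + 1

/-- An expression uses registers below `40` only. -/
def Low : Ex → Prop
  | lit _ => True
  | reg q => q < 40
  | bin _ x y => x.Low ∧ y.Low

/-- All intermediate values are `w`-bit words. -/
def Fits (w : ℕ) (ρ : ℕ → ℕ) : Ex → Prop
  | lit v => v < 2 ^ w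
  | reg q => ρ q < 2 ^ w
  | bin o x y => x.Fits w ρ ∧ y.Fits w ρ ∧ o.eval (x.eval ρ) (y.eval ρ) < 2 ^ w

/-- Evaluates an expression into the register `d`. -/
def comp : Ex → ℕ → Program
  | lit v, d => .const d v
  | reg q, d => .op .or d q q
  | bin o x y, d => comp x d ;; comp y (d + 1) ;; .op o d d (d + 1)

theorem eval_congr {ρ ρ' : ℕ → ℕ} {e : Ex} (h : ∀ q < 40, ρ q = ρ' q) (hl : e.Low) :
    e.eval ρ = e.eval ρ' := by
  induction e with
  | lit v => rfl
  | reg q => exact h q hl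
  | bin o x y hx hy => simp only [eval, hx hl.1, hy hl.2]

theorem fits_congr {w : ℕ} {ρ ρ' : ℕ → ℕ} {e : Ex} (h : ∀ q < 40, ρ q = ρ' q) (hl : e.Low)
    (hf : e.Fits w ρ) : e.Fits w ρ' := by
  induction e with
  | lit v => exact hf
  | reg q => have := h q hl; unfold Fits at *; omega
  | bin o x y hx hy =>
    exact ⟨hx hl.1 hf.1, hy hl.2 hf.2.1, by
      rw [← eval_congr h hl.1, ← eval_congr h hl.2]; exact hf.2.2⟩

theorem comp_runs {w : ℕ} (e : Ex) {d : ℕ} {s : State} (hd : 40 ≤ d) (hl : e.Low)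
    (hf : e.Fits w s.reg) (hsz : d + e.size ≤ 114) :
    Runs w (e.comp d) s fun s' t => t = e.size ∧ s'.mem = s.mem ∧ s'.reg d = e.eval s.reg ∧
      ∀ q, q < d ∨ 114 ≤ q → s'.reg q = s.reg q := by
  induction e generalizing d s with
  | lit v =>
    simp only [size] at hsz
    refine .const hf ⟨rfl, rfl, by simp [eval], fun q hq => ?_⟩
    rw [State.reg_setReg, if_neg (by omega)]
  | reg q =>
    simp only [size] at hsz
    have hf' : s.reg q < 2 ^ w := hf
    refine .op (by simpa [Op.eval] using hf') ⟨rfl, rfl, by simp [eval, Op.eval], fun q' hq => ?_⟩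
    rw [State.reg_setReg, if_neg (by omega)]
  | bin o x y hx hy =>
    simp only [size] at hsz
    refine .seq ((hx hd hl.1 hf.1 (by omega)).mono ?_)
    rintro s₁ t₁ ⟨ht1, m1, v1, f1⟩
    have e1 : ∀ q < 40, s.reg q = s₁.reg q := fun q hq => (f1 q (by omega)).symm
    refine .seq ((hy (by omega) hl.2 (fits_congr e1 hl.2 hf.2.1) (by omega)).mono ?_)
    rintro s₂ t₂ ⟨ht2, m2, v2, f2⟩
    have e2 : s₂.reg d = x.eval s.reg := by rw [f2 _ (by omega), v1]
    have e3 : s₂.reg (d + 1) = y.eval s.reg := by rw [v2, eval_congr e1 hl.2]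
    refine .op (by rw [e2, e3]; exact hf.2.2) ⟨by simp only [size]; omega, by
      show s₂.mem = _; rw [m2, m1], by rw [State.reg_setReg, if_pos rfl, e2, e3]; rfl,
      fun q hq => ?_⟩
    rw [State.reg_setReg, if_neg (by omega), f2 _ (by omega), f1 _ (by omega)]

end Ex

/-- Assigns the values of expressions to registers, one after the other. -/
def assigns : List (ℕ × Ex) → Program
  | [] => .nop
  | (r, e) :: as => e.comp 40 ;; .op .or r 40 40 ;; assigns as

/-- The registers after such assignments. -/
def assigned : List (ℕ × Ex) → (ℕ → ℕ) → ℕ → ℕ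
  | [], ρ => ρ
  | (r, e) :: as, ρ => assigned as fun q => if q = r then e.eval ρ else ρ q

/-- All values that occur in the assignments are `w`-bit words, and only registers below `40`
are used. -/
def AssignOK (w : ℕ) : List (ℕ × Ex) → (ℕ → ℕ) → Prop
  | [], _ => True
  | (r, e) :: as, ρ => (r < 40 ∧ e.Low ∧ e.size ≤ 74 ∧ e.Fits w ρ) ∧
      AssignOK w as fun q => if q = r then e.eval ρ else ρ q

theorem assigns_runs {w : ℕ} (as : List (ℕ × Ex)) {ρ : ℕ → ℕ} {s : State}
    (hs : ∀ q, q < 40 ∨ 114 ≤ q → s.reg q = ρ q) (hok : AssignOK w as ρ) :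
    Runs w (assigns as) s fun s' t => t ≤ 75 * as.length + 1 ∧ s'.mem = s.mem ∧
      ∀ q, q < 40 ∨ 114 ≤ q → s'.reg q = assigned as ρ q := by
  induction as generalizing s ρ with
  | nil => exact .nop ⟨by simp, rfl, hs⟩
  | cons a as ih =>
    obtain ⟨r, e⟩ := a
    obtain ⟨⟨h1, h2, h3, h4⟩, h5⟩ := hok
    have e1 : ∀ q < 40, ρ q = s.reg q := fun q hq => (hs q (by omega)).symm
    refine .seq ((e.comp_runs le_rfl h2 (Ex.fits_congr e1 h2 h4) (by omega)).mono ?_)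
    rintro s₁ t₁ ⟨ht1, m1, v1, f1⟩
    have hv : e.eval ρ < 2 ^ w := by
      cases e with
      | lit v => exact h4
      | reg q => exact h4
      | bin o x y => exact h4.2.2
    have hv' : s₁.reg 40 = e.eval ρ := by rw [v1, Ex.eval_congr e1 h2]
    refine .seq (.op (by simpa [Op.eval, hv'] using hv) ((ih ?_ h5).mono ?_))
    · intro q hq
      simp only [State.reg_setReg, Op.eval, hv', Nat.or_self]
      split_ifs
      · rfl
      · rw [f1 q (by omega), hs q hq]
    · rintro s' t ⟨ht, hm, hf⟩
      refine ⟨?_, by rw [hm]; exact m1, hf⟩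
      simp only [List.length_cons]; omega

/-- The binary logarithm of the register `src`. -/
def logP (dst src : ℕ) : Program :=
  .const 41 1 ;; .op .shr 40 src 41 ;; .const dst 0 ;;
    .loop 40 (.op .add dst dst 41 ;; .op .shr 40 40 41)

theorem logP_runs {w dst src X : ℕ} {s : State} (hd : dst < 40) (hs : src < 40) (hX : 1 ≤ X)
    (hXw : X < 2 ^ w) (h : s.reg src = X) :
    Runs w (logP dst src) s fun s' t => t ≤ 3 * Nat.log 2 X + 10 ∧ s'.mem = s.mem ∧
      s'.reg dst = Nat.log 2 X ∧ ∀ q, (q < 40 ∧ q ≠ dst) ∨ 114 ≤ q → s'.reg q = s.reg q := by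
  have hle : X / 2 < 2 ^ w := lt_of_le_of_lt (Nat.div_le_self _ _) hXw
  have hlog : Nat.log 2 X ≤ X := Nat.log_le_self _ _
  refine .seq (.const (by omega) (.seq (.op ?_ (.seq (.const (by omega) ?_)))))
  · simp [Op.eval, show src ≠ 41 by omega, h, Nat.shiftRight_eq_div_pow, hle]
  simp only [State.reg_setReg, Op.eval, if_true, show src ≠ 41 by omega, if_false, h,
    Nat.shiftRight_eq_div_pow, pow_one]
  refine (Runs.loop_count (fun i s' => s'.reg 40 = X / 2 ^ (i + 1) ∧ s'.reg 41 = 1 ∧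
    s'.reg dst = i ∧ s'.mem = s.mem ∧ ∀ q, (q < 40 ∧ q ≠ dst) ∨ 114 ≤ q → s'.reg q = s.reg q)
    (Nat.log 2 X) 2 ?_ ?_ ?_).mono ?_
  · refine ⟨by simp [show 40 ≠ dst by omega], by simp [show 41 ≠ dst by omega], by simp, rfl, ?_⟩
    intro q hq
    simp only [State.reg_setReg]
    rw [if_neg (by omega), if_neg (by omega), if_neg (by omega)]
  · rintro i hi s' ⟨h1, h2, h3, h4, h5⟩
    have hpow : 2 ^ (i + 1) ≤ X := Nat.pow_le_of_le_log (by omega) hi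
    refine ⟨?_, .seq (.op ?_ (.op ?_ ⟨⟨?_, ?_, ?_, h4, ?_⟩, by omega⟩))⟩
    · rw [h1]; exact (Nat.div_pos hpow (by positivity)).ne'
    · simp only [Op.eval, h3, h2]; omega
    · simp only [State.reg_setReg, Op.eval, show 40 ≠ dst by omega, show 41 ≠ dst by omega,
        if_false, h1, h2, Nat.shiftRight_eq_div_pow, pow_one]
      exact lt_of_le_of_lt (Nat.div_le_self _ _) (lt_of_le_of_lt (Nat.div_le_self _ _) hXw)
    · simp [Op.eval, show 40 ≠ dst by omega, show 41 ≠ dst by omega, h1, h2,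
        Nat.shiftRight_eq_div_pow, Nat.div_div_eq_div_mul, pow_succ]
    · simp [show 41 ≠ dst by omega, h2]
    · simp [show dst ≠ 40 by omega, Op.eval, h3, h2]
    · intro q hq
      simp only [State.reg_setReg]
      rw [if_neg (by omega), if_neg (by omega), h5 q hq]
  · rintro s' ⟨h1, -⟩
    rw [h1, Nat.div_eq_of_lt]
    exact Nat.lt_pow_succ_log_self (by omega) X
  · rintro s' t ⟨⟨-, -, h3, h4, h5⟩, ht⟩
    exact ⟨by omega, h4, h3, h5⟩

/-- The rules by which the machine finds its parameters. The machine registers `9` and `10` hold the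
logarithms of `n + l` and of `n`; the registers `5, 6, 7` receive the parameters of the memory
layout, and the registers from `15` on the constants of the abstract machine. -/
def setupList (c₁ c₂ p q p' q' : ℕ) : List (ℕ × Ex) :=
  [(7, .bin .add (.reg 3) (.bin .mul (.lit c₁) (.bin .add (.reg 9) (.lit 1)))),
    (6, .bin .shl (.lit 1) (.bin .mul (.lit c₂) (.bin .add (.reg 9) (.lit 1)))),
    (22, .bin .add (.bin .mul (.bin .mul (.reg 0) (.reg 1)) (.bin .add (.reg 3) (.lit 2)))
      (.bin .mul (.bin .mul (.reg 1) (.reg 0)) (.bin .add (.reg 3) (.lit 2)))),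
    (23, .bin .mul (.bin .mul (.reg 0) (.reg 0)) (.bin .add (.reg 3) (.lit 3))),
    (5, .bin .add (.reg 22) (.reg 23)), (15, .reg 0), (16, .reg 1), (18, .reg 7),
    (19, .bin .sub (.reg 7) (.lit 1)),
    (20, .bin .div (.bin .mul (.reg 10) (.lit p)) (.lit q)),
    (21, .bin .div (.bin .mul (.reg 10) (.lit p')) (.lit q')),
    (24, .bin .add (.reg 3) (.lit 1)), (25, .bin .add (.reg 3) (.lit 2)),
    (26, .bin .add (.reg 7) (.lit 1)), (27, .bin .add (.reg 7) (.lit 2)), (28, .reg 0),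
    (29, .bin .add (.reg 3) (.lit 3))]

/-- Computes the parameters of the memory layout. -/
def setup (c₁ c₂ p q p' q' : ℕ) : Program :=
  assigns [(8, .lit 1), (11, .bin .add (.reg 0) (.reg 3))] ;; logP 9 11 ;; logP 10 0 ;;
    assigns (setupList c₁ c₂ p q p' q')

/-- From the initial state of the machine, the setup reaches a representation of an initial state
of the abstract machine. -/
theorem setup_runs {E : Env} {n b l c₁ c₂ p q p' q' : ℕ}
    (A : Matrix (Fin n) (Fin b) (WithTop ℤ)) (B : Matrix (Fin b) (Fin n) (WithTop ℤ))
    (hn : 1 ≤ n) (hW : E.W = l + c₁ * (Nat.log 2 (n + l) + 1))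
    (hN : E.N = 2 ^ (c₂ * (Nat.log 2 (n + l) + 1)))
    (hZ : E.Z = n * b * (l + 2) + b * n * (l + 2) + n * n * (l + 3))
    (hb : b < E.N) (hl : l + 5 ≤ E.W) (hWN : E.W + 2 ≤ E.N) (hnl : n + l < E.N) (hc : 1 ≤ c₂)
    (hlits : ∀ v ∈ [c₁, c₂, p, q, p', q', c₂ * (Nat.log 2 (n + l) + 1), Nat.log 2 n * p,
      Nat.log 2 n * p'], v < E.N) :
    Runs E.w (setup c₁ c₂ p q p' q') (inputState l A B) fun s t =>
      t ≤ 6 * Nat.log 2 (n + l) + 2000 ∧ ∃ h, Rep E h s ∧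
        Init E n b l (Nat.log 2 n * p / q) (Nat.log 2 n * p' / q') (ext A) (ext B) h := by
  have hlt := fun {y : ℕ} (hy : y ≤ E.N) => E.lt_of_lt_N hy
  have hNN := E.hZ
  have hN1 := E.hN
  have i0 : (inputState l A B).reg 0 = n := rfl
  have i1 : (inputState l A B).reg 1 = b := rfl
  have i3 : (inputState l A B).reg 3 = l := rfl
  have ige : ∀ r, 4 ≤ r → (inputState l A B).reg r = 0 := fun r hr => by
    show [n, b, n, l].getD r 0 = 0
    rw [List.getD_eq_default]; simpa using hr
  simp only [List.mem_cons, List.not_mem_nil, or_false, forall_eq_or_imp, forall_eq] at hlits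
  obtain ⟨l1, l2, l3, l4, l5, l6, l7, l8, l9⟩ := hlits
  have hlog : Nat.log 2 n ≤ Nat.log 2 (n + l) := Nat.log_mono_right (by omega)
  have hlog' : Nat.log 2 (n + l) ≤ n + l := Nat.log_le_self _ _
  refine .seq ((assigns_runs _ (ρ := (inputState l A B).reg) (fun _ _ => rfl) ?_).mono ?_)
  · simp only [AssignOK, Ex.Low, Ex.size, Ex.Fits, Ex.eval, Op.eval, i0, i3, OfNat.zero_ne_ofNat,
      Nat.reduceEqDiff, if_false]
    refine ⟨⟨?_, ?_, ?_, hlt (by omega)⟩, ⟨?_, ?_, ?_, hlt (by omega), hlt (by omega),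
      hlt (by omega)⟩, trivial⟩ <;> simp
  rintro s₁ t₁ ⟨ht1, m1, f1⟩
  have a0 : s₁.reg 0 = n := by rw [f1 _ (by omega)]; simp [assigned, i0]
  have a11 : s₁.reg 11 = n + l := by
    rw [f1 _ (by omega)]; simp [assigned, i0, i3, Ex.eval, Op.eval]
  refine .seq ((logP_runs (by omega) (by omega) (by omega) (hlt (by omega)) a11).mono ?_)
  rintro s₂ t₂ ⟨ht2, m2, v2, f2⟩
  refine .seq ((logP_runs (X := n) (by omega) (by omega) (by omega) (hlt (by omega))
    (by rw [f2 _ (by omega), a0])).mono ?_)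
  rintro s₃ t₃ ⟨ht3, m3, v3, f3⟩
  set L := Nat.log 2 (n + l) with hL
  set e := Nat.log 2 n with he
  have hcL : c₂ * (L + 1) = c₂ * L + c₂ := by ring
  have hL1 : L + 1 ≤ c₂ * (L + 1) := Nat.le_mul_of_pos_left _ hc
  have b0 : s₃.reg 0 = n := by rw [f3 _ (by omega), f2 _ (by omega), a0]
  have b1 : s₃.reg 1 = b := by
    rw [f3 _ (by omega), f2 _ (by omega), f1 _ (by omega)]; simp [assigned, i1]
  have b3 : s₃.reg 3 = l := by
    rw [f3 _ (by omega), f2 _ (by omega), f1 _ (by omega)]; simp [assigned, i3]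
  have b8 : s₃.reg 8 = 1 := by
    rw [f3 _ (by omega), f2 _ (by omega), f1 _ (by omega)]; simp [assigned, Ex.eval]
  have b9 : s₃.reg 9 = L := by rw [f3 _ (by omega), v2]
  have b10 : s₃.reg 10 = e := v3
  have bge : ∀ r, (r = 4 ∨ r = 14 ∨ 114 ≤ r) → s₃.reg r = 0 := by
    intro r hr
    rw [f3 _ (by omega), f2 _ (by omega), f1 _ (by omega)]
    simp only [assigned]
    rw [if_neg (by omega), if_neg (by omega), ige _ (by omega)]
  have hm : s₃.mem = (inputState l A B).mem := by rw [m3, m2, m1]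
  have hshl : 1 <<< (c₂ * (L + 1)) = E.N := by rw [hN, Nat.one_shiftLeft]
  have hdiv : ∀ x y : ℕ, x / y ≤ x := fun x y => Nat.div_le_self x y
  have d1 := hdiv (e * p) q
  have d2 := hdiv (e * p') q'
  have k1 : n * b ≤ n * b * (l + 2) := Nat.le_mul_of_pos_right _ (by omega)
  have k2 : b * n ≤ b * n * (l + 2) := Nat.le_mul_of_pos_right _ (by omega)
  have k3 : n * n ≤ n * n * (l + 3) := Nat.le_mul_of_pos_right _ (by omega)
  refine (assigns_runs _ (ρ := s₃.reg) (fun _ _ => rfl) ?_).mono ?_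
  · simp only [setupList, AssignOK, Ex.Low, Ex.size, Ex.Fits, Ex.eval, Op.eval,
      OfNat.zero_ne_ofNat, OfNat.one_ne_ofNat,
      Nat.reduceEqDiff, if_false, if_true, b0, b1, b3, b9, b10, hshl, ← hW]
    norm_num only [and_true, true_and]
    repeat' apply And.intro
    all_goals exact hlt (by omega)
  rintro s₄ t₄ ⟨ht4, m4, f4⟩
  have hm4 : s₄.mem = (inputState l A B).mem := by rw [m4, hm]
  have hlen : (setupList c₁ c₂ p q p' q').length = 17 := rfl
  have g : ∀ r < 40, s₄.reg r = assigned (setupList c₁ c₂ p q p' q') s₃.reg r :=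
    fun r hr => f4 r (by omega)
  simp only [setupList, assigned, Ex.eval, Op.eval,
      OfNat.zero_ne_ofNat, OfNat.one_ne_ofNat,
      Nat.reduceEqDiff, if_false, if_true, b0, b1, b3, b9, b10, hshl, ← hW] at g
  have hmem : ∀ z, (inputState l A B).mem z = inCell n b (l + 1) (ext A) (ext B) z :=
    inputWords_getD A B
  have hzero : ∀ z, E.Z ≤ z → s₄.mem z = 0 := by
    intro z hz
    rw [hm4, hmem, inCell, if_neg, if_neg]
    · show ¬ z < n * b * (l + 2) + b * n * (l + 2)
      omega
    · show ¬ z < n * b * (l + 2)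
      omega
  refine ⟨?_, ⟨fun r => s₄.reg (r + 14), s₄.mem, fun _ _ _ => 0, fun _ _ _ => 0⟩, ?_, ?_⟩
  · rw [hlen] at ht4; simp only [List.length_cons, List.length_nil] at ht1; omega
  · refine ⟨fun _ => rfl, ?_, ?_, ?_, ?_, ?_, fun _ _ => rfl, fun a x y _ _ => ?_,
      fun a x y _ _ i _ => ?_⟩
    · rw [g _ (by omega)]; simpa using bge 4 (by omega)
    · rw [g _ (by omega)]; simp [hZ]
    · rw [g _ (by omega)]; simp
    · rw [g _ (by omega)]; simp
    · rw [g _ (by omega)]; simpa using b8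
    · exact hzero _ (Nat.le_add_right _ _)
    · rw [bit_zero']
      exact hzero _ ((Nat.le_add_right _ _).trans (Nat.le_add_right _ _))
  · have hge : ∀ r, 114 ≤ r → s₄.reg r = 0 := by
      intro r hr
      rw [f4 _ (by omega)]
      simp only [setupList, assigned]
      iterate 17 rw [if_neg (by omega)]
      exact bge r (by omega)
    constructor
    any_goals (show s₄.reg _ = _; rw [g _ (by omega)]; simp; done)
    · show s₄.reg 14 = 0
      rw [g _ (by omega)]; simpa using bge 14 (by omega)
    · intro r hr; exact hge _ (by omega)
    · intro _ _ _; rfl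
    · intro _ _ _; rfl
    · intro z hz
      show s₄.mem z = _
      rw [hm4, hmem]

/-! ### The word length -/

theorem entryCell_lt (x : WithTop ℤ) (t : ℕ) : entryCell x t < 2 := by
  unfold entryCell
  split_ifs
  · omega
  · omega
  · exact bit_lt _ _

theorem inCell_lt (n b nb : ℕ) (A B : ℕ → ℕ → WithTop ℤ) (z : ℕ) : inCell n b nb A B z < 2 := by
  unfold inCell
  split_ifs
  · exact entryCell_lt _ _
  · exact entryCell_lt _ _
  · omega

/-- The word length and the parameters of the memory layout: there are constants such that words of
`κ (log (n + l) + 1)` bits, integers of `l + c₁ (log (n + l) + 1)` bits and arrays of side length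
`2 ^ (c₂ (log (n + l) + 1))` suffice for everything that the algorithms need. -/
theorem exists_env (β' κ₀ p q p' q' : ℕ) : ∃ c₁ c₂ κ : ℕ, 1 ≤ c₂ ∧ ∀ n b l : ℕ, 1 ≤ n →
    b ≤ n ^ β' → ∃ E : Env, E.w = κ * (Nat.log 2 (n + l) + 1) ∧
      E.W = l + c₁ * (Nat.log 2 (n + l) + 1) ∧
      E.N = 2 ^ (c₂ * (Nat.log 2 (n + l) + 1)) ∧
      E.Z = n * b * (l + 2) + b * n * (l + 2) + n * n * (l + 3) ∧
      b < E.N ∧ l + 5 ≤ E.W ∧ E.W + 2 ≤ E.N ∧ n + l + 1 < E.N ∧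
      (∀ v ∈ [c₁, c₂, p, q, p', q', c₂ * (Nat.log 2 (n + l) + 1), Nat.log 2 n * p,
        Nat.log 2 n * p'], v < E.N) ∧
      64 * 2 ^ (l + 2) + 64 * 2 ^ (Nat.log 2 n * p' / q') + 64 * (n * b) ≤ 2 ^ (E.W - 1) ∧
      64 * 2 ^ (Nat.log 2 n * p / q) ≤ 2 ^ (E.W - 1) ∧
      n * b * (E.W + 1) + b * n * (E.W + 1) + n * n * (E.W + 2) < E.N ∧
      2 ^ (κ₀ * (Nat.log 2 (n + (E.W - 1)) + 1)) ≤ E.N := by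
  obtain ⟨c₁, hc₁⟩ : ∃ c, c = β' + p + p' + 20 := ⟨_, rfl⟩
  obtain ⟨c₂, hc₂⟩ : ∃ c, c = κ₀ * (c₁ + 2) + (β' + c₁ + p + p' + q + q' + 30) := ⟨_, rfl⟩
  refine ⟨c₁, c₂, 2 * c₂ + c₁ + 10, by omega, fun n b l hn hb => ?_⟩
  obtain ⟨L, hL⟩ : ∃ L, L = Nat.log 2 (n + l) := ⟨_, rfl⟩
  obtain ⟨W, hW⟩ : ∃ W, W = l + c₁ * (L + 1) := ⟨_, rfl⟩
  -- all sizes are compared with powers of `X`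
  obtain ⟨X, hX⟩ : ∃ X, X = 2 ^ (L + 1) := ⟨_, rfl⟩
  rw [← hL]
  have hpow : ∀ c, 2 ^ (c * (L + 1)) = X ^ c := fun c => by rw [hX, ← pow_mul, Nat.mul_comm]
  have X2 : 2 ≤ X := by rw [hX, pow_succ]; have := Nat.one_le_two_pow (n := L); omega
  have Xmono : ∀ {i j}, i ≤ j → X ^ i ≤ X ^ j := fun h => Nat.pow_le_pow_right (by omega) h
  have Xlt : ∀ c, c < X ^ c := fun c => Nat.lt_pow_self (by omega)
  have hnl : n + l < X := by rw [hX, hL]; exact Nat.lt_pow_succ_log_self (by omega) _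
  have hLX : L + 1 < X := by rw [hX]; exact Nat.lt_two_pow_self
  have hbX : b ≤ X ^ β' := hb.trans (Nat.pow_le_pow_left (by omega) _)
  have hlogn : Nat.log 2 n ≤ L := by rw [hL]; exact Nat.log_mono_right (by omega)
  have hcL : c₁ * (L + 1) = (β' + p + p') * (L + 1) + 20 * (L + 1) := by rw [hc₁]; ring
  have hWX : W + 2 ≤ X ^ (c₁ + 3) := by
    have h1 : c₁ * (L + 1) ≤ c₁ * X := Nat.mul_le_mul_left _ hLX.le
    have h2 : W + 2 ≤ (c₁ + 2) * X := by rw [add_mul]; omega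
    calc W + 2 ≤ (c₁ + 2) * X := h2
      _ ≤ X ^ (c₁ + 2) * X := Nat.mul_le_mul_right _ (Xlt _).le
      _ = X ^ (c₁ + 3) := by ring
  have hnb : n * b ≤ X ^ (β' + 1) := by
    rw [pow_succ, Nat.mul_comm]; exact Nat.mul_le_mul hbX (by omega)
  have hfit' : n * b * (W + 1) + b * n * (W + 1) + n * n * (W + 2) < X ^ (β' + c₁ + 8) := by
    have h1 : n * b * (W + 1) ≤ X ^ (β' + c₁ + 5) := by
      calc n * b * (W + 1) ≤ X ^ (β' + 1) * X ^ (c₁ + 3) := Nat.mul_le_mul hnb (by omega)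
        _ = X ^ (β' + 1 + (c₁ + 3)) := (pow_add _ _ _).symm
        _ ≤ _ := Xmono (by omega)
    have h2 : n * n * (W + 2) ≤ X ^ (β' + c₁ + 5) := by
      calc n * n * (W + 2) ≤ X * X * X ^ (c₁ + 3) :=
            Nat.mul_le_mul (Nat.mul_le_mul (by omega) (by omega)) hWX
        _ = X ^ (2 + (c₁ + 3)) := by rw [pow_add]; ring
        _ ≤ _ := Xmono (by omega)
    have h3 : 8 * X ^ (β' + c₁ + 5) ≤ X ^ (β' + c₁ + 8) := by
      rw [show β' + c₁ + 8 = 3 + (β' + c₁ + 5) by ring, pow_add X 3]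
      exact Nat.mul_le_mul_right _ (Nat.pow_le_pow_left X2 3)
    have h4 : 1 ≤ X ^ (β' + c₁ + 5) := Nat.one_le_pow _ _ (by omega)
    rw [Nat.mul_comm b n]
    omega
  have hN1 : X ^ (β' + c₁ + 8) ≤ X ^ c₂ := Xmono (by omega)
  have hZ : n * b * (l + 2) + b * n * (l + 2) + n * n * (l + 3) ≤
      n * b * (W + 1) + b * n * (W + 1) + n * n * (W + 2) := by
    have : l + 20 ≤ W := by omega
    exact Nat.add_le_add (Nat.add_le_add (Nat.mul_le_mul_left _ (by omega))
      (Nat.mul_le_mul_left _ (by omega))) (Nat.mul_le_mul_left _ (by omega))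
  have hXN : X ^ 4 ≤ X ^ c₂ := Xmono (by omega)
  have hX4 : 8 * X ≤ X ^ 4 := by
    rw [pow_succ]; exact Nat.mul_le_mul_right _ (Nat.pow_le_pow_left X2 3)
  have hWN : W + 2 ≤ X ^ c₂ := hWX.trans (Xmono (by omega))
  have ccN : ∀ v, v ≤ c₂ → v < X ^ c₂ := fun v hv => lt_of_le_of_lt hv (Xlt c₂)
  have hlogN : ∀ v, v + 1 ≤ c₂ → Nat.log 2 n * v < X ^ c₂ := by
    intro v hv
    have h1 := Xlt v
    calc Nat.log 2 n * v < X * X ^ v := by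
          rcases Nat.eq_zero_or_pos v with rfl | h
          · simp; omega
          · exact Nat.mul_lt_mul'' (by omega) h1
      _ = X ^ (v + 1) := by ring
      _ ≤ _ := Xmono hv
  have small : ∀ u, u + 3 ≤ W → 2 ^ u ≤ 2 ^ (W - 3) := fun u hu =>
    Nat.pow_le_pow_right (by omega) (by omega)
  have e4 : 2 ^ (W - 1) = 4 * 2 ^ (W - 3) := by
    rw [show W - 1 = 2 + (W - 3) by omega, pow_add]; rfl
  have hdiv : ∀ v v' : ℕ, Nat.log 2 n * v / v' ≤ v * (L + 1) := fun v v' =>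
    (Nat.div_le_self _ _).trans (by rw [Nat.mul_comm]; exact Nat.mul_le_mul_left _ (by omega))
  have eT : ∀ v v' : ℕ, v ≤ p + p' → 64 * 2 ^ (Nat.log 2 n * v / v') ≤ 2 ^ (W - 3) := by
    intro v v' hv
    have h1 := hdiv v v'
    have h2 : v * (L + 1) ≤ (β' + p + p') * (L + 1) := Nat.mul_le_mul_right _ (by omega)
    have := small (6 + Nat.log 2 n * v / v') (by omega)
    rwa [pow_add] at this
  refine ⟨⟨(2 * c₂ + c₁ + 10) * (L + 1), n * b * (l + 2) + b * n * (l + 2) + n * n * (l + 3),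
    2 ^ (c₂ * (L + 1)), W, by omega, ?_, ?_, ?_, ?_⟩, rfl, hW, rfl, rfl, ?_, ?_, ?_, ?_, ?_, ?_, ?_, ?_, ?_⟩
  all_goals simp only [hpow]
  · omega
  · omega
  · omega
  · have h1 : X ^ c₂ * X ^ c₂ * 64 * (W + 2) ≤ X ^ (2 * c₂ + c₁ + 9) := by
      calc X ^ c₂ * X ^ c₂ * 64 * (W + 2) ≤ X ^ c₂ * X ^ c₂ * X ^ 6 * X ^ (c₁ + 3) :=
            Nat.mul_le_mul (Nat.mul_le_mul_left _ (Nat.pow_le_pow_left X2 6)) hWX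
        _ = _ := by rw [← pow_add, ← pow_add, ← pow_add]; congr 1; ring
    have h2 : X ^ (2 * c₂ + c₁ + 9) ≤ X ^ (2 * c₂ + c₁ + 10) := Xmono (by omega)
    have h3 : X ^ c₂ ≤ X ^ c₂ * X ^ c₂ * 64 := by
      rw [Nat.mul_assoc]; exact Nat.le_mul_of_pos_right _ (by positivity)
    rw [Nat.mul_add] at h1
    omega
  · refine lt_of_le_of_lt hbX (Nat.pow_lt_pow_right (by omega) (by omega))
  · omega
  · exact hWN
  · omega
  · simp only [List.mem_cons, List.not_mem_nil, or_false, forall_eq_or_imp, forall_eq]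
    refine ⟨ccN _ (by omega), ccN _ (by omega), ccN _ (by omega), ccN _ (by omega), ccN _ (by omega),
      ccN _ (by omega), ?_, hlogN _ (by omega), hlogN _ (by omega)⟩
    rw [← hpow]; exact Nat.lt_two_pow_self
  · have h1 : 64 * 2 ^ (l + 2) ≤ 2 ^ (W - 3) := by
      have := small (6 + (l + 2)) (by omega)
      rwa [pow_add] at this
    have h2 := eT p' q' (by omega)
    have h3 : 64 * (n * b) ≤ 2 ^ (W - 3) := by
      have h4 : (β' + 1) * (L + 1) ≤ (β' + p + p') * (L + 1) + (L + 1) := by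
        rw [add_mul, one_mul, add_assoc β', add_mul]; omega
      have := small (6 + (β' + 1) * (L + 1)) (by omega)
      rw [pow_add, hpow] at this
      omega
    omega
  · have := eT p q (by omega)
    omega
  · omega
  · have h1 : Nat.log 2 (n + (W - 1)) < L + c₁ + 2 := by
      refine Nat.log_lt_of_lt_pow (by omega) ?_
      have h2 : c₁ * (L + 1) ≤ c₁ * X := Nat.mul_le_mul_left _ hLX.le
      have h3 : (c₁ + 1) * X ≤ 2 ^ (c₁ + 1) * X := Nat.mul_le_mul_right _ Nat.lt_two_pow_self.le
      have h4 : 2 ^ (L + c₁ + 2) = 2 ^ (c₁ + 1) * X := by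
        rw [hX, ← pow_add]; congr 1; ring
      rw [add_mul] at h3
      omega
    rw [← hpow]
    refine Nat.pow_le_pow_right (by omega) ?_
    calc κ₀ * (Nat.log 2 (n + (W - 1)) + 1) ≤ κ₀ * ((c₁ + 2) * (L + 1)) :=
          Nat.mul_le_mul_left _ (by
            have : (c₁ + 2) * (L + 1) = c₁ * L + c₁ + 2 * L + 2 := by ring
            omega)
      _ = κ₀ * (c₁ + 2) * (L + 1) := by ring
      _ ≤ c₂ * (L + 1) := Nat.mul_le_mul_right _ (by omega)

/-- A program for the abstract machine that is correct from the state `Init` on computes the product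
once the setup has been run before it. -/
theorem computes_of_solve {E : Env} {n b l c₁ c₂ p q p' q' : ℕ} {P : Program}
    {A : Matrix (Fin n) (Fin b) (WithTop ℤ)} {B : Matrix (Fin b) (Fin n) (WithTop ℤ)}
    (hn : 1 ≤ n) (hW : E.W = l + c₁ * (Nat.log 2 (n + l) + 1))
    (hN : E.N = 2 ^ (c₂ * (Nat.log 2 (n + l) + 1)))
    (hZ : E.Z = n * b * (l + 2) + b * n * (l + 2) + n * n * (l + 3))
    (hb : b < E.N) (hl : l + 5 ≤ E.W) (hWN : E.W + 2 ≤ E.N) (hnl : n + l < E.N) (hc : 1 ≤ c₂)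
    (hlits : ∀ v ∈ [c₁, c₂, p, q, p', q', c₂ * (Nat.log 2 (n + l) + 1), Nat.log 2 n * p,
      Nat.log 2 n * p'], v < E.N) {K : ℕ → Prop}
    (hP : ∀ h, Init E n b l (Nat.log 2 n * p / q) (Nat.log 2 n * p' / q') (ext A) (ext B) h →
      Tri E P h fun h' t => K t ∧ ∀ z < n * n * (l + 3),
        h'.raw (n * b * (l + 2) + b * n * (l + 2) + z) =
          encCell (l + 2) n (mpF b (ext A) (ext B)) z) :
    ∃ t k, ComputesIn E.w (setup c₁ c₂ p q p' q' ;; P) l A B t ∧ K k ∧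
      t ≤ 60 * E.W * k + 6 * Nat.log 2 (n + l) + 2000 := by
  have hlt := fun {y : ℕ} (hy : y ≤ E.N) => E.lt_of_lt_N hy
  obtain ⟨t₁, s₁, x₁, ht₁, h₁, rep₁, init₁⟩ := setup_runs A B hn hW hN hZ hb hl hWN hnl hc hlits
  obtain ⟨t₂, s₂, x₂, h₂, k, ht₂, rep₂, hk, out₂⟩ := hP h₁ init₁ s₁ rep₁
  refine ⟨t₁ + t₂, k, ⟨⟨?_, ?_⟩, s₂, .seq x₁ x₂, ?_⟩, hk, ?_⟩
  · intro r
    show [n, b, n, l].getD r 0 < 2 ^ E.w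
    rcases r with _ | _ | _ | _ | r
    · exact hlt (y := n) (by omega)
    · exact hlt (y := b) (by omega)
    · exact hlt (y := n) (by omega)
    · exact hlt (y := l) (by omega)
    · simp
  · intro z
    show (inputWords l A B).getD z 0 < 2 ^ E.w
    rw [inputWords_getD]
    exact (inCell_lt _ _ _ _ _ _).trans_le (hlt (by have := E.hN; omega : 2 ≤ E.N)).le
  · intro z hz
    rw [length_encodeMatrix] at hz
    have hz' : z < n * n * (l + 3) := hz
    rw [length_inputWords, rep₂.raw _ (by omega), out₂ z hz']
    simp only [encodeMatrix_eq, List.getElem_map, List.getElem_range]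
    refine encCell_congr (r := n) (fun i hi j hj => ?_) hz
    rw [ext_minPlus _ _ hi hj]
  · have : E.unit * k = 60 * E.W * k := rfl
    omega

/-! ### Programs for the word RAM -/

theorem two_errOf_le (e : ℕ) : 2 * errOf e ≤ 2 ^ e := by
  unfold errOf
  split_ifs with h
  · positivity
  · obtain ⟨e, rfl⟩ : ∃ e', e = e' + 1 := ⟨e - 1, by omega⟩
    rw [Nat.add_sub_cancel, pow_succ, mul_comm]

/-- The contribution of the row `k` to the total range. -/
noncomputable def rowRange {b c : ℕ} (B : Matrix (Fin b) (Fin c) (WithTop ℤ)) (k : ℕ) : ℕ :=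
  if h : k < b then (Finset.univ.filter fun j => B ⟨k, h⟩ j ≠ ⊤).sup fun j =>
    ((B ⟨k, h⟩ j).untopD 0 - (B ⟨k, h⟩ ⟨0, j.pos⟩).untopD 0 + 1).toNat else 0

theorem sum_rowRange {b c : ℕ} (B : Matrix (Fin b) (Fin c) (WithTop ℤ)) :
    ∑ k ∈ Finset.range b, rowRange B k = totalRange B := by
  rw [Finset.sum_range]
  refine Finset.sum_congr rfl fun k _ => ?_
  rw [rowRange, dif_pos k.2]

theorem le_rowRange {b c : ℕ} (B : Matrix (Fin b) (Fin c) (WithTop ℤ)) {k j : ℕ} (hk : k < b)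
    (hj : j < c) (h : ext B k j ≠ ⊤) :
    (ext B k j).untopD 0 ≤ (ext B k 0).untopD 0 + rowRange B k := by
  have e1 : ext B k j = B ⟨k, hk⟩ ⟨j, hj⟩ := ext_fin B ⟨k, hk⟩ ⟨j, hj⟩
  have e2 : ext B k 0 = B ⟨k, hk⟩ ⟨0, by omega⟩ := ext_fin B ⟨k, hk⟩ ⟨0, by omega⟩
  rw [rowRange, dif_pos hk, e1, e2]
  rw [e1] at h
  have hmem : (⟨j, hj⟩ : Fin c) ∈ Finset.univ.filter fun j => B ⟨k, hk⟩ j ≠ ⊤ := by simpa using h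
  have h5 : ((B ⟨k, hk⟩ ⟨j, hj⟩).untopD 0 - (B ⟨k, hk⟩ ⟨0, by omega⟩).untopD 0 + 1).toNat ≤
      (Finset.univ.filter fun j => B ⟨k, hk⟩ j ≠ ⊤).sup fun j =>
        ((B ⟨k, hk⟩ j).untopD 0 - (B ⟨k, hk⟩ ⟨0, j.pos⟩).untopD 0 + 1).toNat :=
    Finset.le_sup (f := fun j : Fin c => ((B ⟨k, hk⟩ j).untopD 0 -
      (B ⟨k, hk⟩ ⟨0, j.pos⟩).untopD 0 + 1).toNat) hmem
  omega

theorem HasBits.ext {a b l : ℕ} {A : Matrix (Fin a) (Fin b) (WithTop ℤ)} (h : HasBits l A) :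
    ∀ i < a, ∀ j < b, ∀ v : ℤ, ext A i j = v → |v| < 2 ^ l := fun i hi j hj v hv =>
  h ⟨i, hi⟩ ⟨j, hj⟩ v (by rw [← hv]; exact (ext_fin A ⟨i, hi⟩ ⟨j, hj⟩).symm)

theorem IsMonotone.ext {b c : ℕ} {B : Matrix (Fin b) (Fin c) (WithTop ℤ)} (h : IsMonotone B) :
    ∀ k < b, ∀ j j', j ≤ j' → j' < c → ext B k j ≤ ext B k j' := fun k hk j j' hj hj' => by
  have e1 := ext_fin B ⟨k, hk⟩ ⟨j, by omega⟩
  have e2 := ext_fin B ⟨k, hk⟩ ⟨j', hj'⟩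
  simp only at e1 e2
  rw [e1, e2]
  exact h ⟨k, hk⟩ (Fin.mk_le_mk.2 hj)

/-- The trivial algorithm. -/
theorem exists_naive_program (β' : ℕ) : ∃ (P : Program) (κ D c : ℕ), ∀ n b l : ℕ, 1 ≤ n → 1 ≤ b →
    b ≤ n ^ β' → ∀ (A : Matrix (Fin n) (Fin b) (WithTop ℤ)) (B : Matrix (Fin b) (Fin n) (WithTop ℤ)),
      HasBits l A → HasBits l B → ∃ t, ComputesIn (κ * (Nat.log 2 (n + l) + 1)) P l A B t ∧
        t ≤ D * (l + c * (Nat.log 2 (n + l) + 1)) ^ 2 * (n * b * n) := by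
  obtain ⟨c₁, c₂, κ, hc₂, henv⟩ := exists_env β' 0 0 0 0 0
  refine ⟨setup c₁ c₂ 0 0 0 0 ;; solve naive, κ, 50000, c₁, fun n b l hn hb hbn A B hA hB => ?_⟩
  obtain ⟨E, hw, hW, hN, hZ, h1, h2, h3, h4, h5, h6, h7, h8, h9⟩ := henv n b l hn hbn
  have h1' := E.hZ
  obtain ⟨t, k, hc, hk, ht⟩ := computes_of_solve (A := A) (B := B) hn hW hN hZ h1 h2 h3 (by omega) hc₂ h5
    (fun h hi => Tri.solveNaive (l := l) ⟨hn, hb, by omega, h1, h2, hZ.ge, by simp, by simp⟩ hi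
      h6 hA.ext hB.ext)
  rw [hw] at hc
  refine ⟨t, hc, ?_⟩
  rw [← hW]
  have hL : Nat.log 2 (n + l) ≤ E.W + n := (Nat.log_le_self _ _).trans (by omega)
  have e1 : n ≤ n * b * n := by
    calc n = n * 1 * 1 := by ring
      _ ≤ n * b * n := Nat.mul_le_mul (Nat.mul_le_mul_left _ hb) hn
  have e2 : n * n ≤ n * b * n := Nat.mul_le_mul_right _ (Nat.le_mul_of_pos_right _ hb)
  obtain ⟨V, hV⟩ : ∃ V, V = n * b * n := ⟨_, rfl⟩
  rw [← hV] at e1 e2 hk ⊢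
  generalize E.W = W at hk ht h2 hL ⊢
  have e3 : n * n * (l + 3) ≤ V * W := Nat.mul_le_mul e2 (by omega)
  have e4 : V * (l + 3) ≤ V * W := Nat.mul_le_mul le_rfl (by omega)
  have e5 : W ≤ V * W := Nat.le_mul_of_pos_left _ (by omega)
  have e6 : V ≤ V * W := Nat.le_mul_of_pos_right _ (by omega)
  simp only [Nat.mul_zero, Nat.zero_div] at hk
  have e7 : k ≤ 600 * (V * W) := by omega
  have e8 : 60 * W * k ≤ 60 * W * (600 * (V * W)) := Nat.mul_le_mul le_rfl e7
  have e9 : V * W ≤ V * W * W := Nat.le_mul_of_pos_right _ (by omega)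
  have e10 : 60 * W * (600 * (V * W)) = 36000 * (V * W * W) := by ring
  have e11 : 50000 * W ^ 2 * V = 50000 * (V * W * W) := by ring
  omega

/-- The algorithm for monotone matrices as a program for the word RAM. It uses a program `P` for
`W - 1`-bit matrices in which the entries of `A` are at most `2 ^ ⌊⌊log n⌋ p' / q'⌋`, and the
threshold `2 ^ ⌊⌊log n⌋ p / q⌋`. Here `t₀` is a bound on the time of `P`, `S` is the number of
segments and `r` the number of rounds. -/
theorem exists_monotone_program (β' κ₀ p q p' q' : ℕ) (P : Program) :
    ∃ (P' : Program) (κ D c : ℕ), ∀ n b l : ℕ, 1 ≤ n → 1 ≤ b → b ≤ n ^ β' →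
      ∃ W, 1 ≤ W ∧ W = l + c * (Nat.log 2 (n + l) + 1) ∧
      ∀ (A : Matrix (Fin n) (Fin b) (WithTop ℤ)) (B : Matrix (Fin b) (Fin n) (WithTop ℤ)),
      HasBits l A → HasBits l B → IsMonotone B → ∀ t₀,
      (∀ (A' : Matrix (Fin n) (Fin b) (WithTop ℤ)) (B' : Matrix (Fin b) (Fin n) (WithTop ℤ)),
        (∀ i k, ∀ v : ℤ, A' i k = v → |v| ≤ 2 ^ (Nat.log 2 n * p' / q')) →
        HasBits (W - 1) A' → HasBits (W - 1) B' →
        ∃ t, ComputesIn (κ₀ * (Nat.log 2 (n + (W - 1)) + 1)) P (W - 1) A' B' t ∧ t ≤ t₀) →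
      ∃ t S r, ComputesIn (κ * (Nat.log 2 (n + l) + 1)) P' l A B t ∧
        t ≤ D * W ^ 2 * (n * S + n * b + n * n + n * 2 ^ (Nat.log 2 n * p / q) +
          r * (n * b + n * n + t₀)) ∧
        S * 2 ^ (Nat.log 2 n * p' / q') ≤
          2 * totalRange B + 4 * b * 2 ^ (Nat.log 2 n * p' / q') ∧
        r * 2 ^ (Nat.log 2 n * p / q) ≤ n * b := by
  obtain ⟨c₁, c₂, κ, hc₂, henv⟩ := exists_env β' κ₀ p q p' q'
  obtain ⟨R, hR⟩ : ∃ R, R = max (regBound P) 4 := ⟨_, rfl⟩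
  refine ⟨setup c₁ c₂ p q p' q' ;; solve (core R (sim P)), κ, 60 * (1000 + R + 3 * p + 3 * p'), c₁,
    fun n b l hn hb hbn => ?_⟩
  obtain ⟨E, hw, hW, hN, hZ, h1, h2, h3, h4, h5, h6, h7, h8, h9⟩ := henv n b l hn hbn
  refine ⟨E.W, E.hW, hW, fun A B hA hB hmono t₀ hP => ?_⟩
  have h1' := E.hZ
  obtain ⟨tE, htE⟩ : ∃ tE, tE = Nat.log 2 n * p / q := ⟨_, rfl⟩
  obtain ⟨eE, heE⟩ : ∃ eE, eE = Nat.log 2 n * p' / q' := ⟨_, rfl⟩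
  rw [← heE] at hP
  have h5' := h5
  simp only [List.mem_cons, List.not_mem_nil, or_false, forall_eq_or_imp, forall_eq] at h5'
  have d1 : tE ≤ Nat.log 2 n * p := by rw [htE]; exact Nat.div_le_self _ _
  have d2 : eE ≤ Nat.log 2 n * p' := by rw [heE]; exact Nat.div_le_self _ _
  have hor : OracleOK E n b (2 * errOf eE) R t₀ (sim P) := by
    rw [hR]
    refine oracleOK_sim h9 h8.le ?_ fun A' B' hA' => hP A' B' fun i k v hv =>
      (hA' i k v hv).trans (two_errOf_le eE)
    refine (two_errOf_le eE).trans_lt ?_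
    have : 2 ^ eE < 2 ^ (E.W - 1) := by
      rw [← heE] at h6
      have := Nat.one_le_two_pow (n := l + 2)
      omega
    exact_mod_cast this
  obtain ⟨t, k, hc, ⟨S, r, hk, hS, hr⟩, ht⟩ := computes_of_solve (A := A) (B := B) hn hW hN hZ h1 h2
    h3 (by omega) hc₂ h5 (fun h hi => Tri.solveMonotone (l := l) (ρ := rowRange B)
      ⟨hn, hb, by omega, h1, h2, hZ.ge, by omega, by omega⟩ hi h6 h7 (by omega) h8 (heE ▸ hor)
      hA.ext hB.ext hmono.ext fun k hk j hj => le_rowRange B hk hj)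
  rw [hw] at hc
  rw [sum_rowRange] at hS
  rw [← heE, ← htE] at *
  refine ⟨t, S, r, hc, ?_, hS, hr⟩
  have hlog : Nat.log 2 n ≤ Nat.log 2 (n + l) := Nat.log_mono_right (by omega)
  have hc1 : 1 ≤ c₁ := by
    rcases Nat.eq_zero_or_pos c₁ with h | h
    · rw [h] at hW; omega
    · exact h
  have hLW : Nat.log 2 (n + l) + 1 ≤ E.W := by
    rw [hW]; exact (Nat.le_mul_of_pos_left _ hc1).trans (Nat.le_add_left _ _)
  generalize E.W = W at hk ht h2 hLW ⊢
  have d3 : tE ≤ p * W := d1.trans (by rw [Nat.mul_comm]; exact Nat.mul_le_mul_left _ (by omega))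
  have d4 : eE ≤ p' * W := d2.trans (by rw [Nat.mul_comm]; exact Nat.mul_le_mul_left _ (by omega))
  have n2 : 1 ≤ n * n := Nat.mul_pos hn hn
  have nn : n ≤ n * n := Nat.le_mul_of_pos_left _ hn
  obtain ⟨U, hU⟩ : ∃ U, U = n * b + n * n + t₀ := ⟨_, rfl⟩
  obtain ⟨V, hV⟩ : ∃ V, V = n * S + n * b + n * n + n * 2 ^ tE + r * U := ⟨_, rfl⟩
  rw [← hU, ← hV]
  have e1 : 3 * n + n * b * (10 * W + 100) + n * n * (6 * W + 43) + t₀ + R + 30 ≤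
      (300 + R) * (W * U) := by
    have a1 : U ≤ W * U := Nat.le_mul_of_pos_left _ (by omega)
    have a2 : W * U = W * (n * b) + W * (n * n) + W * t₀ := by rw [hU]; ring
    have a3 : n * b * (10 * W + 100) = 10 * (W * (n * b)) + 100 * (n * b) := by ring
    have a4 : n * n * (6 * W + 43) = 6 * (W * (n * n)) + 43 * (n * n) := by ring
    have a5 : R ≤ R * (W * U) := Nat.le_mul_of_pos_right _ (by omega)
    rw [add_mul]
    omega
  have e2 := Nat.mul_le_mul_left r e1
  have e3 : r * ((300 + R) * (W * U)) = (300 + R) * (W * (r * U)) := by ring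
  have e4 : k ≤ (700 + R + 3 * p + 3 * p') * (W * V) := by
    have a1 : W * V = W * (n * S) + W * (n * b) + W * (n * n) + W * (n * 2 ^ tE) + W * (r * U) := by
      rw [hV]; ring
    have a2 : n * S ≤ W * (n * S) := Nat.le_mul_of_pos_left _ (by omega)
    have a3 : n * b * (l + 3) ≤ W * (n * b) := by
      rw [Nat.mul_comm W]; exact Nat.mul_le_mul_left _ (by omega)
    have a4 : n * n * (l + 3) ≤ W * (n * n) := by
      rw [Nat.mul_comm W]; exact Nat.mul_le_mul_left _ (by omega)
    have a5 : n * 2 ^ tE ≤ W * (n * 2 ^ tE) := Nat.le_mul_of_pos_left _ (by omega)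
    have a6 : W ≤ W * (n * n) := Nat.le_mul_of_pos_right _ n2
    have a7 : W ≤ W * V := by omega
    have a8 : p * W ≤ p * (W * V) := Nat.mul_le_mul_left _ a7
    have a9 : p' * W ≤ p' * (W * V) := Nat.mul_le_mul_left _ a7
    have a10 : (300 + R) * (W * (r * U)) ≤ (300 + R) * (W * V) := Nat.mul_le_mul_left _ (by omega)
    have a11 : (700 + R + 3 * p + 3 * p') * (W * V) =
      400 * (W * V) + (300 + R) * (W * V) + 3 * (p * (W * V)) + 3 * (p' * (W * V)) := by ring
    omega
  have e5 := Nat.mul_le_mul_left (60 * W) e4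
  have e6 : 60 * W * ((700 + R + 3 * p + 3 * p') * (W * V)) + 60 * 300 * (W ^ 2 * V) =
    60 * (1000 + R + 3 * p + 3 * p') * W ^ 2 * V := by ring
  have e7 : W ≤ W ^ 2 * V := by
    calc W = W * 1 * 1 := by ring
      _ ≤ W * W * V := Nat.mul_le_mul (Nat.mul_le_mul_left _ (by omega)) (by omega)
      _ = W ^ 2 * V := by ring
  omega

/-! ### Lower bounds for the number of steps -/

theorem Exec.det {w : ℕ} {P : Program} {s s' : State} {t : ℕ} (h : Exec w P s t s') :
    ∀ {t₂ s₂}, Exec w P s t₂ s₂ → s₂ = s' := by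
  induction h with
  | nop => rintro _ _ ⟨⟩; rfl
  | const => rintro _ _ ⟨⟩; rfl
  | op => rintro _ _ ⟨⟩; rfl
  | load => rintro _ _ ⟨⟩; rfl
  | store => rintro _ _ ⟨⟩; rfl
  | seq _ _ ih₁ ih₂ =>
    intro _ _ h
    cases h with
    | seq h₁ h₂ =>
      cases ih₁ h₁
      exact ih₂ h₂
  | condTrue hx _ ih =>
    intro _ _ h
    cases h with
    | condTrue _ h => exact ih h
    | condFalse hx' _ => exact absurd hx' hx
  | condFalse hx _ ih =>
    intro _ _ h
    cases h with
    | condTrue hx' _ => exact absurd hx hx'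
    | condFalse _ h => exact ih h
  | loopDone hx =>
    intro _ _ h
    cases h with
    | loopDone => rfl
    | loopStep hx' => exact absurd hx hx'
  | loopStep hx _ _ ih₁ ih₂ =>
    intro _ _ h
    cases h with
    | loopDone hx' => exact absurd hx' hx
    | loopStep _ h₁ h₂ =>
      cases ih₁ h₁
      exact ih₂ h₂

/-- An execution of `t` steps touches at most `t` cells; the others could hold anything. -/
theorem Exec.touched {w : ℕ} {P : Program} {s s' : State} {t : ℕ} (h : Exec w P s t s') :
    ∃ R : Finset ℕ, R.card ≤ t ∧ ∀ a ∉ R, s'.mem a = s.mem a ∧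
      ∀ v, Exec w P (s.setMem a v) t (s'.setMem a v) := by
  induction h with
  | nop => exact ⟨∅, by simp, fun a _ => ⟨rfl, fun v => .nop _⟩⟩
  | const _ _ _ h => exact ⟨∅, by simp, fun a _ => ⟨rfl, fun v => .const _ _ _ h⟩⟩
  | op _ _ _ _ _ h => exact ⟨∅, by simp, fun a _ => ⟨rfl, fun v => .op _ _ _ _ _ h⟩⟩
  | load s r x =>
    refine ⟨{s.reg x}, by simp, fun a ha => ⟨rfl, fun v => ?_⟩⟩
    have e : (s.setMem a v).mem (s.reg x) = s.mem (s.reg x) := by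
      rw [State.mem_setMem, if_neg]; rintro rfl; simp at ha
    have := Exec.load (w := w) (s.setMem a v) r x
    rw [State.reg_setMem, e] at this
    exact this
  | store s x y =>
    refine ⟨{s.reg x}, by simp, fun a ha => ?_⟩
    have hne : a ≠ s.reg x := by simpa using ha
    refine ⟨by rw [State.mem_setMem, if_neg hne], fun v => ?_⟩
    have := Exec.store (w := w) (s.setMem a v) x y
    have e : (s.setMem a v).setMem (s.reg x) (s.reg y) = (s.setMem (s.reg x) (s.reg y)).setMem a v := by
      unfold State.setMem
      simp only [State.mk.injEq, true_and]
      exact Function.update_comm hne _ _ _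
    rw [State.reg_setMem, e] at this
    exact this
  | seq _ _ ih₁ ih₂ =>
    obtain ⟨R₁, c₁, h₁⟩ := ih₁
    obtain ⟨R₂, c₂, h₂⟩ := ih₂
    refine ⟨R₁ ∪ R₂, (Finset.card_union_le _ _).trans (by omega), fun a ha => ?_⟩
    simp only [Finset.mem_union, not_or] at ha
    exact ⟨((h₂ a ha.2).1).trans (h₁ a ha.1).1, fun v => .seq ((h₁ a ha.1).2 v) ((h₂ a ha.2).2 v)⟩
  | condTrue hx _ ih =>
    obtain ⟨R, c, h⟩ := ih
    exact ⟨R, by omega, fun a ha => ⟨(h a ha).1, fun v => .condTrue hx ((h a ha).2 v)⟩⟩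
  | condFalse hx _ ih =>
    obtain ⟨R, c, h⟩ := ih
    exact ⟨R, by omega, fun a ha => ⟨(h a ha).1, fun v => .condFalse hx ((h a ha).2 v)⟩⟩
  | loopDone hx => exact ⟨∅, by simp, fun a _ => ⟨rfl, fun v => .loopDone hx⟩⟩
  | loopStep hx _ _ ih₁ ih₂ =>
    obtain ⟨R₁, c₁, h₁⟩ := ih₁
    obtain ⟨R₂, c₂, h₂⟩ := ih₂
    refine ⟨R₁ ∪ R₂, (Finset.card_union_le _ _).trans (by omega), fun a ha => ?_⟩
    simp only [Finset.mem_union, not_or] at ha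
    exact ⟨((h₂ a ha.2).1).trans (h₁ a ha.1).1,
      fun v => .loopStep hx ((h₁ a ha.1).2 v) ((h₂ a ha.2).2 v)⟩

theorem encCell_flag {nb c : ℕ} (f : ℕ → ℕ → WithTop ℤ) {i j : ℕ} (hj : j < c) :
    encCell nb c f ((i * c + j) * (nb + 1)) = if f i j = ⊤ then 1 else 0 := by
  have h1 : (i * c + j) * (nb + 1) / (nb + 1) = i * c + j := Nat.mul_div_cancel _ (by omega)
  have h2 : (i * c + j) / c = i := by
    rw [Nat.add_comm, Nat.add_mul_div_right _ _ (by omega), Nat.div_eq_of_lt hj, Nat.zero_add]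
  have h3 : (i * c + j) % c = j := by
    rw [Nat.add_comm, Nat.add_mul_mod_self_right, Nat.mod_eq_of_lt hj]
  rw [encCell, h1, h2, h3, Nat.mul_mod_left, entryCell, if_pos rfl]

/-- A set of cells that contains the first cell of each entry of an `r × c` matrix is large. -/
theorem card_flags (p r c m : ℕ) (R : Finset ℕ)
    (h : ∀ i < r, ∀ j < c, p + (i * c + j) * (m + 1) ∈ R) : r * c ≤ R.card := by
  have h1 : ((Finset.range (r * c)).image fun z => p + z * (m + 1)) ⊆ R := by
    intro x hx
    obtain ⟨z, hz, rfl⟩ := Finset.mem_image.1 hx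
    have hz := Finset.mem_range.1 hz
    have hc : 0 < c := by
      rcases Nat.eq_zero_or_pos c with rfl | hc
      · simp at hz
      · exact hc
    have := h (z / c) ((Nat.div_lt_iff_lt_mul hc).2 hz) (z % c) (Nat.mod_lt _ hc)
    rwa [Nat.div_add_mod'] at this
  have h2 := Finset.card_le_card h1
  rwa [Finset.card_image_of_injective, Finset.card_range] at h2
  intro x y hxy
  simpa using hxy

/-- The flag of an entry of the product in the final state. -/
theorem Holds.flag {n b l : ℕ} {A : Matrix (Fin n) (Fin b) (WithTop ℤ)}
    {B : Matrix (Fin b) (Fin n) (WithTop ℤ)} {s : State}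
    (h : s.Holds (inputWords l A B).length (encodeMatrix (l + 2) (minPlus A B))) (i j : Fin n) :
    s.mem (n * b * (l + 2) + b * n * (l + 2) + (i * n + j) * (l + 3)) =
      if minPlus A B i j = ⊤ then 1 else 0 := by
  have hlt : (i * n + j : ℕ) * (l + 3) < n * n * (l + 3) :=
    Nat.mul_lt_mul_of_pos_right (lin_lt i.2 j.2) (by omega)
  have h1 := h ((i * n + j) * (l + 3)) (by rw [length_encodeMatrix]; exact hlt)
  rw [length_inputWords] at h1
  rw [h1]
  simp only [encodeMatrix_eq, List.getElem_map, List.getElem_range]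
  refine (encCell_flag _ j.2).trans ?_
  rw [ext_fin]

/-- The matrix with equal entries. -/
def constMatrix {n b : ℕ} (x : WithTop ℤ) : Matrix (Fin n) (Fin b) (WithTop ℤ) := fun _ _ => x

theorem ext_constMatrix {n b : ℕ} {x : WithTop ℤ} {i j : ℕ} (hi : i < n) (hj : j < b) :
    ext (constMatrix x : Matrix (Fin n) (Fin b) (WithTop ℤ)) i j = x := ext_fin _ ⟨i, hi⟩ ⟨j, hj⟩

/-- The output has to be written. -/
theorem sq_le_steps {n b l w t : ℕ} {P : Program} {B : Matrix (Fin b) (Fin n) (WithTop ℤ)}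
    (h : ComputesIn w P l (constMatrix ⊤ : Matrix (Fin n) (Fin b) (WithTop ℤ)) B t) : n * n ≤ t := by
  obtain ⟨-, s, hs, hout⟩ := h
  obtain ⟨R, hR, hR'⟩ := hs.touched
  refine (card_flags (n * b * (l + 2) + b * n * (l + 2)) n n (l + 2) R ?_).trans hR
  intro i hi j hj
  by_contra hmem
  have h1 := (hR' _ hmem).1
  have h2 := Holds.flag hout ⟨i, hi⟩ ⟨j, hj⟩
  rw [if_pos] at h2
  · have h3 : (inputState l (constMatrix ⊤ : Matrix (Fin n) (Fin b) (WithTop ℤ)) B).mem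
        (n * b * (l + 2) + b * n * (l + 2) + (i * n + j) * (l + 2 + 1)) = 0 := by
      show (inputWords l _ B).getD _ 0 = 0
      rw [List.getD_eq_default]
      rw [length_inputWords]
      exact Nat.le_add_right _ _
    rw [h3] at h1
    exact absurd (h2.symm.trans h1) (by omega)
  · simp [minPlus, constMatrix]

/-- The matrix with the only finite entry `0` in the position `i, k`. -/
def single {n b : ℕ} (i : Fin n) (k : Fin b) : Matrix (Fin n) (Fin b) (WithTop ℤ) :=
  fun x y => if x = i ∧ y = k then 0 else ⊤

/-- The matrix `A` has to be read: if the flag of one of its entries `∞` is not touched, the run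
stays the same when this entry becomes `0`, although a row of the product becomes finite. -/
theorem mul_le_steps {n b l w t : ℕ} {P : Program} (hn : 0 < n)
    (h : ComputesIn w P l (constMatrix ⊤ : Matrix (Fin n) (Fin b) (WithTop ℤ))
      (constMatrix 0 : Matrix (Fin b) (Fin n) (WithTop ℤ)) t)
    (h' : ∀ i k, ∃ t, ComputesIn w P l (single i k : Matrix (Fin n) (Fin b) (WithTop ℤ))
      (constMatrix 0 : Matrix (Fin b) (Fin n) (WithTop ℤ)) t) : n * b ≤ t := by
  obtain ⟨-, s, hs, hout⟩ := h
  obtain ⟨R, hR, hR'⟩ := hs.touched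
  refine (card_flags 0 n b (l + 1) R ?_).trans hR
  intro i hi k hk
  by_contra hmem
  have h1 := (hR' _ hmem).2 0
  obtain ⟨t', -, s', hs', hout'⟩ := h' ⟨i, hi⟩ ⟨k, hk⟩
  have hlt : (i * b + k) * (l + 1 + 1) < n * b * (l + 1 + 1) :=
    Nat.mul_lt_mul_of_pos_right (lin_lt hi hk) (by omega)
  have key : (inputState l (constMatrix ⊤ : Matrix (Fin n) (Fin b) (WithTop ℤ))
      (constMatrix 0 : Matrix (Fin b) (Fin n) (WithTop ℤ))).setMem
      (0 + (i * b + k) * (l + 1 + 1)) 0 =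
      inputState l (single ⟨i, hi⟩ ⟨k, hk⟩ : Matrix (Fin n) (Fin b) (WithTop ℤ))
        (constMatrix 0 : Matrix (Fin b) (Fin n) (WithTop ℤ)) := by
    unfold State.setMem inputState
    simp only [State.mk.injEq, true_and]
    funext z
    rw [Function.update_apply]
    simp only [inputWords_getD, inCell]
    by_cases h2 : z = 0 + (i * b + k) * (l + 1 + 1)
    · subst h2
      rw [if_pos rfl, if_pos (by omega), Nat.zero_add, encCell_flag _ hk, if_neg]
      rw [show ext (single ⟨i, hi⟩ ⟨k, hk⟩ : Matrix (Fin n) (Fin b) _) i k =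
        single ⟨i, hi⟩ ⟨k, hk⟩ ⟨i, hi⟩ ⟨k, hk⟩ from ext_fin _ ⟨i, hi⟩ ⟨k, hk⟩]
      simp [single]
    rw [if_neg h2]
    by_cases h4 : z < n * b * (l + 1 + 1)
    · rw [if_pos h4, if_pos h4]
      unfold encCell
      have hz : z / (l + 1 + 1) < n * b := (Nat.div_lt_iff_lt_mul (by omega)).2 h4
      have hb : 0 < b := by omega
      have h6 : z / (l + 1 + 1) / b < n := (Nat.div_lt_iff_lt_mul hb).2 hz
      have h7 : z / (l + 1 + 1) % b < b := Nat.mod_lt _ hb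
      have e1 : ext (single ⟨i, hi⟩ ⟨k, hk⟩ : Matrix (Fin n) (Fin b) (WithTop ℤ))
          (z / (l + 1 + 1) / b) (z / (l + 1 + 1) % b) =
          if z / (l + 1 + 1) / b = i ∧ z / (l + 1 + 1) % b = k then 0 else ⊤ := by
        refine (ext_fin _ ⟨_, h6⟩ ⟨_, h7⟩).trans ?_
        simp only [single, Fin.mk.injEq]
      rw [ext_constMatrix h6 h7, e1]
      split_ifs with h8
      · have h5 : z % (l + 1 + 1) ≠ 0 := by
          intro h5
          apply h2
          have a1 := Nat.div_add_mod' (z / (l + 1 + 1)) b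
          have a2 := Nat.div_add_mod' z (l + 1 + 1)
          rw [h8.1, h8.2] at a1
          rw [← a1, h5] at a2
          omega
        unfold entryCell
        rw [if_neg h5, if_neg h5]
        rfl
      · rfl
    · rw [if_neg h4, if_neg h4]
  rw [key] at h1
  have h2 := Holds.flag hout' ⟨i, hi⟩ ⟨0, hn⟩
  have h3 := Holds.flag hout ⟨i, hi⟩ ⟨0, hn⟩
  rw [if_pos (by simp [minPlus, constMatrix])] at h3
  rw [if_neg] at h2
  · rw [← hs'.det h1, State.mem_setMem, if_neg (by
      show ¬ n * b * (l + 1 + 1) + b * n * (l + 2) + (i * n + 0) * (l + 3) = _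
      omega)] at h2
    exact absurd (h3.symm.trans h2) (by omega)
  · intro h4
    have h5 := Finset.inf_le (f := fun k' => single ⟨i, hi⟩ ⟨k, hk⟩ ⟨i, hi⟩ k' +
      (0 : WithTop ℤ)) (Finset.mem_univ (⟨k, hk⟩ : Fin b))
    have h6 : (⊤ : WithTop ℤ) ≤ single ⟨i, hi⟩ ⟨k, hk⟩ ⟨i, hi⟩ ⟨k, hk⟩ + 0 := by
      rw [← h4]; exact h5
    simp [single] at h6

/-! ### Exponents -/

theorem dim_one (n : ℕ) : dim n 1 = n := by simp [dim]

theorem dim_le_rpow (n : ℕ) (β : ℝ) : (dim n β : ℝ) ≤ (n : ℝ) ^ β :=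
  Nat.floor_le (by positivity)

theorem one_le_dim {n : ℕ} (hn : 1 ≤ n) {β : ℝ} (hβ : 0 ≤ β) : 1 ≤ dim n β :=
  (Nat.one_le_floor_iff _).2 (Real.one_le_rpow (by exact_mod_cast hn) hβ)

theorem rpow_le_two_mul_dim {n : ℕ} (hn : 1 ≤ n) {β : ℝ} (hβ : 0 ≤ β) :
    (n : ℝ) ^ β ≤ 2 * dim n β := by
  have h1 : (n : ℝ) ^ β < dim n β + 1 := Nat.lt_floor_add_one _
  have h2 : (1 : ℝ) ≤ dim n β := by exact_mod_cast one_le_dim hn hβ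
  linarith

theorem dim_le_pow {n : ℕ} (hn : 1 ≤ n) (β : ℝ) : dim n β ≤ n ^ ⌈β⌉₊ := by
  have h1 : (n : ℝ) ^ β ≤ (n : ℝ) ^ (⌈β⌉₊ : ℝ) :=
    Real.rpow_le_rpow_of_exponent_le (by exact_mod_cast hn) (Nat.le_ceil β)
  rw [Real.rpow_natCast] at h1
  exact_mod_cast (dim_le_rpow n β).trans h1

theorem le_of_rpow_le_mul_rpow {x y D : ℝ}
    (h : ∀ n : ℕ, 1 ≤ n → (n : ℝ) ^ x ≤ D * (n : ℝ) ^ y) : x ≤ y := by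
  by_contra hxy
  push Not at hxy
  have h1 : Filter.Tendsto (fun n : ℕ => (n : ℝ) ^ (x - y)) Filter.atTop Filter.atTop :=
    (tendsto_rpow_atTop (by linarith)).comp tendsto_natCast_atTop_atTop
  obtain ⟨n, hn1, hn2⟩ := ((h1.eventually_gt_atTop D).and (Filter.eventually_ge_atTop 1)).exists
  have hn : (0 : ℝ) < n := by exact_mod_cast hn2
  have h2 := h n hn2
  rw [Real.rpow_sub hn, lt_div_iff₀ (by positivity)] at hn1
  linarith

theorem hasBits_top {a b l : ℕ} : HasBits l (constMatrix ⊤ : Matrix (Fin a) (Fin b) (WithTop ℤ)) :=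
  fun _ _ _ h => absurd h (by simp [constMatrix])

/-- A class that contains the matrices without finite entries needs quadratic time. -/
theorem two_le_of_solvable {β τ : ℝ}
    {Inst : ℕ → ∀ n : ℕ, Matrix (Fin (dim n 1)) (Fin (dim n β)) (WithTop ℤ) →
      Matrix (Fin (dim n β)) (Fin (dim n 1)) (WithTop ℤ) → Prop}
    (h : Solvable 1 β 1 Inst τ) (hI : ∀ n, Inst 0 n (constMatrix ⊤) (constMatrix ⊤)) : 2 ≤ τ := by
  refine le_of_forall_pos_le_add fun ε hε => ?_
  obtain ⟨P, κ, hP⟩ := h ε hε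
  obtain ⟨D, hD⟩ := hP 0
  refine le_of_rpow_le_mul_rpow (D := D) fun n hn => ?_
  obtain ⟨t, ht, htD⟩ := hD n hn 0 (Nat.zero_le _) (constMatrix ⊤) (constMatrix ⊤) hasBits_top
    hasBits_top (hI n)
  have h1 := sq_le_steps ht
  rw [dim_one] at h1
  refine le_trans ?_ htD
  rw [Real.rpow_two, sq]
  exact_mod_cast h1

/-- The bounded-entry problem needs the time to read the matrix `A`. -/
theorem one_add_le_of_boundedSolvable {β θ τ : ℝ} (hβ : 0 ≤ β)
    (h : BoundedSolvable 1 β 1 θ τ) : 1 + β ≤ τ := by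
  refine le_of_forall_pos_le_add fun ε hε => ?_
  obtain ⟨P, κ, hP⟩ := h ε hε
  obtain ⟨D, hD⟩ := hP 0
  refine le_of_rpow_le_mul_rpow (D := 2 * D) fun n hn => ?_
  have zeroBits : ∀ {x : WithTop ℤ}, x = 0 ∨ x = ⊤ → ∀ v : ℤ, x = v → v = 0 := by
    rintro x (rfl | rfl) v hv
    · exact_mod_cast hv.symm
    · exact absurd hv (by simp)
  have hB : HasBits 0 (constMatrix 0 : Matrix (Fin (dim n β)) (Fin (dim n 1)) (WithTop ℤ)) := by
    intro i j v hv
    rw [zeroBits (.inl rfl) v hv]; simp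
  obtain ⟨t, ht, htD⟩ := hD n hn 0 (Nat.zero_le _) (constMatrix ⊤) (constMatrix 0) hasBits_top hB
    fun _ _ _ h => absurd h (by simp [constMatrix])
  have h1 := mul_le_steps (by rw [dim_one]; exact hn) ht fun i k => by
    have key : ∀ x y, ∀ v : ℤ, (single i k : Matrix (Fin (dim n 1)) (Fin (dim n β)) _) x y = v →
        v = 0 := by
      intro x y
      refine zeroBits ?_
      unfold single
      split_ifs
      · exact .inl rfl
      · exact .inr rfl
    obtain ⟨t, ht, -⟩ := hD n hn 0 (Nat.zero_le _) (single i k) (constMatrix 0)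
      (fun x y v hv => by rw [key x y v hv]; simp) hB
      fun x y v hv => by rw [key x y v hv]; simp; positivity
    exact ⟨t, ht⟩
  rw [dim_one] at h1
  have h2 : (n : ℝ) * dim n β ≤ t := by exact_mod_cast h1
  have h3 := rpow_le_two_mul_dim hn hβ
  rw [Real.rpow_add (by exact_mod_cast hn), Real.rpow_one]
  calc (n : ℝ) * (n : ℝ) ^ β ≤ n * (2 * dim n β) := by gcongr
    _ = 2 * (n * dim n β) := by ring
    _ ≤ 2 * (D * (n : ℝ) ^ (τ + ε)) := by linarith
    _ = _ := by ring

/-- The length of the integers is polylogarithmic. -/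
theorem length_le (c C : ℕ) : ∃ C', ∀ n : ℕ, 1 ≤ n → ∀ l, l ≤ C * (Nat.log 2 n + 1) ^ C →
    l + c * (Nat.log 2 (n + l) + 1) ≤ C' * (Nat.log 2 n + 1) ^ C' := by
  refine ⟨(1 + c) * C + 2 * c + C + 1, fun n hn l hl => ?_⟩
  have h1 : Nat.log 2 (n + l) ≤ Nat.log 2 n + l := by
    have h2 : n + l < 2 ^ (Nat.log 2 n + l + 1) := by
      have h3 : n < 2 ^ (Nat.log 2 n + 1) := Nat.lt_pow_succ_log_self (by omega) n
      have h4 : l + 1 ≤ 2 ^ l := Nat.lt_two_pow_self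
      calc n + l ≤ n * (l + 1) := by nlinarith
        _ ≤ n * 2 ^ l := Nat.mul_le_mul_left _ h4
        _ < 2 ^ (Nat.log 2 n + 1) * 2 ^ l := Nat.mul_lt_mul_of_pos_right h3 (by positivity)
        _ = _ := by rw [← pow_add]; congr 1; ring
    have := Nat.log_lt_of_lt_pow (by omega) h2
    omega
  obtain ⟨x, hx⟩ : ∃ x, x = Nat.log 2 n + 1 := ⟨_, rfl⟩
  rw [← hx] at hl ⊢
  have x1 : 1 ≤ x := by omega
  have e1 : x ≤ x ^ (C + 1) := Nat.le_self_pow (by omega) x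
  have e2 : x ^ C ≤ x ^ (C + 1) := Nat.pow_le_pow_right x1 (by omega)
  calc l + c * (Nat.log 2 (n + l) + 1) ≤ l + c * (x + l) :=
        Nat.add_le_add_left (Nat.mul_le_mul_left _ (by omega)) _
    _ = (1 + c) * l + c * x := by ring
    _ ≤ (1 + c) * (C * x ^ (C + 1)) + c * x ^ (C + 1) := by
        gcongr; exact hl.trans (Nat.mul_le_mul_left _ e2)
    _ = ((1 + c) * C + c) * x ^ (C + 1) := by ring
    _ ≤ ((1 + c) * C + 2 * c + C + 1) * x ^ ((1 + c) * C + 2 * c + C + 1) :=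
        Nat.mul_le_mul (by omega) (Nat.pow_le_pow_right x1 (by omega))

theorem log_le_rpow {δ : ℝ} (hδ : 0 < δ) : ∃ K : ℝ, 0 ≤ K ∧ ∀ n : ℕ, 1 ≤ n →
    ((Nat.log 2 n + 1 : ℕ) : ℝ) ≤ K * (n : ℝ) ^ δ := by
  have hlog : 0 < Real.log 2 := Real.log_pos (by norm_num)
  refine ⟨1 / δ / Real.log 2 + 1, by positivity, fun n hn => ?_⟩
  have hn' : (1 : ℝ) ≤ n := by exact_mod_cast hn
  have h1 : (2 : ℝ) ^ Nat.log 2 n ≤ n := by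
    exact_mod_cast Nat.pow_log_le_self 2 (by omega : n ≠ 0)
  have h2 := Real.log_le_log (by positivity) h1
  rw [Real.log_pow] at h2
  have h3 := Real.log_le_rpow_div (by linarith : (0 : ℝ) ≤ n) hδ
  have h4 : (1 : ℝ) ≤ (n : ℝ) ^ δ := Real.one_le_rpow hn' hδ.le
  push_cast
  have h5 : (Nat.log 2 n : ℝ) ≤ (n : ℝ) ^ δ / δ / Real.log 2 := by
    rw [le_div_iff₀ hlog]; linarith
  calc (Nat.log 2 n : ℝ) + 1 ≤ (n : ℝ) ^ δ / δ / Real.log 2 + (n : ℝ) ^ δ := by linarith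
    _ = _ := by ring

theorem polylog_le_rpow (C : ℕ) {ε : ℝ} (hε : 0 < ε) : ∃ K : ℝ, 0 ≤ K ∧ ∀ n : ℕ, 1 ≤ n →
    ∀ W : ℕ, W ≤ C * (Nat.log 2 n + 1) ^ C → (W : ℝ) ^ 2 ≤ K * (n : ℝ) ^ ε := by
  obtain ⟨K, hK, h⟩ := log_le_rpow (δ := ε / (2 * C + 1)) (by positivity)
  refine ⟨(C * K ^ C) ^ 2, by positivity, fun n hn W hW => ?_⟩
  have hn' : (1 : ℝ) ≤ n := by exact_mod_cast hn
  have h1 : (W : ℝ) ≤ C * ((Nat.log 2 n + 1 : ℕ) : ℝ) ^ C := by exact_mod_cast hW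
  have h2 : ((Nat.log 2 n + 1 : ℕ) : ℝ) ^ C ≤ (K * (n : ℝ) ^ (ε / (2 * C + 1))) ^ C :=
    pow_le_pow_left₀ (by positivity) (h n hn) _
  calc (W : ℝ) ^ 2 ≤ (C * (K * (n : ℝ) ^ (ε / (2 * C + 1))) ^ C) ^ 2 := by
        refine pow_le_pow_left₀ (by positivity) (h1.trans ?_) 2
        gcongr
    _ = (C * K ^ C) ^ 2 * ((n : ℝ) ^ (ε / (2 * C + 1))) ^ (2 * C) := by ring
    _ ≤ (C * K ^ C) ^ 2 * (n : ℝ) ^ ε := by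
        refine mul_le_mul_of_nonneg_left ?_ (by positivity)
        rw [← Real.rpow_natCast, ← Real.rpow_mul (by linarith)]
        refine Real.rpow_le_rpow_of_exponent_le hn' ?_
        push_cast
        rw [div_mul_eq_mul_div, div_le_iff₀ (by positivity)]
        nlinarith

theorem exists_rat_near {x ε : ℝ} (hx : 0 ≤ x) (hε : 0 < ε) : ∃ p q : ℕ, 1 ≤ q ∧
    (p / q : ℝ) ≤ x ∧ x - ε < (p / q : ℝ) := by
  obtain ⟨q, hq⟩ := exists_nat_gt (1 / ε)
  have hq0 : (0 : ℝ) < q := lt_trans (by positivity) hq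
  refine ⟨⌊x * q⌋₊, q, by exact_mod_cast hq0, ?_, ?_⟩
  · rw [div_le_iff₀ hq0]; exact Nat.floor_le (by positivity)
  · rw [lt_div_iff₀ hq0]
    have := Nat.lt_floor_add_one (x * q)
    rw [div_lt_iff₀ hε] at hq
    nlinarith

/-- Powers of two approximate the powers of `n` with rational exponents. -/
theorem two_pow_approx {n p q : ℕ} (hn : 1 ≤ n) (hq : 1 ≤ q) :
    (2 : ℝ) ^ (Nat.log 2 n * p / q) ≤ (n : ℝ) ^ (p / q : ℝ) ∧
      (n : ℝ) ^ (p / q : ℝ) ≤ 2 ^ (1 + p / q : ℝ) * 2 ^ (Nat.log 2 n * p / q) := by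
  have hq0 : (0 : ℝ) < q := by exact_mod_cast hq
  have h1 : ((Nat.log 2 n * p / q : ℕ) : ℝ) ≤ Nat.log 2 n * (p / q : ℝ) := by
    refine (Nat.cast_div_le).trans (le_of_eq ?_)
    push_cast; ring
  have h2 : Nat.log 2 n * (p / q : ℝ) ≤ ((Nat.log 2 n * p / q : ℕ) : ℝ) + 1 := by
    rw [← mul_div_assoc, div_le_iff₀ hq0]
    have := Nat.lt_mul_div_succ (Nat.log 2 n * p) hq
    have h3 : Nat.log 2 n * p ≤ (Nat.log 2 n * p / q + 1) * q := by
      rw [Nat.mul_comm _ q]; exact this.le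
    exact_mod_cast h3
  have h3 : ((2 : ℝ) ^ (Nat.log 2 n : ℝ)) ≤ n := by
    rw [Real.rpow_natCast]
    exact_mod_cast Nat.pow_log_le_self 2 (by omega : n ≠ 0)
  have h4 : (n : ℝ) ≤ (2 : ℝ) ^ (Nat.log 2 n + 1 : ℝ) := by
    have := (Nat.lt_pow_succ_log_self (by omega : 1 < 2) n).le
    have h5 : (n : ℝ) ≤ (2 : ℝ) ^ (Nat.log 2 n + 1) := by exact_mod_cast this
    rw [← Real.rpow_natCast] at h5
    push_cast at h5
    exact h5
  rw [← Real.rpow_natCast]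
  constructor
  · calc (2 : ℝ) ^ ((Nat.log 2 n * p / q : ℕ) : ℝ) ≤ 2 ^ (Nat.log 2 n * (p / q : ℝ)) :=
          Real.rpow_le_rpow_of_exponent_le (by norm_num) h1
      _ = (2 ^ (Nat.log 2 n : ℝ)) ^ (p / q : ℝ) := Real.rpow_mul (by norm_num) _ _
      _ ≤ (n : ℝ) ^ (p / q : ℝ) := Real.rpow_le_rpow (by positivity) h3 (by positivity)
  · calc (n : ℝ) ^ (p / q : ℝ) ≤ (2 ^ (Nat.log 2 n + 1 : ℝ)) ^ (p / q : ℝ) :=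
          Real.rpow_le_rpow (by positivity) h4 (by positivity)
      _ = 2 ^ ((Nat.log 2 n + 1) * (p / q : ℝ)) := (Real.rpow_mul (by norm_num) _ _).symm
      _ ≤ 2 ^ ((1 + p / q : ℝ) + ((Nat.log 2 n * p / q : ℕ) : ℝ)) :=
          Real.rpow_le_rpow_of_exponent_le (by norm_num) (by linarith)
      _ = _ := Real.rpow_add (by norm_num) _ _

/-- The trivial algorithm solves the bounded-entry problem in time `Õ(n ^ (2 + β))`. Hence the
infimum in the definition of `g` is taken over a nonempty set. -/
theorem boundedSolvable_trivial {β θ : ℝ} (hβ : 0 ≤ β) : BoundedSolvable 1 β 1 θ (2 + β) := by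
  intro ε hε
  obtain ⟨P, κ, D, c, hP⟩ := exists_naive_program ⌈β⌉₊
  refine ⟨P, κ, fun C => ?_⟩
  obtain ⟨C', hC'⟩ := length_le c C
  obtain ⟨K, hK, hpoly⟩ := polylog_le_rpow C' hε
  refine ⟨D * K, fun n hn l hl => ?_⟩
  have h1 := hP n (dim n β) l hn (one_le_dim hn hβ) (dim_le_pow hn β)
  have hn' : (0 : ℝ) < n := by exact_mod_cast hn
  beta_reduce
  rw [dim_one]
  intro A B hA hB _
  obtain ⟨t, ht, htD⟩ := h1 A B hA hB
  refine ⟨t, ht, ?_⟩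
  have h2 := hpoly n hn _ (hC' n hn l hl)
  have h3 := dim_le_rpow n β
  have h4 : (t : ℝ) ≤ D * ((l + c * (Nat.log 2 (n + l) + 1) : ℕ) : ℝ) ^ 2 * (n * dim n β * n) := by
    exact_mod_cast htD
  calc (t : ℝ) ≤ D * ((l + c * (Nat.log 2 (n + l) + 1) : ℕ) : ℝ) ^ 2 * (n * dim n β * n) := h4
    _ ≤ D * (K * (n : ℝ) ^ ε) * (n * (n : ℝ) ^ β * n) := by gcongr
    _ = D * K * ((n : ℝ) ^ (2 : ℝ) * (n : ℝ) ^ β * (n : ℝ) ^ ε) := by rw [Real.rpow_two]; ring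
    _ = _ := by rw [Real.rpow_add hn', Real.rpow_add hn']

/-! ### The exponent of the algorithm -/

/-- The time bound of the algorithm for monotone matrices in terms of exponents. Here `S` is the
number of segments, `r` the number of rounds and `t₀` the time of a call; `U ≈ n ^ p` is the
threshold and `V ≈ n ^ q` the bound on the entries in the calls. The choice `p ≈ (β + G) / 2`
balances the time `n U` for the remaining triples with the time `n b / U * n ^ G` of all calls. The
lower bounds on `G` ensure that the preparation of a call takes no longer than the call. -/
theorem time_le {n b S r t₀ : ℕ} {β η G p q e C D K K' U V R : ℝ} (hn : 1 ≤ n) (he : 0 < e)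
    (hβ : 0 ≤ β) (hC : 0 ≤ C) (hD : 0 ≤ D) (hK : 0 ≤ K) (hK' : 0 ≤ K') (hG : 2 ≤ G)
    (hG' : 1 + β ≤ G) (hb : (b : ℝ) ≤ (n : ℝ) ^ β) (hU : 0 < U) (hV : 0 < V)
    (hp : p ≤ (β + G) / 2) (hp' : (β + G) / 2 - e < p)
    (hU1 : U ≤ (n : ℝ) ^ p) (hU2 : (n : ℝ) ^ p ≤ K * U) (hV2 : (n : ℝ) ^ q ≤ K' * V)
    (hR : R ≤ C * (n : ℝ) ^ (β + η)) (hS : S * V ≤ 2 * R + 4 * b * V) (hr : r * U ≤ n * b)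
    (ht₀ : (t₀ : ℝ) ≤ D * (n : ℝ) ^ (G + 2 * e)) :
    (n * S + n * b + n * n + n * U + r * (n * b + n * n + t₀) : ℝ) ≤
      (2 * C * K' + 7 + K * (2 + D)) *
        (n : ℝ) ^ (max (1 + β + η - q) (1 / 2 * (2 + β + G)) + 3 * e) := by
  have n0 : (0 : ℝ) < n := by exact_mod_cast hn
  have n1 : (1 : ℝ) ≤ n := by exact_mod_cast hn
  set N : ℝ := (n : ℝ) with hN
  set F := max (1 + β + η - q) (1 / 2 * (2 + β + G)) with hF
  have F1 : 1 + β + η - q ≤ F := le_max_left _ _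
  have F2 : 1 / 2 * (2 + β + G) ≤ F := le_max_right _ _
  have mono : ∀ {x}, x ≤ F + 3 * e → N ^ x ≤ N ^ (F + 3 * e) := fun h =>
    Real.rpow_le_rpow_of_exponent_le n1 h
  have hpos : ∀ x : ℝ, 0 < N ^ x := fun x => Real.rpow_pos_of_pos n0 x
  have mul : ∀ x y : ℝ, N ^ x * N ^ y = N ^ (x + y) := fun x y => (Real.rpow_add n0 x y).symm
  have tb : N * b ≤ N ^ (1 + β) := by
    rw [Real.rpow_add n0, Real.rpow_one]; gcongr
  have t1 : N * S ≤ (2 * C * K' + 4) * N ^ (F + 3 * e) := by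
    -- the range is divided by `V ≈ n ^ q`, and each row has a bounded number of additional segments
    have h1 : (1 : ℝ) ≤ K' * V * N ^ (-q) := by
      have := mul_le_mul_of_nonneg_right hV2 (hpos (-q)).le
      rwa [mul, add_neg_cancel, Real.rpow_zero] at this
    have h2 : (S : ℝ) ≤ 2 * C * K' * N ^ (β + η - q) + 4 * b := by
      have h3 : S * V ≤ (2 * C * K' * N ^ (β + η - q) + 4 * b) * V := by
        calc S * V ≤ 2 * (C * N ^ (β + η)) * 1 + 4 * b * V := by linarith
          _ ≤ 2 * (C * N ^ (β + η)) * (K' * V * N ^ (-q)) + 4 * b * V := by gcongr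
          _ = (2 * C * K' * (N ^ (β + η) * N ^ (-q)) + 4 * b) * V := by ring
          _ = _ := by rw [mul]; rfl
      exact le_of_mul_le_mul_right h3 hV
    calc N * S ≤ N * (2 * C * K' * N ^ (β + η - q) + 4 * b) := by gcongr
      _ = 2 * C * K' * (N ^ (1 : ℝ) * N ^ (β + η - q)) + 4 * (N * b) := by rw [Real.rpow_one]; ring
      _ ≤ 2 * C * K' * N ^ (F + 3 * e) + 4 * N ^ (F + 3 * e) := by
          rw [mul]
          exact add_le_add (mul_le_mul_of_nonneg_left (mono (by linarith)) (by positivity))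
            (mul_le_mul_of_nonneg_left (tb.trans (mono (by linarith))) (by norm_num))
      _ = _ := by ring
  have t2 : N * b ≤ N ^ (F + 3 * e) := tb.trans (mono (by linarith))
  have sq : N * N = N ^ (2 : ℝ) := by rw [Real.rpow_two]; ring
  have t3 : N * N ≤ N ^ (F + 3 * e) := by rw [sq]; exact mono (by linarith)
  have t4 : N * U ≤ N ^ (F + 3 * e) := by
    calc N * U ≤ N ^ (1 : ℝ) * N ^ p := by rw [Real.rpow_one]; gcongr
      _ = N ^ (1 + p) := mul _ _
      _ ≤ _ := mono (by linarith)
  -- the rounds: `n b / U` times the time of a call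
  have t5 : r * (N * b + N * N + t₀) ≤ K * (2 + D) * N ^ (F + 3 * e) := by
    have h1 : (1 : ℝ) ≤ K * U * N ^ (-p) := by
      have := mul_le_mul_of_nonneg_right hU2 (hpos (-p)).le
      rwa [mul, add_neg_cancel, Real.rpow_zero] at this
    have h2 : (r : ℝ) ≤ K * N ^ (1 + β - p) := by
      have h3 : r * U ≤ K * N ^ (1 + β - p) * U := by
        calc r * U ≤ N ^ (1 + β) * 1 := by linarith
          _ ≤ N ^ (1 + β) * (K * U * N ^ (-p)) := by gcongr
          _ = K * (N ^ (1 + β) * N ^ (-p)) * U := by ring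
          _ = _ := by rw [mul]; rfl
      exact le_of_mul_le_mul_right h3 hU
    have h4 : N * b + N * N + t₀ ≤ (2 + D) * N ^ (G + 2 * e) := by
      have a1 : N * b ≤ N ^ (G + 2 * e) :=
        tb.trans (Real.rpow_le_rpow_of_exponent_le n1 (by linarith))
      have a2 : N * N ≤ N ^ (G + 2 * e) := by
        rw [sq]; exact Real.rpow_le_rpow_of_exponent_le n1 (by linarith)
      linarith
    calc r * (N * b + N * N + t₀) ≤ K * N ^ (1 + β - p) * ((2 + D) * N ^ (G + 2 * e)) := by
          gcongr
      _ = K * (2 + D) * (N ^ (1 + β - p) * N ^ (G + 2 * e)) := by ring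
      _ ≤ _ := by
          rw [mul]
          exact mul_le_mul_of_nonneg_left (mono (by linarith)) (by positivity)
  linarith

/-- The algorithm for one choice of `θ`. The threshold and the rounding error are powers of two,
with exponents `⌊log n⌋ p / q` and `⌊log n⌋ p' / q'` for rational approximations `p / q` of
`(β + g) / 2` and `p' / q'` of `θ` from below. -/
theorem monotoneSolvable {β η θ : ℝ} (hβ : 0 ≤ β) (hθ : 0 ≤ θ) :
    MonotoneSolvable 1 β 1 η (max (1 + β + η - θ) (1 / 2 * (2 + β + g 1 β 1 θ))) := by
  have hne : {τ | BoundedSolvable 1 β 1 θ τ}.Nonempty := ⟨_, boundedSolvable_trivial hβ⟩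
  have hG : 2 ≤ g 1 β 1 θ := le_csInf hne fun τ hτ =>
    two_le_of_solvable hτ fun n _ _ _ h => absurd h (by simp [constMatrix])
  have hG' : 1 + β ≤ g 1 β 1 θ := le_csInf hne fun τ hτ => one_add_le_of_boundedSolvable hβ hτ
  intro ε hε
  -- `3 e` come from `time_le`, one `e` from the approximation of `θ`, one from the factor `W ^ 2`
  obtain ⟨e, he⟩ : ∃ e, e = ε / 5 := ⟨_, rfl⟩
  have he0 : 0 < e := by rw [he]; positivity
  obtain ⟨τ₀, hτ₀, hτg⟩ := exists_lt_of_csInf_lt hne (lt_add_of_pos_right (g 1 β 1 θ) he0)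
  obtain ⟨P, κ₀, hP⟩ := hτ₀ e he0
  obtain ⟨p, q, hq, hp1, hp2⟩ := exists_rat_near (x := (β + g 1 β 1 θ) / 2) (by linarith) he0
  obtain ⟨p', q', hq', hp1', hp2'⟩ := exists_rat_near hθ he0
  obtain ⟨P', κ, D₁, c, hP'⟩ := exists_monotone_program ⌈β⌉₊ κ₀ p q p' q' P
  refine ⟨P', κ, fun C => ?_⟩
  obtain ⟨C', hC'⟩ := length_le c C
  obtain ⟨D₀, hD₀⟩ := hP C'
  obtain ⟨K₀, hK₀, hpoly⟩ := polylog_le_rpow C' he0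
  refine ⟨D₁ * K₀ * (2 * C * 2 ^ (1 + p' / q' : ℝ) + 7 + 2 ^ (1 + p / q : ℝ) * (2 + |D₀|)),
    fun n hn l hl => ?_⟩
  have n1 : (1 : ℝ) ≤ n := by exact_mod_cast hn
  have n0 : (0 : ℝ) < n := by linarith
  obtain ⟨W, hW1, hW, hmain⟩ := hP' n (dim n β) l hn (one_le_dim hn hβ) (dim_le_pow hn β)
  have hWle : W ≤ C' * (Nat.log 2 n + 1) ^ C' := hW ▸ hC' n hn l hl
  have hora := hD₀ n hn (W - 1) (by omega)
  beta_reduce at hora ⊢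
  rw [dim_one] at hora ⊢
  intro A B hA hB hI
  obtain ⟨hmono, hrange⟩ := hI
  obtain ⟨t, S, r, ht, htle, hS, hr⟩ := hmain A B hA hB hmono ⌊|D₀| * (n : ℝ) ^ (τ₀ + e)⌋₊ (by
    intro A' B' hA' hbA hbB
    obtain ⟨t, ht, htD⟩ := hora A' B' hbA hbB (by
      intro i k v hv
      have h1 : |(v : ℝ)| ≤ 2 ^ (Nat.log 2 n * p' / q') := by exact_mod_cast hA' i k v hv
      refine h1.trans ((two_pow_approx hn hq').1.trans ?_)
      exact Real.rpow_le_rpow_of_exponent_le n1 hp1')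
    refine ⟨t, ht, Nat.le_floor (htD.trans ?_)⟩
    gcongr
    exact le_abs_self _)
  refine ⟨t, ht, ?_⟩
  have hfl : ((⌊|D₀| * (n : ℝ) ^ (τ₀ + e)⌋₊ : ℕ) : ℝ) ≤ |D₀| * (n : ℝ) ^ (g 1 β 1 θ + 2 * e) := by
    refine (Nat.floor_le (by positivity)).trans ?_
    refine mul_le_mul_of_nonneg_left ?_ (abs_nonneg _)
    refine Real.rpow_le_rpow_of_exponent_le n1 ?_
    have : τ₀ < g 1 β 1 θ + e := hτg
    linarith
  have key := time_le (n := n) (b := dim n β) (S := S) (r := r) (β := β) (η := η) (G := g 1 β 1 θ)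
    (p := p / q) (q := p' / q') (e := e) (C := C) (D := |D₀|) (K := 2 ^ (1 + p / q : ℝ))
    (K' := 2 ^ (1 + p' / q' : ℝ)) (U := 2 ^ (Nat.log 2 n * p / q))
    (V := 2 ^ (Nat.log 2 n * p' / q')) (R := totalRange B)
    hn he0 hβ (by positivity) (abs_nonneg _) (by positivity) (by positivity) hG hG'
    (dim_le_rpow n β) (by positivity) (by positivity) hp1 hp2
    (two_pow_approx hn hq).1 (two_pow_approx hn hq).2 (two_pow_approx hn hq').2 hrange
    (by exact_mod_cast hS) (by exact_mod_cast hr) hfl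
  have hpW := hpoly n hn W hWle
  have htle' : (t : ℝ) ≤ D₁ * (W : ℝ) ^ 2 * (n * S + n * dim n β + n * n +
      n * 2 ^ (Nat.log 2 n * p / q) + r * (n * dim n β + n * n +
        (⌊|D₀| * (n : ℝ) ^ (τ₀ + e)⌋₊ : ℕ))) := by exact_mod_cast htle
  set Q := 2 * C * 2 ^ (1 + p' / q' : ℝ) + 7 + 2 ^ (1 + p / q : ℝ) * (2 + |D₀|) with hQ
  have hQ0 : 0 ≤ Q := by positivity
  calc (t : ℝ) ≤ _ := htle'
    _ ≤ D₁ * (K₀ * (n : ℝ) ^ e) * (Q * (n : ℝ) ^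
        (max (1 + β + η - p' / q') (1 / 2 * (2 + β + g 1 β 1 θ)) + 3 * e)) := by gcongr
    _ = D₁ * K₀ * Q * ((n : ℝ) ^ e * (n : ℝ) ^
        (max (1 + β + η - p' / q') (1 / 2 * (2 + β + g 1 β 1 θ)) + 3 * e)) := by ring
    _ ≤ _ := by
      rw [← Real.rpow_add n0]
      refine mul_le_mul_of_nonneg_left ?_ (by positivity)
      refine Real.rpow_le_rpow_of_exponent_le n1 ?_
      have h1 : max (1 + β + η - p' / q') (1 / 2 * (2 + β + g 1 β 1 θ)) ≤
          max (1 + β + η - θ) (1 / 2 * (2 + β + g 1 β 1 θ)) + e := by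
        refine max_le ?_ ?_
        · have := le_max_left (1 + β + η - θ) (1 / 2 * (2 + β + g 1 β 1 θ))
          linarith
        · have := le_max_right (1 + β + η - θ) (1 / 2 * (2 + β + g 1 β 1 θ))
          linarith
      linarith

end MinPlus

theorem mainTheorem1 (β η : ℝ) (hβ : 0 ≤ β) (hη : 0 ≤ η) :
    (∀ θ ∈ Set.Icc (0 : ℝ) η,
      MinPlus.MonotoneSolvable 1 β 1 η
        (max (1 + β + η - θ) (1 / 2 * (2 + β + MinPlus.g 1 β 1 θ)))) ∧
    MinPlus.m 1 β 1 η ≤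
      ⨅ θ : Set.Icc (0 : ℝ) η,
        max (1 + β + η - (θ : ℝ)) (1 / 2 * (2 + β + MinPlus.g 1 β 1 (θ : ℝ))) := by
  have main : ∀ θ ∈ Set.Icc (0 : ℝ) η, MinPlus.MonotoneSolvable 1 β 1 η
      (max (1 + β + η - θ) (1 / 2 * (2 + β + MinPlus.g 1 β 1 θ))) :=
    fun θ hθ => MinPlus.monotoneSolvable hβ hθ.1
  refine ⟨main, ?_⟩
  have : Nonempty (Set.Icc (0 : ℝ) η) := ⟨⟨0, le_rfl, hη⟩⟩
  -- the exponents are bounded below, as the output has to be written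
  refine le_ciInf fun θ => csInf_le ⟨2, fun τ hτ => ?_⟩ (main θ θ.2)
  refine MinPlus.two_le_of_solvable hτ fun n => ⟨fun k i j _ => le_rfl, ?_⟩
  simp [MinPlus.totalRange, MinPlus.constMatrix]
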